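/- **Setting.** Let $\mathbb T^2=(\mathbb R/2\pi\mathbb Z)^2$ with Lebesgue measure $dx$, ${\bf e}_k(x)=\frac1{2\pi}e^{\sqrt{-1}k\cdot x}$ and $\lambda_k=1+|k|^2$ for $k\in\mathbb Z^2$, and $H=L^2(\mathbb T^2;\mathbb R)$. For $s\in\mathbb R$ let $H^{s}=H^s(\mathbb T^2)$ be the real Hilbert space of distributions $u$ on $\mathbb T^2$ whose Fourier coefficients $\hat u(k)=\langle u,{\bf e}_k\rangle$ satisfy $\hat u(-k)=\overline{\hat u(k)}$ and $\sum_k\lambda_k^{s}|\hat u(k)|^2<\infty$, with $(u,v)_{H^s}=\sum_k\lambda_k^s\hat u(k)\hat v(-k)$; ${}_{H^{-\alpha}}\langle\cdot,\cdot\rangle_{H^\alpha}$ denotes the duality extending the product $(\cdot,\cdot)_H$ of $H$. Fix $\delta>0$, put $E=H^{-\delta}$ and $A=(1-\Delta)^{-1}$, and let $\mu_0=N(0,A^{1+\delta})$ be the free field, i.e. the centred Gaussian probability measure on $E$ with $\int_E (l_1,z)_E(l_2,z)_E\,\mu_0(dz)=(A^{1+\delta}l_1,l_2)_E$ for $l_1,l_2\in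 E$. A cut-off set is a compact $\Lambda\subset\mathbb R^2$ with $\Lambda=-\Lambda$ and $0$ in its interior. For such $\Lambda$ and $z\in E$, $x\in\mathbb T^2$, put $(\Pi_\Lambda z)(x)=\sum_{k\in\Lambda\cap\mathbb Z^2}\hat z(k){\bf e}_k(x)$, $\rho_\Lambda=\mathbb E^{\mu_0}[(\Pi_\Lambda z)(x)^2]^{1/2}$ (which does not depend on $x$) and $$\cos_\Lambda(az)_x=\cos\big(a(\Pi_\Lambda z)(x)\big)e^{(a\rho_\Lambda)^2/2},\qquad \sin_\Lambda(az)_x=\sin\big(a(\Pi_\Lambda z)(x)\big)e^{(a\rho_\Lambda)^2/2},$$ $$\Phi_{n,\Lambda}(z)_x=\sqrt{n!}\,\rho_\Lambda^n\,\mathbb H_n\big(\rho_\Lambda^{-1}(\Pi_\Lambda z)(x)\big),\qquad \mathbb H_n(\xi)=\frac{(-1)^n}{\sqrt{n!}}e^{\xi^2/2}\Big(\frac{d}{d\xi}\Big)^ne^{-\xi^2/2}.$$ For $n\ge0$, $\alpha>0$ and $g\in H$, the Wick power $\Phi_n$ is the limit of $\Phi_{n,N\Lambda}$ as $N\to\infty$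 in $L^p(\mu_0;H^{-\alpha})$, and $\Phi_n(\cdot)(g)$ is the limit of $(\Phi_{n,N\Lambda}(\cdot),g)_H$ in $L^p(\mu_0)$; these limits exist for all $p\ge1$ and depend neither on $p$ nor on $\Lambda$. **Corollary.** Let $p\ge2$, $0<\alpha\le1$, $g\in H$, and let $\Lambda$ be a cut-off set. (1) If $|a|<\sqrt{4\pi\alpha}$, then in $L^2(\mu_0;H^{-\alpha})$ $$\lim_{N\to\infty}\cos_{N\Lambda}(a\cdot)=\sum_{n=0}^\infty(-1)^n\frac{a^{2n}}{(2n)!}\Phi_{2n},\qquad \lim_{N\to\infty}\sin_{N\Lambda}(a\cdot)=\sum_{n=0}^\infty(-1)^n\frac{a^{2n+1}}{(2n+1)!}\Phi_{2n+1},$$ where the series converge in $L^2(\mu_0;H^{-\alpha})$. The right-hand sides are denoted by $:\!\cos(a\cdot)\!:$ and $:\!\sin(a\cdot)\!:$. (2) If $|a|<\sqrt{4\pi}$, then in $L^2(\mu_0)$ $$\lim_{N\to\infty}(\cos_{N\Lambda}(a\cdot),g)_H=\sum_{n=0}^\infty(-1)^n\frac{a^{2n}}{(2n)!}\Phi_{2n}(\cdot)(g),\qquad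 \lim_{N\to\infty}(\sin_{N\Lambda}(a\cdot),g)_H=\sum_{n=0}^\infty(-1)^n\frac{a^{2n+1}}{(2n+1)!}\Phi_{2n+1}(\cdot)(g),$$ where the series converge in $L^2(\mu_0)$. The right-hand sides are denoted by $:\!\cos(a\cdot)\!:(g)$ and $:\!\sin(a\cdot)\!:(g)$. If moreover $g\in H^\alpha$ and $|a|<\sqrt{4\pi\alpha}$, then for $\mu_0$-a.e. $z\in E$ $$:\!\cos(az)\!:(g)={}_{H^{-\alpha}}\langle :\!\cos(az)\!:,g\rangle_{H^\alpha},\qquad :\!\sin(az)\!:(g)={}_{H^{-\alpha}}\langle :\!\sin(az)\!:,g\rangle_{H^\alpha}.$$ (3) If $|a|<\sqrt{4\pi\alpha/(p-1)}$, then $:\!\cos(a\cdot)\!:$ and $:\!\sin(a\cdot)\!:$ belong to $L^p(\mu_0;H^{-\alpha})$. If $|a|<\sqrt{4\pi/(p-1)}$, then $:\!\cos(a\cdot)\!:(g)$ and $:\!\sin(a\cdot)\!:(g)$ belong to $L^p(\mu_0)$. -/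

import Mathlib

open MeasureTheory ProbabilityTheory Filter Topology ComplexConjugate
open scoped ENNReal NNReal ContDiff Pointwise Real

noncomputable section

namespace Torus

instance factTwoPiPos : Fact (0 < 2 * π) := ⟨Real.two_pi_pos⟩

/-- The torus `(ℝ / 2πℤ)²`; its `volume` is the Lebesgue measure, of total mass `4π²`. -/
abbrev T2 : Type := AddCircle (2 * π) × AddCircle (2 * π)

/-- The quotient map `ℝ² → (ℝ / 2πℤ)²`. -/
def mk (p : ℝ × ℝ) : T2 := (p.1, p.2)

/-- `e_k(x) = (2π)⁻¹ exp(i k·x)`. -/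
def e (k : ℤ × ℤ) (x : T2) : ℂ :=
  (1 / (2 * π) : ℂ) * (fourier k.1 x.1 * fourier k.2 x.2)

theorem e_mk (k : ℤ × ℤ) (p : ℝ × ℝ) :
    e k (mk p) = (1 / (2 * π) : ℂ) * Complex.exp (Complex.I * (k.1 * p.1 + k.2 * p.2)) := by
  have hpi : (π : ℂ) ≠ 0 := by exact_mod_cast Real.pi_ne_zero
  simp only [e, mk, fourier_coe_apply, ← Complex.exp_add]
  congr 2
  push_cast
  field_simp

theorem continuous_e (k : ℤ × ℤ) : Continuous (e k) := by
  unfold e; fun_prop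

theorem norm_e (k : ℤ × ℤ) (x : T2) : ‖e k x‖ = 1 / (2 * π) := by
  have h1 : ‖fourier k.1 x.1‖ = 1 := Circle.norm_coe _
  have h2 : ‖fourier k.2 x.2‖ = 1 := Circle.norm_coe _
  rw [e, norm_mul, norm_mul, h1, h2]
  simp [abs_of_pos Real.pi_pos]

theorem conj_e (k : ℤ × ℤ) (x : T2) : conj (e k x) = e (-k) x := by
  have h2 : conj (2 : ℂ) = 2 := Complex.conj_ofNat 2
  simp [e, map_mul, Complex.conj_ofReal, h2]

/-- Smooth functions on the torus: the lift to `ℝ²` is `C^∞`. -/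
def TestFun : Submodule ℂ (T2 → ℂ) where
  carrier := {φ | ContDiff ℝ ∞ (fun p => φ (mk p))}
  zero_mem' := (contDiff_const : ContDiff ℝ ∞ fun _ : ℝ × ℝ => (0 : ℂ))
  add_mem' {φ ψ} h1 h2 := by
    have h1' : ContDiff ℝ ∞ (fun p => φ (mk p)) := h1
    exact h1'.add h2
  smul_mem' c φ h := by
    have h' : ContDiff ℝ ∞ (fun p => φ (mk p)) := h
    exact h'.const_smul c

theorem TestFun.contDiff (φ : TestFun) : ContDiff ℝ ∞ (fun p => (φ : T2 → ℂ) (mk p)) := φ.2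

theorem mk_add (p q : ℝ × ℝ) : mk (p + q) = mk p + mk q := rfl

theorem mk_surjective : Function.Surjective mk := by
  rintro ⟨x, y⟩
  induction x using QuotientAddGroup.induction_on with | _ x
  induction y using QuotientAddGroup.induction_on with | _ y
  exact ⟨(x, y), rfl⟩

theorem isOpenQuotientMap_mk : IsOpenQuotientMap mk :=
  (QuotientAddGroup.isOpenQuotientMap_mk (N := AddSubgroup.zmultiples (2 * π))).prodMap
    (QuotientAddGroup.isOpenQuotientMap_mk (N := AddSubgroup.zmultiples (2 * π)))

theorem TestFun.continuous (φ : TestFun) : Continuous (φ : T2 → ℂ) :=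
  isOpenQuotientMap_mk.isQuotientMap.continuous_iff.2 (TestFun.contDiff φ).continuous

/-- Directional derivative on the torus: the derivative at `t = 0` of `φ (x + t v)`. -/
def dirDeriv (v : ℝ × ℝ) (φ : T2 → ℂ) (x : T2) : ℂ := deriv (fun t : ℝ => φ (x + mk (t • v))) 0

theorem dirDeriv_mk (v : ℝ × ℝ) (φ : TestFun) (p : ℝ × ℝ) :
    dirDeriv v φ (mk p) = fderiv ℝ (fun q => (φ : T2 → ℂ) (mk q)) p v := by
  have hd : DifferentiableAt ℝ (fun q => (φ : T2 → ℂ) (mk q)) p :=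
    ((TestFun.contDiff φ).differentiable (by simp)).differentiableAt
  rw [← hd.lineDeriv_eq_fderiv]
  simp [dirDeriv, lineDeriv, mk_add]

theorem hasDerivAt_dirDeriv (v : ℝ × ℝ) (φ : TestFun) (x : T2) :
    HasDerivAt (fun t : ℝ => (φ : T2 → ℂ) (x + mk (t • v))) (dirDeriv v φ x) 0 := by
  obtain ⟨p, rfl⟩ := mk_surjective x
  have hd : DifferentiableAt ℝ (fun q => (φ : T2 → ℂ) (mk q)) p :=
    ((TestFun.contDiff φ).differentiable (by simp)).differentiableAt
  have := hd.hasFDerivAt.hasLineDerivAt v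
  rw [dirDeriv_mk]
  simpa [HasLineDerivAt, mk_add] using this

/-- The derivative in direction `v`, as an operator on smooth functions. -/
def D (v : ℝ × ℝ) : TestFun →ₗ[ℂ] TestFun where
  toFun φ := ⟨dirDeriv v φ, by
    have h : (fun p => dirDeriv v φ (mk p)) =
        fun p => fderiv ℝ (fun q => (φ : T2 → ℂ) (mk q)) p v := by
      ext p; exact dirDeriv_mk v φ p
    change ContDiff ℝ ∞ (fun p => dirDeriv v φ (mk p))
    rw [h]
    exact ((TestFun.contDiff φ).fderiv_right (m := ∞) (by simp)).clm_apply contDiff_const⟩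
  map_add' φ ψ := by
    ext x
    exact ((hasDerivAt_dirDeriv v φ x).add (hasDerivAt_dirDeriv v ψ x)).deriv
  map_smul' c φ := by
    ext x
    exact ((hasDerivAt_dirDeriv v φ x).const_smul c).deriv

/-- `∂^{i+j} φ / ∂x₁^i ∂x₂^j`. -/
def partialD (i j : ℕ) (φ : TestFun) : TestFun := (D (1, 0))^[i] ((D (0, 1))^[j] φ)

/-- `e_k` as a test function. -/
def eTest (k : ℤ × ℤ) : TestFun := ⟨e k, by
  have h : (fun p => e k (mk p)) = fun p : ℝ × ℝ =>
      (1 / (2 * π) : ℂ) * Complex.exp (Complex.I * (k.1 * p.1 + k.2 * p.2)) := by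
    ext p; exact e_mk k p
  change ContDiff ℝ ∞ (fun p => e k (mk p))
  rw [h]
  have h1 : ContDiff ℝ ∞ (fun p : ℝ × ℝ => (p.1 : ℂ)) :=
    Complex.ofRealCLM.contDiff.comp contDiff_fst
  have h2 : ContDiff ℝ ∞ (fun p : ℝ × ℝ => (p.2 : ℂ)) :=
    Complex.ofRealCLM.contDiff.comp contDiff_snd
  fun_prop⟩

/-- Distributions on the torus: linear forms on the smooth functions that are bounded by finitely
many sup norms of derivatives. -/
def Distr : Submodule ℂ (Module.Dual ℂ TestFun) where
  carrier := {u | ∃ (N : ℕ) (C : ℝ), ∀ (φ : TestFun) (B : ℝ),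
    (∀ i j : ℕ, i + j ≤ N → ∀ x : T2, ‖(partialD i j φ : T2 → ℂ) x‖ ≤ B) → ‖u φ‖ ≤ C * B}
  zero_mem' := ⟨0, 0, by simp⟩
  add_mem' := by
    rintro u v ⟨N, C, h⟩ ⟨M, C', h'⟩
    refine ⟨max N M, C + C', fun φ B hB => ?_⟩
    have h1 := h φ B fun i j hij => hB i j (hij.trans (le_max_left _ _))
    have h2 := h' φ B fun i j hij => hB i j (hij.trans (le_max_right _ _))
    calc ‖u φ + v φ‖ ≤ ‖u φ‖ + ‖v φ‖ := norm_add_le _ _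
      _ ≤ (C + C') * B := by linarith
  smul_mem' := by
    rintro c u ⟨N, C, h⟩
    refine ⟨N, ‖c‖ * C, fun φ B hB => ?_⟩
    have h1 := h φ B hB
    calc ‖c • u φ‖ = ‖c‖ * ‖u φ‖ := norm_smul _ _
      _ ≤ ‖c‖ * (C * B) := by gcongr
      _ = _ := by ring

/-- Fourier coefficients of a distribution: `û(k) = u(conj e_k) = u(e_{-k})`, the extension of the
`L²` product `(u, e_k) = ∫ u conj(e_k) dx`. -/
def hat (u : Distr) (k : ℤ × ℤ) : ℂ := (u : Module.Dual ℂ TestFun) (eTest (-k))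

/-! Fourier coefficients determine a distribution -/

theorem integral_T2 (f : T2 → ℂ) (hf : Continuous f) :
    ∫ x, f x = ∫ b : AddCircle (2 * π), ∫ s in (0 : ℝ)..(0 + 2 * π), f ((s : AddCircle (2 * π)), b) := by
  have hi : Integrable f (volume : Measure T2) :=
    hf.integrable_of_hasCompactSupport (HasCompactSupport.of_compactSpace f)
  rw [Measure.volume_eq_prod] at hi ⊢
  rw [integral_prod_symm _ hi]
  congr 1
  ext b
  rw [← AddCircle.intervalIntegral_preimage (2 * π) 0 (fun a => f (a, b))]

theorem integral_T2' (f : T2 → ℂ) (hf : Continuous f) :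
    ∫ x, f x = ∫ a : AddCircle (2 * π), ∫ s in (0 : ℝ)..(0 + 2 * π), f (a, (s : AddCircle (2 * π))) := by
  have hi : Integrable f (volume : Measure T2) :=
    hf.integrable_of_hasCompactSupport (HasCompactSupport.of_compactSpace f)
  rw [Measure.volume_eq_prod] at hi ⊢
  rw [integral_prod _ hi]
  congr 1
  ext b
  rw [← AddCircle.intervalIntegral_preimage (2 * π) 0 (fun a => f (b, a))]

theorem hasDerivAt_line (v : ℝ × ℝ) (φ : TestFun) (x : T2) (s : ℝ) :
    HasDerivAt (fun t : ℝ => (φ : T2 → ℂ) (x + mk (t • v)))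
      ((D v φ : T2 → ℂ) (x + mk (s • v))) s := by
  have h := hasDerivAt_dirDeriv v φ (x + mk (s • v))
  have h2 := HasDerivAt.comp_sub_const (f := fun t : ℝ => (φ : T2 → ℂ) (x + mk (s • v) + mk (t • v)))
    s s (by simpa using h)
  refine h2.congr_of_eventuallyEq (Eventually.of_forall fun t => ?_)
  have : mk (t • v) = mk (s • v) + mk ((t - s) • v) := by
    rw [← mk_add, ← add_smul]; congr 2; ring
  simp only [this, add_assoc]

theorem integral_D1 (φ : TestFun) : ∫ x, (D (1, 0) φ : T2 → ℂ) x = 0 := by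
  rw [integral_T2 _ (TestFun.continuous _)]
  have : ∀ b : AddCircle (2 * π), ∫ s in (0 : ℝ)..(0 + 2 * π),
      (D (1, 0) φ : T2 → ℂ) ((s : AddCircle (2 * π)), b) = 0 := by
    intro b
    rw [intervalIntegral.integral_eq_sub_of_hasDerivAt
      (f := fun s : ℝ => (φ : T2 → ℂ) ((s : AddCircle (2 * π)), b))]
    · rw [zero_add, AddCircle.coe_period]; simp
    · intro s _
      simpa [mk] using hasDerivAt_line (1, 0) φ (0, b) s
    · refine Continuous.intervalIntegrable ?_ _ _
      exact (TestFun.continuous (D (1, 0) φ)).comp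
        ((AddCircle.continuous_mk' (2 * π)).prodMk continuous_const)
  simp only [this, integral_zero]

theorem integral_D2 (φ : TestFun) : ∫ x, (D (0, 1) φ : T2 → ℂ) x = 0 := by
  rw [integral_T2' _ (TestFun.continuous _)]
  have : ∀ b : AddCircle (2 * π), ∫ s in (0 : ℝ)..(0 + 2 * π),
      (D (0, 1) φ : T2 → ℂ) (b, (s : AddCircle (2 * π))) = 0 := by
    intro b
    rw [intervalIntegral.integral_eq_sub_of_hasDerivAt
      (f := fun s : ℝ => (φ : T2 → ℂ) (b, (s : AddCircle (2 * π))))]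
    · rw [zero_add, AddCircle.coe_period]; simp
    · intro s _
      simpa [mk] using hasDerivAt_line (0, 1) φ (b, 0) s
    · refine Continuous.intervalIntegrable ?_ _ _
      exact (TestFun.continuous (D (0, 1) φ)).comp
        (continuous_const.prodMk (AddCircle.continuous_mk' (2 * π)))
  simp only [this, integral_zero]

theorem D_e (v : ℝ × ℝ) (k : ℤ × ℤ) (x : T2) :
    (D v (eTest k) : T2 → ℂ) x = Complex.I * (k.1 * v.1 + k.2 * v.2) * e k x := by
  obtain ⟨p, rfl⟩ := mk_surjective x
  have h1 := hasDerivAt_dirDeriv v (eTest k) (mk p)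
  refine h1.unique ?_
  have h : (fun t : ℝ => (eTest k : T2 → ℂ) (mk p + mk (t • v))) = fun t : ℝ =>
      (1 / (2 * π) : ℂ) * Complex.exp (Complex.I * (k.1 * (p.1 + t * v.1) + k.2 * (p.2 + t * v.2))) := by
    ext t
    rw [← mk_add]
    simp only [eTest, e_mk]
    simp
  rw [h, e_mk]
  have ht : HasDerivAt (fun t : ℝ => (t : ℂ)) 1 0 := Complex.ofRealCLM.hasDerivAt
  have := (((((ht.mul_const (v.1 : ℂ)).const_add (p.1 : ℂ)).const_mul (k.1 : ℂ)).add
    (((ht.mul_const (v.2 : ℂ)).const_add (p.2 : ℂ)).const_mul (k.2 : ℂ))).const_mul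
      Complex.I).cexp.const_mul (1 / (2 * π) : ℂ)
  refine this.congr_deriv ?_
  simp only [Pi.add_apply, Complex.ofReal_zero, zero_mul, add_zero, one_mul]
  ring

/-- The product of two test functions. -/
def mulTest (φ ψ : TestFun) : TestFun :=
  ⟨fun x => (φ : T2 → ℂ) x * (ψ : T2 → ℂ) x, (TestFun.contDiff φ).mul (TestFun.contDiff ψ)⟩

theorem D_mul (v : ℝ × ℝ) (φ ψ : TestFun) (x : T2) :
    (D v (mulTest φ ψ) : T2 → ℂ) x =
      (D v φ : T2 → ℂ) x * (ψ : T2 → ℂ) x + (φ : T2 → ℂ) x * (D v ψ : T2 → ℂ) x := by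
  have := ((hasDerivAt_dirDeriv v φ x).mul (hasDerivAt_dirDeriv v ψ x)).deriv
  have h0 : mk ((0 : ℝ) • v) = 0 := by rw [zero_smul]; rfl
  rw [h0, add_zero] at this
  exact this

/-- Fourier coefficients of a test function. -/
def coef (φ : TestFun) (k : ℤ × ℤ) : ℂ := ∫ x, (φ : T2 → ℂ) x * e (-k) x

theorem integrable_of_cont {f : T2 → ℂ} (hf : Continuous f) : Integrable f :=
  hf.integrable_of_hasCompactSupport (HasCompactSupport.of_compactSpace f)

theorem coef_D (v : ℝ × ℝ) (hv : ∀ ψ : TestFun, ∫ x, (D v ψ : T2 → ℂ) x = 0) (φ : TestFun)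
    (k : ℤ × ℤ) : coef (D v φ) k = Complex.I * (k.1 * v.1 + k.2 * v.2) * coef φ k := by
  have h := hv (mulTest φ (eTest (-k)))
  simp only [D_mul, D_e] at h
  change ∫ x, ((D v φ : T2 → ℂ) x * e (-k) x + _) = 0 at h
  rw [integral_add] at h
  · have h2 : ∀ x : T2, (φ : T2 → ℂ) x * (Complex.I * (((-k).1 : ℤ) * v.1 + ((-k).2 : ℤ) * v.2) * e (-k) x)
        = -(Complex.I * (k.1 * v.1 + k.2 * v.2)) * ((φ : T2 → ℂ) x * e (-k) x) := by
      intro x; push_cast [Prod.fst_neg, Prod.snd_neg]; ring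
    simp only [h2] at h
    rw [integral_const_mul] at h
    rw [coef, coef]
    linear_combination h
  · exact integrable_of_cont ((TestFun.continuous _).mul (continuous_e _))
  · exact integrable_of_cont ((TestFun.continuous _).mul (continuous_const.mul (continuous_e _)))

theorem coef_D1 (φ : TestFun) (k : ℤ × ℤ) : coef (D (1, 0) φ) k = Complex.I * k.1 * coef φ k := by
  simpa using coef_D _ integral_D1 φ k

theorem coef_D2 (φ : TestFun) (k : ℤ × ℤ) : coef (D (0, 1) φ) k = Complex.I * k.2 * coef φ k := by
  simpa using coef_D _ integral_D2 φ k

theorem coef_sub (φ ψ : TestFun) (k : ℤ × ℤ) : coef (φ - ψ) k = coef φ k - coef ψ k := by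
  unfold coef
  rw [← integral_sub]
  · congr 1; ext x; simp [sub_mul]
  · exact integrable_of_cont ((TestFun.continuous _).mul (continuous_e _))
  · exact integrable_of_cont ((TestFun.continuous _).mul (continuous_e _))

theorem coef_bdd (φ : TestFun) : ∃ C : ℝ, ∀ k, ‖coef φ k‖ ≤ C := by
  refine ⟨∫ x, ‖(φ : T2 → ℂ) x‖ * (1 / (2 * π)), fun k => ?_⟩
  refine (norm_integral_le_integral_norm _).trans (le_of_eq ?_)
  congr 1; ext x
  rw [norm_mul, norm_e]

theorem summable_int : Summable fun n : ℤ => (1 + (n : ℝ) ^ 2)⁻¹ := by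
  have h := (Real.summable_one_div_int_add_rpow (1 / 2) 2).2 (by norm_num)
  refine Summable.of_nonneg_of_le (fun n => by positivity) (fun n => ?_) (h.mul_left 4)
  have hn : (n : ℝ) + 1 / 2 ≠ 0 := by
    intro h0
    have : (2 * n + 1 : ℤ) = 0 := by
      have : (2 * (n : ℝ) + 1) = 0 := by linarith
      exact_mod_cast this
    omega
  have hp : 0 < ((n : ℝ) + 1 / 2) ^ 2 := by positivity
  rw [show ((2 : ℝ)) = ((2 : ℕ) : ℝ) by norm_num, Real.rpow_natCast, sq_abs] 
  rw [inv_eq_one_div, ← mul_div_assoc, div_le_div_iff₀ (by positivity) (by simpa using hp)]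
  push_cast
  nlinarith [sq_nonneg ((n : ℝ) - 1)]

theorem summable_coef (φ : TestFun) : Summable fun k => ‖coef φ k‖ := by
  obtain ⟨C, hC⟩ := coef_bdd
    ((φ - D (1, 0) (D (1, 0) φ)) - D (0, 1) (D (0, 1) (φ - D (1, 0) (D (1, 0) φ))))
  have hs := (summable_int.mul_of_nonneg summable_int (fun _ => by positivity)
    (fun _ => by positivity)).mul_left C
  refine Summable.of_nonneg_of_le (fun _ => norm_nonneg _) (fun k => ?_) hs
  have h := hC k
  simp only [coef_sub, coef_D1, coef_D2] at h
  have h2 : coef φ k - Complex.I * k.1 * (Complex.I * k.1 * coef φ k) - Complex.I * k.2 *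
      (Complex.I * k.2 * (coef φ k - Complex.I * k.1 * (Complex.I * k.1 * coef φ k))) =
      (((1 + (k.1 : ℝ) ^ 2) * (1 + (k.2 : ℝ) ^ 2) : ℝ) : ℂ) * coef φ k := by
    push_cast
    linear_combination (-(k.1 : ℂ) ^ 2 - (k.2 : ℂ) ^ 2 + (Complex.I ^ 2 - 1) * (k.1 : ℂ) ^ 2 * (k.2 : ℂ) ^ 2)
      * coef φ k * Complex.I_sq
  rw [h2, norm_mul, Complex.norm_real, Real.norm_of_nonneg (by positivity)] at h
  rw [← mul_inv, ← div_eq_mul_inv, le_div_iff₀ (by positivity)]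
  linarith

theorem eq_zero_of_coef (f : C(T2, ℂ)) (h : ∀ k, ∫ x, f x * e k x = 0) : f = 0 := by
  have one (g : C(AddCircle (2 * π), ℂ)) (hg : ∀ n, ∫ s, g s * fourier n s = 0) : g = 0 := by
    have hc : fourierCoeff g = 0 := by
      ext n
      have h1 : ∫ s, fourier (-n) s * g s ∂(volume : Measure (AddCircle (2 * π))) = 0 := by
        simpa [mul_comm] using hg (-n)
      rw [fourierCoeff]
      rw [AddCircle.volume_eq_smul_haarAddCircle, integral_smul_measure] at h1
      rcases smul_eq_zero.1 h1 with h0 | h0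
      · exact absurd h0 (by rw [ENNReal.toReal_ofReal (by positivity)]; positivity)
      · simpa using h0
    ext s
    have := has_pointwise_sum_fourier_series_of_summable (f := g) (by rw [hc]; exact summable_zero) s
    simp only [hc, Pi.zero_apply, zero_smul] at this
    simpa using this.unique hasSum_zero
  have hF (m : ℤ) : Continuous fun b : AddCircle (2 * π) =>
      ∫ a : AddCircle (2 * π), f (a, b) * fourier m a := by
    have := continuous_parametric_integral_of_continuous
      (f := fun (b a : AddCircle (2 * π)) => f (a, b) * fourier m a) (μ := volume)
      (s := Set.univ) (by fun_prop) isCompact_univ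
    simpa using this
  have hz (m : ℤ) : (⟨_, hF m⟩ : C(AddCircle (2 * π), ℂ)) = 0 := by
    refine one _ fun n => ?_
    have h1 := h (m, n)
    have hi : Integrable (fun x : T2 => f x * e (m, n) x) :=
      integrable_of_cont (f.continuous.mul (continuous_e _))
    rw [Measure.volume_eq_prod] at h1 hi
    rw [integral_prod_symm _ hi] at h1
    have h2 : ∀ a b : AddCircle (2 * π), f (a, b) * e (m, n) (a, b) =
        (f (a, b) * fourier m a) * ((1 / (2 * π) : ℂ) * fourier n b) := by
      intro a b; simp only [e]; ring
    simp only [h2, integral_mul_const] at h1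
    have h3 : ∀ b : AddCircle (2 * π), (∫ a : AddCircle (2 * π), f (a, b) * fourier m a) *
        ((1 / (2 * π) : ℂ) * fourier n b) = (1 / (2 * π) : ℂ) *
        ((∫ a : AddCircle (2 * π), f (a, b) * fourier m a) * fourier n b) := by
      intro b; ring
    simp only [h3, integral_const_mul] at h1
    rcases mul_eq_zero.1 h1 with h0 | h0
    · have : (π : ℂ) ≠ 0 := by exact_mod_cast Real.pi_ne_zero
      simp [this] at h0
    · exact h0
  ext ⟨a, b⟩
  have := one ⟨fun a => f (a, b), by fun_prop⟩ fun m => by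
    simpa using DFunLike.congr_fun (hz m) b
  simpa using DFunLike.congr_fun this a

theorem integral_e_mul (k l : ℤ × ℤ) : ∫ x, e k x * e (-l) x = if k = l then 1 else 0 := by
  have one (n : ℤ) : ∫ s : AddCircle (2 * π), fourier n s = if n = 0 then (2 * π : ℂ) else 0 := by
    have h := fourierCoeff_fourier (T := 2 * π) n
    have h1 := congrFun h 0
    rw [fourierCoeff] at h1
    rw [AddCircle.volume_eq_smul_haarAddCircle, integral_smul_measure]
    simp only [neg_zero, fourier_zero, one_smul] at h1
    rw [h1, ENNReal.toReal_ofReal (by positivity)]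
    by_cases hn : n = 0
    · subst hn; simp
    · simp [hn, Ne.symm hn]
  have hp : (π : ℂ) ≠ 0 := by exact_mod_cast Real.pi_ne_zero
  have h2 : ∀ x : T2, e k x * e (-l) x = (1 / (2 * π) : ℂ) ^ 2 *
      (fourier (k.1 - l.1) x.1 * fourier (k.2 - l.2) x.2) := by
    intro x
    simp only [e, sub_eq_add_neg, fourier_add, Prod.fst_neg, Prod.snd_neg]
    ring
  simp only [h2]
  rw [integral_const_mul, Measure.volume_eq_prod,
    integral_prod_mul (fun a => fourier (k.1 - l.1) a) (fun b => fourier (k.2 - l.2) b), one, one]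
  simp only [sub_eq_zero, Prod.ext_iff]
  by_cases h3 : k.1 = l.1 <;> by_cases h4 : k.2 = l.2 <;> simp [h3, h4]
  field_simp

theorem hasSum_fourier (φ : TestFun) (x : T2) :
    HasSum (fun k => coef φ k * e k x) ((φ : T2 → ℂ) x) := by
  let E : ℤ × ℤ → C(T2, ℂ) := fun k => ⟨e k, continuous_e k⟩
  have hE : ∀ k, ‖E k‖ ≤ 1 := fun k => by
    rw [ContinuousMap.norm_le _ zero_le_one]
    intro x
    rw [show E k x = e k x from rfl, norm_e, div_le_one (by positivity)]
    nlinarith [Real.pi_gt_three]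
  have hs : Summable fun k => coef φ k • E k := by
    refine Summable.of_norm_bounded (summable_coef φ) fun k => ?_
    rw [norm_smul]
    exact mul_le_of_le_one_right (norm_nonneg _) (hE k)
  obtain ⟨F, hF⟩ := hs
  have hFx : ∀ x, HasSum (fun k => coef φ k * e k x) (F x) := fun x => by
    simpa [E] using (ContinuousMap.evalCLM ℂ x).hasSum hF
  have hzero : (⟨φ, TestFun.continuous φ⟩ : C(T2, ℂ)) - F = 0 := by
    refine eq_zero_of_coef _ fun l => ?_
    have hL : HasSum (fun k => ∫ x, coef φ k * e k x * e l x) (∫ x, F x * e l x) := by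
      have h0 := hasSum_integral_of_summable_integral_norm (μ := (volume : Measure T2))
        (F := fun k x => coef φ k * e k x * e l x)
        (fun k => integrable_of_cont ((continuous_const.mul (continuous_e k)).mul (continuous_e l)))
        (by
          simp only [norm_mul, norm_e, integral_const]
          exact (((summable_coef φ).mul_right _).mul_right _).const_smul _)
      have h1 : ∀ x, ∑' k, coef φ k * e k x * e l x = F x * e l x := fun x =>
        ((hFx x).mul_right (e l x)).tsum_eq
      simpa only [h1] using h0
    have h1 : ∀ k, ∫ x, coef φ k * e k x * e l x = if k = -l then coef φ (-l) else 0 := fun k => by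
      simp only [mul_assoc]
      rw [integral_const_mul]
      have := integral_e_mul k (-l)
      rw [neg_neg] at this
      rw [this]
      split_ifs with h
      · rw [h, mul_one]
      · simp
    simp only [h1] at hL
    have h2 := hL.unique (hasSum_ite_eq (-l) (coef φ (-l)))
    have h3 : coef φ (-l) = ∫ x, (φ : T2 → ℂ) x * e l x := by rw [coef, neg_neg]
    simp only [ContinuousMap.sub_apply, ContinuousMap.coe_mk, sub_mul]
    rw [integral_sub, h2, h3, sub_self]
    · exact integrable_of_cont ((TestFun.continuous φ).mul (continuous_e _))
    · exact integrable_of_cont (F.continuous.mul (continuous_e _))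
  have : F x = (φ : T2 → ℂ) x := (sub_eq_zero.1 (DFunLike.congr_fun hzero x)).symm
  rw [← this]
  exact hFx x

theorem norm_sub_partial (φ : TestFun) (F : Finset (ℤ × ℤ)) (x : T2) :
    ‖(φ : T2 → ℂ) x - ∑ k ∈ F, coef φ k * e k x‖ ≤ ∑' k : {k // k ∉ F}, ‖coef φ k‖ := by
  have h := hasSum_fourier φ x
  have h2 := (Finset.hasSum_compl_iff (f := fun k => coef φ k * e k x) F (a := (φ : T2 → ℂ) x -
    ∑ k ∈ F, coef φ k * e k x)).2 (by simpa using h)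
  have h3 : Summable fun k : {k // k ∉ F} => ‖coef φ k‖ := (summable_coef φ).subtype _
  refine h2.norm_le_of_bounded h3.hasSum fun k => ?_
  rw [norm_mul, norm_e]
  refine mul_le_of_le_one_right (norm_nonneg _) ?_
  rw [div_le_one (by positivity)]
  nlinarith [Real.pi_gt_three]

theorem partialD_sub (i j : ℕ) (φ ψ : TestFun) :
    partialD i j (φ - ψ) = partialD i j φ - partialD i j ψ := by
  simp only [partialD, iterate_map_sub]

theorem partialD_sum (i j : ℕ) (F : Finset (ℤ × ℤ)) (c : ℤ × ℤ → ℂ) (x : T2) :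
    (partialD i j (∑ k ∈ F, c k • eTest k) : T2 → ℂ) x =
      ∑ k ∈ F, c k * ((Complex.I * k.1) ^ i * (Complex.I * k.2) ^ j) * e k x := by
  have h1 : ∀ k, D (1, 0) (eTest k) = (Complex.I * k.1) • eTest k := fun k => by
    ext x; simpa [eTest] using D_e (1, 0) k x
  have h2 : ∀ k, D (0, 1) (eTest k) = (Complex.I * k.2) • eTest k := fun k => by
    ext x; simpa [eTest] using D_e (0, 1) k x
  have h3 : ∀ (j : ℕ) (v : ℝ × ℝ) (m : ℤ × ℤ → ℂ) (_ : ∀ k, D v (eTest k) = m k • eTest k)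
      (c : ℤ × ℤ → ℂ), (D v)^[j] (∑ k ∈ F, c k • eTest k) = ∑ k ∈ F, (c k * m k ^ j) • eTest k := by
    intro j v m hm c
    induction j with
    | zero => simp
    | succ j ih =>
      rw [Function.iterate_succ_apply', ih, map_sum]
      refine Finset.sum_congr rfl fun k _ => ?_
      rw [map_smul, hm, smul_smul]; congr 1; ring
  rw [partialD, h3 j (0, 1) (fun k => Complex.I * k.2) h2,
    h3 i (1, 0) (fun k => Complex.I * k.1) h1]
  simp only [Submodule.coe_sum, Finset.sum_apply, Submodule.coe_smul, Pi.smul_apply, smul_eq_mul]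
  refine Finset.sum_congr rfl fun k _ => ?_
  simp only [eTest]; ring

theorem coef_partialD (i j : ℕ) (φ : TestFun) (k : ℤ × ℤ) :
    coef (partialD i j φ) k = (Complex.I * k.1) ^ i * (Complex.I * k.2) ^ j * coef φ k := by
  have h1 : ∀ (i : ℕ) (ψ : TestFun), coef ((D (1, 0))^[i] ψ) k = (Complex.I * k.1) ^ i * coef ψ k := by
    intro i ψ
    induction i with
    | zero => simp
    | succ i ih => rw [Function.iterate_succ_apply', coef_D1, ih]; ring
  have h2 : ∀ (i : ℕ) (ψ : TestFun), coef ((D (0, 1))^[i] ψ) k = (Complex.I * k.2) ^ i * coef ψ k := by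
    intro i ψ
    induction i with
    | zero => simp
    | succ i ih => rw [Function.iterate_succ_apply', coef_D2, ih]; ring
  rw [partialD, h1, h2]; ring

theorem distr_bound (u : Module.Dual ℂ TestFun) (N : ℕ) (C : ℝ)
    (hu : ∀ (φ : TestFun) (B : ℝ),
      (∀ i j : ℕ, i + j ≤ N → ∀ x : T2, ‖(partialD i j φ : T2 → ℂ) x‖ ≤ B) → ‖u φ‖ ≤ C * B)
    (he : ∀ k, u (eTest k) = 0) (φ : TestFun) (F : Finset (ℤ × ℤ)) :
    ‖u φ‖ ≤ C * ∑ ij ∈ Finset.range (N + 1) ×ˢ Finset.range (N + 1),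
        ∑' k : {k // k ∉ F}, ‖coef (partialD ij.1 ij.2 φ) k‖ := by
  have h0 : u φ = u (φ - ∑ k ∈ F, coef φ k • eTest k) := by
    rw [map_sub, map_sum]
    simp only [map_smul, he, smul_zero, Finset.sum_const_zero, sub_zero]
  rw [h0]
  refine hu _ _ fun i j hij x => ?_
  have h1 := norm_sub_partial (partialD i j φ) F x
  have h2 : (partialD i j (φ - ∑ k ∈ F, coef φ k • eTest k) : T2 → ℂ) x =
      (partialD i j φ : T2 → ℂ) x - ∑ k ∈ F, coef (partialD i j φ) k * e k x := by
    rw [partialD_sub, Submodule.coe_sub, Pi.sub_apply, partialD_sum]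
    congr 1
    refine Finset.sum_congr rfl fun k _ => ?_
    rw [coef_partialD]; ring
  rw [h2]
  refine h1.trans ?_
  have hmem : (i, j) ∈ Finset.range (N + 1) ×ˢ Finset.range (N + 1) := by
    simp only [Finset.mem_product, Finset.mem_range]; omega
  have hnn : ∀ ij ∈ Finset.range (N + 1) ×ˢ Finset.range (N + 1),
      0 ≤ ∑' k : {k // k ∉ F}, ‖coef (partialD ij.1 ij.2 φ) k‖ :=
    fun _ _ => tsum_nonneg fun _ => norm_nonneg _
  exact Finset.single_le_sum hnn hmem

/-- A distribution with vanishing Fourier coefficients is zero. -/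
theorem Distr.ext_hat {u : Distr} (h : ∀ k, hat u k = 0) : u = 0 := by
  have he : ∀ k, (u : Module.Dual ℂ TestFun) (eTest k) = 0 := fun k => by
    simpa [hat] using h (-k)
  have hex : ∃ (N : ℕ) (C : ℝ), ∀ (φ : TestFun) (B : ℝ),
    (∀ i j : ℕ, i + j ≤ N → ∀ x : T2, ‖(partialD i j φ : T2 → ℂ) x‖ ≤ B) →
      ‖(u : Module.Dual ℂ TestFun) φ‖ ≤ C * B := u.2
  obtain ⟨N, C, hu⟩ := hex
  refine Subtype.ext (LinearMap.ext fun φ => ?_)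
  change (u : Module.Dual ℂ TestFun) φ = 0
  have hlim1 : ∀ ij : ℕ × ℕ, Tendsto (fun F : Finset (ℤ × ℤ) =>
      ∑' k : {k // k ∉ F}, ‖coef (partialD ij.1 ij.2 φ) k‖) atTop (𝓝 0) :=
    fun ij => tendsto_tsum_compl_atTop_zero fun k => ‖coef (partialD ij.1 ij.2 φ) k‖
  have hlim := (tendsto_finsetSum (Finset.range (N + 1) ×ˢ Finset.range (N + 1))
    fun ij _ => hlim1 ij).const_mul C
  have h0 := ge_of_tendsto' hlim (distr_bound _ N C hu he φ)
  rwa [Finset.sum_const_zero, mul_zero, norm_le_zero_iff] at h0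
/-! Sobolev spaces -/

/-- `λ_k = 1 + |k|²`. -/
def lam (k : ℤ × ℤ) : ℝ := 1 + ((k.1 : ℝ) ^ 2 + (k.2 : ℝ) ^ 2)

theorem one_le_lam (k : ℤ × ℤ) : 1 ≤ lam k := by unfold lam; nlinarith [sq_nonneg (k.1 : ℝ), sq_nonneg (k.2 : ℝ)]

theorem lam_pos (k : ℤ × ℤ) : 0 < lam k := zero_lt_one.trans_le (one_le_lam k)

theorem hat_add (u v : Distr) (k : ℤ × ℤ) : hat (u + v) k = hat u k + hat v k := rfl

theorem hat_smul (c : ℝ) (u : Distr) (k : ℤ × ℤ) : hat (c • u) k = c * hat u k := rfl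

theorem summable_weight_iff (s : ℝ) (u : Distr) :
    Summable (fun k => lam k ^ s * ‖hat u k‖ ^ 2) ↔
      Memℓp (fun k => ((lam k ^ (s / 2) : ℝ) : ℂ) * hat u k) 2 := by
  rw [memℓp_gen_iff (by norm_num)]
  refine summable_congr fun k => ?_
  have h := lam_pos k
  have h2 : (2 : ℝ≥0∞).toReal = ((2 : ℕ) : ℝ) := by norm_num
  rw [h2, Real.rpow_natCast, norm_mul, mul_pow, Complex.norm_real,
    Real.norm_of_nonneg (by positivity), ← Real.rpow_natCast (lam k ^ (s / 2)), ← Real.rpow_mul h.le]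
  norm_num

/-- The real `L²`-Sobolev space `H^s(T²)`, as a real subspace of the distributions. -/
def sobolev (s : ℝ) : Submodule ℝ Distr where
  carrier := {u | Summable (fun k => lam k ^ s * ‖hat u k‖ ^ 2) ∧
    ∀ k, hat u (-k) = conj (hat u k)}
  zero_mem' := by
    have h : ∀ k, hat (0 : Distr) k = 0 := fun _ => rfl
    constructor <;> simp [h, summable_zero]
  add_mem' := by
    rintro u v ⟨hu, hu'⟩ ⟨hv, hv'⟩
    refine ⟨?_, fun k => by rw [hat_add, hat_add, hu', hv', map_add]⟩
    rw [summable_weight_iff] at hu hv ⊢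
    convert hu.add hv using 1
    ext k; simp only [hat_add, Pi.add_apply, mul_add]
  smul_mem' := by
    rintro c u ⟨hu, hu'⟩
    refine ⟨?_, fun k => by rw [hat_smul, hat_smul, hu', map_mul, Complex.conj_ofReal]⟩
    rw [summable_weight_iff] at hu ⊢
    convert hu.const_smul (c : ℂ) using 1
    ext k; simp only [hat_smul, Pi.smul_apply, smul_eq_mul]; ring

/-- `H^s(T²)` as a type. -/
def Sobolev (s : ℝ) : Type := sobolev s

namespace Sobolev

instance (s : ℝ) : AddCommGroup (Sobolev s) := inferInstanceAs (AddCommGroup (sobolev s))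
instance (s : ℝ) : Module ℝ (Sobolev s) := inferInstanceAs (Module ℝ (sobolev s))

/-- The underlying distribution. -/
def toDistr {s : ℝ} (u : Sobolev s) : Distr := (show sobolev s from u).1

/-- The weighted sequence of Fourier coefficients, `(λ_k^{s/2} û(k))_k`. -/
def toSeq {s : ℝ} (u : Sobolev s) : lp (fun _ : ℤ × ℤ => ℂ) 2 :=
  ⟨fun k => ((lam k ^ (s / 2) : ℝ) : ℂ) * hat u.toDistr k, (summable_weight_iff s _).1 u.2.1⟩

theorem hasSum_inner {s : ℝ} (u v : Sobolev s) :
    HasSum (fun k => ((lam k ^ s : ℝ) : ℂ) * hat u.toDistr k * hat v.toDistr (-k))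
      (inner ℂ v.toSeq u.toSeq) := by
  have h0 : HasSum (fun k => inner ℂ (v.toSeq k) (u.toSeq k)) (inner ℂ v.toSeq u.toSeq) :=
    lp.hasSum_inner (𝕜 := ℂ) v.toSeq u.toSeq
  have heq : (fun k => ((lam k ^ s : ℝ) : ℂ) * hat u.toDistr k * hat v.toDistr (-k)) =
      fun k => inner ℂ (v.toSeq k) (u.toSeq k) := by
    funext k
    have hv : hat v.toDistr (-k) = conj (hat v.toDistr k) := v.2.2 k
    have h : lam k ^ s = lam k ^ (s / 2) * lam k ^ (s / 2) := by
      rw [← Real.rpow_add (lam_pos k)]; norm_num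
    rw [hv, h]
    simp only [toSeq, RCLike.inner_apply, map_mul, Complex.conj_ofReal]
    push_cast; ring
  rw [heq]
  exact h0

theorem toSeq_eq_zero {s : ℝ} {u : Sobolev s} (h : u.toSeq = 0) : u = 0 := by
  refine Subtype.ext (Distr.ext_hat fun k => ?_)
  have h1 : ((lam k ^ (s / 2) : ℝ) : ℂ) * hat u.toDistr k = 0 := congrFun (congrArg Subtype.val h) k
  rcases mul_eq_zero.1 h1 with h2 | h2
  · exact absurd (Complex.ofReal_eq_zero.1 h2) (Real.rpow_pos_of_pos (lam_pos k) _).ne'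
  · exact h2

theorem toSeq_add {s : ℝ} (u v : Sobolev s) : (u + v).toSeq = u.toSeq + v.toSeq := by
  ext k
  exact mul_add _ _ _

theorem toSeq_smul {s : ℝ} (c : ℝ) (u : Sobolev s) : (c • u).toSeq = (c : ℂ) • u.toSeq := by
  ext k
  exact mul_left_comm _ _ _

/-- The inner product `(u, v)_{H^s} = ∑_k (1 + |k|²)^s û(k) v̂(-k)` (a real number). -/
def innerH {s : ℝ} (u v : Sobolev s) : ℝ :=
  (∑' k, ((lam k ^ s : ℝ) : ℂ) * hat u.toDistr k * hat v.toDistr (-k)).re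

theorem innerH_eq {s : ℝ} (u v : Sobolev s) : innerH u v = (inner ℂ v.toSeq u.toSeq).re :=
  congrArg Complex.re (hasSum_inner u v).tsum_eq

/-- The Hilbert space structure of `H^s`. -/
abbrev core (s : ℝ) : InnerProductSpace.Core ℝ (Sobolev s) where
  inner := innerH
  conj_inner_symm u v := by
    simp only [innerH_eq, conj_trivial]
    rw [← inner_conj_symm, Complex.conj_re]
  re_inner_nonneg u := by
    simp only [innerH_eq, RCLike.re_to_real]
    exact inner_self_nonneg (𝕜 := ℂ)
  add_left u v w := by
    simp only [innerH_eq, toSeq_add, inner_add_right, Complex.add_re]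
  smul_left u v c := by
    simp only [innerH_eq, toSeq_smul, inner_smul_right, Complex.re_ofReal_mul, conj_trivial]
  definite u h := by
    simp only [innerH_eq] at h
    exact toSeq_eq_zero (inner_self_eq_zero.1 (by
      rw [← inner_self_ofReal_re (𝕜 := ℂ)]; exact congrArg Complex.ofReal h))

instance (s : ℝ) : NormedAddCommGroup (Sobolev s) := (core s).toNormedAddCommGroup
instance (s : ℝ) : InnerProductSpace ℝ (Sobolev s) := InnerProductSpace.ofCore (core s).toCore
instance (s : ℝ) : MeasurableSpace (Sobolev s) := borel _
instance (s : ℝ) : BorelSpace (Sobolev s) := ⟨rfl⟩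

theorem inner_eq {s : ℝ} (u v : Sobolev s) :
    inner ℝ u v = (∑' k, ((lam k ^ s : ℝ) : ℂ) * hat u.toDistr k * hat v.toDistr (-k)).re := rfl

end Sobolev

/-- `H = L²(T²; ℝ)`. -/
abbrev H : Type := Lp ℝ 2 (volume : Measure T2)

/-- An element of `L²(T²; ℝ)`, viewed as the distribution `φ ↦ ∫ g φ dx`. -/
def l2Distr (g : H) : Distr :=
  have hg : Integrable (fun x => ((g x : ℝ) : ℂ)) :=
    ((Lp.memLp g).integrable (by norm_num)).ofReal
  have hi : ∀ φ : TestFun, Integrable fun x => ((g x : ℝ) : ℂ) * (φ : T2 → ℂ) x := fun φ => by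
    obtain ⟨B, hB⟩ := (isCompact_range (TestFun.continuous φ)).isBounded.exists_norm_le
    exact hg.mul_bdd (c := B) (TestFun.continuous φ).aestronglyMeasurable
      (Eventually.of_forall fun x => hB _ ⟨x, rfl⟩)
  ⟨{ toFun := fun φ => ∫ x, ((g x : ℝ) : ℂ) * (φ : T2 → ℂ) x
     map_add' := fun φ ψ => by
       rw [← integral_add (hi φ) (hi ψ)]
       congr 1; ext x; exact mul_add _ _ _
     map_smul' := fun c φ => by
       rw [RingHom.id_apply, smul_eq_mul, ← integral_const_mul]
       congr 1; ext x; exact mul_left_comm _ _ _ },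
   0, ∫ x, ‖((g x : ℝ) : ℂ)‖, fun φ B hB => by
     have h0 : ∀ x, ‖(φ : T2 → ℂ) x‖ ≤ B := fun x => hB 0 0 le_rfl x
     rw [← integral_mul_const]
     refine norm_integral_le_of_norm_le (hg.norm.mul_const B) (Eventually.of_forall fun x => ?_)
     rw [norm_mul]
     exact mul_le_mul_of_nonneg_left (h0 x) (norm_nonneg _)⟩

theorem hat_l2Distr (g : H) (k : ℤ × ℤ) : hat (l2Distr g) k = ∫ x, ((g x : ℝ) : ℂ) * e (-k) x := rfl

theorem summable_hat_l2 (g : H) : Summable fun k => ‖hat (l2Distr g) k‖ ^ 2 := by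
  have he : ∀ k, MemLp (e k) 2 (volume : Measure T2) := fun k =>
    MemLp.of_bound (continuous_e k).aestronglyMeasurable _ (Eventually.of_forall fun x => (norm_e k x).le)
  have hg : MemLp (fun x => ((g x : ℝ) : ℂ)) 2 (volume : Measure T2) := (Lp.memLp g).ofReal
  have hin : ∀ (k : ℤ × ℤ) (f : T2 → ℂ) (hf : MemLp f 2 (volume : Measure T2)),
      inner ℂ (he k).toLp hf.toLp = ∫ x, f x * e (-k) x := fun k f hf => by
    rw [L2.inner_def]
    refine integral_congr_ae ?_
    filter_upwards [(he k).coeFn_toLp, hf.coeFn_toLp] with x h1 h2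
    rw [h1, h2, RCLike.inner_apply, conj_e]
  have ho : Orthonormal ℂ fun k => (he k).toLp := by
    rw [orthonormal_iff_ite]
    intro k l
    rw [hin, integral_e_mul]
    simp only [eq_comm]
  have h := ho.inner_products_summable (x := hg.toLp)
  simpa only [hin, ← hat_l2Distr] using h

theorem l2Distr_mem {α : ℝ} (hα : 0 ≤ α) (g : H) : l2Distr g ∈ sobolev (-α) := by
  refine ⟨(summable_hat_l2 g).of_nonneg_of_le
    (fun k => mul_nonneg (Real.rpow_nonneg (lam_pos k).le _) (sq_nonneg _))
    fun k => mul_le_of_le_one_left (sq_nonneg _) ?_, fun k => ?_⟩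
  · exact Real.rpow_le_one_of_one_le_of_nonpos (one_le_lam k) (by linarith)
  · rw [hat_l2Distr, hat_l2Distr, ← integral_conj]
    congr 1; ext x
    rw [map_mul, Complex.conj_ofReal, conj_e]

/-- The inclusion `L²(T²) ⊂ H^{-α}(T²)`, `α ≥ 0`. -/
def embed {α : ℝ} (hα : 0 ≤ α) (g : H) : Sobolev (-α) := ⟨l2Distr g, l2Distr_mem hα g⟩

/-- The duality of `H^{-α}` and `H^α` that extends the `L²` product: `∑_k û(k) conj(v̂(k))`. -/
def duality {α : ℝ} (u : Sobolev (-α)) (v : Sobolev α) : ℂ :=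
  ∑' k, hat u.toDistr k * conj (hat v.toDistr k)

/-- The class in `L²(T²)` of a square integrable function (`0` if `f` is not square integrable; it
is only used for continuous `f`). -/
def toH (f : T2 → ℝ) : H :=
  open scoped Classical in if hf : MemLp f 2 (volume : Measure T2) then hf.toLp f else 0

/-! The free field and its Wick powers -/

/-- `(A^r u, v)_{H^s}` for `A = (1 - Δ)⁻¹`, where `A e_k = λ_k⁻¹ e_k`. -/
def powerForm {s : ℝ} (r : ℝ) (u v : Sobolev s) : ℝ :=
  (∑' k, ((lam k ^ (-r) : ℝ) : ℂ) *
    (((lam k ^ s : ℝ) : ℂ) * hat u.toDistr k * hat v.toDistr (-k))).re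

/-- `μ` is the free field `N(0, A^{1+δ})` on `E = H^{-δ}(T²)`: the centred Gaussian measure with
covariance operator `A^{1+δ}`. -/
structure IsFreeField (δ : ℝ) (μ : Measure (Sobolev (-δ))) : Prop where
  gaussian : IsGaussian μ
  mean_zero : ∀ l : Sobolev (-δ), ∫ z, inner ℝ l z ∂μ = 0
  covariance : ∀ l₁ l₂ : Sobolev (-δ),
    ∫ z, inner ℝ l₁ z * inner ℝ l₂ z ∂μ = powerForm (1 + δ) l₁ l₂

/-- The conditions on the cut-off set `Λ ⊂ ℝ²`. -/
structure IsCutoff (Λ : Set (ℝ × ℝ)) : Prop where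
  compact : IsCompact Λ
  symm : -Λ = Λ
  zero_mem : (0 : ℝ × ℝ) ∈ interior Λ

/-- `(Π_Λ z)(x) = ∑_k 1_Λ(k) ẑ(k) e_k(x)`, a finite sum whose value is real if `Λ = -Λ`. -/
def proj {s : ℝ} (Λ : Set (ℝ × ℝ)) (z : Sobolev s) (x : T2) : ℝ :=
  (∑' k : ℤ × ℤ, Set.indicator {k : ℤ × ℤ | ((k.1 : ℝ), (k.2 : ℝ)) ∈ Λ}
    (fun k => hat z.toDistr k * e k x) k).re

/-- `ρ_Λ = 𝔼[(Π_Λ z)(x)²]^{1/2}`. -/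
def rho {s : ℝ} (μ : Measure (Sobolev s)) (Λ : Set (ℝ × ℝ)) (x : T2) : ℝ :=
  Real.sqrt (∫ z, proj Λ z x ^ 2 ∂μ)

/-- The normalized Hermite polynomials
`ℍ_n(ξ) = (-1)ⁿ / √n! · exp(ξ²/2) (d/dξ)ⁿ exp(-ξ²/2)`. -/
def hermiteH (n : ℕ) (ξ : ℝ) : ℝ :=
  (-1) ^ n / Real.sqrt (n.factorial) * Real.exp (ξ ^ 2 / 2) *
    iteratedDeriv n (fun y => Real.exp (-(y ^ 2) / 2)) ξ

/-- The regularized Wick power `Φ_{n,Λ}(z)_x = √n! ρ_Λⁿ ℍ_n(ρ_Λ⁻¹ (Π_Λ z)(x))`. -/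
def wickApprox {s : ℝ} (μ : Measure (Sobolev s)) (n : ℕ) (Λ : Set (ℝ × ℝ)) (z : Sobolev s)
    (x : T2) : ℝ :=
  Real.sqrt (n.factorial) * rho μ Λ x ^ n * hermiteH n ((rho μ Λ x)⁻¹ * proj Λ z x)

/-- `cos_Λ(az)_x = cos(a (Π_Λ z)(x)) exp((a ρ_Λ)² / 2)`. -/
def cosApprox {s : ℝ} (μ : Measure (Sobolev s)) (a : ℝ) (Λ : Set (ℝ × ℝ)) (z : Sobolev s)
    (x : T2) : ℝ :=
  Real.cos (a * proj Λ z x) * Real.exp ((a * rho μ Λ x) ^ 2 / 2)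

/-- `sin_Λ(az)_x = sin(a (Π_Λ z)(x)) exp((a ρ_Λ)² / 2)`. -/
def sinApprox {s : ℝ} (μ : Measure (Sobolev s)) (a : ℝ) (Λ : Set (ℝ × ℝ)) (z : Sobolev s)
    (x : T2) : ℝ :=
  Real.sin (a * proj Λ z x) * Real.exp ((a * rho μ Λ x) ^ 2 / 2)

/-- `F_N → G` in `L^p(μ; X)`, including that all `F_N` and `G` belong to `L^p(μ; X)`. -/
def TendstoLp {Ω X : Type} [MeasurableSpace Ω] [NormedAddCommGroup X] (p : ℝ≥0∞) (μ : Measure Ω)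
    (F : ℕ → Ω → X) (G : Ω → X) : Prop :=
  (∀ N, MemLp (F N) p μ) ∧ MemLp G p μ ∧
    Tendsto (fun N => eLpNorm (fun z => F N z - G z) p μ) atTop (𝓝 0)

/-- `∑_n F_n = G` in `L^p(μ; X)`: the partial sums converge. -/
def SeriesLp {Ω X : Type} [MeasurableSpace Ω] [NormedAddCommGroup X] (p : ℝ≥0∞) (μ : Measure Ω)
    (F : ℕ → Ω → X) (G : Ω → X) : Prop :=
  TendstoLp p μ (fun M z => ∑ n ∈ Finset.range M, F n z) G

/-- `Φ` is the Wick power `:zⁿ:` in `H^{-α}`: the limit of `Φ_{n,NΛ}` in `L^p(μ; H^{-α})`, for every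
`p ≥ 1` and every cut-off set `Λ`. This determines `Φ` almost everywhere. -/
def IsWickPower {s α : ℝ} (hα : 0 ≤ α) (μ : Measure (Sobolev s)) (n : ℕ)
    (Φ : Sobolev s → Sobolev (-α)) : Prop :=
  ∀ Λ, IsCutoff Λ → ∀ p : ℝ, 1 ≤ p → TendstoLp (ENNReal.ofReal p) μ
    (fun N z => embed hα (toH (wickApprox μ n ((N : ℝ) • Λ) z))) Φ

/-- `Φ` is the tested Wick power `:zⁿ:(g)`: the limit of `(Φ_{n,NΛ}, g)_H` in `L^p(μ)`, for every
`p ≥ 1` and every cut-off set `Λ`. This determines `Φ` almost everywhere. -/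
def IsWickPowerTested {s : ℝ} (μ : Measure (Sobolev s)) (n : ℕ) (g : H)
    (Φ : Sobolev s → ℝ) : Prop :=
  ∀ Λ, IsCutoff Λ → ∀ p : ℝ, 1 ≤ p → TendstoLp (ENNReal.ofReal p) μ
    (fun N z => ∫ x, wickApprox μ n ((N : ℝ) • Λ) z x * g x) Φ

end Torus

end

noncomputable section

/-! ### Gaussian hypercontractivity from L² to L^p. -/

namespace Hypercontractive

/-! The covariance kernel G of the free field has only a logarithmic singularity: uniformly in a
heat regularization, G(x) ≤ (4π)⁻¹ log(π² / (‖x₁‖‖x₂‖)) + K (`integral_heat_le`). Hence exp(bG) is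
integrable on the torus for b < 4π, which is where the threshold of the statement comes from.

The factor exp((aρ)²/2) makes the Wick cosine and sine the real and imaginary parts of the
generating function of the Wick powers (`Wick.hasSum_wick`), so they are series of Wick powers
already at each cut-off. Wick powers of different degrees are orthogonal, and those of degree n at
points x, y have covariance n! G(x - y)ⁿ, where G is truncated to the common frequencies. Let J be a
continuous linear map into a Hilbert space, either the inclusion in H^{-α} or integration against g.
The squared L² norm of the term of degree n is then aⁿ·aⁿ/n! times ∑ cov(k₁)⋯cov(kₙ) w(k₁ + ⋯ + kₙ),
with w(k) = ‖J cos(k·)‖² + ‖J sin(k·)‖². Summed over n this is ∫ Q exp(a²G), where Q has Fourier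
coefficients w. It is bounded uniformly in the cut-off (`Admissible`) in two cases: a² < 4π if w is
summable, which covers g ∈ L², and a² < 4πα if w = λ^{-α} with α ≤ 1. In the latter case Q is, for α
< 1, of size |x|^{2α-2} near 0 and exp(a²G) of size |x|^{-a²/2π}, and the product is integrable
precisely in this range. See `exists_exp_sum_convSum_le`, `admissible_of_summable` and
`admissible_lam_rpow`.

Given this uniform bound, convergence is Hilbert space geometry. In each degree the truncations form
a net with orthogonal increments and bounded norms, hence converge, and dominated convergence for
orthogonal series exchanges the sum over degrees with the limit
(`OrthogonalNet.IsOrthogonalNet.tendsto_of_hasSum`). The net is indexed by all finite symmetric sets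
of frequencies, so one limit serves every cut-off set.

For L^p, the Mehler operator with parameter c multiplies a Wick power of degree n by cⁿ and turns
the Wick cosine of parameter a into that of parameter ca. It contracts L² into L^p for c = (p -
1)^{-1/2} (`Hypercontractive.lintegral_rotation_rpow_le`). Consequently L² convergence in a fixed
degree is L^p convergence for every p, and the L^p norm at a is at most the L² norm at √(p-1) a,
which gives the last range of a. -/

theorem two_mul_le_rpow_sub {r b : ℝ} (hr0 : 0 < r) (hr1 : r ≤ 1) (hb0 : 0 ≤ b) (hb1 : b ≤ 1) :
    2 * r * b ≤ (1 + b) ^ r - (1 - b) ^ r := by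
  have hmono : MonotoneOn (fun b : ℝ => (1 + b) ^ r - (1 - b) ^ r - 2 * r * b) (Set.Icc 0 1) := by
    refine monotoneOn_of_deriv_nonneg (convex_Icc 0 1) ?_ ?_ ?_
    · refine ContinuousOn.sub (ContinuousOn.sub ?_ ?_) (by fun_prop)
      · exact ContinuousOn.rpow_const (by fun_prop) fun x _ => Or.inr hr0.le
      · exact ContinuousOn.rpow_const (by fun_prop) fun x _ => Or.inr hr0.le
    · intro x hx
      rw [interior_Icc] at hx
      have h1 : (1 + x) ≠ 0 := by linarith [hx.1]
      have h2 : (1 - x) ≠ 0 := by linarith [hx.2]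
      refine DifferentiableAt.differentiableWithinAt ?_
      refine ((DifferentiableAt.rpow_const (by fun_prop) (Or.inl h1)).sub
        (DifferentiableAt.rpow_const (by fun_prop) (Or.inl h2))).sub (by fun_prop)
    · intro x hx
      rw [interior_Icc] at hx
      have h1 : 0 < 1 + x := by linarith [hx.1]
      have h2 : 0 < 1 - x := by linarith [hx.2]
      have hd : HasDerivAt (fun b : ℝ => (1 + b) ^ r - (1 - b) ^ r - 2 * r * b)
          (1 * r * (1 + x) ^ (r - 1) - (-1) * r * (1 - x) ^ (r - 1) - 2 * r * 1) x := by
        refine (HasDerivAt.sub ?_ ?_).sub ((hasDerivAt_id x).const_mul (2 * r))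
        · exact ((hasDerivAt_id x).const_add 1).rpow_const (Or.inl h1.ne')
        · exact ((hasDerivAt_id x).const_sub 1).rpow_const (Or.inl h2.ne')
      rw [hd.deriv]
      set u := (1 + x) ^ (r - 1)
      set w := (1 - x) ^ (r - 1)
      have hu : 0 < u := Real.rpow_pos_of_pos h1 _
      have hw : 0 < w := Real.rpow_pos_of_pos h2 _
      -- The derivative is r(u + w - 2); since uw = (1 - x²)^{r-1} ≥ 1, the arithmetic-geometric
      -- mean inequality gives u + w ≥ 2.
      have huw : 1 ≤ u * w := by
        rw [← Real.mul_rpow h1.le h2.le]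
        exact Real.one_le_rpow_of_pos_of_le_one_of_nonpos (mul_pos h1 h2)
            (by nlinarith [sq_nonneg x])
          (by linarith)
      have : 2 ≤ u + w := by nlinarith [sq_nonneg (u - w)]
      nlinarith
  have := hmono (Set.left_mem_Icc.2 zero_le_one) ⟨hb0, hb1⟩ hb0
  simp at this
  linarith

/-- The right side dominates its second order expansion at b = 0: the derivative of the difference
is, up to a positive factor, the previous inequality with exponent r = q - 1. -/
theorem one_add_le_rpow_add {q b : ℝ} (hq1 : 1 < q) (hq2 : q ≤ 2) (hb0 : 0 ≤ b) (hb1 : b ≤ 1) :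
    1 + q * (q - 1) / 2 * b ^ 2 ≤ ((1 + b) ^ q + (1 - b) ^ q) / 2 := by
  have hmono : MonotoneOn (fun b : ℝ => ((1 + b) ^ q + (1 - b) ^ q) - q * (q - 1) * b ^ 2)
      (Set.Icc 0 1) := by
    refine monotoneOn_of_deriv_nonneg (convex_Icc 0 1) ?_ ?_ ?_
    · refine ContinuousOn.sub (ContinuousOn.add ?_ ?_) (by fun_prop)
      · exact ContinuousOn.rpow_const (by fun_prop) fun x _ => Or.inr (by linarith)
      · exact ContinuousOn.rpow_const (by fun_prop) fun x _ => Or.inr (by linarith)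
    · intro x hx
      refine DifferentiableAt.differentiableWithinAt ?_
      refine ((DifferentiableAt.rpow_const (by fun_prop) (Or.inr hq1.le)).add
        (DifferentiableAt.rpow_const (by fun_prop) (Or.inr hq1.le))).sub (by fun_prop)
    · intro x hx
      rw [interior_Icc] at hx
      have hd : HasDerivAt (fun b : ℝ => ((1 + b) ^ q + (1 - b) ^ q) - q * (q - 1) * b ^ 2)
          (1 * q * (1 + x) ^ (q - 1) + (-1) * q * (1 - x) ^ (q - 1) -
            q * (q - 1) * (2 * x)) x := by
        refine (HasDerivAt.add ?_ ?_).sub ?_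
        · exact ((hasDerivAt_id x).const_add 1).rpow_const (Or.inr hq1.le)
        · exact ((hasDerivAt_id x).const_sub 1).rpow_const (Or.inr hq1.le)
        · simpa using (hasDerivAt_pow 2 x).const_mul (q * (q - 1))
      rw [hd.deriv]
      have := two_mul_le_rpow_sub (r := q - 1) (by linarith) (by linarith) hx.1.le hx.2.le
      nlinarith
  have := hmono (Set.left_mem_Icc.2 zero_le_one) ⟨hb0, hb1⟩ hb0
  simp at this
  linarith

/-- The two-point inequality. -/
theorem two_point {q x y : ℝ} (hq1 : 1 < q) (hq2 : q ≤ 2) (hx : 0 ≤ x) (hy : 0 ≤ y) :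
    ((x + y) / 2) ^ 2 + (q - 1) * ((x - y) / 2) ^ 2 ≤ ((x ^ q + y ^ q) / 2) ^ (2 / q) := by
  wlog hxy : y ≤ x generalizing x y
  · have := this hy hx (by linarith)
    rw [add_comm y, show (y - x) = -(x - y) by ring, neg_div, neg_sq, add_comm (y ^ q)] at this
    exact this
  rcases hx.eq_or_lt with rfl | hx0
  · have : y = 0 := le_antisymm hxy hy
    subst this
    have hq0 : q ≠ 0 := by linarith
    have : (2 / q) ≠ 0 := by positivity
    simp [Real.zero_rpow, hq0]
  have hq0 : 0 < q := by linarith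
  -- By homogeneity, division by the mean A reduces the pair (x, y) to (1 + b, 1 - b) and leaves an
  -- inequality in b alone.
  set A := (x + y) / 2 with hA
  have hA0 : 0 < A := by positivity
  set b := (x - y) / (x + y) with hb
  have hs : 0 < x + y := by linarith
  have hb0 : 0 ≤ b := by apply div_nonneg <;> linarith
  have hb1 : b ≤ 1 := by rw [hb, div_le_one hs]; linarith
  have hxb : x = A * (1 + b) := by rw [hA, hb]; field_simp; ring
  have hyb : y = A * (1 - b) := by rw [hA, hb]; field_simp; ring
  have hdb : (x - y) / 2 = A * b := by rw [hA, hb]; field_simp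
  have key : (1 + (q - 1) * b ^ 2) ^ (q / 2) ≤ ((1 + b) ^ q + (1 - b) ^ q) / 2 := by
    refine le_trans ?_ (one_add_le_rpow_add hq1 hq2 hb0 hb1)
    -- Bernoulli's inequality with exponent q/2 ≤ 1 produces exactly the quadratic coefficient q(q -
    -- 1)/2.
    have := rpow_one_add_le_one_add_mul_self (s := (q - 1) * b ^ 2) (p := q / 2)
      (by nlinarith [sq_nonneg b, mul_nonneg (sub_nonneg.2 hq1.le) (sq_nonneg b)])
      (by positivity) (by linarith)
    refine this.trans (le_of_eq (by ring))
  have hpos : 0 ≤ 1 + (q - 1) * b ^ 2 := by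
    nlinarith [mul_nonneg (sub_nonneg.2 hq1.le) (sq_nonneg b)]
  have key2 : 1 + (q - 1) * b ^ 2 ≤ (((1 + b) ^ q + (1 - b) ^ q) / 2) ^ (2 / q) := by
    calc 1 + (q - 1) * b ^ 2 = ((1 + (q - 1) * b ^ 2) ^ (q / 2)) ^ (2 / q) := by
          rw [← Real.rpow_mul hpos]
          rw [show q / 2 * (2 / q) = 1 by field_simp, Real.rpow_one]
      _ ≤ _ := Real.rpow_le_rpow (Real.rpow_nonneg hpos _) key (by positivity)
  have e1 : (x ^ q + y ^ q) / 2 = A ^ q * (((1 + b) ^ q + (1 - b) ^ q) / 2) := by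
    rw [hxb, hyb, Real.mul_rpow hA0.le (by linarith), Real.mul_rpow hA0.le (by linarith)]
    ring
  rw [hdb, e1, Real.mul_rpow (by positivity)
    (by have := Real.rpow_nonneg (show 0 ≤ 1 + b by linarith) q
        have := Real.rpow_nonneg (show 0 ≤ 1 - b by linarith) q
        linarith),
    ← Real.rpow_mul hA0.le, show q * (2 / q) = ((2 : ℕ) : ℝ) by field_simp; norm_num,
    Real.rpow_natCast]
  calc A ^ 2 + (q - 1) * (A * b) ^ 2 = A ^ 2 * (1 + (q - 1) * b ^ 2) := by ring
    _ ≤ _ := by gcongr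

/-- The bilinear form of the two-point inequality. Averaging g over a c-correlated sign gives the
values A ± cB; Cauchy-Schwarz against f leaves A² + c²B², which is the left side of `two_point` for
q - 1 = c². -/
theorem two_point_pair {c f₁ f₂ g₁ g₂ : ℝ} (hc0 : 0 < c) (hc1 : c ≤ 1) (hg₁ : 0 ≤ g₁)
    (hg₂ : 0 ≤ g₂) :
    (1 + c) / 4 * (f₁ * g₁ + f₂ * g₂) + (1 - c) / 4 * (f₁ * g₂ + f₂ * g₁) ≤
      ((f₁ ^ 2 + f₂ ^ 2) / 2) ^ (1 / 2 : ℝ) *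
        ((g₁ ^ (1 + c ^ 2) + g₂ ^ (1 + c ^ 2)) / 2) ^ (1 / (1 + c ^ 2)) := by
  have h := two_point (q := 1 + c ^ 2) (by nlinarith) (by nlinarith) hg₁ hg₂
  set S := (g₁ ^ (1 + c ^ 2) + g₂ ^ (1 + c ^ 2)) / 2 with hS
  have hS0 : 0 ≤ S := by positivity
  set A := (g₁ + g₂) / 2
  set B := (g₁ - g₂) / 2
  have e1 : S ^ (1 / (1 + c ^ 2)) = (S ^ (2 / (1 + c ^ 2))) ^ (1 / 2 : ℝ) := by
    rw [← Real.rpow_mul hS0]; congr 1; field_simp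
  rw [e1, ← Real.mul_rpow (by positivity) (by positivity), ← Real.sqrt_eq_rpow]
  refine Real.le_sqrt_of_sq_le ?_
  have e2 : (1 + c) / 4 * (f₁ * g₁ + f₂ * g₂) + (1 - c) / 4 * (f₁ * g₂ + f₂ * g₁) =
      (f₁ * (A + c * B) + f₂ * (A - c * B)) / 2 := by simp only [A, B]; ring
  rw [e2]
  have h2 : A ^ 2 + c ^ 2 * B ^ 2 ≤ S ^ (2 / (1 + c ^ 2)) := by
    refine le_trans (le_of_eq ?_) h; ring
  calc ((f₁ * (A + c * B) + f₂ * (A - c * B)) / 2) ^ 2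
      ≤ (f₁ ^ 2 + f₂ ^ 2) / 2 * (A ^ 2 + c ^ 2 * B ^ 2) := by
        nlinarith [sq_nonneg (f₁ * (A - c * B) - f₂ * (A + c * B))]
    _ ≤ _ := by gcongr

variable {V : Type} [NormedAddCommGroup V] [InnerProductSpace ℝ V] [MeasurableSpace V]
  [BorelSpace V] [FiniteDimensional ℝ V]

/-- The pair inequality `E[f(X) g(Y)] ≤ ‖f(X)‖₂ ‖g(Y)‖_q` for the joint law `ν` of `(X, Y)`. -/
def PairBound (q : ℝ) (ν : Measure (WithLp 2 (V × V))) : Prop :=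
  ∀ f g : V → ℝ≥0∞, Measurable f → Measurable g →
    ∫⁻ w, f w.fst * g w.snd ∂ν ≤
      (∫⁻ w, f w.fst ^ 2 ∂ν) ^ (1 / 2 : ℝ) * (∫⁻ w, g w.snd ^ q ∂ν) ^ (1 / q)

/-- The bound is stable under independent sums. With the first summand x fixed, the bound for ν₂
applies to translates of f and g; the resulting factors depend on x.fst and x.snd separately, so the
bound for ν₁ applies to them. -/
theorem PairBound.conv {q : ℝ} (hq : 0 < q) {ν₁ ν₂ : Measure (WithLp 2 (V × V))} [SFinite ν₁]
    [SFinite ν₂] (h₁ : PairBound q ν₁) (h₂ : PairBound q ν₂) : PairBound q (ν₁ ∗ ν₂) := by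
  intro f g hf hg
  have hfst : Measurable fun w : WithLp 2 (V × V) => w.fst :=
    (WithLp.prod_continuous_ofLp 2 V V).fst.measurable
  have hsnd : Measurable fun w : WithLp 2 (V × V) => w.snd :=
    (WithLp.prod_continuous_ofLp 2 V V).snd.measurable
  rw [Measure.lintegral_conv (by fun_prop), Measure.lintegral_conv (by fun_prop),
    Measure.lintegral_conv (by fun_prop)]
  have key : ∀ x : WithLp 2 (V × V), ∫⁻ y, f (x + y).fst * g (x + y).snd ∂ν₂ ≤
      (∫⁻ y, f (x.fst + y.fst) ^ 2 ∂ν₂) ^ (1 / 2 : ℝ) *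
        (∫⁻ y, g (x.snd + y.snd) ^ q ∂ν₂) ^ (1 / q) := fun x =>
    h₂ (fun v => f (x.fst + v)) (fun v => g (x.snd + v)) (by fun_prop) (by fun_prop)
  refine (lintegral_mono key).trans ?_
  have hF : Measurable fun v : V => (∫⁻ y, f (v + y.fst) ^ 2 ∂ν₂) ^ (1 / 2 : ℝ) := by
    refine Measurable.pow_const ?_ _
    exact Measurable.lintegral_prod_right' (f := fun p : V × WithLp 2 (V × V) =>
      f (p.1 + p.2.fst) ^ 2) (by fun_prop)
  have hG : Measurable fun v : V => (∫⁻ y, g (v + y.snd) ^ q ∂ν₂) ^ (1 / q) := by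
    refine Measurable.pow_const ?_ _
    exact Measurable.lintegral_prod_right' (f := fun p : V × WithLp 2 (V × V) =>
      g (p.1 + p.2.snd) ^ q) (by fun_prop)
  refine (h₁ _ _ hF hG).trans (le_of_eq ?_)
  congr 2
  · refine lintegral_congr fun x => ?_
    rw [← ENNReal.rpow_natCast, ← ENNReal.rpow_mul]
    norm_num
  · refine lintegral_congr fun x => ?_
    rw [← ENNReal.rpow_mul, one_div_mul_cancel hq.ne', ENNReal.rpow_one]
    rfl

/-- The law of `(ε v, ε' v)` for `c`-correlated signs `ε, ε'`. -/
def signPair (c : ℝ) (v : V) : Measure (WithLp 2 (V × V)) :=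
  ENNReal.ofReal ((1 + c) / 4) • (Measure.dirac (WithLp.toLp 2 (v, v)) +
      Measure.dirac (WithLp.toLp 2 (-v, -v))) +
    ENNReal.ofReal ((1 - c) / 4) • (Measure.dirac (WithLp.toLp 2 (v, -v)) +
      Measure.dirac (WithLp.toLp 2 (-v, v)))

theorem lintegral_signPair (c : ℝ) (v : V) (f : WithLp 2 (V × V) → ℝ≥0∞) :
    ∫⁻ w, f w ∂(signPair c v) =
      ENNReal.ofReal ((1 + c) / 4) * (f (WithLp.toLp 2 (v, v)) + f (WithLp.toLp 2 (-v, -v))) +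
      ENNReal.ofReal ((1 - c) / 4) * (f (WithLp.toLp 2 (v, -v)) + f (WithLp.toLp 2 (-v, v))) := by
  simp [signPair, lintegral_add_measure, lintegral_smul_measure, mul_add]

theorem isProbabilityMeasure_signPair {c : ℝ} (hc0 : 0 < c) (hc1 : c ≤ 1) (v : V) :
    IsProbabilityMeasure (signPair c v) := by
  constructor
  rw [← lintegral_one, lintegral_signPair, one_add_one_eq_two,
    show (2 : ℝ≥0∞) = ENNReal.ofReal 2 by simp,
    ← ENNReal.ofReal_mul (by linarith), ← ENNReal.ofReal_mul (by linarith),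
    ← ENNReal.ofReal_add (by linarith) (by linarith)]
  rw [show (1 + c) / 4 * 2 + (1 - c) / 4 * 2 = 1 by ring, ENNReal.ofReal_one]

theorem pairBound_signPair {c : ℝ} (hc0 : 0 < c) (hc1 : c ≤ 1) (v : V) :
    PairBound (1 + c ^ 2) (signPair c v) := by
  intro f g _ _
  simp only [lintegral_signPair, WithLp.toLp_fst, WithLp.toLp_snd]
  have hq : 0 < 1 + c ^ 2 := by positivity
  generalize f v = f₁, f (-v) = f₂, g v = g₁, g (-v) = g₂
  have e0 : ENNReal.ofReal ((1 + c) / 4) + ENNReal.ofReal ((1 - c) / 4) = 2⁻¹ := by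
    rw [← ENNReal.ofReal_add (by linarith) (by linarith),
      show (1 + c) / 4 + (1 - c) / 4 = (2 : ℝ)⁻¹ by ring,
      ENNReal.ofReal_inv_of_pos (by norm_num)]
    simp
  have e1 : ∀ x y : ℝ≥0∞, ENNReal.ofReal ((1 + c) / 4) * (x + y) +
      ENNReal.ofReal ((1 - c) / 4) * (x + y) = 2⁻¹ * (x + y) := fun x y => by
    rw [← add_mul, e0]
  have e2 : ∀ x y : ℝ≥0∞, ENNReal.ofReal ((1 + c) / 4) * (x + y) +
      ENNReal.ofReal ((1 - c) / 4) * (y + x) = 2⁻¹ * (x + y) := fun x y => by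
    rw [add_comm y x, e1]
  rw [e1, e2]
  -- Vanishing functions are set aside before infinite values, because 0 * ⊤ = 0 would spoil the
  -- comparison with an infinite right side.
  by_cases hf0 : f₁ = 0 ∧ f₂ = 0
  · simp [hf0.1, hf0.2]
  by_cases hg0 : g₁ = 0 ∧ g₂ = 0
  · simp [hg0.1, hg0.2]
  have hF : (2⁻¹ * (f₁ ^ 2 + f₂ ^ 2)) ^ (1 / 2 : ℝ) ≠ 0 := by
    simp only [ne_eq, ENNReal.rpow_eq_zero_iff, mul_eq_zero, add_eq_zero]
    simp
    tauto
  have hG : (2⁻¹ * (g₁ ^ (1 + c ^ 2) + g₂ ^ (1 + c ^ 2))) ^ (1 / (1 + c ^ 2)) ≠ 0 := by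
    simp only [ne_eq, ENNReal.rpow_eq_zero_iff, mul_eq_zero, add_eq_zero]
    simp [hq, hq.not_gt]
    tauto
  by_cases hft : f₁ = ⊤ ∨ f₂ = ⊤
  · have : (2⁻¹ * (f₁ ^ 2 + f₂ ^ 2)) ^ (1 / 2 : ℝ) = ⊤ := by
      rcases hft with h | h <;> simp [h, ENNReal.mul_top]
    rw [this, ENNReal.top_mul hG]
    exact le_top
  by_cases hgt : g₁ = ⊤ ∨ g₂ = ⊤
  · have : (2⁻¹ * (g₁ ^ (1 + c ^ 2) + g₂ ^ (1 + c ^ 2))) ^ (1 / (1 + c ^ 2)) = ⊤ := by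
      rcases hgt with h | h <;> simp [h, ENNReal.mul_top, ENNReal.top_rpow_of_pos, hq]
    rw [this, ENNReal.mul_top hF]
    exact le_top
  push Not at hft hgt
  lift f₁ to ℝ≥0 using hft.1
  lift f₂ to ℝ≥0 using hft.2
  lift g₁ to ℝ≥0 using hgt.1
  lift g₂ to ℝ≥0 using hgt.2
  have key := two_point_pair (f₁ := f₁) (f₂ := f₂) hc0 hc1
    (NNReal.coe_nonneg g₁) (NNReal.coe_nonneg g₂)
  have hn : ∀ x : ℝ≥0, ((x : ℝ≥0) : ℝ≥0∞) = ENNReal.ofReal x := fun x => by simp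
  have h1c : 0 ≤ (1 - c) / 4 := by linarith
  simp only [hn]
  rw [show (2⁻¹ : ℝ≥0∞) = ENNReal.ofReal 2⁻¹ by rw [ENNReal.ofReal_inv_of_pos (by norm_num)]; simp]
  simp only [ENNReal.ofReal_rpow_of_nonneg (NNReal.coe_nonneg _) hq.le,
    ← ENNReal.ofReal_pow (NNReal.coe_nonneg _)]
  simp (disch := positivity) only [← ENNReal.ofReal_mul, ← ENNReal.ofReal_add,
    ENNReal.ofReal_rpow_of_nonneg]
  refine ENNReal.ofReal_le_ofReal ?_
  convert key using 3 <;> ring_nf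

theorem charFun_signPair {c : ℝ} (hc0 : 0 < c) (hc1 : c ≤ 1) (v : V) (t : WithLp 2 (V × V)) :
    charFun (signPair c v) t =
      (((1 + c) / 2 * Real.cos (inner ℝ v t.fst + inner ℝ v t.snd) +
        (1 - c) / 2 * Real.cos (inner ℝ v t.fst - inner ℝ v t.snd) : ℝ) : ℂ) := by
  have hi : ∀ μ : Measure (WithLp 2 (V × V)), IsFiniteMeasure μ →
      Integrable (fun x => Complex.exp (inner ℝ x t * Complex.I)) μ := fun μ _ =>
    (integrable_const (1 : ℝ)).mono (by fun_prop) (by simp [Complex.norm_exp])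
  rw [charFun_apply, signPair, integral_add_measure, integral_smul_measure, integral_smul_measure,
    integral_add_measure, integral_add_measure]
  · simp only [integral_dirac, WithLp.prod_inner_apply, inner_neg_left]
    rw [ENNReal.toReal_ofReal (by linarith), ENNReal.toReal_ofReal (by linarith)]
    push_cast
    rw [Complex.cos, Complex.cos]
    simp only [Complex.real_smul]
    push_cast
    have e1 : -((inner ℝ v t.ofLp.1 : ℝ) : ℂ) + -((inner ℝ v t.ofLp.2 : ℝ) : ℂ) =
      -(((inner ℝ v t.ofLp.1 : ℝ) : ℂ) + ((inner ℝ v t.ofLp.2 : ℝ) : ℂ)) := by ring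
    have e2 : ((inner ℝ v t.ofLp.1 : ℝ) : ℂ) + -((inner ℝ v t.ofLp.2 : ℝ) : ℂ) =
      (((inner ℝ v t.ofLp.1 : ℝ) : ℂ) - ((inner ℝ v t.ofLp.2 : ℝ) : ℂ)) := by ring
    have e3 : -((inner ℝ v t.ofLp.1 : ℝ) : ℂ) + ((inner ℝ v t.ofLp.2 : ℝ) : ℂ) =
      -(((inner ℝ v t.ofLp.1 : ℝ) : ℂ) - ((inner ℝ v t.ofLp.2 : ℝ) : ℂ)) := by ring
    rw [show t.fst = t.ofLp.1 from rfl, show t.snd = t.ofLp.2 from rfl, e1, e2, e3]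
    ring
  · exact hi _ inferInstance
  · exact hi _ inferInstance
  · exact hi _ inferInstance
  · exact hi _ inferInstance
  · exact (hi _ inferInstance).smul_measure ENNReal.ofReal_ne_top
  · exact (hi _ inferInstance).smul_measure ENNReal.ofReal_ne_top

/-- Cosines of small angles, rescaled. -/
theorem tendsto_mul_cos_sub_one (x : ℝ) :
    Tendsto (fun m : ℕ => (m : ℝ) * (Real.cos ((√m)⁻¹ * x) - 1)) atTop (𝓝 (-(x ^ 2 / 2))) := by
  have h0 : Tendsto (fun m : ℕ => (√(m : ℝ))⁻¹ * x) atTop (𝓝 0) := by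
    simpa using (tendsto_inv_atTop_zero.comp
      (Real.tendsto_sqrt_atTop.comp tendsto_natCast_atTop_atTop)).mul_const x
  have h1 : Tendsto (fun m : ℕ => -(x ^ 2 / 2) + x ^ 4 * (5 / 96) * (m : ℝ)⁻¹) atTop
      (𝓝 (-(x ^ 2 / 2))) := by
    simpa using (tendsto_inv_atTop_zero.comp
      (tendsto_natCast_atTop_atTop (R := ℝ))).const_mul (x ^ 4 * (5 / 96)) |>.const_add (-(x ^ 2 / 2))
  refine tendsto_of_tendsto_of_tendsto_of_le_of_le' tendsto_const_nhds h1 ?_ ?_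
  · filter_upwards [eventually_gt_atTop 0] with m hm
    have hm' : (0 : ℝ) < m := by exact_mod_cast hm
    have := Real.one_sub_sq_div_two_le_cos (x := (√m)⁻¹ * x)
    rw [mul_pow, inv_pow, Real.sq_sqrt hm'.le] at this
    have h2 : (m : ℝ) * ((m : ℝ)⁻¹ * x ^ 2 / 2) = x ^ 2 / 2 := by field_simp
    nlinarith
  · have h3 : ∀ᶠ m : ℕ in atTop, |(√(m : ℝ))⁻¹ * x| ≤ 1 := by
      have := h0.abs
      rw [abs_zero] at this
      exact (this.eventually_lt_const zero_lt_one).mono fun _ h => h.le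
    filter_upwards [eventually_gt_atTop 0, h3] with m hm hx
    have hm' : (0 : ℝ) < m := by exact_mod_cast hm
    have := (abs_le.1 (Real.cos_bound hx)).2
    have e4 : |(√(m : ℝ))⁻¹ * x| ^ 4 = ((m : ℝ)⁻¹) ^ 2 * x ^ 4 := by
      rw [show 4 = 2 * 2 by norm_num, pow_mul, sq_abs, mul_pow, inv_pow, Real.sq_sqrt hm'.le]; ring
    rw [e4, mul_pow, inv_pow, Real.sq_sqrt hm'.le] at this
    have h2 : (m : ℝ) * ((m : ℝ)⁻¹ * x ^ 2 / 2) = x ^ 2 / 2 := by field_simp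
    have h5 : (m : ℝ) * ((m : ℝ)⁻¹ ^ 2 * x ^ 4 * (5 / 96)) = x ^ 4 * (5 / 96) * (m : ℝ)⁻¹ := by
      field_simp
    nlinarith

/-- The central limit theorem at the level of characteristic functions. The weights (1 ± c)/2 of (a
± b)² combine to a² + b² + 2cab, the quadratic form of a pair with correlation c. -/
theorem tendsto_cos_mix_pow (c a b : ℝ) :
    Tendsto (fun m : ℕ => ((1 + c) / 2 * Real.cos ((√m)⁻¹ * a + (√m)⁻¹ * b) +
      (1 - c) / 2 * Real.cos ((√m)⁻¹ * a - (√m)⁻¹ * b)) ^ m) atTop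
      (𝓝 (Real.exp (-((a ^ 2 + b ^ 2 + 2 * c * (a * b)) / 2)))) := by
  have h := ((tendsto_mul_cos_sub_one (a + b)).const_mul ((1 + c) / 2)).add
    ((tendsto_mul_cos_sub_one (a - b)).const_mul ((1 - c) / 2))
  have h2 := Real.tendsto_one_add_pow_exp_of_tendsto (g := fun m : ℕ =>
    (1 + c) / 2 * (Real.cos ((√m)⁻¹ * (a + b)) - 1) +
    (1 - c) / 2 * (Real.cos ((√m)⁻¹ * (a - b)) - 1)) (h.congr fun m => by ring)
  convert! h2 using 2
  · congr 1
    rw [mul_add, mul_sub]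
    ring_nf
  · congr 1
    ring

/-- The law of a sum of m independent copies of the sign pair, recorded only through its
characteristic function, which is all that the central limit theorem needs. -/
theorem exists_pairBound_pow {c : ℝ} (hc0 : 0 < c) (hc1 : c ≤ 1) (v : V) (m : ℕ) :
    ∃ ν : Measure (WithLp 2 (V × V)), IsProbabilityMeasure ν ∧ PairBound (1 + c ^ 2) ν ∧
      ∀ t, charFun ν t = charFun (signPair c v) t ^ m := by
  have hq : 0 < 1 + c ^ 2 := by positivity
  have := isProbabilityMeasure_signPair hc0 hc1 v
  induction m with
  | zero =>
    refine ⟨Measure.dirac 0, inferInstance, fun f g hf hg => ?_, fun t => ?_⟩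
    · simp only [lintegral_dirac]
      rw [← ENNReal.rpow_natCast, ← ENNReal.rpow_mul, ← ENNReal.rpow_mul,
        mul_one_div_cancel hq.ne']
      norm_num
    · simp [charFun_apply]
  | succ m ih =>
    obtain ⟨ν, hν, hb, hc⟩ := ih
    exact ⟨ν ∗ signPair c v, inferInstance, hb.conv hq (pairBound_signPair hc0 hc1 v), fun t => by
      rw [charFun_conv, hc, pow_succ]⟩

theorem exists_pairBound_prod {c : ℝ} (hc0 : 0 < c) (hc1 : c ≤ 1) {ι : Type} (s : Finset ι)
    (v : ι → V) (m : ℕ) :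
    ∃ ν : Measure (WithLp 2 (V × V)), IsProbabilityMeasure ν ∧ PairBound (1 + c ^ 2) ν ∧
      ∀ t, charFun ν t = ∏ i ∈ s, charFun (signPair c (v i)) t ^ m := by
  classical
  induction s using Finset.induction_on with
  | empty => simpa using exists_pairBound_pow hc0 hc1 (0 : V) 0
  | insert i s hi ih =>
    obtain ⟨ν, hν, hb, hc⟩ := ih
    obtain ⟨ν', hν', hb', hc'⟩ := exists_pairBound_pow hc0 hc1 (v i) m
    exact ⟨ν' ∗ ν, inferInstance, hb'.conv (by positivity) hb, fun t => by
      rw [charFun_conv, hc, hc', Finset.prod_insert hi]⟩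

variable (V) in
/-- The law of `(c X + √(1 - c²) Y, X)` for independent standard Gaussian `X`, `Y`. -/
def gaussianPair (c : ℝ) : Measure (WithLp 2 (V × V)) :=
  ((stdGaussian V).prod (stdGaussian V)).map
    fun p => WithLp.toLp 2 (c • p.1 + √(1 - c ^ 2) • p.2, p.1)

theorem measurable_gaussianPair_map (c : ℝ) :
    Measurable fun p : V × V => WithLp.toLp 2 (c • p.1 + √(1 - c ^ 2) • p.2, p.1) :=
  ((WithLp.prod_continuous_toLp 2 V V).comp (by fun_prop)).measurable

instance (c : ℝ) : IsProbabilityMeasure (gaussianPair V c) :=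
  Measure.isProbabilityMeasure_map (measurable_gaussianPair_map c).aemeasurable

theorem charFun_gaussianPair {c : ℝ} (hc0 : 0 < c) (hc1 : c ≤ 1) (t : WithLp 2 (V × V)) :
    charFun (gaussianPair V c) t =
      Complex.exp (-((‖t.fst‖ ^ 2 + ‖t.snd‖ ^ 2 + 2 * c * inner ℝ t.fst t.snd) / 2 : ℝ)) := by
  rw [charFun_apply, gaussianPair, integral_map (measurable_gaussianPair_map c).aemeasurable
    (by fun_prop)]
  simp only [WithLp.prod_inner_apply]
  have e : ∀ p : V × V, Complex.exp (((inner ℝ (c • p.1 + √(1 - c ^ 2) • p.2) t.fst +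
      inner ℝ p.1 t.snd : ℝ) : ℂ) * Complex.I) =
      Complex.exp ((inner ℝ p.1 (t.snd + c • t.fst) : ℝ) * Complex.I) *
      Complex.exp ((inner ℝ p.2 (√(1 - c ^ 2) • t.fst) : ℝ) * Complex.I) := fun p => by
    rw [← Complex.exp_add]
    congr 1
    simp only [inner_add_left, inner_add_right, inner_smul_left, inner_smul_right, conj_trivial]
    push_cast
    ring
  refine (integral_congr_ae (Eventually.of_forall e)).trans ?_
  rw [integral_prod_mul
      (fun x : V => Complex.exp ((inner ℝ x (t.snd + c • t.fst) : ℝ) * Complex.I))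
      (fun y : V => Complex.exp ((inner ℝ y (√(1 - c ^ 2) • t.fst) : ℝ) * Complex.I)),
    ← charFun_apply, ← charFun_apply, charFun_stdGaussian,
    charFun_stdGaussian, ← Complex.exp_add]
  congr 1
  rw [← Complex.ofReal_pow, ← Complex.ofReal_pow, norm_add_sq_real, norm_smul, norm_smul,
    mul_pow, mul_pow, Real.norm_eq_abs, Real.norm_eq_abs, sq_abs, sq_abs,
    Real.sq_sqrt (by nlinarith), inner_smul_right, real_inner_comm]
  push_cast
  ring

/-- Sums of m independent correlated sign pairs in each direction of an orthonormal basis, scaled by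
m^{-1/2}, converge in law to the Gaussian pair by Lévy's theorem. Boundedness and continuity of f
and g let all three integrals pass to the limit. -/
theorem lintegral_mul_le_gaussianPair {c : ℝ} (hc0 : 0 < c) (hc1 : c ≤ 1)
    (f g : BoundedContinuousFunction V ℝ≥0) :
    ∫⁻ w, f w.fst * g w.snd ∂(gaussianPair V c) ≤
      (∫⁻ w, (f w.fst : ℝ≥0∞) ^ 2 ∂(gaussianPair V c)) ^ (1 / 2 : ℝ) *
        (∫⁻ w, (g w.snd : ℝ≥0∞) ^ (1 + c ^ 2) ∂(gaussianPair V c)) ^ (1 / (1 + c ^ 2)) := by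
  have hq : 0 < 1 + c ^ 2 := by positivity
  let b := stdOrthonormalBasis ℝ V
  choose ν hν hb hch using fun m : ℕ => exists_pairBound_prod hc0 hc1 Finset.univ
    (fun i => (√(m : ℝ))⁻¹ • b i) m
  let N : ℕ → ProbabilityMeasure (WithLp 2 (V × V)) := fun m => ⟨ν m, hν m⟩
  let G : ProbabilityMeasure (WithLp 2 (V × V)) := ⟨gaussianPair V c, inferInstance⟩
  have hlim : Tendsto N atTop (𝓝 G) := by
    rw [ProbabilityMeasure.tendsto_iff_tendsto_charFun]
    intro t
    have h1 := tendsto_finsetProd Finset.univ fun i _ =>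
      tendsto_cos_mix_pow c (inner ℝ (b i) t.fst) (inner ℝ (b i) t.snd)
    have h2 := (Complex.continuous_ofReal.tendsto _).comp h1
    convert! h2 using 2
    · change charFun (ν _) t = _
      rw [hch]
      simp only [charFun_signPair hc0 hc1, Function.comp_def, inner_smul_left]
      push_cast
      simp
    · change charFun (gaussianPair V c) t = _
      rw [charFun_gaussianPair hc0 hc1, ← Real.exp_sum, Complex.ofReal_exp]
      congr 2
      rw [Finset.sum_neg_distrib, ← Finset.sum_div, Finset.sum_add_distrib,
        Finset.sum_add_distrib, ← Finset.mul_sum, b.sum_sq_inner_right, b.sum_sq_inner_right,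
        ← b.sum_inner_mul_inner]
      simp only [real_inner_comm]
      push_cast
      rfl
  rw [ProbabilityMeasure.tendsto_iff_forall_lintegral_tendsto] at hlim
  have hfst : Continuous fun w : WithLp 2 (V × V) => w.fst :=
    (WithLp.prod_continuous_ofLp 2 V V).fst
  have hsnd : Continuous fun w : WithLp 2 (V × V) => w.snd :=
    (WithLp.prod_continuous_ofLp 2 V V).snd
  let F : BoundedContinuousFunction (WithLp 2 (V × V)) ℝ≥0 := f.compContinuous ⟨_, hfst⟩
  let K : BoundedContinuousFunction (WithLp 2 (V × V)) ℝ≥0 := g.compContinuous ⟨_, hsnd⟩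
  have hKb : ∃ B, ∀ x y, dist (K x ^ (1 + c ^ 2)) (K y ^ (1 + c ^ 2)) ≤ B := by
    refine ⟨nndist g 0 ^ (1 + c ^ 2), fun x y => ?_⟩
    have h : ∀ z, K z ^ (1 + c ^ 2) ≤ nndist g 0 ^ (1 + c ^ 2) := fun z =>
      NNReal.rpow_le_rpow (BoundedContinuousFunction.NNReal.upper_bound g _) hq.le
    rw [NNReal.dist_eq]
    exact abs_sub_le_of_nonneg_of_le (NNReal.coe_nonneg _) (NNReal.coe_le_coe.2 (h x))
      (NNReal.coe_nonneg _) (NNReal.coe_le_coe.2 (h y))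
  let Kq : BoundedContinuousFunction (WithLp 2 (V × V)) ℝ≥0 :=
    ⟨⟨fun w => K w ^ (1 + c ^ 2), (NNReal.continuous_rpow_const hq.le).comp K.continuous⟩, hKb⟩
  have l1 := hlim (F * K)
  have l2 := (hlim (F * F)).ennrpow_const (1 / 2 : ℝ)
  have l3 := (hlim Kq).ennrpow_const (1 / (1 + c ^ 2))
  have hfin : ∀ L : BoundedContinuousFunction (WithLp 2 (V × V)) ℝ≥0,
      ∫⁻ w, L w ∂(G : Measure (WithLp 2 (V × V))) ≠ ⊤ := fun L =>
    (BoundedContinuousFunction.lintegral_lt_top_of_nnreal _ L).ne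
  have l4 := ENNReal.Tendsto.mul l2
    (Or.inr (ENNReal.rpow_ne_top_of_nonneg (by positivity) (hfin _))) l3
    (Or.inr (ENNReal.rpow_ne_top_of_nonneg (by positivity) (hfin _)))
  have hle := le_of_tendsto_of_tendsto' l1 l4 fun m => by
    have := hb m (fun v => f v) (fun v => g v) (by fun_prop) (by fun_prop)
    refine le_trans (le_of_eq ?_) (this.trans (le_of_eq ?_))
    · exact lintegral_congr fun w => ENNReal.coe_mul _ _
    · congr 2
      · exact lintegral_congr fun w => by rw [sq]; exact (ENNReal.coe_mul _ _).symm
      · exact lintegral_congr fun w => (ENNReal.coe_rpow_of_nonneg _ hq.le).symm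
  refine le_trans (le_of_eq ?_) (hle.trans (le_of_eq ?_))
  · exact lintegral_congr fun w => (ENNReal.coe_mul _ _).symm
  · congr 2
    · exact lintegral_congr fun w => by rw [sq]; exact ENNReal.coe_mul _ _
    · exact lintegral_congr fun w => ENNReal.coe_rpow_of_nonneg _ hq.le

theorem lintegral_gaussianPair {c : ℝ} {f : WithLp 2 (V × V) → ℝ≥0∞} (hf : Measurable f) :
    ∫⁻ w, f w ∂(gaussianPair V c) =
      ∫⁻ x, ∫⁻ y, f (WithLp.toLp 2 (c • x + √(1 - c ^ 2) • y, x)) ∂(stdGaussian V)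
        ∂(stdGaussian V) := by
  rw [gaussianPair, lintegral_map hf (measurable_gaussianPair_map c)]
  exact lintegral_prod _ (hf.comp (measurable_gaussianPair_map c)).aemeasurable

/-- The rotation `(x, y) ↦ c x + √(1 - c²) y` preserves the Gaussian measure. -/
theorem map_rotation_stdGaussian {c : ℝ} (hc0 : 0 < c) (hc1 : c ≤ 1) :
    ((stdGaussian V).prod (stdGaussian V)).map (fun p => c • p.1 + √(1 - c ^ 2) • p.2) =
      stdGaussian V := by
  refine Measure.ext_of_charFun (funext fun t => ?_)
  -- At frequency 0 in the second slot, the characteristic function of the pair is that of its first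
  -- marginal.
  have h := charFun_gaussianPair hc0 hc1 (WithLp.toLp 2 (t, (0 : V)))
  rw [charFun_apply, gaussianPair, integral_map (measurable_gaussianPair_map c).aemeasurable
    (by fun_prop)] at h
  rw [charFun_apply, integral_map (by fun_prop) (by fun_prop), charFun_stdGaussian]
  simp only [WithLp.prod_inner_apply, inner_zero_right, add_zero] at h
  rw [h]
  congr 1
  simp [neg_div]

theorem lintegral_rotation {c : ℝ} (hc0 : 0 < c) (hc1 : c ≤ 1) {f : V → ℝ≥0∞}
    (hf : Measurable f) :
    ∫⁻ x, ∫⁻ y, f (c • x + √(1 - c ^ 2) • y) ∂(stdGaussian V) ∂(stdGaussian V) =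
      ∫⁻ x, f x ∂(stdGaussian V) := by
  conv_rhs => rw [← map_rotation_stdGaussian hc0 hc1]
  rw [lintegral_map hf (by fun_prop), lintegral_prod _ (by fun_prop)]

/-- Gaussian hypercontractivity for bounded continuous functions. -/
theorem lintegral_rotation_rpow_le_of_bounded {p : ℝ} (hp : 2 < p)
    (f : BoundedContinuousFunction V ℝ≥0) :
    ∫⁻ x, (∫⁻ y, f ((√(p - 1))⁻¹ • x + √(1 - (√(p - 1))⁻¹ ^ 2) • y) ∂(stdGaussian V)) ^ p
      ∂(stdGaussian V) ≤ (∫⁻ x, (f x : ℝ≥0∞) ^ 2 ∂(stdGaussian V)) ^ (p / 2) := by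
  set c := (√(p - 1))⁻¹ with hc
  have hc0 : 0 < c := inv_pos.2 (Real.sqrt_pos.2 (by linarith))
  have hc1 : c ≤ 1 := inv_le_one_of_one_le₀ (Real.one_le_sqrt.2 (by linarith))
  -- This choice of c makes 1 + c² the exponent conjugate to p.
  have hcq : 1 + c ^ 2 = p / (p - 1) := by
    rw [hc, inv_pow, Real.sq_sqrt (by linarith)]
    have : p - 1 ≠ 0 := by linarith
    field_simp
    ring
  have hfs : Measurable fun w : WithLp 2 (V × V) => w.fst :=
    (WithLp.prod_continuous_ofLp 2 V V).fst.measurable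
  have hsn : Measurable fun w : WithLp 2 (V × V) => w.snd :=
    (WithLp.prod_continuous_ofLp 2 V V).snd.measurable
  have hb : ∀ z, (f z : ℝ) ≤ nndist f 0 := fun z =>
    NNReal.coe_le_coe.2 (BoundedContinuousFunction.NNReal.upper_bound f z)
  let u : V → ℝ := fun x => ∫ y, (f (c • x + √(1 - c ^ 2) • y) : ℝ) ∂(stdGaussian V)
  have hu0 : ∀ x, 0 ≤ u x := fun x => integral_nonneg fun y => NNReal.coe_nonneg _
  have hint : ∀ x, Integrable (fun y => (f (c • x + √(1 - c ^ 2) • y) : ℝ)) (stdGaussian V) :=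
    fun x => Integrable.of_bound (by fun_prop) _ (Eventually.of_forall fun y => by
      rw [Real.norm_of_nonneg (NNReal.coe_nonneg _)]; exact hb _)
  have hub : ∀ x, u x ≤ nndist f 0 := fun x => by
    refine (integral_mono (hint x) (integrable_const _) fun y => hb _).trans ?_
    simp
  have huc : Continuous u := by
    refine continuous_of_dominated (bound := fun _ => (nndist f 0 : ℝ)) (fun x => by fun_prop)
      (fun x => Eventually.of_forall fun y => ?_) (integrable_const _)
      (Eventually.of_forall fun y => by fun_prop)
    rw [Real.norm_of_nonneg (NNReal.coe_nonneg _)]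
    exact hb _
  let v : V → ℝ≥0 := fun x => ⟨u x, hu0 x⟩
  have hvc : Continuous v := huc.subtype_mk _
  have hv : ∀ x, ((v x : ℝ≥0) : ℝ≥0∞) =
      ∫⁻ y, f (c • x + √(1 - c ^ 2) • y) ∂(stdGaussian V) := fun x => by
    rw [lintegral_coe_eq_integral _ (hint x)]
    exact (ENNReal.ofReal_eq_coe_nnreal (hu0 x)).symm
  have hvb : ∀ x, v x ≤ nndist f 0 := fun x => hub x
  have hp1 : 0 < p - 1 := by linarith
  -- Duality: v is the Mehler average of f, and g = v^{p-1} turns the left side of the bilinear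
  -- bound into ∫ v^p and the norm of g into a power of the same integral.
  let g : BoundedContinuousFunction V ℝ≥0 :=
    ⟨⟨fun x => v x ^ (p - 1), (NNReal.continuous_rpow_const hp1.le).comp hvc⟩, by
      refine ⟨nndist f 0 ^ (p - 1), fun x y => ?_⟩
      have h : ∀ z, v z ^ (p - 1) ≤ nndist f 0 ^ (p - 1) := fun z =>
        NNReal.rpow_le_rpow (hvb z) hp1.le
      change dist (v x ^ (p - 1)) (v y ^ (p - 1)) ≤ _
      rw [NNReal.dist_eq]
      exact abs_sub_le_of_nonneg_of_le (NNReal.coe_nonneg _) (NNReal.coe_le_coe.2 (h x))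
        (NNReal.coe_nonneg _) (NNReal.coe_le_coe.2 (h y))⟩
  have hg : ∀ x, (g x : ℝ≥0∞) = (v x : ℝ≥0∞) ^ (p - 1) := fun x =>
    (ENNReal.coe_rpow_of_nonneg _ hp1.le)
  have key := lintegral_mul_le_gaussianPair hc0 hc1 f g
  rw [lintegral_gaussianPair (by fun_prop), lintegral_gaussianPair (by fun_prop),
    lintegral_gaussianPair (by fun_prop)] at key
  simp only [WithLp.toLp_fst, WithLp.toLp_snd, lintegral_const, measure_univ, mul_one] at key
  rw [lintegral_rotation hc0 hc1 (f := fun x => (f x : ℝ≥0∞) ^ 2) (by fun_prop)] at key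
  simp only [← hv]
  have e1 : ∀ x, ∫⁻ y, f (c • x + √(1 - c ^ 2) • y) * g x ∂(stdGaussian V) =
      (v x : ℝ≥0∞) ^ p := fun x => by
    rw [lintegral_mul_const _ (by fun_prop), ← hv, hg]
    nth_rewrite 1 [← ENNReal.rpow_one (v x : ℝ≥0∞)]
    rw [← ENNReal.rpow_add_of_nonneg _ _ zero_le_one hp1.le]
    congr 1; ring
  have e2 : ∀ x, (g x : ℝ≥0∞) ^ (1 + c ^ 2) = (v x : ℝ≥0∞) ^ p := fun x => by
    rw [hg, ← ENNReal.rpow_mul, hcq]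
    congr 1; field_simp
  simp only [e1, e2] at key
  -- Finiteness comes from the boundedness of f; together with I ≠ 0 it permits cancelling the norm
  -- of g on both sides.
  have hI : ∫⁻ x, (v x : ℝ≥0∞) ^ p ∂(stdGaussian V) ≠ ⊤ := by
    refine ne_top_of_le_ne_top (b := ((nndist f 0 : ℝ≥0) : ℝ≥0∞) ^ p)
      (ENNReal.rpow_ne_top_of_nonneg (by linarith) ENNReal.coe_ne_top) ?_
    refine (lintegral_mono fun x => ENNReal.rpow_le_rpow
      (ENNReal.coe_le_coe.2 (hvb x)) (by linarith)).trans ?_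
    simp
  set I := ∫⁻ x, (v x : ℝ≥0∞) ^ p ∂(stdGaussian V)
  set A := ∫⁻ x, (f x : ℝ≥0∞) ^ 2 ∂(stdGaussian V)
  rcases eq_or_ne I 0 with h0 | h0
  · rw [h0]; exact zero_le
  have hp0 : 0 < p := by linarith
  have hI2 : I ^ (1 / p) ≤ A ^ (1 / 2 : ℝ) := by
    have h1 : I = I ^ (1 / p) * I ^ (1 / (1 + c ^ 2)) := by
      rw [← ENNReal.rpow_add _ _ h0 hI, hcq,
        show 1 / p + 1 / (p / (p - 1)) = 1 by field_simp; ring, ENNReal.rpow_one]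
    refine (ENNReal.mul_le_mul_iff_left ?_ ?_).1 (h1.symm.le.trans key)
    · simp [ENNReal.rpow_eq_zero_iff, h0, hI]
    · exact ENNReal.rpow_ne_top_of_nonneg (by positivity) hI
  calc I = (I ^ (1 / p)) ^ p := by
        rw [← ENNReal.rpow_mul, one_div_mul_cancel hp0.ne', ENNReal.rpow_one]
    _ ≤ (A ^ (1 / 2 : ℝ)) ^ p := ENNReal.rpow_le_rpow hI2 hp0.le
    _ = A ^ (p / 2) := by rw [← ENNReal.rpow_mul]; congr 1; ring

/-- Gaussian hypercontractivity `L² → L^p`. -/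
theorem lintegral_rotation_rpow_le {p : ℝ} (hp : 2 < p) {f : V → ℝ≥0} (hf : Continuous f) :
    ∫⁻ x, (∫⁻ y, f ((√(p - 1))⁻¹ • x + √(1 - (√(p - 1))⁻¹ ^ 2) • y) ∂(stdGaussian V)) ^ p
      ∂(stdGaussian V) ≤ (∫⁻ x, (f x : ℝ≥0∞) ^ 2 ∂(stdGaussian V)) ^ (p / 2) := by
  set c := (√(p - 1))⁻¹ with hc
  have hp0 : 0 < p := by linarith
  -- Truncation at height k; monotone convergence applies to the inner average and then to the outer
  -- integral.
  let F : ℕ → BoundedContinuousFunction V ℝ≥0 := fun k =>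
    ⟨⟨fun x => min (f x) k, by fun_prop⟩, by
      refine ⟨k, fun x y => ?_⟩
      change dist (min (f x) (k : ℝ≥0)) (min (f y) (k : ℝ≥0)) ≤ _
      rw [NNReal.dist_eq]
      refine abs_sub_le_of_nonneg_of_le (NNReal.coe_nonneg _) ?_ (NNReal.coe_nonneg _) ?_
      · exact_mod_cast min_le_right (f x) (k : ℝ≥0)
      · exact_mod_cast min_le_right (f y) (k : ℝ≥0)⟩
  have hF : ∀ k x, F k x = min (f x) k := fun _ _ => rfl
  have hmono : ∀ x, Monotone fun k => (F k x : ℝ≥0∞) := fun x k l hkl => by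
    simp only [hF, ENNReal.coe_le_coe]
    exact min_le_min_left _ (by exact_mod_cast hkl)
  have hsup : ∀ x, ⨆ k, (F k x : ℝ≥0∞) = f x := fun x => by
    refine le_antisymm (iSup_le fun k => ENNReal.coe_le_coe.2 (min_le_left _ _)) ?_
    obtain ⟨k, hk⟩ := exists_nat_ge (f x)
    refine le_iSup_of_le k (ENNReal.coe_le_coe.2 ?_)
    rw [hF, min_eq_left hk]
  have h1 : ∀ x, ∫⁻ y, f (c • x + √(1 - c ^ 2) • y) ∂(stdGaussian V) =
      ⨆ k, ∫⁻ y, F k (c • x + √(1 - c ^ 2) • y) ∂(stdGaussian V) := fun x => by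
    refine (lintegral_congr fun y => (hsup _).symm).trans ?_
    exact lintegral_iSup (f := fun k y => (F k (c • x + √(1 - c ^ 2) • y) : ℝ≥0∞))
      (fun k => by fun_prop) fun k l hkl y => hmono _ hkl
  have h2 : ∀ x, (⨆ k, ∫⁻ y, F k (c • x + √(1 - c ^ 2) • y) ∂(stdGaussian V)) ^ p =
      ⨆ k, (∫⁻ y, F k (c • x + √(1 - c ^ 2) • y) ∂(stdGaussian V)) ^ p := fun x =>
    (ENNReal.orderIsoRpow p hp0).map_iSup _
  simp only [h1, h2]
  rw [lintegral_iSup (fun k => ?_) fun k l hkl x => ?_]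
  · refine iSup_le fun k => (lintegral_rotation_rpow_le_of_bounded hp (F k)).trans ?_
    refine ENNReal.rpow_le_rpow (lintegral_mono fun x => ?_) (by positivity)
    gcongr
    exact min_le_left _ _
  · refine Measurable.pow_const ?_ _
    exact Measurable.lintegral_prod_right' (f := fun q : V × V =>
      (F k (c • q.1 + √(1 - c ^ 2) • q.2) : ℝ≥0∞)) (by fun_prop)
  · exact ENNReal.rpow_le_rpow (lintegral_mono fun y => hmono _ hkl) hp0.le

end Hypercontractive

end

noncomputable section

/-! ### Wick powers on the line: recursion, generating function, Gaussian orthogonality. -/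

namespace Wick

/-- The Wick power `:xⁿ:` with respect to a centred Gaussian of variance `v`. -/
def wick (v : ℝ) : ℕ → ℝ → ℝ
  | 0, _ => 1
  | 1, x => x
  | n + 2, x => x * wick v (n + 1) x - (n + 1) * v * wick v n x

theorem wick_zero (v x : ℝ) : wick v 0 x = 1 := by rw [wick]

theorem wick_one (v x : ℝ) : wick v 1 x = x := by rw [wick]

/-- A form of the recursion without case distinction: for n = 0 the truncated index n - 1 is
harmless because its coefficient vanishes. -/
theorem wick_succ (v : ℝ) (n : ℕ) (x : ℝ) :
    wick v (n + 1) x = x * wick v n x - n * v * wick v (n - 1) x := by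
  cases n with
  | zero => simp [wick_zero, wick_one]
  | succ n => rw [wick]; push_cast; rfl

theorem continuous_wick (v : ℝ) (n : ℕ) : Continuous (wick v n) := by
  induction n using Nat.strong_induction_on with
  | _ n ih =>
    match n, ih with
    | 0, _ => exact continuous_const.congr fun x => (wick_zero v x).symm
    | 1, _ => exact continuous_id.congr fun x => (wick_one v x).symm
    | n + 2, ih =>
      have h1 := ih (n + 1) (by omega)
      have h2 := ih n (by omega)
      have : wick v (n + 2) = fun x => x * wick v (n + 1) x - (n + 1) * v * wick v n x := by
        ext x; rw [wick]
      rw [this]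
      fun_prop

/-- The Appell property; combined with the recursion it makes Gaussian integration by parts close on
the Wick powers. -/
theorem hasDerivAt_wick (v : ℝ) (n : ℕ) (x : ℝ) :
    HasDerivAt (wick v n) (n * wick v (n - 1) x) x := by
  induction n using Nat.strong_induction_on with
  | _ n ih =>
    match n, ih with
    | 0, _ =>
      have : wick v 0 = fun _ => 1 := by ext x; exact wick_zero v x
      simpa [this] using hasDerivAt_const x (1 : ℝ)
    | 1, _ =>
      have : wick v 1 = fun x => x := by ext x; exact wick_one v x
      simpa [this, wick_zero] using hasDerivAt_id' x
    | n + 2, ih =>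
      have h1 := ih (n + 1) (by omega)
      have h2 := ih n (by omega)
      have : wick v (n + 2) = fun x => x * wick v (n + 1) x - (n + 1) * v * wick v n x := by
        ext x; rw [wick]
      rw [this]
      refine (((hasDerivAt_id x).mul h1).sub (h2.const_mul ((n + 1) * v))).congr_deriv ?_
      simp only [id, Nat.add_sub_cancel, show n + 2 - 1 = n + 1 by omega]
      have := wick_succ v n x
      rw [this]
      push_cast
      ring

theorem wick_smul (v c : ℝ) (n : ℕ) (x : ℝ) : wick (c ^ 2 * v) n (c * x) = c ^ n * wick v n x := by
  induction n using Nat.strong_induction_on with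
  | _ n ih =>
    match n, ih with
    | 0, _ => simp [wick_zero]
    | 1, _ => simp [wick_one]
    | n + 2, ih =>
      rw [wick, ih (n + 1) (by omega), ih n (by omega), wick]
      ring

theorem wick_zero_var (n : ℕ) (x : ℝ) : wick 0 n x = x ^ n := by
  induction n with
  | zero => simp [wick_zero]
  | succ n ih => rw [wick_succ, ih]; ring

/-- Growth of order √n!, rather than n!, is what makes the exponential series of Wick powers
converge uniformly on bounded sets for every parameter. -/
theorem abs_wick_le (v : ℝ) (n : ℕ) {x R : ℝ} (hx : |x| ≤ R) :
    |wick v n x| ≤ √(n.factorial) * (R + |v| + 1) ^ n := by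
  have hR : 0 ≤ R := (abs_nonneg x).trans hx
  set K := R + |v| + 1 with hK
  have hv := abs_nonneg v
  have hK0 : 0 < K := by positivity
  induction n using Nat.strong_induction_on with
  | _ n ih =>
    match n, ih with
    | 0, _ => simp [wick_zero]
    | 1, _ =>
      simp only [wick_one, Nat.factorial_one, Nat.cast_one, Real.sqrt_one, one_mul, pow_one]
      linarith
    | n + 2, ih =>
      have h1 := ih (n + 1) (by omega)
      have h2 := ih n (by omega)
      have e1 : √((n + 1).factorial : ℝ) = √(n + 1) * √(n.factorial) := by
        rw [Nat.factorial_succ]; push_cast; rw [Real.sqrt_mul (by positivity)]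
      have e2 : √((n + 2).factorial : ℝ) = √(n + 2) * (√(n + 1) * √(n.factorial)) := by
        rw [Nat.factorial_succ, ← e1]; push_cast; rw [Real.sqrt_mul (by positivity)]; congr 2; ring
      rw [e2]
      rw [e1] at h1
      set F := √(n.factorial : ℝ)
      set s := √((n : ℝ) + 1)
      set t := √((n : ℝ) + 2)
      have hF : 0 ≤ F := Real.sqrt_nonneg _
      have hs0 : 0 ≤ s := Real.sqrt_nonneg _
      have hs1 : s ^ 2 = n + 1 := Real.sq_sqrt (by positivity)
      have hst : s ≤ t := Real.sqrt_le_sqrt (by linarith)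
      have ht1 : 1 ≤ t := Real.one_le_sqrt.2 (by linarith [(Nat.cast_nonneg n : (0 : ℝ) ≤ n)])
      have hKn : 0 < K ^ n := by positivity
      rw [wick]
      calc |x * wick v (n + 1) x - (n + 1) * v * wick v n x|
          ≤ |x| * |wick v (n + 1) x| + (n + 1) * |v| * |wick v n x| := by
            refine (abs_sub _ _).trans (le_of_eq ?_)
            rw [abs_mul, abs_mul, abs_mul, abs_of_nonneg (show (0 : ℝ) ≤ n + 1 by positivity)]
        _ ≤ R * (s * F * K ^ (n + 1)) + (n + 1) * |v| * (F * K ^ n) := by gcongr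
        _ = (F * K ^ n * s) * (R * K + s * |v|) := by rw [← hs1]; ring
        _ ≤ (F * K ^ n * s) * (t * K ^ 2) := by
            gcongr
            have a1 : R * K ≤ t * (R * K) := le_mul_of_one_le_left (by positivity) ht1
            have a2 : s * |v| ≤ t * (|v| * K) := by
              refine mul_le_mul hst (le_mul_of_one_le_right hv (by linarith)) hv (by linarith)
            have a3 : t * (R * K) + t * (|v| * K) ≤ t * K ^ 2 := by
              have : 0 ≤ t * K := by positivity
              nlinarith
            linarith
        _ = _ := by ring

open Polynomial in
theorem derivative_hermite (n : ℕ) : derivative (hermite (n + 1)) = (n + 1 : ℤ[X]) * hermite n := by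
  induction n with
  | zero => simp
  | succ n ih =>
    rw [hermite_succ (n + 1), derivative_sub, derivative_mul, derivative_X, ih]
    have h2 : derivative ((n + 1 : ℤ[X]) * hermite n) = (n + 1 : ℤ[X]) * derivative (hermite n) := by
      rw [derivative_mul]
      have : derivative ((n : ℤ[X]) + 1) = 0 := by simp
      rw [this]; ring
    rw [h2, hermite_succ n]
    push_cast
    ring

open Polynomial in
theorem hermite_succ_succ (n : ℕ) :
    hermite (n + 2) = X * hermite (n + 1) - (n + 1 : ℤ[X]) * hermite n := by
  rw [hermite_succ (n + 1), derivative_hermite]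

open Polynomial in
theorem wick_eq_hermite {ρ : ℝ} (hρ : ρ ≠ 0) (n : ℕ) (x : ℝ) :
    wick (ρ ^ 2) n x = ρ ^ n * aeval (ρ⁻¹ * x) (hermite n) := by
  induction n using Nat.strong_induction_on with
  | _ n ih =>
    match n, ih with
    | 0, _ => simp [wick_zero]
    | 1, _ => simp [wick_one, hρ]
    | n + 2, ih =>
      rw [wick, ih (n + 1) (by omega), ih n (by omega), hermite_succ_succ]
      simp only [map_sub, map_mul, aeval_X, map_add, map_natCast, map_one]
      field_simp
      ring

theorem aeval_hermite_eq (n : ℕ) (x : ℝ) :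
    Polynomial.aeval x (Polynomial.hermite n) =
      (-1) ^ n * Real.exp (x ^ 2 / 2) * iteratedDeriv n (fun y => Real.exp (-(y ^ 2) / 2)) x := by
  rw [Polynomial.hermite_eq_deriv_gaussian', iteratedDeriv_eq_iterate]
  simp only [neg_div]
  ring

/-- The complex Gaussian generates the Hermite polynomials. -/
theorem iteratedDeriv_cexp_gaussian (n : ℕ) (z : ℂ) :
    iteratedDeriv n (fun w : ℂ => Complex.exp (-(w ^ 2 / 2))) z =
      (-1) ^ n * Polynomial.aeval z (Polynomial.hermite n) * Complex.exp (-(z ^ 2 / 2)) := by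
  induction n generalizing z with
  | zero => simp
  | succ n ih =>
    rw [iteratedDeriv_succ, show iteratedDeriv n (fun w : ℂ => Complex.exp (-(w ^ 2 / 2))) = _ from
      funext ih]
    have h1 : HasDerivAt (fun w : ℂ => Complex.exp (-(w ^ 2 / 2)))
        (Complex.exp (-(z ^ 2 / 2)) * (-z)) z := by
      have := (((hasDerivAt_pow 2 z).div_const 2).neg).cexp
      refine this.congr_deriv ?_
      simp
    have h2 := ((((Polynomial.hermite n).hasDerivAt_aeval z).const_mul ((-1 : ℂ) ^ n)).mul h1).deriv
    refine h2.trans ?_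
    rw [Polynomial.hermite_succ]
    simp only [map_sub, map_mul, Polynomial.aeval_X]
    ring

/-- Taylor's expansion at z of the entire function exp(-w²/2), evaluated at z - t and multiplied by
exp(z²/2). -/
theorem hasSum_hermite (t z : ℂ) :
    HasSum (fun n : ℕ => t ^ n / n.factorial * Polynomial.aeval z (Polynomial.hermite n))
      (Complex.exp (t * z - t ^ 2 / 2)) := by
  have hd : Differentiable ℂ fun w : ℂ => Complex.exp (-(w ^ 2 / 2)) := by fun_prop
  have h := Complex.hasSum_taylorSeries_of_entire hd z (z - t)
  have h2 := h.mul_right (Complex.exp (z ^ 2 / 2))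
  have e1 : (fun n : ℕ => t ^ n / n.factorial * Polynomial.aeval z (Polynomial.hermite n)) =
      fun n : ℕ => ((n.factorial : ℂ)⁻¹ • (z - t - z) ^ n •
        iteratedDeriv n (fun w => Complex.exp (-(w ^ 2 / 2))) z) * Complex.exp (z ^ 2 / 2) := by
    ext n
    rw [iteratedDeriv_cexp_gaussian, show z - t - z = -t by ring, neg_pow]
    have h3 : Complex.exp (-(z ^ 2 / 2)) * Complex.exp (z ^ 2 / 2) = 1 := by
      rw [← Complex.exp_add]; simp
    have h4 : ((-1 : ℂ) ^ n) * (-1) ^ n = 1 := by rw [← mul_pow]; simp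
    simp only [smul_eq_mul]
    linear_combination (-(t ^ n / n.factorial * Polynomial.aeval z (Polynomial.hermite n))) * h3 -
      (t ^ n / n.factorial * Polynomial.aeval z (Polynomial.hermite n)) *
        (Complex.exp (-(z ^ 2 / 2)) * Complex.exp (z ^ 2 / 2)) * h4
  have e2 : Complex.exp (t * z - t ^ 2 / 2) =
      Complex.exp (-((z - t) ^ 2 / 2)) * Complex.exp (z ^ 2 / 2) := by
    rw [← Complex.exp_add]
    congr 1; ring
  rw [e1, e2]
  exact h2

/-- The generating function of the Wick powers at an imaginary argument. -/
theorem hasSum_wick {ρ : ℝ} (hρ : ρ ≠ 0) (a x : ℝ) :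
    HasSum (fun n : ℕ => (Complex.I * a) ^ n / n.factorial * (wick (ρ ^ 2) n x : ℂ))
      (Complex.exp (Complex.I * (a * x : ℝ)) * (Real.exp ((a * ρ) ^ 2 / 2) : ℝ)) := by
  have h := hasSum_hermite (Complex.I * a * ρ) ((ρ⁻¹ * x : ℝ) : ℂ)
  have e1 : (fun n : ℕ => (Complex.I * a) ^ n / n.factorial * (wick (ρ ^ 2) n x : ℂ)) =
      fun n : ℕ => (Complex.I * a * ρ) ^ n / n.factorial *
        Polynomial.aeval ((ρ⁻¹ * x : ℝ) : ℂ) (Polynomial.hermite n) := by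
    ext n
    have : (Polynomial.aeval ((ρ⁻¹ * x : ℝ) : ℂ)) (Polynomial.hermite n) =
        ((Polynomial.aeval (ρ⁻¹ * x) (Polynomial.hermite n) : ℝ) : ℂ) :=
      Polynomial.aeval_algebraMap_apply ℂ (ρ⁻¹ * x) (Polynomial.hermite n)
    rw [wick_eq_hermite hρ, this]
    push_cast
    ring
  have e2 : Complex.exp (Complex.I * (a * x : ℝ)) * (Real.exp ((a * ρ) ^ 2 / 2) : ℝ) =
      Complex.exp (Complex.I * a * ρ * (ρ⁻¹ * x : ℝ) - (Complex.I * a * ρ) ^ 2 / 2) := by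
    rw [Complex.ofReal_exp, ← Complex.exp_add]
    congr 1
    push_cast
    have : (ρ : ℂ) ≠ 0 := by exact_mod_cast hρ
    field_simp
    linear_combination (a : ℂ) * ρ ^ 2 * a * Complex.I_sq
  rw [e1, e2]
  exact h

theorem I_mul_pow_even (a : ℝ) (n : ℕ) :
    (Complex.I * a) ^ (2 * n) = (((-1) ^ n * a ^ (2 * n) : ℝ) : ℂ) := by
  rw [mul_pow, pow_mul, Complex.I_sq]; push_cast; ring

theorem I_mul_pow_odd (a : ℝ) (n : ℕ) :
    (Complex.I * a) ^ (2 * n + 1) = Complex.I * (((-1) ^ n * a ^ (2 * n + 1) : ℝ) : ℂ) := by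
  rw [pow_succ, I_mul_pow_even]; push_cast; ring

theorem exp_I_mul (y r : ℝ) : Complex.exp (Complex.I * y) * r =
    ((Real.cos y * r : ℝ) : ℂ) + Complex.I * ((Real.sin y * r : ℝ) : ℂ) := by
  rw [mul_comm Complex.I, Complex.exp_mul_I]; push_cast; ring

theorem re_add_I_mul (x y : ℝ) : ((x : ℂ) + Complex.I * (y : ℂ)).re = x := by simp

theorem im_add_I_mul (x y : ℝ) : ((x : ℂ) + Complex.I * (y : ℂ)).im = y := by simp

theorem ofReal_div_mul (x w : ℝ) (k : ℕ) : (x : ℂ) / (k : ℂ) * (w : ℂ) = ((x / k * w : ℝ) : ℂ) := by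
  push_cast; rfl

theorem I_mul_div_mul (x w : ℝ) (k : ℕ) :
    Complex.I * (x : ℂ) / (k : ℂ) * (w : ℂ) = ((0 : ℝ) : ℂ) + Complex.I * ((x / k * w : ℝ) : ℂ) := by
  push_cast; ring

/-- The real part of the generating function at ia: terms of odd degree are imaginary, which leaves
the sum over the range of n ↦ 2n. -/
theorem hasSum_wick_cos {ρ : ℝ} (hρ : ρ ≠ 0) (a x : ℝ) :
    HasSum (fun n : ℕ => (-1) ^ n * a ^ (2 * n) / ((2 * n).factorial : ℝ) * wick (ρ ^ 2) (2 * n) x)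
      (Real.cos (a * x) * Real.exp ((a * ρ) ^ 2 / 2)) := by
  have h := Complex.hasSum_re (hasSum_wick hρ a x)
  rw [exp_I_mul] at h
  have hinj : Function.Injective fun n : ℕ => 2 * n := fun m n h => by simpa using h
  rw [← hinj.hasSum_iff (fun n hn => ?_)] at h
  · rw [re_add_I_mul] at h
    refine (congrArg (HasSum · _) (funext fun n => ?_)).mp h
    rw [Function.comp_apply, I_mul_pow_even, ofReal_div_mul, Complex.ofReal_re]
  · rcases Nat.even_or_odd' n with ⟨m, rfl | rfl⟩
    · exact absurd ⟨m, rfl⟩ hn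
    · rw [I_mul_pow_odd, I_mul_div_mul, re_add_I_mul]

theorem hasSum_wick_sin {ρ : ℝ} (hρ : ρ ≠ 0) (a x : ℝ) :
    HasSum (fun n : ℕ => (-1) ^ n * a ^ (2 * n + 1) / ((2 * n + 1).factorial : ℝ) *
      wick (ρ ^ 2) (2 * n + 1) x) (Real.sin (a * x) * Real.exp ((a * ρ) ^ 2 / 2)) := by
  have h := Complex.hasSum_im (hasSum_wick hρ a x)
  rw [exp_I_mul] at h
  have hinj : Function.Injective fun n : ℕ => 2 * n + 1 := fun m n h => by simpa using h
  rw [← hinj.hasSum_iff (fun n hn => ?_)] at h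
  · rw [im_add_I_mul] at h
    refine (congrArg (HasSum · _) (funext fun n => ?_)).mp h
    rw [Function.comp_apply, I_mul_pow_odd, I_mul_div_mul, im_add_I_mul]
  · rcases Nat.even_or_odd' n with ⟨m, rfl | rfl⟩
    · rw [I_mul_pow_even, ofReal_div_mul, Complex.ofReal_im]
    · exact absurd ⟨m, rfl⟩ hn

/-- Integrability to every finite power. -/
def AllLp {Ω : Type} [MeasurableSpace Ω] (μ : Measure Ω) (f : Ω → ℝ) : Prop :=
  ∀ q : ℝ≥0∞, q ≠ ⊤ → MemLp f q μ

namespace AllLp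

variable {Ω : Type} [MeasurableSpace Ω] {μ : Measure Ω} {f g : Ω → ℝ}

theorem mul (hf : AllLp μ f) (hg : AllLp μ g) : AllLp μ fun x => f x * g x := fun q hq => by
  have : ENNReal.HolderTriple (2 * q) (2 * q) q := ⟨by
    rw [ENNReal.mul_inv (Or.inl (by norm_num)) (Or.inl (by norm_num)), ← add_mul,
      ENNReal.inv_two_add_inv_two, one_mul]⟩
  have hq2 : 2 * q ≠ ⊤ := ENNReal.mul_ne_top (by norm_num) hq
  exact MemLp.mul (hg _ hq2) (hf _ hq2)

theorem add (hf : AllLp μ f) (hg : AllLp μ g) : AllLp μ fun x => f x + g x :=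
  fun q hq => (hf q hq).add (hg q hq)

theorem sub (hf : AllLp μ f) (hg : AllLp μ g) : AllLp μ fun x => f x - g x :=
  fun q hq => (hf q hq).sub (hg q hq)

theorem const_mul (hf : AllLp μ f) (c : ℝ) : AllLp μ fun x => c * f x :=
  fun q hq => (hf q hq).const_mul c

theorem const [IsFiniteMeasure μ] (c : ℝ) : AllLp μ fun _ => c := fun _ _ => memLp_const c

theorem integrable (hf : AllLp μ f) : Integrable f μ :=
  memLp_one_iff_integrable.1 (hf 1 ENNReal.one_ne_top)

theorem wick [IsFiniteMeasure μ] (hf : AllLp μ f) (v : ℝ) (n : ℕ) :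
    AllLp μ fun x => Wick.wick v n (f x) := by
  induction n using Nat.strong_induction_on with
  | _ n ih =>
    match n, ih with
    | 0, _ => simpa only [wick_zero] using const 1
    | 1, _ => simpa only [wick_one] using hf
    | n + 2, ih =>
      simp only [Wick.wick]
      exact (hf.mul (ih (n + 1) (by omega))).sub ((ih n (by omega)).const_mul _)

end AllLp

theorem allLp_id_gaussianReal : AllLp (gaussianReal 0 1) fun x => x :=
  fun q hq => memLp_id_gaussianReal' q hq

theorem integrable_gaussianReal_iff {f : ℝ → ℝ} :
    Integrable f (gaussianReal 0 1) ↔ Integrable fun x => gaussianPDFReal 0 1 x * f x := by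
  rw [gaussianReal_of_var_ne_zero 0 one_ne_zero,
    integrable_withDensity_iff_integrable_smul₀' (measurable_gaussianPDF 0 1).aemeasurable
      (Eventually.of_forall fun x => gaussianPDF_lt_top)]
  simp [toReal_gaussianPDF]

/-- Gaussian integration by parts. -/
theorem integral_id_mul_gaussianReal {f f' : ℝ → ℝ} (hd : ∀ x, HasDerivAt f (f' x) x)
    (hf : AllLp (gaussianReal 0 1) f) (hf' : AllLp (gaussianReal 0 1) f') :
    ∫ x, x * f x ∂(gaussianReal 0 1) = ∫ x, f' x ∂(gaussianReal 0 1) := by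
  have h1 := integrable_gaussianReal_iff.1 hf.integrable
  have h2 := integrable_gaussianReal_iff.1 hf'.integrable
  have h3 := integrable_gaussianReal_iff.1 (allLp_id_gaussianReal.mul hf).integrable
  have hp : ∀ x, HasDerivAt (gaussianPDFReal 0 1) (-x * gaussianPDFReal 0 1 x) x := fun x => by
    rw [gaussianPDFReal_def]
    have := ((((hasDerivAt_id' x).sub_const 0).pow 2).neg.div_const (2 * ((1 : ℝ≥0) : ℝ))).exp.const_mul
      ((√(2 * π * ((1 : ℝ≥0) : ℝ)))⁻¹)
    refine this.congr_deriv ?_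
    simp
    ring
  have h4 := integral_eq_zero_of_hasDerivAt_of_integrable
    (f := fun x => gaussianPDFReal 0 1 x * f x)
    (f' := fun x => gaussianPDFReal 0 1 x * f' x - gaussianPDFReal 0 1 x * (x * f x))
    (fun x => ((hp x).mul (hd x)).congr_deriv (by ring)) (h2.sub h3) h1
  rw [integral_sub h2 h3, sub_eq_zero] at h4
  rw [integral_gaussianReal_eq_integral_smul one_ne_zero,
    integral_gaussianReal_eq_integral_smul one_ne_zero]
  simpa using h4.symm

/-- Averaging out an independent Gaussian of variance `r²`. -/
theorem integral_wick_add (u α r : ℝ) (m : ℕ) :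
    ∫ y, wick u m (α + r * y) ∂(gaussianReal 0 1) = wick (u - r ^ 2) m α := by
  have hA : AllLp (gaussianReal 0 1) fun y => α + r * y :=
    (AllLp.const α).add (allLp_id_gaussianReal.const_mul r)
  induction m using Nat.strong_induction_on with
  | _ m ih =>
    match m, ih with
    | 0, _ => simp [wick_zero]
    | m + 1, ih =>
      -- Integration by parts turns the factor y into m r times a Wick power of lower degree; in the
      -- recursion this lowers the variance from u to u - r².
      have hst := integral_id_mul_gaussianReal (f := fun y => wick u m (α + r * y))
        (f' := fun y => m * r * wick u (m - 1) (α + r * y)) (fun y => by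
          have h1 : HasDerivAt (fun y : ℝ => α + r * y) r y := by
            simpa using ((hasDerivAt_id y).const_mul r).const_add α
          exact ((hasDerivAt_wick u m (α + r * y)).comp y h1).congr_deriv (by ring))
        (hA.wick u m) ((hA.wick u (m - 1)).const_mul _)
      rw [integral_const_mul] at hst
      have i1 := ((hA.wick u m).const_mul α).integrable
      have i2 := ((allLp_id_gaussianReal.mul (hA.wick u m)).const_mul r).integrable
      have i3 := ((hA.wick u (m - 1)).const_mul (m * u)).integrable
      have e : ∀ y, wick u (m + 1) (α + r * y) = α * wick u m (α + r * y) +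
          r * (y * wick u m (α + r * y)) - m * u * wick u (m - 1) (α + r * y) := fun y => by
        rw [wick_succ]; ring
      simp only [e]
      rw [integral_sub (by exact i1.add i2) i3, integral_add i1 i2, integral_const_mul, integral_const_mul,
        integral_const_mul, hst, ih m (by omega), wick_succ]
      rcases m with _ | m
      · simp
      · rw [ih (m + 1 - 1) (by omega)]; ring

/-- The fully correlated case, by induction on n. After integration by parts the derivative of the
first factor cancels the second term of the recursion, leaving m s p times the integral with both
degrees lowered by one. -/
theorem integral_wick_mul_wick (s p : ℝ) (n m : ℕ) :
    ∫ x, wick (s ^ 2) n (s * x) * wick (p ^ 2) m (p * x) ∂(gaussianReal 0 1) =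
      if n = m then n.factorial * (s * p) ^ n else 0 := by
  have hS : AllLp (gaussianReal 0 1) fun x => s * x := allLp_id_gaussianReal.const_mul s
  have hP : AllLp (gaussianReal 0 1) fun x => p * x := allLp_id_gaussianReal.const_mul p
  induction n generalizing m with
  | zero =>
    have := integral_wick_add (p ^ 2) 0 p m
    simp only [zero_add, sub_self, wick_zero_var] at this
    simp only [wick_zero, one_mul, this]
    rcases m with _ | m <;> simp
  | succ n ih =>
    have hst := integral_id_mul_gaussianReal
      (f := fun x => wick (s ^ 2) n (s * x) * wick (p ^ 2) m (p * x))
      (f' := fun x => n * s * (wick (s ^ 2) (n - 1) (s * x) * wick (p ^ 2) m (p * x)) +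
        m * p * (wick (s ^ 2) n (s * x) * wick (p ^ 2) (m - 1) (p * x))) (fun x => by
          have h1 : HasDerivAt (fun y : ℝ => s * y) s x := by
            simpa using (hasDerivAt_id x).const_mul s
          have h2 : HasDerivAt (fun y : ℝ => p * y) p x := by
            simpa using (hasDerivAt_id x).const_mul p
          exact (((hasDerivAt_wick _ n (s * x)).comp x h1).mul
            ((hasDerivAt_wick _ m (p * x)).comp x h2)).congr_deriv (by
              simp only [Function.comp_apply]; ring))
      ((hS.wick _ n).mul (hP.wick _ m))
      ((((hS.wick _ (n - 1)).mul (hP.wick _ m)).const_mul _).add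
        (((hS.wick _ n).mul (hP.wick _ (m - 1))).const_mul _))
    have i1 := (((hS.wick (s ^ 2) (n - 1)).mul (hP.wick (p ^ 2) m)).const_mul (n * s)).integrable
    have i2 := (((hS.wick (s ^ 2) n).mul (hP.wick (p ^ 2) (m - 1))).const_mul (m * p)).integrable
    have i3 := ((allLp_id_gaussianReal.mul
      ((hS.wick (s ^ 2) n).mul (hP.wick (p ^ 2) m))).const_mul s).integrable
    have i4 := (((hS.wick (s ^ 2) (n - 1)).mul (hP.wick (p ^ 2) m)).const_mul (n * s ^ 2)).integrable
    rw [integral_add i1 i2, integral_const_mul, integral_const_mul] at hst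
    have e : ∀ x, wick (s ^ 2) (n + 1) (s * x) * wick (p ^ 2) m (p * x) =
        s * (x * (wick (s ^ 2) n (s * x) * wick (p ^ 2) m (p * x))) -
        n * s ^ 2 * (wick (s ^ 2) (n - 1) (s * x) * wick (p ^ 2) m (p * x)) := fun x => by
      rw [wick_succ]; ring
    simp only [e]
    rw [integral_sub i3 i4, integral_const_mul, integral_const_mul, hst]
    rcases m with _ | m
    · simp
      ring
    · rw [ih (m + 1 - 1)]
      simp only [Nat.add_sub_cancel, Nat.add_right_cancel_iff]
      split_ifs with h
      · subst h
        rw [Nat.factorial_succ]; push_cast; ring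
      · ring

end Wick

end

noncomputable section

/-! ### Wick functions of linear functionals on a finite-dimensional Gaussian space. -/

namespace Wick

variable {V : Type} [NormedAddCommGroup V] [InnerProductSpace ℝ V] [MeasurableSpace V]
  [BorelSpace V] [FiniteDimensional ℝ V]

theorem map_inner_stdGaussian (a : V) :
    (stdGaussian V).map (fun w => inner ℝ a w) = (gaussianReal 0 1).map fun x => ‖a‖ * x := by
  refine Measure.ext_of_charFun (funext fun t => ?_)
  have h := charFun_stdGaussian (t • a)
  have h2 := charFun_gaussianReal (μ := 0) (v := 1) (t * ‖a‖)
  rw [charFun_apply] at h h2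
  rw [charFun_apply, charFun_apply, integral_map (by fun_prop) (by fun_prop),
    integral_map (by fun_prop) (by fun_prop)]
  have e1 : ∀ w : V, inner ℝ (inner ℝ a w) t = inner ℝ w (t • a) := fun w => by
    rw [inner_smul_right, real_inner_comm w a, RCLike.inner_apply, conj_trivial]
  have e2 : ∀ x : ℝ, inner ℝ (‖a‖ * x) t = inner ℝ x (t * ‖a‖) := fun x => by
    simp only [RCLike.inner_apply, conj_trivial]; ring
  simp only [e1, e2]
  rw [h, h2, norm_smul]
  congr 1
  push_cast
  rw [mul_pow, mul_pow, ← Complex.ofReal_pow ‖t‖, Real.norm_eq_abs, sq_abs]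
  push_cast
  ring

/-- The law of a pair of linear functionals under the standard Gaussian measure. -/
theorem map_inner_pair_stdGaussian (a b : V) :
    (stdGaussian V).map (fun w => WithLp.toLp 2 (inner ℝ a w, inner ℝ b w)) =
      ((gaussianReal 0 1).prod (gaussianReal 0 1)).map fun x => WithLp.toLp 2
        (‖a‖ * x.1, inner ℝ a b / ‖a‖ * x.1 + √(‖b‖ ^ 2 - (inner ℝ a b / ‖a‖) ^ 2) * x.2) := by
  set p := inner ℝ a b / ‖a‖ with hp
  set q := √(‖b‖ ^ 2 - p ^ 2) with hq
  -- For a = 0 the quotient p is 0 by the convention on division, and both sides vanish.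
  have hpa : ‖a‖ * p = inner ℝ a b := by
    rcases eq_or_ne a 0 with rfl | ha
    · simp
    · rw [hp]; field_simp [norm_ne_zero_iff.2 ha]
  have hpb : |p| ≤ ‖b‖ := by
    rw [hp, abs_div, abs_norm]
    refine div_le_of_le_mul₀ (norm_nonneg _) (norm_nonneg _) ?_
    rw [mul_comm]
    exact abs_real_inner_le_norm a b
  have hq2 : q ^ 2 = ‖b‖ ^ 2 - p ^ 2 := Real.sq_sqrt (by
    rw [sub_nonneg, ← sq_abs p]
    exact pow_le_pow_left₀ (abs_nonneg _) hpb 2)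
  have hm1 : Measurable fun w : V => WithLp.toLp 2 (inner ℝ a w, inner ℝ b w) :=
    ((WithLp.prod_continuous_toLp 2 ℝ ℝ).comp (by fun_prop)).measurable
  have hm2 : Measurable fun x : ℝ × ℝ => WithLp.toLp 2 (‖a‖ * x.1, p * x.1 + q * x.2) :=
    ((WithLp.prod_continuous_toLp 2 ℝ ℝ).comp (by fun_prop)).measurable
  have := Measure.isProbabilityMeasure_map (μ := stdGaussian V) hm1.aemeasurable
  have := Measure.isProbabilityMeasure_map
    (μ := (gaussianReal 0 1).prod (gaussianReal 0 1)) hm2.aemeasurable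
  refine Measure.ext_of_charFun (funext fun t => ?_)
  rw [charFun_apply, charFun_apply, integral_map hm1.aemeasurable (by fun_prop),
    integral_map hm2.aemeasurable (by fun_prop)]
  simp only [WithLp.prod_inner_apply]
  have e1 : ∀ w : V, inner ℝ (inner ℝ a w) t.fst + inner ℝ (inner ℝ b w) t.snd =
      inner ℝ w (t.fst • a + t.snd • b) := fun w => by
    rw [inner_add_right, inner_smul_right, inner_smul_right, real_inner_comm w a,
      real_inner_comm w b]
    simp only [RCLike.inner_apply, conj_trivial]
  have e2 : ∀ x : ℝ × ℝ, Complex.exp ((inner ℝ (‖a‖ * x.1) t.fst +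
      inner ℝ (p * x.1 + q * x.2) t.snd : ℝ) * Complex.I) =
      Complex.exp ((inner ℝ x.1 (t.fst * ‖a‖ + t.snd * p) : ℝ) * Complex.I) *
        Complex.exp ((inner ℝ x.2 (t.snd * q) : ℝ) * Complex.I) := fun x => by
    rw [← Complex.exp_add]
    congr 1
    simp only [RCLike.inner_apply, conj_trivial]
    push_cast
    ring
  have l : ∫ w : V, Complex.exp ((inner ℝ (inner ℝ a w) t.fst + inner ℝ (inner ℝ b w) t.snd : ℝ) *
      Complex.I) ∂(stdGaussian V) = Complex.exp (-(‖t.fst • a + t.snd • b‖ : ℂ) ^ 2 / 2) := by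
    simp only [e1]
    rw [← charFun_apply, charFun_stdGaussian]
  have r : ∫ x : ℝ × ℝ, Complex.exp ((inner ℝ (‖a‖ * x.1) t.fst +
      inner ℝ (p * x.1 + q * x.2) t.snd : ℝ) * Complex.I)
        ∂((gaussianReal 0 1).prod (gaussianReal 0 1)) =
      Complex.exp (-((t.fst * ‖a‖ + t.snd * p : ℝ) : ℂ) ^ 2 / 2 - ((t.snd * q : ℝ) : ℂ) ^ 2 / 2) := by
    simp only [e2]
    rw [integral_prod_mul
      (fun x : ℝ => Complex.exp ((inner ℝ x (t.fst * ‖a‖ + t.snd * p) : ℝ) * Complex.I))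
      (fun y : ℝ => Complex.exp ((inner ℝ y (t.snd * q) : ℝ) * Complex.I)),
      ← charFun_apply, ← charFun_apply, charFun_gaussianReal, charFun_gaussianReal,
      ← Complex.exp_add]
    congr 1
    push_cast
    ring
  refine l.trans (Eq.trans ?_ r.symm)
  congr 1
  rw [← Complex.ofReal_pow, norm_add_sq_real, norm_smul, norm_smul, inner_smul_left,
    inner_smul_right, mul_pow, mul_pow, Real.norm_eq_abs, Real.norm_eq_abs, sq_abs, sq_abs,
    ← Complex.ofReal_pow, ← Complex.ofReal_pow, mul_pow t.snd q, hq2, conj_trivial, ← hpa]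
  push_cast
  ring

/-- Orthogonality of the Wick powers of two jointly Gaussian variables. -/
theorem integral_wick_inner_mul_wick_inner (a b : V) (n m : ℕ) :
    ∫ w, wick (‖a‖ ^ 2) n (inner ℝ a w) * wick (‖b‖ ^ 2) m (inner ℝ b w) ∂(stdGaussian V) =
      if n = m then n.factorial * (inner ℝ a b) ^ n else 0 := by
  set p := inner ℝ a b / ‖a‖ with hp
  set q := √(‖b‖ ^ 2 - p ^ 2) with hq
  have hpa : ‖a‖ * p = inner ℝ a b := by
    rcases eq_or_ne a 0 with rfl | ha
    · simp
    · rw [hp]; field_simp [norm_ne_zero_iff.2 ha]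
  have hpb : |p| ≤ ‖b‖ := by
    rw [hp, abs_div, abs_norm]
    refine div_le_of_le_mul₀ (norm_nonneg _) (norm_nonneg _) ?_
    rw [mul_comm]
    exact abs_real_inner_le_norm a b
  have hq2 : q ^ 2 = ‖b‖ ^ 2 - p ^ 2 := Real.sq_sqrt (by
    rw [sub_nonneg, ← sq_abs p]
    exact pow_le_pow_left₀ (abs_nonneg _) hpb 2)
  have hm1 : Measurable fun w : V => WithLp.toLp 2 (inner ℝ a w, inner ℝ b w) :=
    ((WithLp.prod_continuous_toLp 2 ℝ ℝ).comp (by fun_prop)).measurable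
  have hm2 : Measurable fun x : ℝ × ℝ => WithLp.toLp 2 (‖a‖ * x.1, p * x.1 + q * x.2) :=
    ((WithLp.prod_continuous_toLp 2 ℝ ℝ).comp (by fun_prop)).measurable
  let Ψ : WithLp 2 (ℝ × ℝ) → ℝ := fun w => wick (‖a‖ ^ 2) n w.fst * wick (‖b‖ ^ 2) m w.snd
  have hΨ : Continuous Ψ := by
    have h := WithLp.prod_continuous_ofLp 2 ℝ ℝ
    exact ((continuous_wick _ n).comp h.fst).mul ((continuous_wick _ m).comp h.snd)
  have h1 := integral_map (μ := stdGaussian V) hm1.aemeasurable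
    (f := Ψ) hΨ.aestronglyMeasurable
  have h2 := integral_map (μ := (gaussianReal 0 1).prod (gaussianReal 0 1)) hm2.aemeasurable
    (f := Ψ) hΨ.aestronglyMeasurable
  rw [map_inner_pair_stdGaussian, ← hp, ← hq, h2] at h1
  refine h1.symm.trans ?_
  change ∫ x : ℝ × ℝ, wick (‖a‖ ^ 2) n (‖a‖ * x.1) * wick (‖b‖ ^ 2) m (p * x.1 + q * x.2)
    ∂((gaussianReal 0 1).prod (gaussianReal 0 1)) = _
  have hx : AllLp ((gaussianReal 0 1).prod (gaussianReal 0 1)) fun x : ℝ × ℝ => x.1 :=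
    fun r hr => (allLp_id_gaussianReal r hr).comp_fst _
  have hy : AllLp ((gaussianReal 0 1).prod (gaussianReal 0 1)) fun x : ℝ × ℝ => x.2 :=
    fun r hr => (allLp_id_gaussianReal r hr).comp_snd _
  -- Averaging over the component independent of the first functional lowers the variance of the
  -- second factor from ‖b‖² to p², which is the fully correlated case.
  rw [integral_prod _ (((hx.const_mul ‖a‖).wick (‖a‖ ^ 2) n).mul
    (((hx.const_mul p).add (hy.const_mul q)).wick (‖b‖ ^ 2) m)).integrable]
  simp only [integral_const_mul, integral_wick_add, hq2, sub_sub_cancel]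
  rw [integral_wick_mul_wick, hpa]

theorem integral_comp_inner_stdGaussian (a : V) {f : ℝ → ℝ} (hf : Continuous f) :
    ∫ w, f (inner ℝ a w) ∂(stdGaussian V) = ∫ x, f (‖a‖ * x) ∂(gaussianReal 0 1) := by
  rw [← integral_map (f := f) (φ := fun w : V => inner ℝ a w) (by fun_prop)
    hf.aestronglyMeasurable, map_inner_stdGaussian, integral_map (by fun_prop)
    hf.aestronglyMeasurable]

/-- Wick powers are eigenfunctions of the Mehler operator: the average lowers the variance to
c²‖a‖², and homogeneity (`wick_smul`) extracts cⁿ. -/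
theorem integral_wick_inner_rotation (a w : V) {c : ℝ} (hc0 : 0 < c) (hc1 : c ≤ 1) (n : ℕ) :
    ∫ w', wick (‖a‖ ^ 2) n (inner ℝ a (c • w + √(1 - c ^ 2) • w')) ∂(stdGaussian V) =
      c ^ n * wick (‖a‖ ^ 2) n (inner ℝ a w) := by
  simp only [inner_add_right, inner_smul_right]
  have hcont := continuous_wick (‖a‖ ^ 2) n
  rw [integral_comp_inner_stdGaussian a
    (f := fun y => wick (‖a‖ ^ 2) n (c * inner ℝ a w + √(1 - c ^ 2) * y)) (by fun_prop)]
  simp only [← mul_assoc]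
  rw [integral_wick_add, mul_pow, Real.sq_sqrt (by nlinarith), ← wick_smul]
  congr 1; ring

theorem integral_cexp_gaussianReal (s α r : ℝ) :
    ∫ y, Complex.exp (((s * (α + r * y) : ℝ) : ℂ) * Complex.I) ∂(gaussianReal 0 1) =
      Complex.exp ((s * α : ℝ) * Complex.I) * (Real.exp (-(s * r) ^ 2 / 2) : ℝ) := by
  have h2 := charFun_gaussianReal (μ := 0) (v := 1) (s * r)
  rw [charFun_apply] at h2
  have e : ∀ y : ℝ, Complex.exp (((s * (α + r * y) : ℝ) : ℂ) * Complex.I) =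
      Complex.exp ((s * α : ℝ) * Complex.I) * Complex.exp ((inner ℝ y (s * r) : ℝ) * Complex.I) :=
    fun y => by
      rw [← Complex.exp_add]
      congr 1
      simp only [RCLike.inner_apply, conj_trivial]
      push_cast
      ring
  simp only [e]
  rw [integral_const_mul, h2]
  congr 1
  rw [Complex.ofReal_exp]
  congr 1
  push_cast
  ring

theorem integral_cos_sin_gaussianReal (s α r : ℝ) :
    ∫ y, Real.cos (s * (α + r * y)) ∂(gaussianReal 0 1) =
        Real.cos (s * α) * Real.exp (-(s * r) ^ 2 / 2) ∧
      ∫ y, Real.sin (s * (α + r * y)) ∂(gaussianReal 0 1) =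
        Real.sin (s * α) * Real.exp (-(s * r) ^ 2 / 2) := by
  have h := integral_cexp_gaussianReal s α r
  have hi : Integrable (fun y : ℝ => Complex.exp (((s * (α + r * y) : ℝ) : ℂ) * Complex.I))
      (gaussianReal 0 1) :=
    (integrable_const (1 : ℝ)).mono (by fun_prop) (Eventually.of_forall fun y => by
      rw [Complex.norm_exp_ofReal_mul_I]; simp)
  constructor
  · have := congrArg Complex.re h
    rw [← RCLike.re_to_complex, ← integral_re hi] at this
    simpa only [RCLike.re_to_complex, Complex.exp_ofReal_mul_I_re, Complex.re_mul_ofReal] using this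
  · have := congrArg Complex.im h
    rw [← RCLike.im_to_complex, ← integral_im hi] at this
    simpa only [RCLike.im_to_complex, Complex.exp_ofReal_mul_I_im, Complex.im_mul_ofReal] using this

/-- The Mehler operator replaces the parameter s by sc: the Gaussian average produces exp(-s²(1 -
c²)‖a‖²/2), which converts the normalization for s into the one for sc. This is the origin of the
factor p - 1 in the integrability condition. -/
theorem integral_cos_inner_rotation (a w : V) {c : ℝ} (hc0 : 0 < c) (hc1 : c ≤ 1) (s : ℝ) :
    ∫ w', Real.cos (s * inner ℝ a (c • w + √(1 - c ^ 2) • w')) * Real.exp ((s * ‖a‖) ^ 2 / 2)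
      ∂(stdGaussian V) =
      Real.cos (s * c * inner ℝ a w) * Real.exp ((s * c * ‖a‖) ^ 2 / 2) := by
  simp only [inner_add_right, inner_smul_right]
  rw [integral_mul_const, integral_comp_inner_stdGaussian a
    (f := fun y => Real.cos (s * (c * inner ℝ a w + √(1 - c ^ 2) * y))) (by fun_prop)]
  simp only [← mul_assoc (√(1 - c ^ 2))]
  rw [(integral_cos_sin_gaussianReal _ _ _).1, mul_assoc, ← Real.exp_add, ← mul_assoc s c]
  congr 2
  rw [mul_pow, mul_pow √(1 - c ^ 2), Real.sq_sqrt (by nlinarith)]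
  ring

theorem integral_sin_inner_rotation (a w : V) {c : ℝ} (hc0 : 0 < c) (hc1 : c ≤ 1) (s : ℝ) :
    ∫ w', Real.sin (s * inner ℝ a (c • w + √(1 - c ^ 2) • w')) * Real.exp ((s * ‖a‖) ^ 2 / 2)
      ∂(stdGaussian V) =
      Real.sin (s * c * inner ℝ a w) * Real.exp ((s * c * ‖a‖) ^ 2 / 2) := by
  simp only [inner_add_right, inner_smul_right]
  rw [integral_mul_const, integral_comp_inner_stdGaussian a
    (f := fun y => Real.sin (s * (c * inner ℝ a w + √(1 - c ^ 2) * y))) (by fun_prop)]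
  simp only [← mul_assoc (√(1 - c ^ 2))]
  rw [(integral_cos_sin_gaussianReal _ _ _).2, mul_assoc, ← Real.exp_add, ← mul_assoc s c]
  congr 2
  rw [mul_pow, mul_pow √(1 - c ^ 2), Real.sq_sqrt (by nlinarith)]
  ring

end Wick

end

noncomputable section

namespace Torus

/-! ### Completeness of the Sobolev spaces -/

theorem lam_neg (k : ℤ × ℤ) : lam (-k) = lam k := by simp [lam]

namespace Sobolev

theorem norm_toSeq {s : ℝ} (u : Sobolev s) : ‖u.toSeq‖ = ‖u‖ := by
  have h1 : ‖u‖ ^ 2 = ‖u.toSeq‖ ^ 2 := by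
    rw [← real_inner_self_eq_norm_sq, ← inner_self_eq_norm_sq (𝕜 := ℂ)]
    exact innerH_eq u u
  exact ((sq_eq_sq₀ (norm_nonneg _) (norm_nonneg _)).1 h1).symm

theorem toSeq_sub {s : ℝ} (u v : Sobolev s) : (u - v).toSeq = u.toSeq - v.toSeq := by
  rw [eq_sub_iff_add_eq, ← toSeq_add, sub_add_cancel]

theorem isometry_toSeq (s : ℝ) : Isometry (toSeq : Sobolev s → _) :=
  Isometry.of_dist_eq fun u v => by
    rw [dist_eq_norm, dist_eq_norm, ← toSeq_sub, norm_toSeq]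

theorem toSeq_apply {s : ℝ} (u : Sobolev s) (k : ℤ × ℤ) :
    u.toSeq k = ((lam k ^ (s / 2) : ℝ) : ℂ) * hat u.toDistr k := rfl

end Sobolev

/-- Controls λ^M by the symbols of the identity and of the two pure derivatives of order 2M, so that
decay of Fourier coefficients follows from three sup norms. -/
theorem lam_pow_le (k : ℤ × ℤ) (M : ℕ) :
    lam k ^ M ≤ 3 ^ M * (1 + |(k.1 : ℝ)| ^ (2 * M) + |(k.2 : ℝ)| ^ (2 * M)) := by
  set a := (k.1 : ℝ) ^ 2 with ha
  set b := (k.2 : ℝ) ^ 2 with hb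
  have ha0 : 0 ≤ a := sq_nonneg _
  have hb0 : 0 ≤ b := sq_nonneg _
  have h1 : |(k.1 : ℝ)| ^ (2 * M) = a ^ M := by rw [pow_mul, sq_abs]
  have h2 : |(k.2 : ℝ)| ^ (2 * M) = b ^ M := by rw [pow_mul, sq_abs]
  rw [h1, h2, lam, ← ha, ← hb]
  have hm : 1 + (a + b) ≤ 3 * max 1 (max a b) := by
    have := le_max_left 1 (max a b)
    have := (le_max_left a b).trans (le_max_right 1 (max a b))
    have := (le_max_right a b).trans (le_max_right 1 (max a b))
    linarith
  have hp : (max 1 (max a b)) ^ M ≤ 1 + a ^ M + b ^ M := by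
    have := pow_nonneg ha0 M
    have := pow_nonneg hb0 M
    rcases max_choice 1 (max a b) with h | h <;> rw [h]
    · rw [one_pow]; linarith
    · rcases max_choice a b with h' | h' <;> rw [h'] <;> linarith
  calc (1 + (a + b)) ^ M ≤ (3 * max 1 (max a b)) ^ M := by gcongr
    _ = 3 ^ M * (max 1 (max a b)) ^ M := mul_pow _ _ _
    _ ≤ _ := by gcongr

theorem norm_coef_le (φ : TestFun) {B : ℝ} (hB : ∀ x, ‖(φ : T2 → ℂ) x‖ ≤ B) (k : ℤ × ℤ) :
    ‖coef φ k‖ ≤ B * (volume : Measure T2).real Set.univ := by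
  refine norm_integral_le_of_norm_le_const (Eventually.of_forall fun x => ?_)
  rw [norm_mul, norm_e]
  refine (mul_le_of_le_one_right (norm_nonneg _) ?_).trans (hB x)
  rw [div_le_one (by positivity)]
  nlinarith [Real.pi_gt_three]

theorem lam_pow_mul_coef_le (φ : TestFun) (M : ℕ) {B : ℝ}
    (hB : ∀ i j : ℕ, i + j ≤ 2 * M → ∀ x : T2, ‖(partialD i j φ : T2 → ℂ) x‖ ≤ B) (k : ℤ × ℤ) :
    lam k ^ M * ‖coef φ k‖ ≤ 3 ^ M * 3 * (volume : Measure T2).real Set.univ * B := by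
  have h0 := norm_coef_le _ (hB 0 0 (by simp)) k
  have h1 := norm_coef_le _ (hB (2 * M) 0 (by simp)) k
  have h2 := norm_coef_le _ (hB 0 (2 * M) (by simp)) k
  simp only [coef_partialD, norm_mul, norm_pow, Complex.norm_I, one_mul, pow_zero,
    mul_one, Complex.norm_intCast] at h0 h1 h2
  calc lam k ^ M * ‖coef φ k‖ ≤
      3 ^ M * (1 + |(k.1 : ℝ)| ^ (2 * M) + |(k.2 : ℝ)| ^ (2 * M)) * ‖coef φ k‖ := by
        gcongr; exact lam_pow_le k M
    _ = 3 ^ M * (‖coef φ k‖ + |(k.1 : ℝ)| ^ (2 * M) * ‖coef φ k‖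
        + |(k.2 : ℝ)| ^ (2 * M) * ‖coef φ k‖) := by ring
    _ ≤ 3 ^ M * (B * (volume : Measure T2).real Set.univ + B * (volume : Measure T2).real Set.univ
        + B * (volume : Measure T2).real Set.univ) := by gcongr
    _ = _ := by ring

theorem summable_inv_lam_sq : Summable fun k : ℤ × ℤ => (lam k ^ 2)⁻¹ := by
  have hs := summable_int.mul_of_nonneg summable_int (fun _ => by positivity)
    (fun _ => by positivity)
  refine Summable.of_nonneg_of_le (fun k => by have := lam_pos k; positivity) (fun k => ?_) hs
  rw [← mul_inv]
  have h1 := sq_nonneg (k.1 : ℝ)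
  have h2 := sq_nonneg (k.2 : ℝ)
  gcongr
  unfold lam
  nlinarith

/-- Sequences of polynomial growth are the Fourier coefficients of distributions. -/
theorem exists_distr (y : ℤ × ℤ → ℂ) (m : ℕ) (K : ℝ) (hy : ∀ k, ‖y k‖ ≤ K * lam k ^ m) :
    ∃ u : Distr, ∀ k, hat u k = y k := by
  -- The coefficients y grow like λ^m; spending two more powers of λ on the test function leaves the
  -- summable weight λ^{-2}.
  have hb : ∀ (φ : TestFun) (B : ℝ), (∀ i j : ℕ, i + j ≤ 2 * (m + 2) → ∀ x : T2,
      ‖(partialD i j φ : T2 → ℂ) x‖ ≤ B) → ∀ k, ‖y k * coef φ (-k)‖ ≤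
        (3 ^ (m + 2) * 3 * (volume : Measure T2).real Set.univ * K * B) * (lam k ^ 2)⁻¹ := by
    intro φ B hB k
    have h := lam_pow_mul_coef_le φ (m + 2) hB (-k)
    rw [lam_neg] at h
    have hl := lam_pos k
    have hK : 0 ≤ K := by
      have := (norm_nonneg _).trans (hy k)
      exact nonneg_of_mul_nonneg_left this (by positivity)
    rw [norm_mul, ← div_eq_mul_inv, le_div_iff₀ (by positivity)]
    calc ‖y k‖ * ‖coef φ (-k)‖ * lam k ^ 2 ≤ K * lam k ^ m * ‖coef φ (-k)‖ * lam k ^ 2 := by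
          gcongr; exact hy k
      _ = K * (lam k ^ (m + 2) * ‖coef φ (-k)‖) := by ring
      _ ≤ K * (3 ^ (m + 2) * 3 * (volume : Measure T2).real Set.univ * B) := by gcongr
      _ = _ := by ring
  have hsum : ∀ φ : TestFun, Summable fun k => y k * coef φ (-k) := by
    intro φ
    have hex : ∃ B : ℝ, ∀ i j : ℕ, i + j ≤ 2 * (m + 2) → ∀ x : T2,
        ‖(partialD i j φ : T2 → ℂ) x‖ ≤ B := by
      have h1 : ∀ ij : ℕ × ℕ, ∃ B : ℝ, 0 ≤ B ∧ ∀ x, ‖(partialD ij.1 ij.2 φ : T2 → ℂ) x‖ ≤ B :=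
        fun ij => by
          obtain ⟨B, hB⟩ := (isCompact_range
            (TestFun.continuous (partialD ij.1 ij.2 φ))).isBounded.exists_norm_le
          exact ⟨max B 0, le_max_right _ _, fun x => (hB _ ⟨x, rfl⟩).trans (le_max_left _ _)⟩
      choose B hB0 hB using h1
      refine ⟨∑ ij ∈ Finset.range (2 * (m + 2) + 1) ×ˢ Finset.range (2 * (m + 2) + 1), B ij,
        fun i j hij x => (hB (i, j) x).trans ?_⟩
      exact Finset.single_le_sum (f := B) (fun ij _ => hB0 ij) (by
        simp only [Finset.mem_product, Finset.mem_range]; omega)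
    obtain ⟨B, hB⟩ := hex
    exact Summable.of_norm_bounded (summable_inv_lam_sq.mul_left _) (hb φ B hB)
  have hadd : ∀ φ ψ : TestFun, ∀ k, coef (φ + ψ) k = coef φ k + coef ψ k := by
    intro φ ψ k
    have h := coef_sub (φ + ψ) ψ k
    rw [add_sub_cancel_right] at h
    rw [h, sub_add_cancel]
  have hsmul : ∀ (c : ℂ) (φ : TestFun), ∀ k, coef (c • φ) k = c * coef φ k := by
    intro c φ k
    rw [coef, coef, ← integral_const_mul]
    congr 1; ext x
    exact mul_assoc _ _ _
  let u : Module.Dual ℂ TestFun :=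
    { toFun := fun φ => ∑' k, y k * coef φ (-k)
      map_add' := fun φ ψ => by
        rw [← (hsum φ).tsum_add (hsum ψ)]
        simp only [hadd, mul_add]
      map_smul' := fun c φ => by
        rw [RingHom.id_apply, smul_eq_mul, ← tsum_mul_left]
        simp only [hsmul, mul_left_comm] }
  refine ⟨⟨u, 2 * (m + 2), (3 ^ (m + 2) * 3 * (volume : Measure T2).real Set.univ * K) *
    ∑' k, (lam k ^ 2)⁻¹, fun φ B hB => ?_⟩, fun k => ?_⟩
  · have := tsum_of_norm_bounded (summable_inv_lam_sq.hasSum.mul_left _) (hb φ B hB)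
    refine this.trans (le_of_eq ?_)
    ring
  · change ∑' l, y l * coef (eTest (-k)) (-l) = y k
    rw [tsum_eq_single k]
    · have := integral_e_mul (-k) (-k)
      rw [if_pos rfl] at this
      rw [coef]
      change y k * ∫ x, e (-k) x * e (-(-k)) x = y k
      rw [this, mul_one]
    · intro l hl
      have := integral_e_mul (-k) (-l)
      rw [if_neg (fun h => hl (neg_injective h).symm)] at this
      rw [coef]
      change y l * ∫ x, e (-k) x * e (-(-l)) x = 0
      rw [this, mul_zero]

namespace Sobolev

/-- The weighted Fourier sequences fill the whole subspace of ℓ² cut out by the reality condition.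
That subspace is closed, which yields completeness of H^s. -/
theorem range_toSeq (s : ℝ) : Set.range (toSeq : Sobolev s → _) =
    {x | ∀ k, x (-k) = conj (x k)} := by
  ext x
  constructor
  · rintro ⟨u, rfl⟩ k
    rw [toSeq_apply, toSeq_apply, lam_neg, map_mul, Complex.conj_ofReal]
    congr 1
    exact u.2.2 k
  · intro hx
    obtain ⟨m, hm⟩ := exists_nat_ge (-s / 2)
    have hpos : ∀ k, 0 < lam k ^ (s / 2) := fun k => Real.rpow_pos_of_pos (lam_pos k) _
    obtain ⟨u, hu⟩ := exists_distr (fun k => ((lam k ^ (-s / 2) : ℝ) : ℂ) * x k) m ‖x‖ (by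
      intro k
      rw [norm_mul, Complex.norm_real, Real.norm_of_nonneg (Real.rpow_nonneg (lam_pos k).le _),
        mul_comm]
      have h1 := lp.norm_apply_le_norm (by norm_num) x k
      have h2 : lam k ^ (-s / 2) ≤ lam k ^ m := by
        rw [← Real.rpow_natCast]
        exact Real.rpow_le_rpow_of_exponent_le (one_le_lam k) hm
      have := Real.rpow_nonneg (lam_pos k).le (-s / 2)
      gcongr)
    have hw : ∀ k, ((lam k ^ (s / 2) : ℝ) : ℂ) * hat u k = x k := fun k => by
      rw [hu, ← mul_assoc, ← Complex.ofReal_mul, ← Real.rpow_add (lam_pos k)]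
      rw [show s / 2 + -s / 2 = 0 by ring, Real.rpow_zero, Complex.ofReal_one, one_mul]
    have hmem : u ∈ sobolev s := by
      refine ⟨(summable_weight_iff s u).2 ?_, fun k => ?_⟩
      · simp only [hw]
        exact x.2
      · rw [hu, hu, lam_neg, map_mul, Complex.conj_ofReal, hx]
    refine ⟨⟨u, hmem⟩, ?_⟩
    ext k
    exact hw k

theorem continuous_lp_apply (k : ℤ × ℤ) :
    Continuous fun x : lp (fun _ : ℤ × ℤ => ℂ) 2 => x k :=
  (continuous_apply k).comp lp.uniformContinuous_coe.continuous

instance completeSpace (s : ℝ) : CompleteSpace (Sobolev s) := by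
  rw [completeSpace_iff_isComplete_range (isometry_toSeq s).isUniformInducing, range_toSeq]
  refine IsClosed.isComplete ?_
  simp only [Set.ofPred_forall]
  exact isClosed_iInter fun k => isClosed_eq (continuous_lp_apply _)
    (Complex.continuous_conj.comp (continuous_lp_apply _))

/-- A Fourier coefficient, as a continuous functional on `H^s`. -/
def hatCLM (s : ℝ) (k : ℤ × ℤ) : Sobolev s →L[ℝ] ℂ :=
  LinearMap.mkContinuous
    { toFun := fun u => hat u.toDistr k
      map_add' := fun u v => hat_add _ _ _
      map_smul' := fun c u => by
        rw [RingHom.id_apply, Complex.real_smul]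
        exact hat_smul _ _ _ } (lam k ^ (-s / 2)) (fun u => by
    have h1 := lp.norm_apply_le_norm (by norm_num) u.toSeq k
    rw [toSeq_apply, norm_mul, Complex.norm_real,
      Real.norm_of_nonneg (Real.rpow_nonneg (lam_pos k).le _), norm_toSeq] at h1
    have h2 : lam k ^ (-s / 2) * lam k ^ (s / 2) = 1 := by
      rw [← Real.rpow_add (lam_pos k), show -s / 2 + s / 2 = 0 by ring, Real.rpow_zero]
    calc ‖hat u.toDistr k‖ = lam k ^ (-s / 2) * (lam k ^ (s / 2) * ‖hat u.toDistr k‖) := by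
          rw [← mul_assoc, h2, one_mul]
      _ ≤ _ := mul_le_mul_of_nonneg_left h1 (Real.rpow_nonneg (lam_pos k).le _))

@[simp] theorem hatCLM_apply {s : ℝ} (k : ℤ × ℤ) (u : Sobolev s) :
    hatCLM s k u = hat u.toDistr k := rfl

theorem ext_hat {s : ℝ} {u v : Sobolev s} (h : ∀ k, hat u.toDistr k = hat v.toDistr k) :
    u = v := by
  have h0 : ∀ k, hat (u - v).toDistr k = 0 := fun k => by
    rw [← hatCLM_apply, map_sub, hatCLM_apply, hatCLM_apply, h, sub_self]
  rw [← sub_eq_zero]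
  exact toSeq_eq_zero (by ext k; rw [toSeq_apply, h0, mul_zero]; rfl)

theorem hasSum_real_inner {s : ℝ} (u v : Sobolev s) :
    HasSum (fun k => lam k ^ s * ((hat u.toDistr k).re * (hat v.toDistr k).re +
      (hat u.toDistr k).im * (hat v.toDistr k).im)) (inner ℝ u v) := by
  have h := (Complex.hasSum_re (hasSum_inner u v))
  have e1 : (fun k => (((lam k ^ s : ℝ) : ℂ) * hat u.toDistr k * hat v.toDistr (-k)).re) =
      fun k => lam k ^ s * ((hat u.toDistr k).re * (hat v.toDistr k).re +
      (hat u.toDistr k).im * (hat v.toDistr k).im) := by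
    funext k
    have hv : hat v.toDistr (-k) = conj (hat v.toDistr k) := v.2.2 k
    rw [hv, mul_assoc, Complex.re_ofReal_mul]
    simp
  rw [e1] at h
  rwa [← innerH_eq] at h

end Sobolev

/-! ### Continuous functions as elements of the Sobolev spaces -/

theorem memLp_of_continuousMap (f : C(T2, ℝ)) (p : ℝ≥0∞) : MemLp f p (volume : Measure T2) :=
  MemLp.of_bound f.continuous.aestronglyMeasurable ‖f‖
    (Eventually.of_forall fun x => f.norm_coe_le_norm x)

theorem coeFn_toH (f : C(T2, ℝ)) : toH f =ᵐ[volume] f := by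
  rw [toH, dif_pos (memLp_of_continuousMap f 2)]
  exact MemLp.coeFn_toLp _

theorem hat_toH (f : C(T2, ℝ)) (k : ℤ × ℤ) :
    hat (l2Distr (toH f)) k = ∫ x, ((f x : ℝ) : ℂ) * e (-k) x := by
  rw [hat_l2Distr]
  refine integral_congr_ae ?_
  filter_upwards [coeFn_toH f] with x hx
  rw [hx]

theorem hat_toH_add (f g : C(T2, ℝ)) (k : ℤ × ℤ) :
    hat (l2Distr (toH (f + g : C(T2, ℝ)))) k = hat (l2Distr (toH f)) k + hat (l2Distr (toH g)) k := by
  simp only [hat_toH]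
  rw [← integral_add]
  · congr 1; ext x
    rw [ContinuousMap.add_apply, Complex.ofReal_add, add_mul]
  · exact integrable_of_cont ((Complex.continuous_ofReal.comp f.continuous).mul (continuous_e _))
  · exact integrable_of_cont ((Complex.continuous_ofReal.comp g.continuous).mul (continuous_e _))

theorem hat_toH_smul (c : ℝ) (f : C(T2, ℝ)) (k : ℤ × ℤ) :
    hat (l2Distr (toH (c • f : C(T2, ℝ)))) k = c * hat (l2Distr (toH f)) k := by
  simp only [hat_toH]
  rw [← integral_const_mul]
  congr 1; ext x
  rw [ContinuousMap.smul_apply, smul_eq_mul, Complex.ofReal_mul, mul_assoc]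

theorem norm_hat_toH_le (f : C(T2, ℝ)) (k : ℤ × ℤ) :
    ‖hat (l2Distr (toH f)) k‖ ≤ (volume : Measure T2).real Set.univ * ‖f‖ := by
  rw [hat_toH, mul_comm (Measure.real _ _)]
  refine norm_integral_le_of_norm_le_const (Eventually.of_forall fun x => ?_)
  rw [norm_mul, norm_e, Complex.norm_real]
  refine (mul_le_of_le_one_right (norm_nonneg _) ?_).trans (f.norm_coe_le_norm x)
  rw [div_le_one (by positivity)]
  nlinarith [Real.pi_gt_three]

/-- The `k`-th Fourier coefficient of a continuous function. -/
def coefCLM (k : ℤ × ℤ) : C(T2, ℝ) →L[ℝ] ℂ :=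
  LinearMap.mkContinuous
    { toFun := fun f => hat (l2Distr (toH f)) k
      map_add' := fun f g => hat_toH_add f g k
      map_smul' := fun c f => by
        rw [RingHom.id_apply, Complex.real_smul]
        exact hat_toH_smul c f k } _ (fun f => norm_hat_toH_le f k)

theorem coefCLM_apply (k : ℤ × ℤ) (f : C(T2, ℝ)) :
    coefCLM k f = hat (l2Distr (toH f)) k := rfl

/-- The inclusion of the continuous functions in `H^{-α}`. -/
def toSobolev {α : ℝ} (hα : 0 ≤ α) : C(T2, ℝ) →L[ℝ] Sobolev (-α) :=
  ContinuousLinearMap.ofSeqClosedGraph (g :=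
    { toFun := fun f => embed hα (toH f)
      map_add' := fun f g => Sobolev.ext_hat fun k => by
        rw [← Sobolev.hatCLM_apply k (_ + _), map_add]
        exact hat_toH_add f g k
      map_smul' := fun c f => Sobolev.ext_hat fun k => by
        rw [RingHom.id_apply, ← Sobolev.hatCLM_apply k (_ • _), map_smul, Complex.real_smul]
        exact hat_toH_smul c f k }) (by
    -- Closed graph: both limits have the same Fourier coefficients, because these are continuous
    -- functionals on either side.
    intro u x y hu hy
    refine Sobolev.ext_hat fun k => ?_
    have h1 := ((Sobolev.hatCLM (-α) k).continuous.tendsto y).comp hy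
    have h2 := ((coefCLM k).continuous.tendsto x).comp hu
    exact tendsto_nhds_unique h1 h2)

theorem hat_toSobolev {α : ℝ} (hα : 0 ≤ α) (f : C(T2, ℝ)) (k : ℤ × ℤ) :
    hat (toSobolev hα f).toDistr k = coefCLM k f := rfl

/-- Integration against `g`. -/
def testCLM (g : H) : C(T2, ℝ) →L[ℝ] ℝ :=
  have hg : Integrable g (volume : Measure T2) := (Lp.memLp g).integrable (by norm_num)
  have hi : ∀ f : C(T2, ℝ), Integrable (fun x => f x * g x) (volume : Measure T2) := fun f =>
    hg.bdd_mul (c := ‖f‖) f.continuous.aestronglyMeasurable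
      (Eventually.of_forall fun x => f.norm_coe_le_norm x)
  LinearMap.mkContinuous
    { toFun := fun f => ∫ x, f x * g x
      map_add' := fun f f' => by
        rw [← integral_add (hi f) (hi f')]
        congr 1; ext x
        rw [ContinuousMap.add_apply, add_mul]
      map_smul' := fun c f => by
        rw [RingHom.id_apply, smul_eq_mul, ← integral_const_mul]
        congr 1; ext x
        rw [ContinuousMap.smul_apply, smul_eq_mul, mul_assoc] } (∫ x, ‖g x‖) (fun f => by
    rw [mul_comm (∫ x, ‖g x‖), ← integral_const_mul]
    refine norm_integral_le_of_norm_le (hg.norm.const_mul _) (Eventually.of_forall fun x => ?_)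
    rw [norm_mul]
    exact mul_le_mul_of_nonneg_right (f.norm_coe_le_norm x) (norm_nonneg _))

theorem testCLM_apply (g : H) (f : C(T2, ℝ)) : testCLM g f = ∫ x, f x * g x := rfl

/-! ### The real trigonometric functions -/

/-- The character `x ↦ exp(i k·x)`. -/
def char (k : ℤ × ℤ) : C(T2, ℂ) := ⟨fun x => fourier k.1 x.1 * fourier k.2 x.2, by fun_prop⟩

theorem char_apply (k : ℤ × ℤ) (x : T2) : char k x = fourier k.1 x.1 * fourier k.2 x.2 := rfl

theorem char_eq (k : ℤ × ℤ) (x : T2) : char k x = 2 * π * e k x := by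
  have hp : (π : ℂ) ≠ 0 := by exact_mod_cast Real.pi_ne_zero
  rw [char_apply, e]
  field_simp

theorem char_add (k l : ℤ × ℤ) (x : T2) : char (k + l) x = char k x * char l x := by
  simp only [char_apply, Prod.fst_add, Prod.snd_add, fourier_add]
  ring

theorem char_zero (x : T2) : char 0 x = 1 := by simp [char_apply]

theorem char_neg (k : ℤ × ℤ) (x : T2) : char (-k) x = conj (char k x) := by
  simp [char_apply]

theorem norm_char (k : ℤ × ℤ) (x : T2) : ‖char k x‖ = 1 := by
  rw [char_apply, norm_mul, fourier_apply, fourier_apply, Circle.norm_coe, Circle.norm_coe, one_mul]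

theorem char_sum {n : ℕ} (f : Fin n → ℤ × ℤ) (x : T2) :
    char (∑ i, f i) x = ∏ i, char (f i) x := by
  induction n with
  | zero => simp [char_zero]
  | succ n ih => rw [Fin.sum_univ_succ, Fin.prod_univ_succ, char_add, ih]

/-- `cos(k·x)`. -/
def cosC (k : ℤ × ℤ) : C(T2, ℝ) := ⟨fun x => (char k x).re, by fun_prop⟩

/-- `sin(k·x)`. -/
def sinC (k : ℤ × ℤ) : C(T2, ℝ) := ⟨fun x => (char k x).im, by fun_prop⟩

theorem cosC_apply (k : ℤ × ℤ) (x : T2) : cosC k x = (char k x).re := rfl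

theorem sinC_apply (k : ℤ × ℤ) (x : T2) : sinC k x = (char k x).im := rfl

theorem coefCLM_cosC (j k : ℤ × ℤ) : coefCLM j (cosC k) =
    π * ((if k = j then 1 else 0) + if k = -j then 1 else 0) := by
  rw [coefCLM_apply, hat_toH]
  have h : ∀ x, ((cosC k x : ℝ) : ℂ) * e (-j) x = π * (e k x * e (-j) x + e (-k) x * e (-j) x) := by
    intro x
    rw [cosC_apply, Complex.re_eq_add_conj, ← char_neg, char_eq, char_eq]
    ring
  simp only [h]
  rw [integral_const_mul, integral_add, integral_e_mul, integral_e_mul]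
  · simp only [neg_eq_iff_eq_neg]
  · exact integrable_of_cont ((continuous_e _).mul (continuous_e _))
  · exact integrable_of_cont ((continuous_e _).mul (continuous_e _))

theorem coefCLM_sinC (j k : ℤ × ℤ) : coefCLM j (sinC k) =
    π / Complex.I * ((if k = j then 1 else 0) - if k = -j then 1 else 0) := by
  rw [coefCLM_apply, hat_toH]
  have h : ∀ x, ((sinC k x : ℝ) : ℂ) * e (-j) x =
      π / Complex.I * (e k x * e (-j) x - e (-k) x * e (-j) x) := by
    intro x
    rw [sinC_apply, Complex.im_eq_sub_conj, ← char_neg, char_eq, char_eq]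
    field_simp
  simp only [h]
  rw [integral_const_mul, integral_sub, integral_e_mul, integral_e_mul]
  · simp only [neg_eq_iff_eq_neg]
  · exact integrable_of_cont ((continuous_e _).mul (continuous_e _))
  · exact integrable_of_cont ((continuous_e _).mul (continuous_e _))

/-- The weight `‖J cos(k·)‖² + ‖J sin(k·)‖²`. -/
def weight {𝒦 : Type} [NormedAddCommGroup 𝒦] [InnerProductSpace ℝ 𝒦]
    (J : C(T2, ℝ) →L[ℝ] 𝒦) (k : ℤ × ℤ) : ℝ := ‖J (cosC k)‖ ^ 2 + ‖J (sinC k)‖ ^ 2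

theorem weight_toSobolev {α : ℝ} (hα : 0 ≤ α) (k : ℤ × ℤ) :
    weight (toSobolev hα) k = 4 * π ^ 2 * lam k ^ (-α) := by
  have h1 := (Sobolev.hasSum_real_inner (toSobolev hα (cosC k)) (toSobolev hα (cosC k))).add
    (Sobolev.hasSum_real_inner (toSobolev hα (sinC k)) (toSobolev hα (sinC k)))
  rw [real_inner_self_eq_norm_sq, real_inner_self_eq_norm_sq] at h1
  refine h1.unique ?_
  -- Half of the mass sits at k and half at -k; for k = 0 the two indicator terms coincide and add
  -- up.
  have h2 := ((hasSum_ite_eq k (2 * π ^ 2 * lam k ^ (-α))).add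
    (hasSum_ite_eq (-k) (2 * π ^ 2 * lam k ^ (-α))))
  rw [show 2 * π ^ 2 * lam k ^ (-α) + 2 * π ^ 2 * lam k ^ (-α) = 4 * π ^ 2 * lam k ^ (-α) by ring]
    at h2
  have e1 : (fun j => lam j ^ (-α) * ((hat (toSobolev hα (cosC k)).toDistr j).re *
      (hat (toSobolev hα (cosC k)).toDistr j).re + (hat (toSobolev hα (cosC k)).toDistr j).im *
      (hat (toSobolev hα (cosC k)).toDistr j).im) + lam j ^ (-α) *
      ((hat (toSobolev hα (sinC k)).toDistr j).re * (hat (toSobolev hα (sinC k)).toDistr j).re +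
      (hat (toSobolev hα (sinC k)).toDistr j).im * (hat (toSobolev hα (sinC k)).toDistr j).im)) =
      fun j => (if j = k then 2 * π ^ 2 * lam k ^ (-α) else 0) +
        if j = -k then 2 * π ^ 2 * lam k ^ (-α) else 0 := by
    funext j
    simp only [hat_toSobolev, coefCLM_cosC, coefCLM_sinC, Complex.div_I]
    have a1 : (k = j) = (j = k) := propext eq_comm
    have a2 : (k = -j) = (j = -k) := propext (by rw [← neg_eq_iff_eq_neg, eq_comm])
    simp only [a1, a2]
    have hl : j = k ∨ j = -k → lam j = lam k := by
      rintro (h | h) <;> rw [h]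
      exact lam_neg k
    by_cases c1 : j = k <;> by_cases c2 : j = -k
    · simp only [if_pos c1, if_pos c2, hl (Or.inl c1)]
      simp
      ring
    · simp only [if_pos c1, if_neg c2, hl (Or.inl c1)]
      simp
      ring
    · simp only [if_neg c1, if_pos c2, hl (Or.inr c2)]
      simp
      ring
    · simp [c1, c2]
  rw [e1]
  exact h2

theorem weight_testCLM (g : H) (k : ℤ × ℤ) :
    weight (testCLM g) k = 4 * π ^ 2 * ‖hat (l2Distr g) k‖ ^ 2 := by
  have hg : Integrable g (volume : Measure T2) := (Lp.memLp g).integrable (by norm_num)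
  have hi : Integrable (fun x => ((g x : ℝ) : ℂ) * e (-k) x) (volume : Measure T2) :=
    hg.ofReal.mul_bdd (c := 1 / (2 * π)) (continuous_e _).aestronglyMeasurable
      (Eventually.of_forall fun x => (norm_e _ x).le)
  have hr : (hat (l2Distr g) k).re = testCLM g (cosC k) / (2 * π) := by
    rw [hat_l2Distr, testCLM_apply, ← integral_div, ← RCLike.re_eq_complex_re, ← integral_re hi]
    congr 1; ext x
    rw [← conj_e, cosC_apply, char_eq, RCLike.re_eq_complex_re, Complex.re_ofReal_mul]
    have hp := Real.pi_ne_zero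
    have : (2 * (π : ℂ) * e k x).re = 2 * π * (e k x).re := by
      rw [show (2 * (π : ℂ)) = ((2 * π : ℝ) : ℂ) by push_cast; ring, Complex.re_ofReal_mul]
    rw [this, Complex.conj_re]
    field_simp
  have him : (hat (l2Distr g) k).im = -(testCLM g (sinC k) / (2 * π)) := by
    rw [hat_l2Distr, testCLM_apply, ← integral_div, ← integral_neg, ← RCLike.im_eq_complex_im,
      ← integral_im hi]
    congr 1; ext x
    rw [← conj_e, sinC_apply, char_eq, RCLike.im_eq_complex_im, Complex.im_ofReal_mul]
    have hp := Real.pi_ne_zero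
    have : (2 * (π : ℂ) * e k x).im = 2 * π * (e k x).im := by
      rw [show (2 * (π : ℂ)) = ((2 * π : ℝ) : ℂ) by push_cast; ring, Complex.im_ofReal_mul]
    rw [this, Complex.conj_im]
    field_simp
  have hp := Real.pi_ne_zero
  rw [weight, Complex.sq_norm, Complex.normSq_apply, hr, him, Real.norm_eq_abs, Real.norm_eq_abs,
    sq_abs, sq_abs]
  field_simp
  ring

end Torus

end

noncomputable section

namespace Torus

/-! ### The heat kernel on the circle -/

theorem exp_neg_le_inv {u : ℝ} (hu : 0 < u) : Real.exp (-u) ≤ u⁻¹ := by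
  rw [Real.exp_neg]
  exact inv_anti₀ hu (by linarith [Real.add_one_le_exp u])

theorem summable_exp_neg_sq {t : ℝ} (ht : 0 < t) :
    Summable fun n : ℤ => Real.exp (-(t * (n : ℝ) ^ 2)) := by
  refine Summable.of_nonneg_of_le (fun _ => (Real.exp_pos _).le) (fun n => ?_)
    (summable_int.mul_left (max 1 t⁻¹))
  have h1 := Real.add_one_le_exp (t * (n : ℝ) ^ 2)
  rw [Real.exp_neg, ← div_eq_mul_inv, le_div_iff₀ (by positivity),
    inv_mul_le_iff₀ (Real.exp_pos _)]
  have h2 : 1 + (n : ℝ) ^ 2 ≤ (t * (n : ℝ) ^ 2 + 1) * max 1 t⁻¹ := by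
    have a1 := le_max_left 1 t⁻¹
    have a2 : (n : ℝ) ^ 2 ≤ (t * (n : ℝ) ^ 2) * max 1 t⁻¹ := by
      calc (n : ℝ) ^ 2 = (t * (n : ℝ) ^ 2) * t⁻¹ := by field_simp
        _ ≤ _ := by gcongr; exact le_max_right _ _
    linarith
  refine h2.trans ?_
  gcongr

/-- The heat kernel on the circle `ℝ / 2πℤ`. -/
def heat (t : ℝ) (x : AddCircle (2 * π)) : ℝ :=
  (2 * π)⁻¹ * (∑' n : ℤ, ((Real.exp (-(t * (n : ℝ) ^ 2)) : ℝ) : ℂ) * fourier n x).re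

theorem summable_heat {t : ℝ} (ht : 0 < t) (x : AddCircle (2 * π)) :
    Summable fun n : ℤ => ((Real.exp (-(t * (n : ℝ) ^ 2)) : ℝ) : ℂ) * fourier n x := by
  refine Summable.of_norm_bounded (summable_exp_neg_sq ht) fun n => ?_
  rw [norm_mul, Complex.norm_real, fourier_apply, Circle.norm_coe, mul_one,
    Real.norm_of_nonneg (Real.exp_pos _).le]

/-- Poisson summation. The Fourier series gives the algebra of the kernel, while this sum over
periodic images gives its reality, positivity and pointwise bounds. -/
theorem tsum_heat {t : ℝ} (ht : 0 < t) (y : ℝ) :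
    ∑' n : ℤ, ((Real.exp (-(t * (n : ℝ) ^ 2)) : ℝ) : ℂ) * fourier n (y : AddCircle (2 * π)) =
      ((√(π / t) * ∑' n : ℤ, Real.exp (-((2 * π * n - y) ^ 2 / (4 * t))) : ℝ) : ℂ) := by
  have hp : (π : ℂ) ≠ 0 := by exact_mod_cast Real.pi_ne_zero
  have htc : (t : ℂ) ≠ 0 := by exact_mod_cast ht.ne'
  have h := Complex.tsum_exp_neg_quadratic (a := ((t / π : ℝ) : ℂ))
    (by rw [Complex.ofReal_re]; exact div_pos ht Real.pi_pos) (Complex.I * y / (2 * π))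
  have e1 : (fun n : ℤ => ((Real.exp (-(t * (n : ℝ) ^ 2)) : ℝ) : ℂ) *
      fourier n (y : AddCircle (2 * π))) = fun n : ℤ => Complex.exp (-π * ((t / π : ℝ) : ℂ) * n ^ 2 +
        2 * π * (Complex.I * y / (2 * π)) * n) := by
    funext n
    rw [fourier_coe_apply, Complex.ofReal_exp, ← Complex.exp_add]
    congr 1
    push_cast
    field_simp
  rw [e1, h, Complex.ofReal_mul, Complex.ofReal_tsum]
  congr 1
  · rw [show (1 / 2 : ℂ) = ((1 / 2 : ℝ) : ℂ) by push_cast; rfl,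
      ← Complex.ofReal_cpow (div_pos ht Real.pi_pos).le, ← Real.sqrt_eq_rpow,
      ← Complex.ofReal_one, ← Complex.ofReal_div, one_div, ← Real.sqrt_inv, inv_div]
  · congr 1
    funext n
    rw [Complex.ofReal_exp]
    congr 1
    push_cast
    have hI : Complex.I * (Complex.I * (y : ℂ) / (2 * π)) = -(y / (2 * π)) := by
      rw [← mul_div_assoc, ← mul_assoc, Complex.I_mul_I]
      ring
    rw [hI]
    field_simp
    ring

theorem hasSum_heat {t : ℝ} (ht : 0 < t) (x : AddCircle (2 * π)) :
    HasSum (fun n : ℤ => ((Real.exp (-(t * (n : ℝ) ^ 2)) : ℝ) : ℂ) * fourier n x)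
      ((2 * π * heat t x : ℝ) : ℂ) := by
  have h := (summable_heat ht x).hasSum
  have e1 : ((2 * π * heat t x : ℝ) : ℂ) =
      ∑' n : ℤ, ((Real.exp (-(t * (n : ℝ) ^ 2)) : ℝ) : ℂ) * fourier n x := by
    rw [heat, ← mul_assoc, mul_inv_cancel₀ (by positivity), one_mul]
    induction x using QuotientAddGroup.induction_on with | _ y
    change ((Complex.re (∑' n : ℤ, ((Real.exp (-(t * (n : ℝ) ^ 2)) : ℝ) : ℂ) *
      fourier n (y : AddCircle (2 * π))) : ℝ) : ℂ) = ∑' n : ℤ,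
      ((Real.exp (-(t * (n : ℝ) ^ 2)) : ℝ) : ℂ) * fourier n (y : AddCircle (2 * π))
    rw [tsum_heat ht, Complex.ofReal_re]
  rw [e1]
  exact h

theorem heat_coe {t : ℝ} (ht : 0 < t) (y : ℝ) : heat t (y : AddCircle (2 * π)) =
    (√(4 * π * t))⁻¹ * ∑' n : ℤ, Real.exp (-((2 * π * n - y) ^ 2 / (4 * t))) := by
  rw [heat, tsum_heat ht, Complex.ofReal_re, ← mul_assoc]
  congr 1
  have hp := Real.pi_pos
  have h1 : (2 * π)⁻¹ = √((2 * π)⁻¹ ^ 2) := (Real.sqrt_sq (by positivity)).symm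
  rw [h1, ← Real.sqrt_mul (by positivity), ← Real.sqrt_inv]
  congr 1
  field_simp
  ring

theorem heat_nonneg {t : ℝ} (ht : 0 < t) (x : AddCircle (2 * π)) : 0 ≤ heat t x := by
  induction x using QuotientAddGroup.induction_on with | _ y
  have := heat_coe ht y
  refine le_of_le_of_eq ?_ this.symm
  exact mul_nonneg (by positivity) (tsum_nonneg fun _ => (Real.exp_pos _).le)

theorem exists_coe_eq_norm (x : AddCircle (2 * π)) :
    ∃ y : ℝ, (y : AddCircle (2 * π)) = x ∧ |y| ≤ π ∧ ‖x‖ = |y| := by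
  set y := AddCircle.equivIoc (2 * π) (-π) x with hy
  have h1 : ((y : ℝ) : AddCircle (2 * π)) = x := AddCircle.coe_equivIoc
  have h2 : |(y : ℝ)| ≤ π := by
    rw [abs_le]
    have := y.2
    exact ⟨this.1.le, by linarith [this.2]⟩
  refine ⟨y, h1, h2, ?_⟩
  rw [← h1]
  refine (AddCircle.norm_coe_eq_abs_iff _ Real.two_pi_pos.ne').2 ?_
  rw [abs_of_pos Real.two_pi_pos]
  linarith

theorem norm_circle_le (x : AddCircle (2 * π)) : ‖x‖ ≤ π := by
  obtain ⟨y, -, h, h'⟩ := exists_coe_eq_norm x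
  rwa [h']

/-- The image n = 0 contributes the Gaussian at distance ‖x‖. As |y| ≤ π, the others lie at distance
at least π|n|; exp(-u) ≤ 1/u sums them to O(t), hence to O(√t) after the prefactor. -/
theorem exists_heat_le : ∃ C : ℝ, 0 ≤ C ∧ ∀ (t : ℝ) (_ : 0 < t) (x : AddCircle (2 * π)),
    heat t x ≤ (√(4 * π * t))⁻¹ * Real.exp (-(‖x‖ ^ 2 / (4 * t))) + C * √t := by
  have hs : Summable fun n : ℤ => if n = 0 then 0 else ((n : ℝ) ^ 2)⁻¹ := by
    refine Summable.of_nonneg_of_le (fun n => by positivity) (fun n => ?_) (summable_int.mul_left 2)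
    split_ifs with h
    · positivity
    · have : (1 : ℝ) ≤ (n : ℝ) ^ 2 := by
        have : 1 ≤ n ^ 2 := by have := sq_pos_of_ne_zero h; omega
        exact_mod_cast this
      rw [← div_eq_mul_inv, le_div_iff₀ (by positivity), inv_mul_le_iff₀ (by positivity)]
      linarith
  refine ⟨∑' n : ℤ, if n = 0 then 0 else ((n : ℝ) ^ 2)⁻¹,
    tsum_nonneg fun n => by positivity, fun t ht x => ?_⟩
  obtain ⟨y, rfl, hy, hn⟩ := exists_coe_eq_norm x
  rw [heat_coe ht, hn, sq_abs]
  have hp := Real.pi_pos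
  have hb : ∀ n : ℤ, Real.exp (-((2 * π * n - y) ^ 2 / (4 * t))) ≤
      (if n = 0 then Real.exp (-(y ^ 2 / (4 * t))) else 0) +
        (4 * t / π ^ 2) * (if n = 0 then 0 else ((n : ℝ) ^ 2)⁻¹) := by
    intro n
    split_ifs with h
    · subst h; simp
    · rw [zero_add]
      have h1 : (1 : ℝ) ≤ |(n : ℝ)| := by
        have := Int.one_le_abs h
        exact_mod_cast this
      have h2 : π * |(n : ℝ)| ≤ |2 * π * n - y| := by
        have h3 := abs_sub_abs_le_abs_sub (2 * π * n) y
        rw [abs_mul, abs_of_pos (by positivity : 0 < 2 * π)] at h3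
        nlinarith
      have h3 : π ^ 2 * (n : ℝ) ^ 2 ≤ (2 * π * n - y) ^ 2 := by
        rw [← sq_abs (2 * π * n - y), ← sq_abs (n : ℝ), ← mul_pow]
        gcongr
      have h4 : 0 < (n : ℝ) ^ 2 := by
        rw [← sq_abs]; positivity
      calc Real.exp (-((2 * π * n - y) ^ 2 / (4 * t))) ≤
          Real.exp (-(π ^ 2 * (n : ℝ) ^ 2 / (4 * t))) := by gcongr
        _ ≤ (π ^ 2 * (n : ℝ) ^ 2 / (4 * t))⁻¹ := exp_neg_le_inv (by positivity)
        _ = _ := by field_simp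
  have hsum := (hasSum_ite_eq (0 : ℤ) (Real.exp (-(y ^ 2 / (4 * t))))).add
    (hs.hasSum.mul_left (4 * t / π ^ 2))
  have hle := tsum_le_of_sum_le' (L := SummationFilter.unconditional ℤ) (f := fun n : ℤ => Real.exp (-((2 * π * n - y) ^ 2 / (4 * t))))
    (a₂ := Real.exp (-(y ^ 2 / (4 * t))) + (4 * t / π ^ 2) *
      ∑' n : ℤ, if n = 0 then 0 else ((n : ℝ) ^ 2)⁻¹) (by positivity) (fun s => by
        refine (Finset.sum_le_sum fun n _ => hb n).trans ?_
        refine sum_le_hasSum s (fun n _ => ?_) hsum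
        split_ifs <;> positivity)
  set S := ∑' n : ℤ, if n = 0 then 0 else ((n : ℝ) ^ 2)⁻¹ with hS
  have hS0 : 0 ≤ S := tsum_nonneg fun n => by positivity
  have hq : (√(4 * π * t))⁻¹ * (4 * t / π ^ 2) ≤ √t := by
    have h1 : √(4 * π * t) = √(4 * π) * √t := Real.sqrt_mul (by positivity) _
    have h2 : 1 ≤ √(4 * π) := Real.one_le_sqrt.2 (by linarith [Real.pi_gt_three])
    have h3 : 4 / π ^ 2 ≤ 1 := by
      rw [div_le_one (by positivity)]
      nlinarith [Real.pi_gt_three]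
    have h4 : 0 < √t := Real.sqrt_pos.2 ht
    rw [inv_mul_le_iff₀ (by positivity), h1, mul_assoc, Real.mul_self_sqrt ht.le]
    calc 4 * t / π ^ 2 = 4 / π ^ 2 * t := by ring
      _ ≤ 1 * t := by gcongr
      _ ≤ √(4 * π) * t := by gcongr
  calc _ ≤ (√(4 * π * t))⁻¹ * (Real.exp (-(y ^ 2 / (4 * t))) + (4 * t / π ^ 2) * S) := by gcongr
    _ = (√(4 * π * t))⁻¹ * Real.exp (-(y ^ 2 / (4 * t))) +
        ((√(4 * π * t))⁻¹ * (4 * t / π ^ 2)) * S := by ring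
    _ ≤ (√(4 * π * t))⁻¹ * Real.exp (-(y ^ 2 / (4 * t))) + √t * S := by gcongr
    _ = _ := by ring

theorem integrable_norm_rpow_circle {s : ℝ} (hs : s < 1) :
    Integrable (fun x : AddCircle (2 * π) => ‖x‖ ^ (-s)) := by
  have hmp := AddCircle.measurePreserving_mk (2 * π) (-π)
  have hm : Measurable fun x : AddCircle (2 * π) => ‖x‖ ^ (-s) :=
    (continuous_norm.measurable).pow_const _
  rw [← hmp.integrable_comp hm.aestronglyMeasurable]
  have hII : IntervalIntegrable (fun y : ℝ => |y| ^ (-s)) volume (-π) π := by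
    have h1 : IntervalIntegrable (fun y : ℝ => |y| ^ (-s)) volume 0 π := by
      refine (intervalIntegral.intervalIntegrable_rpow' (r := -s) (by linarith)).congr ?_
      intro y hy
      rw [Set.uIoc_of_le Real.pi_pos.le] at hy
      simp only [abs_of_pos hy.1]
    have h2 : IntervalIntegrable (fun y : ℝ => |y| ^ (-s)) volume (-π) 0 := by
      have := (IntervalIntegrable.iff_comp_neg (by simp)).1 h1
      simp only [abs_neg, neg_zero] at this
      exact this.symm
    exact h2.trans h1
  have h3 := (intervalIntegrable_iff_integrableOn_Ioc_of_le (by linarith [Real.pi_pos])).1 hII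
  have h4 : -π + 2 * π = π := by ring
  rw [h4]
  refine (integrableOn_congr_fun (fun y hy => ?_) measurableSet_Ioc).1 h3
  have : ‖(y : AddCircle (2 * π))‖ = |y| := by
    refine (AddCircle.norm_coe_eq_abs_iff _ Real.two_pi_pos.ne').2 ?_
    rw [abs_of_pos Real.two_pi_pos, abs_le]
    constructor <;> linarith [hy.1, hy.2]
  simp only [Function.comp_apply, this]

theorem ae_norm_circle_pos : ∀ᵐ x : AddCircle (2 * π), 0 < ‖x‖ := by
  have hmp := AddCircle.measurePreserving_mk (2 * π) (-π)
  rw [← hmp.map_eq, ae_map_iff hmp.measurable.aemeasurable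
    (measurableSet_lt measurable_const continuous_norm.measurable)]
  have h0 : ∀ᵐ y : ℝ, y ≠ 0 := by simp [ae_iff]
  filter_upwards [ae_restrict_of_ae h0, ae_restrict_mem measurableSet_Ioc] with y hy hy'
  have : ‖(y : AddCircle (2 * π))‖ = |y| := by
    refine (AddCircle.norm_coe_eq_abs_iff _ Real.two_pi_pos.ne').2 ?_
    rw [abs_of_pos Real.two_pi_pos, abs_le]
    constructor <;> linarith [hy'.1, hy'.2]
  rw [this]
  exact abs_pos.2 hy

end Torus

end

noncomputable section

namespace Torus

/-! ### The regularized Green function -/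

/-- The regularized covariance `e^{-ελ} / (4π² λ)`. -/
def covReg (ε : ℝ) (k : ℤ × ℤ) : ℝ := Real.exp (-(ε * lam k)) * (4 * π ^ 2 * lam k)⁻¹

theorem covReg_pos (ε : ℝ) (k : ℤ × ℤ) : 0 < covReg ε k := by
  have := lam_pos k
  unfold covReg
  positivity

theorem summable_covReg {ε : ℝ} (hε : 0 < ε) : Summable (covReg ε) := by
  refine Summable.of_nonneg_of_le (fun k => (covReg_pos ε k).le) (fun k => ?_)
    (summable_inv_lam_sq.mul_left ε⁻¹)
  have hl := lam_pos k
  have hp := Real.pi_gt_three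
  calc covReg ε k ≤ (ε * lam k)⁻¹ * (lam k)⁻¹ := by
        unfold covReg
        gcongr
        · exact exp_neg_le_inv (by positivity)
        · exact le_mul_of_one_le_left hl.le (by nlinarith)
    _ = _ := by field_simp

/-- The function `∑ c_k exp(i k·x)`. -/
def trigSeries (c : ℤ × ℤ → ℝ) : C(T2, ℂ) := ∑' k, (c k : ℂ) • char k

theorem norm_char_le (k : ℤ × ℤ) : ‖char k‖ ≤ 1 :=
  (ContinuousMap.norm_le _ zero_le_one).2 fun x => (norm_char k x).le

theorem hasSum_trigSeries {c : ℤ × ℤ → ℝ} (hc : Summable c) :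
    HasSum (fun k => (c k : ℂ) • char k) (trigSeries c) := by
  refine Summable.hasSum (Summable.of_norm_bounded hc.abs fun k => ?_)
  rw [norm_smul, Complex.norm_real, Real.norm_eq_abs]
  exact mul_le_of_le_one_right (abs_nonneg _) (norm_char_le k)

theorem hasSum_trigSeries_apply {c : ℤ × ℤ → ℝ} (hc : Summable c) (x : T2) :
    HasSum (fun k => (c k : ℂ) * char k x) (trigSeries c x) :=
  (ContinuousMap.evalCLM ℂ x).hasSum (hasSum_trigSeries hc)

theorem hasSum_const_mul_mul {f g : ℤ → ℂ} {a b : ℂ} (hf : HasSum f a) (hg : HasSum g b)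
    (hf' : Summable fun n => ‖f n‖) (hg' : Summable fun n => ‖g n‖) (c : ℂ) :
    HasSum (fun k : ℤ × ℤ => c * (f k.1 * g k.2)) (c * (a * b)) :=
  (hf.mul hg (summable_mul_of_summable_norm hf' hg')).mul_left c

/-- `exp(-t(1 + |k|²))` are the Fourier coefficients of `4π² e^{-t} p_t`. -/
theorem hasSum_heat_mul_heat {t : ℝ} (ht : 0 < t) (x : T2) :
    HasSum (fun k : ℤ × ℤ => ((Real.exp (-(t * lam k)) * (4 * π ^ 2)⁻¹ : ℝ) : ℂ) * char k x)
      ((Real.exp (-t) * (heat t x.1 * heat t x.2) : ℝ) : ℂ) := by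
  have h := hasSum_const_mul_mul (hasSum_heat ht x.1) (hasSum_heat ht x.2)
    (summable_heat ht x.1).norm (summable_heat ht x.2).norm ((Real.exp (-t) * (4 * π ^ 2)⁻¹ : ℝ) : ℂ)
  have e1 : ((Real.exp (-t) * (heat t x.1 * heat t x.2) : ℝ) : ℂ) =
      ((Real.exp (-t) * (4 * π ^ 2)⁻¹ : ℝ) : ℂ) *
        (((2 * π * heat t x.1 : ℝ) : ℂ) * ((2 * π * heat t x.2 : ℝ) : ℂ)) := by
    rw [← Complex.ofReal_mul, ← Complex.ofReal_mul]
    congr 1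
    have := Real.pi_ne_zero
    field_simp
    ring
  have e2 : (fun k : ℤ × ℤ => ((Real.exp (-(t * lam k)) * (4 * π ^ 2)⁻¹ : ℝ) : ℂ) * char k x) =
      fun k : ℤ × ℤ => ((Real.exp (-t) * (4 * π ^ 2)⁻¹ : ℝ) : ℂ) *
        (((Real.exp (-(t * (k.1 : ℝ) ^ 2)) : ℝ) : ℂ) * fourier k.1 x.1 *
          (((Real.exp (-(t * (k.2 : ℝ) ^ 2)) : ℝ) : ℂ) * fourier k.2 x.2)) := by
    funext k
    have : Real.exp (-(t * lam k)) = Real.exp (-t) * Real.exp (-(t * (k.1 : ℝ) ^ 2)) *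
        Real.exp (-(t * (k.2 : ℝ) ^ 2)) := by
      rw [← Real.exp_add, ← Real.exp_add]
      congr 1
      unfold lam
      ring
    rw [this, char_apply]
    push_cast
    ring
  rw [e1, e2]
  exact h

theorem integral_exp_neg_mul_lam (ε : ℝ) (k : ℤ × ℤ) :
    ∫ t in Set.Ioi ε, Real.exp (-(t * lam k)) * (4 * π ^ 2)⁻¹ = covReg ε k := by
  have h := integral_exp_mul_Ioi (a := -lam k) (by linarith [lam_pos k]) ε
  have e1 : (fun t => Real.exp (-(t * lam k)) * (4 * π ^ 2)⁻¹) =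
      fun t => Real.exp (-lam k * t) * (4 * π ^ 2)⁻¹ := by
    funext t; congr 2; ring
  rw [e1, integral_mul_const, h, covReg, neg_div_neg_eq, mul_inv, neg_mul, mul_comm (lam k)]
  ring

theorem integrableOn_exp_neg_mul_lam (ε : ℝ) (k : ℤ × ℤ) :
    IntegrableOn (fun t => Real.exp (-(t * lam k)) * (4 * π ^ 2)⁻¹) (Set.Ioi ε) := by
  have h := integrableOn_exp_mul_Ioi (a := -lam k) (by linarith [lam_pos k]) ε
  have e1 : (fun t => Real.exp (-(t * lam k)) * (4 * π ^ 2)⁻¹) =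
      fun t => Real.exp (-lam k * t) * (4 * π ^ 2)⁻¹ := by
    funext t; congr 2; ring
  rw [e1]
  exact h.mul_const _

/-- From exp(-ελ)/λ = ∫_ε^∞ exp(-tλ) dt, the regularized Green function is a time integral of heat
kernels; in particular it is real and nonnegative. -/
theorem trigSeries_covReg {ε : ℝ} (hε : 0 < ε) (x : T2) :
    trigSeries (covReg ε) x =
      ((∫ t in Set.Ioi ε, Real.exp (-t) * (heat t x.1 * heat t x.2) : ℝ) : ℂ) := by
  have h1 := hasSum_integral_of_summable_integral_norm (μ := volume.restrict (Set.Ioi ε))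
    (F := fun (k : ℤ × ℤ) (t : ℝ) =>
      ((Real.exp (-(t * lam k)) * (4 * π ^ 2)⁻¹ : ℝ) : ℂ) * char k x)
    (fun k => (integrableOn_exp_neg_mul_lam ε k).ofReal.mul_const _) (by
      refine (summable_covReg hε).congr fun k => ?_
      rw [← integral_exp_neg_mul_lam ε k]
      refine integral_congr_ae (Eventually.of_forall fun t => ?_)
      simp only
      rw [norm_mul, norm_char, mul_one, Complex.norm_real,
        Real.norm_of_nonneg (by positivity)])
  have e1 : (fun k : ℤ × ℤ => ∫ t in Set.Ioi ε,
      ((Real.exp (-(t * lam k)) * (4 * π ^ 2)⁻¹ : ℝ) : ℂ) * char k x) =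
      fun k => (covReg ε k : ℂ) * char k x := by
    funext k
    rw [integral_mul_const, integral_complex_ofReal, integral_exp_neg_mul_lam]
  rw [e1] at h1
  rw [(hasSum_trigSeries_apply (summable_covReg hε) x).unique h1, ← integral_complex_ofReal]
  refine setIntegral_congr_fun measurableSet_Ioi fun t ht => ?_
  exact (hasSum_heat_mul_heat (hε.trans ht) x).tsum_eq

/-- The two Gaussian factors are merged through ‖x₁‖² + ‖x₂‖² ≥ 2‖x₁‖‖x₂‖. A bound in terms of the
product lets the singularity split later into one-dimensional ones, without changing the leading
constant. -/
theorem heat_mul_heat_le : ∃ C : ℝ, 0 ≤ C ∧ ∀ (t : ℝ) (_ : 0 < t) (x : T2),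
    heat t x.1 * heat t x.2 ≤
      (4 * π)⁻¹ * (t⁻¹ * Real.exp (-(‖x.1‖ * ‖x.2‖ / (2 * t)))) + C * (1 + t) := by
  obtain ⟨C, hC, h⟩ := exists_heat_le
  refine ⟨2 * C + C ^ 2, by positivity, fun t ht x => ?_⟩
  have hp := Real.pi_gt_three
  have h4 : 0 < √(4 * π * t) := Real.sqrt_pos.2 (by positivity)
  have ht' : √t ≤ √(4 * π * t) := Real.sqrt_le_sqrt (by nlinarith)
  have h5 : (√(4 * π * t))⁻¹ * √t ≤ 1 := by
    rw [inv_mul_le_iff₀ h4, mul_one]; exact ht'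
  have h6 : (√(4 * π * t))⁻¹ * (√(4 * π * t))⁻¹ = (4 * π)⁻¹ * t⁻¹ := by
    rw [← mul_inv, Real.mul_self_sqrt (by positivity), mul_inv]
  have h7 : √t * √t = t := Real.mul_self_sqrt ht.le
  set r := (√(4 * π * t))⁻¹ with hr
  have hr0 : 0 ≤ r := by positivity
  have hE : Real.exp (-(‖x.1‖ ^ 2 / (4 * t))) * Real.exp (-(‖x.2‖ ^ 2 / (4 * t))) ≤
      Real.exp (-(‖x.1‖ * ‖x.2‖ / (2 * t))) := by
    rw [← Real.exp_add]
    refine Real.exp_le_exp.2 ?_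
    rw [← neg_add, neg_le_neg_iff, ← add_div, div_le_div_iff₀ (by positivity) (by positivity)]
    nlinarith [sq_nonneg (‖x.1‖ - ‖x.2‖)]
  have hE1 : Real.exp (-(‖x.1‖ ^ 2 / (4 * t))) ≤ 1 :=
    Real.exp_le_one_iff.2 (by rw [neg_nonpos]; positivity)
  have hE2 : Real.exp (-(‖x.2‖ ^ 2 / (4 * t))) ≤ 1 :=
    Real.exp_le_one_iff.2 (by rw [neg_nonpos]; positivity)
  have hE1' := Real.exp_pos (-(‖x.1‖ ^ 2 / (4 * t)))
  have hE2' := Real.exp_pos (-(‖x.2‖ ^ 2 / (4 * t)))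
  set E1 := Real.exp (-(‖x.1‖ ^ 2 / (4 * t)))
  set E2 := Real.exp (-(‖x.2‖ ^ 2 / (4 * t)))
  have hs0 : 0 ≤ √t := Real.sqrt_nonneg t
  calc heat t x.1 * heat t x.2 ≤ (r * E1 + C * √t) * (r * E2 + C * √t) := by
        gcongr
        · exact heat_nonneg ht _
        · exact h t ht _
        · exact h t ht _
    _ = (r * r) * (E1 * E2) + C * (r * √t) * (E1 + E2) + C ^ 2 * (√t * √t) := by ring
    _ ≤ (r * r) * Real.exp (-(‖x.1‖ * ‖x.2‖ / (2 * t))) + C * 1 * (1 + 1) + C ^ 2 * (√t * √t) := by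
        gcongr
    _ ≤ _ := by
        rw [h6, h7]
        nlinarith [mul_nonneg hC ht.le, sq_nonneg C]

/-- With ρ = ‖x₁‖‖x₂‖ ≤ π², the logarithm is the integral of dt/t over ρ ≤ t ≤ π². Times t ≤ ρ
contribute a constant, since there t⁻¹exp(-ρ/2t) ≤ 2/ρ, and large times are controlled by exp(-t).
The exact constant 1/(4π), uniform in ε, fixes the thresholds of the corollary. -/
theorem integral_heat_le : ∃ K : ℝ, ∀ (ε : ℝ) (_ : 0 < ε) (x : T2), 0 < ‖x.1‖ → 0 < ‖x.2‖ →
    ∫ t in Set.Ioi ε, Real.exp (-t) * (heat t x.1 * heat t x.2) ≤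
      (4 * π)⁻¹ * Real.log (π ^ 2 / (‖x.1‖ * ‖x.2‖)) + K := by
  obtain ⟨C, hC, h⟩ := heat_mul_heat_le
  have i1 : IntegrableOn (fun t : ℝ => Real.exp (-t)) (Set.Ioi 0) := by
    simpa using exp_neg_integrableOn_Ioi 0 one_pos
  have i2 : IntegrableOn (fun t : ℝ => Real.exp (-t) * t) (Set.Ioi 0) := by
    have := Real.GammaIntegral_convergent (s := 2) (by norm_num)
    norm_num at this
    exact this
  have i3 : IntegrableOn (fun t : ℝ => (4 * π)⁻¹ * Real.exp (-t) +
      C * (Real.exp (-t) + Real.exp (-t) * t)) (Set.Ioi 0) :=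
    (i1.const_mul _).add ((i1.add i2).const_mul C)
  refine ⟨(4 * π)⁻¹ * 2 + ∫ t in Set.Ioi (0 : ℝ), ((4 * π)⁻¹ * Real.exp (-t) +
      C * (Real.exp (-t) + Real.exp (-t) * t)), fun ε hε x hx1 hx2 => ?_⟩
  set ρ := ‖x.1‖ * ‖x.2‖ with hρ
  have hρ0 : 0 < ρ := by positivity
  have hp := Real.pi_gt_three
  have hρπ : ρ ≤ π ^ 2 := by
    rw [hρ, sq]
    exact mul_le_mul (norm_circle_le _) (norm_circle_le _) (norm_nonneg _) (by positivity)
  have j1 : IntegrableOn ((Set.Ioc 0 ρ).indicator fun _ : ℝ => 2 / ρ) (Set.Ioi 0) :=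
    ((integrableOn_const (by simp)).integrable_indicator measurableSet_Ioc).integrableOn
  have k2 : IntervalIntegrable (fun t : ℝ => t⁻¹) volume ρ (π ^ 2) :=
    intervalIntegral.intervalIntegrable_inv (fun t ht => by
      rw [Set.uIcc_of_le hρπ] at ht
      exact (hρ0.trans_le ht.1).ne') continuousOn_id
  have j2 : IntegrableOn ((Set.Ioc ρ (π ^ 2)).indicator fun t : ℝ => t⁻¹) (Set.Ioi 0) :=
    (((intervalIntegrable_iff_integrableOn_Ioc_of_le hρπ).1 k2).integrable_indicator
      measurableSet_Ioc).integrableOn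
  set g : ℝ → ℝ := fun t => (4 * π)⁻¹ * ((Set.Ioc 0 ρ).indicator (fun _ : ℝ => 2 / ρ) t +
    (Set.Ioc ρ (π ^ 2)).indicator (fun t : ℝ => t⁻¹) t) + ((4 * π)⁻¹ * Real.exp (-t) +
      C * (Real.exp (-t) + Real.exp (-t) * t)) with hg
  have hgi : IntegrableOn g (Set.Ioi 0) := ((j1.add j2).const_mul _).add i3
  have hg0 : ∀ t ∈ Set.Ioi (0 : ℝ), 0 ≤ g t := by
    intro t ht
    have ht' : 0 < t := ht
    have a1 : 0 ≤ (Set.Ioc 0 ρ).indicator (fun _ : ℝ => 2 / ρ) t :=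
      Set.indicator_nonneg (fun _ _ => by positivity) _
    have a2 : 0 ≤ (Set.Ioc ρ (π ^ 2)).indicator (fun t : ℝ => t⁻¹) t :=
      Set.indicator_nonneg (fun s hs => inv_nonneg.2 (hρ0.trans hs.1).le) _
    rw [hg]
    positivity
  have hle : ∀ t ∈ Set.Ioi (0 : ℝ), Real.exp (-t) * (heat t x.1 * heat t x.2) ≤ g t := by
    intro t ht
    have ht' : 0 < t := ht
    have hexp := Real.exp_pos (-t)
    have hexp1 : Real.exp (-t) ≤ 1 := Real.exp_le_one_iff.2 (by linarith)
    have key : Real.exp (-t) * (t⁻¹ * Real.exp (-(ρ / (2 * t)))) ≤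
        (Set.Ioc 0 ρ).indicator (fun _ : ℝ => 2 / ρ) t +
        (Set.Ioc ρ (π ^ 2)).indicator (fun t : ℝ => t⁻¹) t + Real.exp (-t) := by
      have he : Real.exp (-(ρ / (2 * t))) ≤ 1 :=
        Real.exp_le_one_iff.2 (by rw [neg_nonpos]; positivity)
      by_cases c1 : t ≤ ρ
      · rw [Set.indicator_of_mem (show t ∈ Set.Ioc 0 ρ from ⟨ht', c1⟩),
          Set.indicator_of_notMem (fun h => absurd h.1 (not_lt.2 c1))]
        have : t⁻¹ * Real.exp (-(ρ / (2 * t))) ≤ 2 / ρ := by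
          calc t⁻¹ * Real.exp (-(ρ / (2 * t))) ≤ t⁻¹ * (ρ / (2 * t))⁻¹ := by
                gcongr; exact exp_neg_le_inv (by positivity)
            _ = 2 / ρ := by field_simp
        have h2 : 0 ≤ t⁻¹ * Real.exp (-(ρ / (2 * t))) := by positivity
        nlinarith
      · rw [Set.indicator_of_notMem (fun h => c1 h.2)]
        by_cases c2 : t ≤ π ^ 2
        · rw [Set.indicator_of_mem (show t ∈ Set.Ioc ρ (π ^ 2) from ⟨not_le.1 c1, c2⟩)]
          have : t⁻¹ * Real.exp (-(ρ / (2 * t))) ≤ t⁻¹ :=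
            mul_le_of_le_one_right (by positivity) he
          have h2 : 0 ≤ t⁻¹ * Real.exp (-(ρ / (2 * t))) := by positivity
          nlinarith
        · rw [Set.indicator_of_notMem (fun h => c2 h.2)]
          have h3 : t⁻¹ ≤ 1 := inv_le_one_of_one_le₀ (by nlinarith [not_le.1 c2])
          have h4 : t⁻¹ * Real.exp (-(ρ / (2 * t))) ≤ 1 :=
            mul_le_one₀ h3 (Real.exp_pos _).le he
          nlinarith
    calc Real.exp (-t) * (heat t x.1 * heat t x.2) ≤
        Real.exp (-t) * ((4 * π)⁻¹ * (t⁻¹ * Real.exp (-(ρ / (2 * t)))) + C * (1 + t)) := by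
          gcongr; exact h t ht' x
      _ = (4 * π)⁻¹ * (Real.exp (-t) * (t⁻¹ * Real.exp (-(ρ / (2 * t))))) +
          C * (Real.exp (-t) + Real.exp (-t) * t) := by ring
      _ ≤ (4 * π)⁻¹ * ((Set.Ioc 0 ρ).indicator (fun _ : ℝ => 2 / ρ) t +
        (Set.Ioc ρ (π ^ 2)).indicator (fun t : ℝ => t⁻¹) t + Real.exp (-t)) +
          C * (Real.exp (-t) + Real.exp (-t) * t) := by gcongr
      _ = g t := by rw [hg]; ring
  have hsub : Set.Ioi ε ⊆ Set.Ioi 0 := Set.Ioi_subset_Ioi hε.le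
  have hI1 : ∫ t in Set.Ioi (0 : ℝ), (Set.Ioc 0 ρ).indicator (fun _ : ℝ => 2 / ρ) t = 2 := by
    rw [setIntegral_indicator measurableSet_Ioc,
      Set.inter_eq_right.2 Set.Ioc_subset_Ioi_self, setIntegral_const]
    simp [hρ0.le]
    field_simp
  have hI2 : ∫ t in Set.Ioi (0 : ℝ), (Set.Ioc ρ (π ^ 2)).indicator (fun t : ℝ => t⁻¹) t =
      Real.log (π ^ 2 / ρ) := by
    rw [setIntegral_indicator measurableSet_Ioc,
      Set.inter_eq_right.2 (show Set.Ioc ρ (π ^ 2) ⊆ Set.Ioi 0 from fun t ht => hρ0.trans ht.1), ← intervalIntegral.integral_of_le hρπ,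
      integral_inv_of_pos hρ0 (by positivity)]
  calc ∫ t in Set.Ioi ε, Real.exp (-t) * (heat t x.1 * heat t x.2) ≤ ∫ t in Set.Ioi ε, g t := by
        refine integral_mono_of_nonneg ?_ (hgi.mono_set hsub) ?_
        · filter_upwards [ae_restrict_mem measurableSet_Ioi] with t ht
          have ht' : 0 < t := hε.trans ht
          have := heat_nonneg ht' x.1
          have := heat_nonneg ht' x.2
          simp only [Pi.zero_apply]
          positivity
        · filter_upwards [ae_restrict_mem measurableSet_Ioi] with t ht
          exact hle t (hsub ht)
    _ ≤ ∫ t in Set.Ioi (0 : ℝ), g t := by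
        refine setIntegral_mono_set hgi ?_ (Eventually.of_forall hsub)
        filter_upwards [ae_restrict_mem measurableSet_Ioi] with t ht
        exact hg0 t ht
    _ = (4 * π)⁻¹ * (2 + Real.log (π ^ 2 / ρ)) + ∫ t in Set.Ioi (0 : ℝ), ((4 * π)⁻¹ *
        Real.exp (-t) + C * (Real.exp (-t) + Real.exp (-t) * t)) := by
        have a1 := integral_add ((j1.add j2).const_mul (4 * π)⁻¹) i3
        have a2 := integral_add j1 j2
        simp only [Pi.add_apply] at a1 a2
        rw [hI1, hI2] at a2
        rw [integral_const_mul, a2] at a1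
        exact a1
    _ = _ := by ring

end Torus

end

noncomputable section

namespace Torus

/-! ### Exponential bounds for convolution powers of the covariance -/

/-- The covariance `1 / (4π² λ)` of the free field. -/
def cov (k : ℤ × ℤ) : ℝ := (4 * π ^ 2 * lam k)⁻¹

theorem cov_pos (k : ℤ × ℤ) : 0 < cov k := by
  have := lam_pos k
  unfold cov
  positivity

/-- `∑ cov(k₁) ⋯ cov(kₙ) w(k₁ + ⋯ + kₙ)`, the sum over `k₁, …, kₙ ∈ S`. -/
def convSum (S : Finset (ℤ × ℤ)) (w : ℤ × ℤ → ℝ) (n : ℕ) : ℝ :=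
  ∑ f ∈ Fintype.piFinset fun _ : Fin n => S, (∏ i, cov (f i)) * w (∑ i, f i)

theorem convSum_mono_right (S : Finset (ℤ × ℤ)) {w w' : ℤ × ℤ → ℝ} (h : ∀ k, w k ≤ w' k) (n : ℕ) :
    convSum S w n ≤ convSum S w' n :=
  Finset.sum_le_sum fun _ _ => mul_le_mul_of_nonneg_left (h _)
    (Finset.prod_nonneg fun _ _ => (cov_pos _).le)

theorem convSum_nonneg (S : Finset (ℤ × ℤ)) {w : ℤ × ℤ → ℝ} (h : ∀ k, 0 ≤ w k) (n : ℕ) :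
    0 ≤ convSum S w n :=
  Finset.sum_nonneg fun _ _ => mul_nonneg (Finset.prod_nonneg fun _ _ => (cov_pos _).le) (h _)

theorem integrable_continuousMap {E : Type} [NormedAddCommGroup E] (f : C(T2, E)) :
    Integrable f (volume : Measure T2) :=
  f.continuous.integrable_of_hasCompactSupport (HasCompactSupport.of_compactSpace _)

/-- Integration against a continuous function. -/
def intCLM (Q : C(T2, ℂ)) : C(T2, ℂ) →L[ℂ] ℂ :=
  LinearMap.mkContinuous
    { toFun := fun F => ∫ x, (Q * F) x
      map_add' := fun F G => by
        rw [← integral_add (integrable_continuousMap _) (integrable_continuousMap _)]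
        congr 1; ext x
        rw [mul_add, ContinuousMap.add_apply]
      map_smul' := fun c F => by
        rw [RingHom.id_apply, smul_eq_mul, ← integral_const_mul]
        congr 1; ext x
        rw [mul_smul_comm, ContinuousMap.smul_apply, smul_eq_mul] }
    (‖Q‖ * (volume : Measure T2).real Set.univ) (fun F => by
      have h : ‖∫ x, (Q * F) x‖ ≤ ‖Q‖ * ‖F‖ * (volume : Measure T2).real Set.univ := by
        refine norm_integral_le_of_norm_le_const (Eventually.of_forall fun x => ?_)
        exact ((Q * F).norm_coe_le_norm x).trans (norm_mul_le _ _)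
      refine h.trans (le_of_eq ?_)
      ring)

theorem intCLM_apply (Q F : C(T2, ℂ)) : intCLM Q F = ∫ x, Q x * F x := rfl

theorem smul_char_prod {n : ℕ} (c : ℤ × ℤ → ℝ) (f : Fin n → ℤ × ℤ) :
    ∏ i, ((c (f i) : ℂ) • char (f i)) = ((∏ i, c (f i) : ℝ) : ℂ) • char (∑ i, f i) := by
  ext x
  rw [ContinuousMap.prod_apply, ContinuousMap.smul_apply, smul_eq_mul, char_sum,
    Complex.ofReal_prod, ← Finset.prod_mul_distrib]
  rfl

theorem intCLM_sum_pow (Q : C(T2, ℂ)) {q : ℤ × ℤ → ℝ} (hQ : ∀ k, ∫ x, Q x * char k x = q k)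
    (S : Finset (ℤ × ℤ)) (c : ℤ × ℤ → ℝ) (n : ℕ) :
    intCLM Q ((∑ k ∈ S, (c k : ℂ) • char k) ^ n) =
      ((∑ f ∈ Fintype.piFinset fun _ : Fin n => S, (∏ i, c (f i)) * q (∑ i, f i) : ℝ) : ℂ) := by
  rw [Finset.sum_pow', map_sum, Complex.ofReal_sum]
  refine Finset.sum_congr rfl fun f _ => ?_
  rw [smul_char_prod, map_smul, intCLM_apply, hQ, smul_eq_mul, ← Complex.ofReal_mul]

/-- Replacing the covariance by the regularized one. -/
theorem convSum_le_norm_intCLM (Q : C(T2, ℂ)) {q : ℤ × ℤ → ℝ} (hq : ∀ k, 0 ≤ q k)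
    (hQ : ∀ k, ∫ x, Q x * char k x = q k) (S : Finset (ℤ × ℤ)) {ε L : ℝ} (hε : 0 < ε)
    (hL : ∀ k ∈ S, lam k ≤ L) (n : ℕ) :
    convSum S q n ≤ Real.exp (ε * L) ^ n * ‖intCLM Q (trigSeries (covReg ε) ^ n)‖ := by
  -- On S the regularization costs at most a factor exp(εL) per covariance.
  have h1 : convSum S q n ≤ Real.exp (ε * L) ^ n *
      ∑ f ∈ Fintype.piFinset fun _ : Fin n => S, (∏ i, covReg ε (f i)) * q (∑ i, f i) := by
    rw [convSum, Finset.mul_sum]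
    refine Finset.sum_le_sum fun f hf => ?_
    rw [← mul_assoc]
    refine mul_le_mul_of_nonneg_right ?_ (hq _)
    have : Real.exp (ε * L) ^ n = ∏ _i : Fin n, Real.exp (ε * L) := by simp
    rw [this, ← Finset.prod_mul_distrib]
    refine Finset.prod_le_prod (fun i _ => (cov_pos _).le) fun i _ => ?_
    have hc := cov_pos (f i)
    have hk := hL _ (Fintype.mem_piFinset.1 hf i)
    rw [covReg, ← mul_assoc, ← Real.exp_add]
    refine le_mul_of_one_le_left hc.le (Real.one_le_exp ?_)
    nlinarith
  refine h1.trans (mul_le_mul_of_nonneg_left ?_ (by positivity))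
  -- All terms are nonnegative, so enlarging S only increases the sum; the limit over finite sets
  -- gives the full regularized Green function.
  have hlim := (((intCLM Q).continuous.comp (continuous_pow n)).tendsto _).comp
    (hasSum_trigSeries (summable_covReg hε))
  have hlim' := hlim.norm
  refine ge_of_tendsto hlim' ?_
  filter_upwards [eventually_ge_atTop S] with T hT
  simp only [Function.comp_apply]
  rw [intCLM_sum_pow Q hQ, Complex.norm_real]
  refine le_trans ?_ (le_abs_self _)
  refine Finset.sum_le_sum_of_subset_of_nonneg (Fintype.piFinset_subset _ _ fun _ => hT)
    fun f _ _ => mul_nonneg (Finset.prod_nonneg fun i _ => (covReg_pos _ _).le) (hq _)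

/-- The convolution sum is ∫ Q Gⁿ for the truncated kernel, so the exponential series is at most ∫
|Q| exp(b₁G). The logarithmic bound turns the exponential into a multiple of (‖x₁‖‖x₂‖)^{-b₁/4π},
integrable because b₁ < 4π. The constant does not depend on Q, so contributions of many functions Q
can be superposed. -/
theorem exists_exp_sum_convSum_le {b₁ : ℝ} (hb₁ : b₁ < 4 * π) (hb₁0 : 0 < b₁) :
    ∃ K : ℝ, 0 ≤ K ∧ ∀ (Q : C(T2, ℂ)) (q : ℤ × ℤ → ℝ) (_ : ∀ k, 0 ≤ q k)
      (_ : ∀ k, ∫ x, Q x * char k x = q k) (b : ℝ) (_ : 0 ≤ b) (_ : b < b₁)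
      (S : Finset (ℤ × ℤ)) (N : ℕ),
      ∑ n ∈ Finset.range N, b ^ n / n.factorial * convSum S q n ≤
        K * ∫ x : T2, ‖Q x‖ * (‖x.1‖ ^ (-(b₁ / (4 * π))) * ‖x.2‖ ^ (-(b₁ / (4 * π)))) := by
  obtain ⟨K, hK⟩ := integral_heat_le
  have hp := Real.pi_pos
  set β := b₁ / (4 * π) with hβ
  have hβ1 : β < 1 := by rw [hβ, div_lt_one (by positivity)]; exact hb₁
  have hβ0 : 0 < β := by positivity
  have hint1 := integrable_norm_rpow_circle hβ1
  have hint2 : Integrable (fun x : T2 => ‖x.1‖ ^ (-β) * ‖x.2‖ ^ (-β)) := hint1.mul_prod hint1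
  refine ⟨(π ^ 2) ^ β * Real.exp (b₁ * K), by positivity,
    fun Q q hq hQ b hb hbb S N => ?_⟩
  have hint3 : Integrable (fun x : T2 => ‖Q x‖ * (‖x.1‖ ^ (-β) * ‖x.2‖ ^ (-β))) :=
    hint2.bdd_mul (c := ‖Q‖) Q.continuous.norm.aestronglyMeasurable
      (Eventually.of_forall fun x => by rw [norm_norm]; exact Q.norm_coe_le_norm x)
  obtain ⟨L, hL⟩ : ∃ L, ∀ k ∈ S, lam k ≤ L :=
    ⟨∑ k ∈ S, lam k, fun k hk => Finset.single_le_sum (fun k _ => (lam_pos k).le) hk⟩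
  -- The regularization is chosen after the finite set S, small enough for its cost to fit in the
  -- gap between b and b₁.
  obtain ⟨ε, hε1, hε⟩ : ∃ ε : ℝ, b * Real.exp (ε * L) < b₁ ∧ 0 < ε := by
    have hc : Tendsto (fun ε : ℝ => b * Real.exp (ε * L)) (𝓝[>] 0) (𝓝 b) := by
      have : Continuous fun ε : ℝ => b * Real.exp (ε * L) := by fun_prop
      have h := (this.tendsto 0).mono_left (nhdsWithin_le_nhds (s := Set.Ioi 0))
      simpa using h
    exact ((hc.eventually (gt_mem_nhds hbb)).and self_mem_nhdsWithin).exists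
  set G := trigSeries (covReg ε) with hG
  have hGle : ∀ᵐ x : T2, ‖G x‖ ≤ (4 * π)⁻¹ * Real.log (π ^ 2 / (‖x.1‖ * ‖x.2‖)) + K ∧
      0 < ‖x.1‖ ∧ 0 < ‖x.2‖ := by
    have a1 : ∀ᵐ x : T2, 0 < ‖x.1‖ :=
      Measure.quasiMeasurePreserving_fst.ae ae_norm_circle_pos
    have a2 : ∀ᵐ x : T2, 0 < ‖x.2‖ :=
      Measure.quasiMeasurePreserving_snd.ae ae_norm_circle_pos
    filter_upwards [a1, a2] with x hx1 hx2
    refine ⟨?_, hx1, hx2⟩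
    rw [hG, trigSeries_covReg hε, Complex.norm_real, Real.norm_of_nonneg]
    · exact hK ε hε x hx1 hx2
    · refine setIntegral_nonneg measurableSet_Ioi fun t ht => ?_
      have ht' : 0 < t := hε.trans ht
      have := heat_nonneg ht' x.1
      have := heat_nonneg ht' x.2
      positivity
  have hterm : ∀ n : ℕ, b ^ n / n.factorial * convSum S q n ≤
      ∫ x, ‖Q x‖ * ((b₁ * ‖G x‖) ^ n / n.factorial) := by
    intro n
    have h1 := convSum_le_norm_intCLM Q hq hQ S hε hL n
    have h2 : ‖intCLM Q (G ^ n)‖ ≤ ∫ x, ‖Q x‖ * ‖G x‖ ^ n := by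
      refine (norm_integral_le_integral_norm _).trans (le_of_eq ?_)
      congr 1; ext x
      rw [ContinuousMap.mul_apply, ContinuousMap.pow_apply, norm_mul, norm_pow]
    have h3 : 0 ≤ ∫ x, ‖Q x‖ * ‖G x‖ ^ n := integral_nonneg fun x => by positivity
    calc b ^ n / n.factorial * convSum S q n ≤
        b ^ n / n.factorial * (Real.exp (ε * L) ^ n * ∫ x, ‖Q x‖ * ‖G x‖ ^ n) := by
          gcongr
          exact h1.trans (by gcongr)
      _ = (b * Real.exp (ε * L)) ^ n / n.factorial * ∫ x, ‖Q x‖ * ‖G x‖ ^ n := by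
          rw [mul_pow]; ring
      _ ≤ b₁ ^ n / n.factorial * ∫ x, ‖Q x‖ * ‖G x‖ ^ n := by gcongr
      _ = _ := by
          rw [← integral_const_mul]
          congr 1; ext x
          rw [mul_pow]; ring
  have hcont : ∀ n : ℕ, Integrable (fun x => ‖Q x‖ * ((b₁ * ‖G x‖) ^ n / n.factorial)) := fun n =>
    integrable_continuousMap (⟨fun x => ‖Q x‖ * ((b₁ * ‖G x‖) ^ n / n.factorial), by fun_prop⟩ : C(T2, ℝ))
  calc ∑ n ∈ Finset.range N, b ^ n / n.factorial * convSum S q n ≤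
      ∑ n ∈ Finset.range N, ∫ x, ‖Q x‖ * ((b₁ * ‖G x‖) ^ n / n.factorial) :=
        Finset.sum_le_sum fun n _ => hterm n
    _ = ∫ x, ∑ n ∈ Finset.range N, ‖Q x‖ * ((b₁ * ‖G x‖) ^ n / n.factorial) :=
        (integral_finsetSum _ fun n _ => hcont n).symm
    _ ≤ ∫ x : T2, ((π ^ 2) ^ β * Real.exp (b₁ * K)) *
        (‖Q x‖ * (‖x.1‖ ^ (-β) * ‖x.2‖ ^ (-β))) := by
        refine integral_mono_ae (integrable_finsetSum _ fun n _ => hcont n)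
          (hint3.const_mul _) ?_
        filter_upwards [hGle] with x hx
        obtain ⟨hx, hx1, hx2⟩ := hx
        rw [← Finset.mul_sum]
        have h1 : ∑ n ∈ Finset.range N, (b₁ * ‖G x‖) ^ n / n.factorial ≤
            Real.exp (b₁ * ‖G x‖) := Real.sum_le_exp_of_nonneg (by positivity) N
        have h2 : Real.exp (b₁ * ‖G x‖) ≤
            (π ^ 2) ^ β * Real.exp (b₁ * K) * (‖x.1‖ ^ (-β) * ‖x.2‖ ^ (-β)) := by
          have e1 : (π ^ 2) ^ β * (‖x.1‖ ^ (-β) * ‖x.2‖ ^ (-β)) =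
              Real.exp (Real.log (π ^ 2 / (‖x.1‖ * ‖x.2‖)) * β) := by
            rw [← Real.rpow_def_of_pos (by positivity), Real.div_rpow (by positivity)
              (by positivity), Real.mul_rpow hx1.le hx2.le, Real.rpow_neg hx1.le,
              Real.rpow_neg hx2.le, ← mul_inv, div_eq_mul_inv]
          calc Real.exp (b₁ * ‖G x‖) ≤
              Real.exp (b₁ * ((4 * π)⁻¹ * Real.log (π ^ 2 / (‖x.1‖ * ‖x.2‖)) + K)) := by gcongr
            _ = Real.exp (Real.log (π ^ 2 / (‖x.1‖ * ‖x.2‖)) * β) * Real.exp (b₁ * K) := by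
                rw [← Real.exp_add, hβ]; congr 1; ring
            _ = _ := by rw [← e1]; ring
        calc ‖Q x‖ * ∑ n ∈ Finset.range N, (b₁ * ‖G x‖) ^ n / n.factorial ≤
            ‖Q x‖ * ((π ^ 2) ^ β * Real.exp (b₁ * K) * (‖x.1‖ ^ (-β) * ‖x.2‖ ^ (-β))) := by
              gcongr
              exact h1.trans h2
          _ = _ := by ring
    _ = _ := integral_const_mul _ _

theorem integral_char_mul_char (j k : ℤ × ℤ) :
    ∫ x : T2, char j x * char k x = if k = -j then ((4 * π ^ 2 : ℝ) : ℂ) else 0 := by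
  have h := integral_e_mul k (-j)
  rw [neg_neg] at h
  have e1 : ∀ x : T2, char j x * char k x = (2 * π) ^ 2 * (e k x * e j x) := fun x => by
    rw [char_eq, char_eq]; ring
  simp only [e1]
  rw [integral_const_mul, h]
  split_ifs
  · push_cast; ring
  · simp

theorem convSum_sum {ι : Type} (F : Finset ι) (S : Finset (ℤ × ℤ)) (w : ι → ℤ × ℤ → ℝ) (n : ℕ) :
    convSum S (fun k => ∑ i ∈ F, w i k) n = ∑ i ∈ F, convSum S (w i) n := by
  simp only [convSum, Finset.mul_sum]
  exact Finset.sum_comm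

theorem convSum_const_mul (c : ℝ) (S : Finset (ℤ × ℤ)) (w : ℤ × ℤ → ℝ) (n : ℕ) :
    convSum S (fun k => c * w k) n = c * convSum S w n := by
  simp only [convSum, Finset.mul_sum]
  exact Finset.sum_congr rfl fun f _ => mul_left_comm _ _ _

/-- `w` is integrable against `exp(b G)`, uniformly in the truncation of `G`. -/
def Admissible (w : ℤ × ℤ → ℝ) (b : ℝ) : Prop :=
  ∃ M : ℝ, ∀ (S : Finset (ℤ × ℤ)) (N : ℕ),
    ∑ n ∈ Finset.range N, b ^ n / n.factorial * convSum S w n ≤ M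

/-- Superposition: each frequency k is charged to the single index m k, and F collects the finitely
many indices that occur for the given S and N. The bound obtained depends on neither. -/
theorem admissible_of_le {ι : Type} {w : ℤ × ℤ → ℝ} {b : ℝ} (hb : 0 ≤ b) (m : ℤ × ℤ → ι)
    {c D : ι → ℝ} {q : ι → ℤ × ℤ → ℝ} (hc : ∀ i, 0 ≤ c i) (hq : ∀ i k, 0 ≤ q i k)
    (hw : ∀ k, w k ≤ c (m k) * q (m k) k) (hD0 : ∀ i, 0 ≤ D i)
    (hD : ∀ i (S : Finset (ℤ × ℤ)) (N : ℕ),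
      ∑ n ∈ Finset.range N, b ^ n / n.factorial * convSum S (q i) n ≤ D i)
    (hs : Summable fun i => c i * D i) : Admissible w b := by
  classical
  refine ⟨∑' i, c i * D i, fun S N => ?_⟩
  set F : Finset ι := (Finset.range N).biUnion fun n =>
    (Fintype.piFinset fun _ : Fin n => S).image fun f => m (∑ i, f i) with hF
  have hle : ∀ n ∈ Finset.range N, convSum S w n ≤ ∑ i ∈ F, c i * convSum S (q i) n := by
    intro n hn
    simp only [← convSum_const_mul]
    rw [← convSum_sum]
    refine Finset.sum_le_sum fun f hf => mul_le_mul_of_nonneg_left ((hw _).trans ?_)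
      (Finset.prod_nonneg fun _ _ => (cov_pos _).le)
    exact Finset.single_le_sum (f := fun i => c i * q i (∑ j, f j))
      (fun i _ => mul_nonneg (hc i) (hq i _))
      (Finset.mem_biUnion.2 ⟨n, hn, Finset.mem_image.2 ⟨f, hf, rfl⟩⟩)
  calc ∑ n ∈ Finset.range N, b ^ n / n.factorial * convSum S w n ≤
      ∑ n ∈ Finset.range N, ∑ i ∈ F, c i * (b ^ n / n.factorial * convSum S (q i) n) := by
        refine Finset.sum_le_sum fun n hn => ?_
        refine (mul_le_mul_of_nonneg_left (hle n hn) (by positivity)).trans (le_of_eq ?_)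
        rw [Finset.mul_sum]
        exact Finset.sum_congr rfl fun i _ => by ring
    _ = ∑ i ∈ F, c i * ∑ n ∈ Finset.range N, (b ^ n / n.factorial * convSum S (q i) n) := by
        rw [Finset.sum_comm]
        simp only [Finset.mul_sum]
    _ ≤ ∑ i ∈ F, c i * D i :=
        Finset.sum_le_sum fun i _ => mul_le_mul_of_nonneg_left (hD i S N) (hc i)
    _ ≤ _ := hs.sum_le_tsum _ fun i _ => mul_nonneg (hc i) (hD0 i)

/-- The weight is a sum of point masses. For each of them Q is a character, of modulus one, so they
all share the same bound. -/
theorem admissible_of_summable {w : ℤ × ℤ → ℝ} (hw0 : ∀ k, 0 ≤ w k) (hw : Summable w) {b : ℝ}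
    (hb : 0 ≤ b) (hb4 : b < 4 * π) : Admissible w b := by
  obtain ⟨b₁, hb₁, hb₁4⟩ := exists_between hb4
  obtain ⟨K, hK0, hK⟩ := exists_exp_sum_convSum_le hb₁4 (hb.trans_lt hb₁)
  have hp := Real.pi_pos
  refine admissible_of_le hb (fun k => k) (c := fun j => w j * (4 * π ^ 2)⁻¹)
    (D := fun _ => K * ∫ x : T2, (‖x.1‖ ^ (-(b₁ / (4 * π))) * ‖x.2‖ ^ (-(b₁ / (4 * π)))))
    (q := fun j k => if k = j then 4 * π ^ 2 else 0) (fun j => by have := hw0 j; positivity)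
    (fun j k => by positivity) (fun k => ?_)
    (fun j => mul_nonneg hK0 (integral_nonneg fun x => by positivity)) (fun j S N => ?_)
    ((hw.mul_right _).mul_right _)
  · rw [if_pos rfl]
    exact le_of_eq (by field_simp)
  · have := hK (char (-j)) (fun k => if k = j then 4 * π ^ 2 else 0)
      (fun k => by positivity) (fun k => by
        rw [integral_char_mul_char, neg_neg]
        split_ifs <;> simp) b hb hb₁ S N
    simpa only [norm_char, one_mul] using this

theorem Admissible.mono {w w' : ℤ × ℤ → ℝ} {b : ℝ} (h : Admissible w' b) (hb : 0 ≤ b) {c : ℝ}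
    (hc : 0 ≤ c) (hw : ∀ k, w k ≤ c * w' k) : Admissible w b := by
  obtain ⟨M, hM⟩ := h
  refine ⟨c * M, fun S N => ?_⟩
  calc ∑ n ∈ Finset.range N, b ^ n / n.factorial * convSum S w n ≤
      ∑ n ∈ Finset.range N, b ^ n / n.factorial * (c * convSum S w' n) := by
        refine Finset.sum_le_sum fun n _ => ?_
        gcongr
        rw [← convSum_const_mul]
        exact convSum_mono_right _ hw _
    _ = c * ∑ n ∈ Finset.range N, b ^ n / n.factorial * convSum S w' n := by
        rw [Finset.mul_sum]
        exact Finset.sum_congr rfl fun n _ => by ring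
    _ ≤ _ := by gcongr; exact hM S N

end Torus

end

noncomputable section

/-! ### Admissibility of the Sobolev weights and of the weights of square integrable functions. -/

namespace Torus

theorem integral_trigSeries_mul_char {c : ℤ × ℤ → ℝ} (hc : Summable c) (k : ℤ × ℤ) :
    ∫ x, trigSeries c x * char k x = ((4 * π ^ 2 * c (-k) : ℝ) : ℂ) := by
  have h := (intCLM (char k)).hasSum (hasSum_trigSeries hc)
  have e1 : ∫ x, trigSeries c x * char k x = intCLM (char k) (trigSeries c) := by
    rw [intCLM_apply]
    simp only [mul_comm]
  have e2 : (fun j => intCLM (char k) ((c j : ℂ) • char j)) =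
      fun j => if j = -k then ((4 * π ^ 2 * c (-k) : ℝ) : ℂ) else 0 := by
    funext j
    rw [map_smul, intCLM_apply, integral_char_mul_char, smul_eq_mul]
    split_ifs with h
    · rw [h]; push_cast; ring
    · rw [mul_zero]
  rw [e1, ← h.tsum_eq, e2]
  exact tsum_ite_eq _ _

theorem summable_exp_neg_lam {t : ℝ} (ht : 0 < t) :
    Summable fun k => Real.exp (-(t * lam k)) * (4 * π ^ 2)⁻¹ := by
  have h := ((summable_exp_neg_sq ht).mul_of_nonneg (summable_exp_neg_sq ht)
    (fun _ => (Real.exp_pos _).le) (fun _ => (Real.exp_pos _).le)).mul_left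
      (Real.exp (-t) * (4 * π ^ 2)⁻¹)
  refine h.congr fun k => ?_
  rw [mul_right_comm, ← Real.exp_add, ← Real.exp_add]
  congr 2
  unfold lam
  ring

/-- The bound exp(-u) ≤ u^{-s} with u = ‖x‖²/4t trades singularity in t for singularity in x:
t^{-1/2} improves to t^{s-1/2} at the price of ‖x‖^{-2s}. -/
theorem heat_mul_rpow_le : ∃ C : ℝ, 0 ≤ C ∧ ∀ (t s β : ℝ) (_ : 0 < t) (_ : t ≤ 1) (_ : 0 ≤ s)
    (_ : s ≤ 1 / 2) (x : AddCircle (2 * π)) (_ : 0 < ‖x‖),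
    heat t x * ‖x‖ ^ (-β) ≤
      t ^ (s - 1 / 2) * (2 * ‖x‖ ^ (-(2 * s + β)) + C * ‖x‖ ^ (-β)) := by
  obtain ⟨C, hC, h⟩ := exists_heat_le
  refine ⟨C, hC, fun t s β ht ht1 hs hs2 x hx => ?_⟩
  have hp := Real.pi_gt_three
  have h1 : Real.exp (-(‖x‖ ^ 2 / (4 * t))) ≤ 2 * t ^ s * ‖x‖ ^ (-(2 * s)) := by
    set u := ‖x‖ ^ 2 / (4 * t) with hu
    have hu0 : 0 < u := by positivity
    have h2 : u ^ s ≤ Real.exp u := by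
      refine le_trans ?_ (Real.add_one_le_exp u)
      rcases le_total u 1 with h | h
      · linarith [Real.rpow_le_one hu0.le h hs]
      · have := Real.rpow_le_rpow_of_exponent_le h (show s ≤ 1 by linarith)
        rw [Real.rpow_one] at this
        linarith
    have h3 : Real.exp (-u) ≤ (u ^ s)⁻¹ := by
      rw [Real.exp_neg]
      exact inv_anti₀ (by positivity) h2
    have h4 : (4 : ℝ) ^ s ≤ 2 := by
      calc (4 : ℝ) ^ s ≤ 4 ^ (1 / 2 : ℝ) := Real.rpow_le_rpow_of_exponent_le (by norm_num) hs2
        _ = 2 := by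
          rw [show (4 : ℝ) = 2 ^ (2 : ℝ) by norm_num, ← Real.rpow_mul (by norm_num)]
          norm_num
    have h5 : (u ^ s)⁻¹ = 4 ^ s * t ^ s * ‖x‖ ^ (-(2 * s)) := by
      rw [hu, Real.div_rpow (by positivity) (by positivity), Real.mul_rpow (by norm_num) ht.le,
        inv_div, Real.rpow_neg hx.le, Real.rpow_mul hx.le, div_eq_mul_inv]
      norm_num
    rw [h5] at h3
    exact h3.trans (by gcongr)
  have h2 : (√(4 * π * t))⁻¹ ≤ t ^ (-(1 / 2 : ℝ)) := by
    rw [Real.rpow_neg ht.le, ← Real.sqrt_eq_rpow]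
    refine inv_anti₀ (Real.sqrt_pos.2 ht) (Real.sqrt_le_sqrt (by nlinarith))
  have h3 : √t ≤ t ^ (s - 1 / 2) := by
    rw [Real.sqrt_eq_rpow]
    exact Real.rpow_le_rpow_of_exponent_ge ht ht1 (by linarith)
  have h4 : 0 ≤ ‖x‖ ^ (-β) := by positivity
  calc heat t x * ‖x‖ ^ (-β) ≤ (t ^ (-(1 / 2 : ℝ)) * (2 * t ^ s * ‖x‖ ^ (-(2 * s))) +
        C * t ^ (s - 1 / 2)) * ‖x‖ ^ (-β) := by
        gcongr
        refine (h t ht x).trans ?_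
        gcongr
    _ = _ := by
        rw [show s - 1 / 2 = -(1 / 2 : ℝ) + s by ring, Real.rpow_add ht,
          show -(2 * s + β) = -(2 * s) + -β by ring, Real.rpow_add hx]
        ring

/-- Dyadic decomposition of λ^{-α} into heat semigroup symbols: a frequency with λ of order 1/t is
charged to t^α exp(-tλ), whose Q is a heat kernel. The choice 2s = 1 - β' with β < β' < α keeps 2s +
β < 1, so the singularity in x stays integrable. The two coordinates together cost t^{2s-1} =
t^{-β'}, and the sum of t^{α-β'} over t = 2^{-m} is geometric. -/
theorem admissible_lam_rpow {α : ℝ} (hα : 0 < α) (hα1 : α ≤ 1) {b : ℝ} (hb : 0 ≤ b)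
    (hbα : b < 4 * π * α) : Admissible (fun k => lam k ^ (-α)) b := by
  obtain ⟨b₁, hb₁, hb₁α⟩ := exists_between hbα
  have hp := Real.pi_pos
  have hb₁4 : b₁ < 4 * π := by nlinarith
  obtain ⟨K, hK0, hK⟩ := exists_exp_sum_convSum_le hb₁4 (hb.trans_lt hb₁)
  set β := b₁ / (4 * π) with hβ
  have hβ0 : 0 ≤ β := by have := hb.trans_lt hb₁; positivity
  have hβα : β < α := by rw [hβ, div_lt_iff₀ (by positivity)]; linarith
  set β' := (α + β) / 2 with hβ'
  set s := (1 - β') / 2 with hs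
  have hs0 : 0 ≤ s := by linarith
  have hs1 : s ≤ 1 / 2 := by linarith
  obtain ⟨C, hC0, hC⟩ := heat_mul_rpow_le
  have hi1 := integrable_norm_rpow_circle (s := 2 * s + β) (by linarith)
  have hi2 := integrable_norm_rpow_circle (s := β) (by linarith)
  set A := ∫ x : AddCircle (2 * π), (2 * ‖x‖ ^ (-(2 * s + β)) + C * ‖x‖ ^ (-β)) with hA
  have hA0 : 0 ≤ A := integral_nonneg fun x => by positivity
  have hheat : ∀ t : ℝ, 0 < t → t ≤ 1 →
      ∫ x : AddCircle (2 * π), heat t x * ‖x‖ ^ (-β) ≤ t ^ (s - 1 / 2) * A := by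
    intro t ht ht1
    rw [hA, ← integral_const_mul]
    refine integral_mono_of_nonneg (Eventually.of_forall fun x =>
      mul_nonneg (heat_nonneg ht x) (by positivity))
      (((hi1.const_mul _).add (hi2.const_mul _)).const_mul _) ?_
    filter_upwards [ae_norm_circle_pos] with x hx
    exact hC t s β ht ht1 hs0 hs1 x hx
  set t : ℕ → ℝ := fun m => (1 / 2 : ℝ) ^ m with ht
  have ht0 : ∀ m, 0 < t m := fun m => by rw [ht]; positivity
  have ht1 : ∀ m, t m ≤ 1 := fun m => pow_le_one₀ (by norm_num) (by norm_num)
  -- Here 2^m ≤ λ < 2^{m+1}, so t_m λ ≤ 2; this is the source of the constant exp(2).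
  have hm : ∀ k, ∃ m : ℕ, lam k ^ (-α) ≤ Real.exp 2 * (t m) ^ α * Real.exp (-(t m * lam k)) := by
    intro k
    obtain ⟨m, h1, h2⟩ := exists_nat_pow_near (one_le_lam k) (one_lt_two (α := ℝ))
    refine ⟨m, ?_⟩
    have e1 : t m = (2 ^ m : ℝ)⁻¹ := by rw [ht]; simp
    have h3 : lam k ^ (-α) ≤ (t m) ^ α := by
      rw [e1, Real.inv_rpow (by positivity), Real.rpow_neg (lam_pos k).le]
      exact inv_anti₀ (by positivity) (Real.rpow_le_rpow (by positivity) h1 hα.le)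
    have h4 : 1 ≤ Real.exp 2 * Real.exp (-(t m * lam k)) := by
      rw [← Real.exp_add]
      refine Real.one_le_exp ?_
      have : t m * lam k ≤ 2 := by
        rw [e1, inv_mul_le_iff₀ (by positivity)]
        rw [pow_succ] at h2
        exact h2.le
      linarith
    have h5 : 0 ≤ (t m) ^ α := Real.rpow_nonneg (ht0 m).le _
    calc lam k ^ (-α) ≤ (t m) ^ α := h3
      _ ≤ (t m) ^ α * (Real.exp 2 * Real.exp (-(t m * lam k))) := le_mul_of_one_le_right h5 h4
      _ = _ := by ring
  choose m hm using hm
  refine admissible_of_le hb m (c := fun i => Real.exp 2 * (t i) ^ α)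
    (D := fun i => K * (t i ^ (s - 1 / 2) * A * (t i ^ (s - 1 / 2) * A)))
    (q := fun i k => Real.exp (-(t i * lam k)))
    (fun i => by have := ht0 i; positivity) (fun i k => (Real.exp_pos _).le) hm
    (fun i => by have := ht0 i; positivity) (fun i S N => ?_) ?_
  · have hsum := summable_exp_neg_lam (ht0 i)
    refine (hK (trigSeries fun k => Real.exp (-(t i * lam k)) * (4 * π ^ 2)⁻¹)
      (fun k => Real.exp (-(t i * lam k))) (fun k => (Real.exp_pos _).le) (fun k => ?_)
      b hb hb₁ S N).trans ?_
    · rw [integral_trigSeries_mul_char hsum, lam_neg]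
      congr 1
      field_simp
    · refine mul_le_mul_of_nonneg_left ?_ hK0
      have e1 : ∀ x : T2, ‖trigSeries (fun k => Real.exp (-(t i * lam k)) * (4 * π ^ 2)⁻¹) x‖ *
          (‖x.1‖ ^ (-β) * ‖x.2‖ ^ (-β)) = Real.exp (-(t i)) *
            ((heat (t i) x.1 * ‖x.1‖ ^ (-β)) * (heat (t i) x.2 * ‖x.2‖ ^ (-β))) := by
        intro x
        rw [(hasSum_trigSeries_apply hsum x).unique (hasSum_heat_mul_heat (ht0 i) x),
          Complex.norm_real, Real.norm_of_nonneg (mul_nonneg (Real.exp_pos _).le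
            (mul_nonneg (heat_nonneg (ht0 i) _) (heat_nonneg (ht0 i) _)))]
        ring
      simp only [e1]
      rw [integral_const_mul, Measure.volume_eq_prod,
        integral_prod_mul (fun x : AddCircle (2 * π) => heat (t i) x * ‖x‖ ^ (-β))
          (fun x : AddCircle (2 * π) => heat (t i) x * ‖x‖ ^ (-β))]
      have h0 : 0 ≤ ∫ x : AddCircle (2 * π), heat (t i) x * ‖x‖ ^ (-β) :=
        integral_nonneg fun x => mul_nonneg (heat_nonneg (ht0 i) x) (by positivity)
      have h1 := hheat (t i) (ht0 i) (ht1 i)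
      refine (mul_le_of_le_one_left (mul_nonneg h0 h0)
        (Real.exp_le_one_iff.2 (by linarith [ht0 i]))).trans ?_
      exact mul_le_mul h1 h1 h0 (h0.trans h1)
  · have e1 : ∀ i, Real.exp 2 * (t i) ^ α * (K * (t i ^ (s - 1 / 2) * A * (t i ^ (s - 1 / 2) * A))) =
        (Real.exp 2 * K * A ^ 2) * ((1 / 2 : ℝ) ^ (α - β')) ^ i := by
      intro i
      have e2 : (t i) ^ α * (t i ^ (s - 1 / 2) * t i ^ (s - 1 / 2)) =
          ((1 / 2 : ℝ) ^ (α - β')) ^ i := by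
        have e3 : t i = (1 / 2 : ℝ) ^ (i : ℝ) := (Real.rpow_natCast _ _).symm
        rw [← Real.rpow_add (ht0 i), ← Real.rpow_add (ht0 i), e3, ← Real.rpow_natCast,
          ← Real.rpow_mul (by norm_num), ← Real.rpow_mul (by norm_num)]
        congr 1
        rw [hs]
        ring
      rw [← e2]
      ring
    simp only [e1]
    refine Summable.mul_left _ (summable_geometric_of_lt_one (by positivity) ?_)
    exact Real.rpow_lt_one (by norm_num) (by norm_num) (by linarith)

theorem admissible_weight_toSobolev {α : ℝ} (hα : 0 < α) (hα1 : α ≤ 1) {b : ℝ} (hb : 0 ≤ b)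
    (hbα : b < 4 * π * α) : Admissible (weight (toSobolev hα.le)) b :=
  (admissible_lam_rpow hα hα1 hb hbα).mono hb (c := 4 * π ^ 2) (by positivity) fun k =>
    (weight_toSobolev hα.le k).le

/-- Some positive exponent is admissible for every Sobolev order. -/
theorem exists_admissible_weight_toSobolev {α : ℝ} (hα : 0 < α) :
    ∃ b : ℝ, 0 < b ∧ Admissible (weight (toSobolev hα.le)) b := by
  have hm : 0 < min α 1 := lt_min hα one_pos
  have hp := Real.pi_pos
  -- For α > 1 the weight is dominated by the one of order 1, up to a constant. Any positive value
  -- below 4π min(α, 1) would do: existence of Wick powers of a fixed degree needs no sharp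
  -- exponent.
  refine ⟨2 * π * min α 1, by positivity, (admissible_lam_rpow hm (min_le_right _ _)
    (by positivity) (by nlinarith)).mono (by positivity) (c := 4 * π ^ 2) (by positivity)
    fun k => ?_⟩
  rw [weight_toSobolev]
  gcongr
  · exact one_le_lam k
  · exact min_le_left _ _

theorem admissible_weight_testCLM (g : H) {b : ℝ} (hb : 0 ≤ b) (hb4 : b < 4 * π) :
    Admissible (weight (testCLM g)) b := by
  refine admissible_of_summable (fun k => by rw [weight]; positivity) ?_ hb hb4
  exact ((summable_hat_l2 g).mul_left (4 * π ^ 2)).congr fun k => (weight_testCLM g k).symm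

end Torus

end

noncomputable section

namespace Torus

open Wick

/-! ### Functions of polynomial growth on a Gaussian space -/

section PolyBdd

variable {V : Type} [NormedAddCommGroup V] {E E' : Type} [NormedAddCommGroup E]
  [NormedAddCommGroup E']

/-- Functions of at most polynomial growth. -/
def PolyBdd (F : V → E) : Prop := ∃ (C : ℝ) (n : ℕ), 0 ≤ C ∧ ∀ w, ‖F w‖ ≤ C * (1 + ‖w‖) ^ n

namespace PolyBdd

variable {F G : V → E}

theorem sub (hF : PolyBdd F) (hG : PolyBdd G) : PolyBdd fun w => F w - G w := by
  obtain ⟨C, n, hC, h⟩ := hF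
  obtain ⟨C', n', hC', h'⟩ := hG
  refine ⟨C + C', max n n', by positivity, fun w => ?_⟩
  have h1 : 1 ≤ 1 + ‖w‖ := by linarith [norm_nonneg w]
  calc ‖F w - G w‖ ≤ ‖F w‖ + ‖G w‖ := norm_sub_le _ _
    _ ≤ C * (1 + ‖w‖) ^ n + C' * (1 + ‖w‖) ^ n' := add_le_add (h w) (h' w)
    _ ≤ C * (1 + ‖w‖) ^ max n n' + C' * (1 + ‖w‖) ^ max n n' := by
        gcongr
        · exact le_max_left _ _
        · exact le_max_right _ _
    _ = _ := by ring

theorem clm_comp [NormedSpace ℝ E] [NormedSpace ℝ E'] (hF : PolyBdd F) (L : E →L[ℝ] E') : PolyBdd fun w => L (F w) := by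
  obtain ⟨C, n, hC, h⟩ := hF
  refine ⟨‖L‖ * C, n, by positivity, fun w => (L.le_opNorm _).trans ?_⟩
  rw [mul_assoc]
  gcongr
  exact h w

theorem rotate [NormedSpace ℝ V] (hF : PolyBdd F) {c s : ℝ} (hc : |c| ≤ 1) (hs : |s| ≤ 1) (w : V) :
    PolyBdd fun w' => F (c • w + s • w') := by
  obtain ⟨C, n, hC, h⟩ := hF
  refine ⟨C * (1 + ‖w‖) ^ n, n, by positivity, fun w' => (h _).trans ?_⟩
  rw [mul_assoc, ← mul_pow]
  have h1 : ‖c • w + s • w'‖ ≤ ‖w‖ + ‖w'‖ := by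
    refine (norm_add_le _ _).trans ?_
    rw [norm_smul, norm_smul]
    exact add_le_add (mul_le_of_le_one_left (norm_nonneg _) hc)
      (mul_le_of_le_one_left (norm_nonneg _) hs)
  gcongr
  nlinarith [mul_nonneg (norm_nonneg w) (norm_nonneg w')]

variable [InnerProductSpace ℝ V] [MeasurableSpace V] [BorelSpace V] [FiniteDimensional ℝ V]

theorem allLp_one_add_norm_pow (n : ℕ) :
    AllLp (stdGaussian V) fun w : V => (1 + ‖w‖) ^ n := by
  induction n with
  | zero => simpa using AllLp.const (μ := stdGaussian V) 1
  | succ n ih =>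
    have h1 : AllLp (stdGaussian V) fun w : V => ‖w‖ := fun q hq =>
      (IsGaussian.memLp_id (stdGaussian V) q hq).norm
    simpa only [pow_succ] using ih.mul ((AllLp.const 1).add h1)

theorem memLp (hF : PolyBdd F) (hc : Continuous F) {q : ℝ≥0∞} (hq : q ≠ ⊤) :
    MemLp F q (stdGaussian V) := by
  obtain ⟨C, n, hC, h⟩ := hF
  refine (((allLp_one_add_norm_pow n).const_mul C) q hq).mono hc.aestronglyMeasurable
    (Eventually.of_forall fun w => (h w).trans (le_abs_self _))

theorem integrable (hF : PolyBdd F) (hc : Continuous F) : Integrable F (stdGaussian V) :=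
  memLp_one_iff_integrable.1 (hF.memLp hc (by simp))

end PolyBdd

end PolyBdd

/-! ### Second moments -/

section Moments

variable {V : Type} [NormedAddCommGroup V] [InnerProductSpace ℝ V] [MeasurableSpace V]
  [BorelSpace V] [FiniteDimensional ℝ V] {𝒦 : Type} [NormedAddCommGroup 𝒦]
  [InnerProductSpace ℝ 𝒦] {J : C(T2, ℝ) →L[ℝ] 𝒦} {ι : Type}
  {l l' : ι → C(T2, ℝ) →L[ℝ] ℝ}

/-- The inner product of `𝒦`, pulled back by `J`, is a series of products of functionals. -/
def IsFrame (J : C(T2, ℝ) →L[ℝ] 𝒦) (l l' : ι → C(T2, ℝ) →L[ℝ] ℝ) : Prop :=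
  ∀ f g, HasSum (fun i => l i f * l i g + l' i f * l' i g) (inner ℝ (J f) (J g))

/-- The covariance kernel `∑ κ_a (cos(j_a·x) cos(j_a·y) + sin(j_a·x) sin(j_a·y))`. -/
def trigKernel {τ : Type} (A : Finset τ) (κ : τ → ℝ) (j : τ → ℤ × ℤ) (x y : T2) : ℝ :=
  ∑ a ∈ A, κ a * (cosC (j a) x * cosC (j a) y + sinC (j a) x * sinC (j a) y)

variable {F G : V → C(T2, ℝ)} {τ : Type} {A : Finset τ} {κ : τ → ℝ} {j : τ → ℤ × ℤ}

/-- Covariances of point evaluations determine those of all continuous functionals: Bochner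
integrals in C(T²) commute with functionals, which is used in one argument and then in the other. -/
theorem integral_mul_of_kernel (hF : Continuous F) (hF' : PolyBdd F) (hG : Continuous G)
    (hG' : PolyBdd G)
    (hK : ∀ x y, ∫ w, F w x * G w y ∂(stdGaussian V) = trigKernel A κ j x y)
    (L L' : C(T2, ℝ) →L[ℝ] ℝ) :
    ∫ w, L (F w) * L' (G w) ∂(stdGaussian V) =
      ∑ a ∈ A, κ a * (L (cosC (j a)) * L' (cosC (j a)) + L (sinC (j a)) * L' (sinC (j a))) := by
  have hi : ∀ (P : C(T2, ℝ) →L[ℝ] ℝ) (F G : V → C(T2, ℝ)), Continuous F → PolyBdd F →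
      Continuous G → PolyBdd G → Integrable (fun w => P (F w) • G w) (stdGaussian V) := by
    intro P F G h1 h2 h3 h4
    have a1 : MemLp (fun w => P (F w)) 2 (stdGaussian V) :=
      (h2.clm_comp P).memLp (P.continuous.comp h1) (by simp)
    have a2 : MemLp G 2 (stdGaussian V) := h4.memLp h3 (by simp)
    exact memLp_one_iff_integrable.1 (MemLp.smul (p := 2) (q := 2) (r := 1) a2 a1)
  have h1 : ∀ x, ∫ w, F w x • G w ∂(stdGaussian V) =
      ∑ a ∈ A, κ a • (cosC (j a) x • cosC (j a) + sinC (j a) x • sinC (j a)) := by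
    intro x
    ext y
    have := (ContinuousMap.evalCLM ℝ y).integral_comp_comm
      (hi (ContinuousMap.evalCLM ℝ x) F G hF hF' hG hG')
    simp only [ContinuousMap.evalCLM_apply] at this
    rw [← this]
    simp only [ContinuousMap.smul_apply, smul_eq_mul]
    rw [hK, trigKernel]
    simp only [ContinuousMap.sum_apply, ContinuousMap.smul_apply, ContinuousMap.add_apply, smul_eq_mul]
  have h2 : ∫ w, L' (G w) • F w ∂(stdGaussian V) = ∑ a ∈ A, κ a • (L' (cosC (j a)) • cosC (j a) +
      L' (sinC (j a)) • sinC (j a)) := by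
    ext x
    have a1 := (ContinuousMap.evalCLM ℝ x).integral_comp_comm (hi L' G F hG hG' hF hF')
    have a2 := L'.integral_comp_comm (hi (ContinuousMap.evalCLM ℝ x) F G hF hF' hG hG')
    simp only [ContinuousMap.evalCLM_apply] at a1 a2
    rw [h1] at a2
    rw [← a1]
    simp only [ContinuousMap.smul_apply, map_smul, map_sum, map_add, smul_eq_mul] at a2 ⊢
    simp only [mul_comm (L' (G _))]
    rw [a2]
    simp only [ContinuousMap.sum_apply, ContinuousMap.smul_apply, ContinuousMap.add_apply, smul_eq_mul]
    exact Finset.sum_congr rfl fun a _ => by ring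
  have h3 := L.integral_comp_comm (hi L' G F hG hG' hF hF')
  rw [h2] at h3
  simp only [map_smul, map_sum, map_add, smul_eq_mul] at h3
  simp only [mul_comm (L (F _))]
  rw [h3]
  exact Finset.sum_congr rfl fun a _ => by ring

/-- The inner product is expanded in the frame and integrated termwise, dominated through |uv| ≤ (u²
+ v²)/2. Summing the frame over cosines and sines reassembles the weight of J. -/
theorem integral_inner_of_kernel [Countable ι] (hJ : IsFrame J l l') (hF : Continuous F)
    (hF' : PolyBdd F) (hG : Continuous G) (hG' : PolyBdd G)
    (hK : ∀ x y, ∫ w, F w x * G w y ∂(stdGaussian V) = trigKernel A κ j x y) :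
    ∫ w, inner ℝ (J (F w)) (J (G w)) ∂(stdGaussian V) = ∑ a ∈ A, κ a * weight J (j a) := by
  have hsq : ∀ f : C(T2, ℝ), HasSum (fun i => l i f ^ 2 + l' i f ^ 2) (‖J f‖ ^ 2) := by
    intro f
    have := hJ f f
    rw [real_inner_self_eq_norm_sq] at this
    simpa only [sq] using this
  have hbd : ∀ w, HasSum (fun i => (1 / 2 : ℝ) * ((l i (F w) ^ 2 + l' i (F w) ^ 2) +
      (l i (G w) ^ 2 + l' i (G w) ^ 2))) ((1 / 2 : ℝ) * (‖J (F w)‖ ^ 2 + ‖J (G w)‖ ^ 2)) :=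
    fun w => ((hsq _).add (hsq _)).mul_left _
  have hsqi : ∀ F : V → C(T2, ℝ), Continuous F → PolyBdd F →
      Integrable (fun w => ‖J (F w)‖ ^ 2) (stdGaussian V) := fun F h1 h2 =>
    ((h2.clm_comp J).memLp (J.continuous.comp h1) (by simp)).integrable_norm_pow (by simp)
  have hcl : ∀ (L : C(T2, ℝ) →L[ℝ] ℝ) (F : V → C(T2, ℝ)), Continuous F →
      Continuous fun w => L (F w) := fun L F h => L.continuous.comp h
  have h1 := hasSum_integral_of_dominated_convergence (μ := stdGaussian V)
    (F := fun i w => l i (F w) * l i (G w) + l' i (F w) * l' i (G w))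
    (f := fun w => inner ℝ (J (F w)) (J (G w)))
    (fun i w => (1 / 2 : ℝ) * ((l i (F w) ^ 2 + l' i (F w) ^ 2) +
      (l i (G w) ^ 2 + l' i (G w) ^ 2)))
    (fun i => Continuous.aestronglyMeasurable
      (((hcl _ _ hF).mul (hcl _ _ hG)).add ((hcl _ _ hF).mul (hcl _ _ hG))))
    (fun i => Eventually.of_forall fun w => by
      rw [Real.norm_eq_abs, abs_le]
      constructor <;> nlinarith [sq_nonneg (l i (F w) + l i (G w)),
        sq_nonneg (l' i (F w) + l' i (G w)), sq_nonneg (l i (F w) - l i (G w)),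
        sq_nonneg (l' i (F w) - l' i (G w))])
    (Eventually.of_forall fun w => (hbd w).summable)
    (by
      simp only [fun w => (hbd w).tsum_eq]
      exact ((hsqi F hF hF').add (hsqi G hG hG')).const_mul _)
    (Eventually.of_forall fun w => hJ _ _)
  refine h1.unique ?_
  have hi : ∀ L : C(T2, ℝ) →L[ℝ] ℝ, Integrable (fun w => L (F w) * L (G w)) (stdGaussian V) := by
    intro L
    exact ((hF'.clm_comp L).memLp (hcl L _ hF) (by simp)).integrable_mul
      (p := 2) (q := 2) ((hG'.clm_comp L).memLp (hcl L _ hG) (by simp))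
  have h2 : ∀ i, ∫ w, (l i (F w) * l i (G w) + l' i (F w) * l' i (G w)) ∂(stdGaussian V) =
      ∑ a ∈ A, κ a * ((l i (cosC (j a)) ^ 2 + l' i (cosC (j a)) ^ 2) +
        (l i (sinC (j a)) ^ 2 + l' i (sinC (j a)) ^ 2)) := by
    intro i
    rw [integral_add (hi _) (hi _), integral_mul_of_kernel hF hF' hG hG' hK,
      integral_mul_of_kernel hF hF' hG hG' hK, ← Finset.sum_add_distrib]
    exact Finset.sum_congr rfl fun a _ => by ring
  simp only [h2]
  exact hasSum_sum fun a _ => ((hsq _).add (hsq _)).mul_left _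

end Moments

/-! ### Hypercontractivity for functions with values in a Hilbert space -/

section Hypercontractivity

variable {V : Type} [NormedAddCommGroup V] [InnerProductSpace ℝ V] [MeasurableSpace V]
  [BorelSpace V] [FiniteDimensional ℝ V] {𝒦 : Type} [NormedAddCommGroup 𝒦]
  [InnerProductSpace ℝ 𝒦] [CompleteSpace 𝒦]

/-- The norm of a Bochner integral is at most the integral of the norm, so scalar hypercontractivity
applied to the function ‖J F‖ is enough for Hilbert space values. -/
theorem eLpNorm_le_of_rotation {p : ℝ} (hp : 2 < p) (J : C(T2, ℝ) →L[ℝ] 𝒦)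
    {F F' : V → C(T2, ℝ)} (hF : Continuous F) (hFb : PolyBdd F)
    (h : ∀ w x, ∫ w', F ((√(p - 1))⁻¹ • w + √(1 - (√(p - 1))⁻¹ ^ 2) • w') x ∂(stdGaussian V) =
      F' w x) :
    eLpNorm (fun w => J (F' w)) (ENNReal.ofReal p) (stdGaussian V) ≤
      eLpNorm (fun w => J (F w)) 2 (stdGaussian V) := by
  set c := (√(p - 1))⁻¹ with hc
  have hp0 : 0 < p := by linarith
  have hc0 : 0 < c := inv_pos.2 (Real.sqrt_pos.2 (by linarith))
  have hc1 : c ≤ 1 := inv_le_one_of_one_le₀ (Real.one_le_sqrt.2 (by linarith))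
  have hcont : ∀ w, Continuous fun w' => F (c • w + √(1 - c ^ 2) • w') := fun w =>
    hF.comp (by fun_prop)
  have hint : ∀ w, Integrable (fun w' => F (c • w + √(1 - c ^ 2) • w')) (stdGaussian V) := by
    intro w
    refine (hFb.rotate (by rw [abs_of_pos hc0]; exact hc1) ?_ w).integrable (hcont w)
    rw [abs_of_nonneg (Real.sqrt_nonneg _)]
    exact Real.sqrt_le_one.2 (by nlinarith)
  have hJ : ∀ w, J (F' w) = ∫ w', J (F (c • w + √(1 - c ^ 2) • w')) ∂(stdGaussian V) := by
    intro w
    rw [J.integral_comp_comm (hint w)]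
    congr 1
    ext x
    have := (ContinuousMap.evalCLM ℝ x).integral_comp_comm (hint w)
    simp only [ContinuousMap.evalCLM_apply] at this
    rw [← this, h]
  have hle : ∀ w, ‖J (F' w)‖ₑ ≤
      ∫⁻ w', (‖J (F (c • w + √(1 - c ^ 2) • w'))‖₊ : ℝ≥0∞) ∂(stdGaussian V) := fun w => by
    rw [hJ]
    exact enorm_integral_le_lintegral_enorm _
  have hmain := Hypercontractive.lintegral_rotation_rpow_le hp (f := fun w => ‖J (F w)‖₊)
    (J.continuous.comp hF).nnnorm
  rw [eLpNorm_eq_lintegral_rpow_enorm_toReal (by simpa using hp0) (by simp),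
    eLpNorm_eq_lintegral_rpow_enorm_toReal (by simp) (by simp), ENNReal.toReal_ofReal hp0.le]
  calc (∫⁻ w, ‖J (F' w)‖ₑ ^ p ∂(stdGaussian V)) ^ (1 / p) ≤
      ((∫⁻ w, (‖J (F w)‖₊ : ℝ≥0∞) ^ 2 ∂(stdGaussian V)) ^ (p / 2)) ^ (1 / p) := by
        gcongr
        refine le_trans (lintegral_mono fun w => ?_) hmain
        gcongr
        exact hle w
    _ = _ := by
        rw [← ENNReal.rpow_mul]
        have e1 : p / 2 * (1 / p) = 1 / 2 := by field_simp
        rw [e1]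
        simp only [ENNReal.toReal_ofNat, ENNReal.rpow_ofNat]
        rfl

end Hypercontractivity

end Torus

end

noncomputable section

namespace Torus

open Wick

/-! ### White noise and its truncated Gaussian fields -/

/-- The orthonormal real trigonometric functions, normalized in the Cameron-Martin space. -/
def basisFn (k : ℤ × ℤ) : C(T2, ℝ) := ((√(lam k))⁻¹ * (2 * π)⁻¹) • (cosC k + sinC k)

/-- The variance of the truncated field. -/
def sumCov (S : Finset (ℤ × ℤ)) : ℝ := ∑ k ∈ S, cov k

theorem sumCov_pos {S : Finset (ℤ × ℤ)} (h : S.Nonempty) : 0 < sumCov S :=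
  Finset.sum_pos (fun k _ => cov_pos k) h

/-- Sets of frequencies that are invariant under `k ↦ -k`. -/
def IsSymm (S : Finset (ℤ × ℤ)) : Prop := ∀ k ∈ S, -k ∈ S

theorem IsSymm.union {S T : Finset (ℤ × ℤ)} (hS : IsSymm S) (hT : IsSymm T) : IsSymm (S ∪ T) :=
  fun k hk => (Finset.mem_union.1 hk).elim (fun h => Finset.mem_union_left _ (hS k h))
    fun h => Finset.mem_union_right _ (hT k h)

theorem IsSymm.inter {S T : Finset (ℤ × ℤ)} (hS : IsSymm S) (hT : IsSymm T) : IsSymm (S ∩ T) :=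
  fun k hk => Finset.mem_inter.2 ⟨hS k (Finset.mem_inter.1 hk).1, hT k (Finset.mem_inter.1 hk).2⟩

theorem cosC_neg (k : ℤ × ℤ) (x : T2) : cosC (-k) x = cosC k x := by
  rw [cosC_apply, cosC_apply, char_neg, Complex.conj_re]

theorem sinC_neg (k : ℤ × ℤ) (x : T2) : sinC (-k) x = -sinC k x := by
  rw [sinC_apply, sinC_apply, char_neg, Complex.conj_im]

theorem cov_neg (k : ℤ × ℤ) : cov (-k) = cov k := by rw [cov, cov, lam_neg]

theorem IsSymm.sum_neg {S : Finset (ℤ × ℤ)} (hS : IsSymm S) (f : ℤ × ℤ → ℝ) :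
    ∑ k ∈ S, f (-k) = ∑ k ∈ S, f k :=
  Finset.sum_bij' (fun k _ => -k) (fun k _ => -k) hS hS (fun k _ => neg_neg k)
    (fun k _ => neg_neg k) fun _ _ => rfl

theorem IsSymm.sum_odd {S : Finset (ℤ × ℤ)} (hS : IsSymm S) {f : ℤ × ℤ → ℝ}
    (hf : ∀ k, f (-k) = -f k) : ∑ k ∈ S, f k = 0 := by
  have h := hS.sum_neg f
  simp only [hf, Finset.sum_neg_distrib] at h
  linarith

/-- One function cos + sin per frequency avoids the choice of half of the lattice. Its price is the
second term, which is odd in k and cancels over symmetric sets. -/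
theorem basisFn_mul_basisFn (k : ℤ × ℤ) (x y : T2) : basisFn k x * basisFn k y =
    cov k * (cosC k x * cosC k y + sinC k x * sinC k y) +
      cov k * (cosC k x * sinC k y + sinC k x * cosC k y) := by
  have hl := lam_pos k
  have h1 : ((√(lam k))⁻¹ * (2 * π)⁻¹) * ((√(lam k))⁻¹ * (2 * π)⁻¹) = cov k := by
    have h2 : (√(lam k))⁻¹ * (√(lam k))⁻¹ = (lam k)⁻¹ := by
      rw [← mul_inv, Real.mul_self_sqrt hl.le]
    calc ((√(lam k))⁻¹ * (2 * π)⁻¹) * ((√(lam k))⁻¹ * (2 * π)⁻¹) =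
        ((√(lam k))⁻¹ * (√(lam k))⁻¹) * ((2 * π)⁻¹ * (2 * π)⁻¹) := by ring
      _ = cov k := by rw [h2, cov, ← mul_inv, ← mul_inv]; congr 1; ring
  simp only [basisFn, ContinuousMap.smul_apply, ContinuousMap.add_apply, smul_eq_mul]
  rw [← h1]
  ring

theorem IsSymm.sum_basisFn {S : Finset (ℤ × ℤ)} (hS : IsSymm S) (x y : T2) :
    ∑ k ∈ S, basisFn k x * basisFn k y = trigKernel S cov id x y := by
  simp only [basisFn_mul_basisFn]
  rw [Finset.sum_add_distrib, hS.sum_odd (f := fun k =>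
    cov k * (cosC k x * sinC k y + sinC k x * cosC k y)), add_zero]
  · rfl
  · intro k
    rw [cosC_neg, cosC_neg, sinC_neg, sinC_neg, cov_neg]
    ring

theorem cosC_sq_add_sinC_sq (k : ℤ × ℤ) (x : T2) :
    cosC k x * cosC k x + sinC k x * sinC k x = 1 := by
  have h := norm_char k x
  rw [cosC_apply, sinC_apply, ← Complex.normSq_apply, Complex.normSq_eq_norm_sq, h, one_pow]

theorem trigKernel_self (S : Finset (ℤ × ℤ)) (x : T2) : trigKernel S cov id x x = sumCov S := by
  simp only [trigKernel, id_eq, cosC_sq_add_sinC_sq, mul_one, sumCov]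

/-- Over a symmetric set the kernel equals ∑ cov(k) χ_k(x) conj(χ_k(y)), since the imaginary part is
odd. Multiplicativity of the characters χ_k then expands its powers. -/
theorem IsSymm.trigKernel_pow {S : Finset (ℤ × ℤ)} (hS : IsSymm S) (n : ℕ) (x y : T2) :
    trigKernel S cov id x y ^ n = trigKernel (Fintype.piFinset fun _ : Fin n => S)
      (fun f => ∏ i, cov (f i)) (fun f => ∑ i, f i) x y := by
  have hre : ∀ k, (char k x * conj (char k y)).re =
      cosC k x * cosC k y + sinC k x * sinC k y := fun k => by
    rw [Complex.mul_re, Complex.conj_re, Complex.conj_im]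
    simp only [cosC_apply, sinC_apply]
    ring
  have him : ∀ k, (char k x * conj (char k y)).im =
      sinC k x * cosC k y - cosC k x * sinC k y := fun k => by
    rw [Complex.mul_im, Complex.conj_re, Complex.conj_im]
    simp only [cosC_apply, sinC_apply]
    ring
  have h1 : ((trigKernel S cov id x y : ℝ) : ℂ) =
      ∑ k ∈ S, (cov k : ℂ) * (char k x * conj (char k y)) := by
    refine Complex.ext ?_ ?_
    · rw [Complex.ofReal_re, Complex.re_sum, trigKernel]
      simp only [Complex.re_ofReal_mul, hre, id_eq]
    · rw [Complex.ofReal_im, Complex.im_sum]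
      simp only [Complex.im_ofReal_mul, him]
      refine (hS.sum_odd fun k => ?_).symm
      rw [cosC_neg, cosC_neg, sinC_neg, sinC_neg, cov_neg]
      ring
  have h2 : ((trigKernel S cov id x y ^ n : ℝ) : ℂ) =
      ∑ f ∈ Fintype.piFinset fun _ : Fin n => S, ((∏ i, cov (f i) : ℝ) : ℂ) *
        (char (∑ i, f i) x * conj (char (∑ i, f i) y)) := by
    rw [Complex.ofReal_pow, h1, Finset.sum_pow']
    refine Finset.sum_congr rfl fun f _ => ?_
    rw [Finset.prod_mul_distrib, Finset.prod_mul_distrib, char_sum, char_sum, map_prod,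
      Complex.ofReal_prod]
  have h3 := congrArg Complex.re h2
  rw [Complex.ofReal_re, Complex.re_sum] at h3
  rw [h3, trigKernel]
  simp only [Complex.re_ofReal_mul, hre]

/-- The truncated field as a function of its Gaussian coordinates. -/
def fieldMap (U S : Finset (ℤ × ℤ)) : EuclideanSpace ℝ U →L[ℝ] C(T2, ℝ) :=
  LinearMap.toContinuousLinearMap
    { toFun := fun w => ∑ k : U, w k • (if (k : ℤ × ℤ) ∈ S then basisFn k else 0)
      map_add' := fun w w' => by
        simp only [PiLp.add_apply, add_smul, Finset.sum_add_distrib]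
      map_smul' := fun c w => by
        simp only [PiLp.smul_apply, RingHom.id_apply, smul_eq_mul, mul_smul, Finset.smul_sum] }

theorem fieldMap_apply (U S : Finset (ℤ × ℤ)) (w : EuclideanSpace ℝ U) :
    fieldMap U S w = ∑ k : U, w k • (if (k : ℤ × ℤ) ∈ S then basisFn k else 0) := rfl

/-- The vector representing the evaluation of the field at a point. -/
def fieldPt (U S : Finset (ℤ × ℤ)) (x : T2) : EuclideanSpace ℝ U :=
  WithLp.toLp 2 fun k => if (k : ℤ × ℤ) ∈ S then basisFn k x else 0

theorem inner_fieldPt (U S : Finset (ℤ × ℤ)) (x : T2) (w : EuclideanSpace ℝ U) :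
    inner ℝ (fieldPt U S x) w = fieldMap U S w x := by
  rw [fieldMap_apply, ContinuousMap.sum_apply, PiLp.inner_apply]
  refine Finset.sum_congr rfl fun k _ => ?_
  simp only [fieldPt, RCLike.inner_apply, conj_trivial, ContinuousMap.smul_apply, smul_eq_mul]
  split_ifs <;> simp

theorem inner_fieldPt_fieldPt {U S T : Finset (ℤ × ℤ)} (hSU : S ⊆ U) (hS : IsSymm S)
    (hT : IsSymm T) (x y : T2) :
    inner ℝ (fieldPt U S x) (fieldPt U T y) = trigKernel (S ∩ T) cov id x y := by
  rw [← (hS.inter hT).sum_basisFn, PiLp.inner_apply]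
  have h1 : ∀ k : U, inner ℝ (fieldPt U S x k) (fieldPt U T y k) =
      if (k : ℤ × ℤ) ∈ S ∩ T then basisFn k x * basisFn k y else 0 := by
    intro k
    simp only [fieldPt, RCLike.inner_apply, conj_trivial, Finset.mem_inter]
    by_cases h1 : (k : ℤ × ℤ) ∈ S <;> by_cases h2 : (k : ℤ × ℤ) ∈ T <;> simp [h1, h2, mul_comm]
  simp only [h1]
  rw [Finset.sum_coe_sort U (fun k => if k ∈ S ∩ T then basisFn k x * basisFn k y else 0),
    ← Finset.sum_filter]
  refine Finset.sum_congr ?_ fun _ _ => rfl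
  ext k
  simp only [Finset.mem_filter, Finset.mem_inter]
  exact ⟨fun h => h.2, fun h => ⟨hSU h.1, h⟩⟩

theorem norm_fieldPt_sq {U S : Finset (ℤ × ℤ)} (hSU : S ⊆ U) (hS : IsSymm S) (x : T2) :
    ‖fieldPt U S x‖ ^ 2 = sumCov S := by
  rw [← real_inner_self_eq_norm_sq, inner_fieldPt_fieldPt hSU hS hS, Finset.inter_self,
    trigKernel_self]

/-! ### Wick powers and Wick trigonometric functions of a field -/

/-- The Wick power, as a continuous function on the line. -/
def wickC (v : ℝ) (n : ℕ) : C(ℝ, ℝ) := ⟨wick v n, continuous_wick v n⟩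

/-- The Wick cosine (for `false`) and sine (for `true`), as continuous functions on the line. -/
def oscC (v a : ℝ) : Bool → C(ℝ, ℝ)
  | false => ⟨fun y => Real.cos (a * y) * Real.exp ((a * √v) ^ 2 / 2), by fun_prop⟩
  | true => ⟨fun y => Real.sin (a * y) * Real.exp ((a * √v) ^ 2 / 2), by fun_prop⟩

/-- The degree of the `n`-th term of the cosine and sine series. -/
def oscDeg : Bool → ℕ → ℕ
  | false, n => 2 * n
  | true, n => 2 * n + 1

theorem oscDeg_injective (i : Bool) : Function.Injective (oscDeg i) := by
  cases i <;> intro m n h <;> simp only [oscDeg] at h <;> omega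

/-- The coefficients of the cosine and sine series. -/
def oscCoef (a : ℝ) (i : Bool) (n : ℕ) : ℝ :=
  (-1) ^ n * a ^ (oscDeg i n) / ((oscDeg i n).factorial : ℝ)

theorem abs_oscCoef (a : ℝ) (i : Bool) (n : ℕ) :
    |oscCoef a i n| = |a| ^ (oscDeg i n) / (oscDeg i n).factorial := by
  rw [oscCoef, abs_div, abs_mul, abs_pow, abs_pow, abs_neg, abs_one, one_pow, one_mul, Nat.abs_cast]

theorem hasSum_oscC {v : ℝ} (hv : 0 < v) (a : ℝ) (i : Bool) (y : ℝ) :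
    HasSum (fun n => oscCoef a i n * wick v (oscDeg i n) y) (oscC v a i y) := by
  have h0 : √v ≠ 0 := (Real.sqrt_pos.2 hv).ne'
  have h1 : √v ^ 2 = v := Real.sq_sqrt hv.le
  cases i
  · have := hasSum_wick_cos h0 a y
    rw [h1] at this
    exact this
  · have := hasSum_wick_sin h0 a y
    rw [h1] at this
    exact this

theorem norm_wickC_comp_le (v : ℝ) (n : ℕ) (f : C(T2, ℝ)) :
    ‖(wickC v n).comp f‖ ≤ √(n.factorial) * (‖f‖ + |v| + 1) ^ n :=
  (ContinuousMap.norm_le _ (by positivity)).2 fun x => abs_wick_le v n (f.norm_coe_le_norm x)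

theorem norm_oscC_comp_le (v a : ℝ) (i : Bool) (f : C(T2, ℝ)) :
    ‖(oscC v a i).comp f‖ ≤ Real.exp ((a * √v) ^ 2 / 2) := by
  refine (ContinuousMap.norm_le _ (Real.exp_pos _).le).2 fun x => ?_
  cases i
  · change |Real.cos (a * f x) * Real.exp ((a * √v) ^ 2 / 2)| ≤ _
    rw [abs_mul, abs_of_pos (Real.exp_pos _)]
    exact mul_le_of_le_one_left (Real.exp_pos _).le (Real.abs_cos_le_one _)
  · change |Real.sin (a * f x) * Real.exp ((a * √v) ^ 2 / 2)| ≤ _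
    rw [abs_mul, abs_of_pos (Real.exp_pos _)]
    exact mul_le_of_le_one_left (Real.exp_pos _).le (Real.abs_sin_le_one _)

/-- Writing the term as ((2y)ⁿ/√n!) · 2⁻ⁿ bounds it by the sum of the two squares, an exponential
and a geometric term. -/
theorem summable_pow_div_sqrt_factorial {y : ℝ} (hy : 0 ≤ y) :
    Summable fun n : ℕ => y ^ n / √(n.factorial) := by
  have h1 := Real.summable_pow_div_factorial ((2 * y) ^ 2)
  have h2 := summable_geometric_of_lt_one (r := (1 / 4 : ℝ)) (by norm_num) (by norm_num)
  refine Summable.of_nonneg_of_le (fun n => by positivity) (fun n => ?_) (h1.add h2)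
  have hf : 0 < √(n.factorial : ℝ) := Real.sqrt_pos.2 (by positivity)
  have e1 : ((2 * y) ^ 2) ^ n / n.factorial = ((2 * y) ^ n / √(n.factorial)) ^ 2 := by
    rw [div_pow, Real.sq_sqrt (by positivity), ← pow_mul, ← pow_mul, mul_comm 2 n]
  have e2 : (1 / 4 : ℝ) ^ n = ((1 / 2 : ℝ) ^ n) ^ 2 := by
    rw [← pow_mul, mul_comm n 2, pow_mul]; norm_num
  have e3 : y ^ n / √(n.factorial) = ((2 * y) ^ n / √(n.factorial)) * (1 / 2 : ℝ) ^ n := by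
    rw [div_mul_eq_mul_div, ← mul_pow]
    congr 2; ring
  rw [e1, e2, e3]
  nlinarith [sq_nonneg ((2 * y) ^ n / √(n.factorial) - (1 / 2 : ℝ) ^ n),
    sq_nonneg ((2 * y) ^ n / √(n.factorial)), sq_nonneg ((1 / 2 : ℝ) ^ n)]

/-- Convergence is in sup norm on the torus for each fixed field, so it survives any continuous
linear map out of C(T²). -/
theorem hasSum_oscC_comp {v : ℝ} (hv : 0 < v) (a : ℝ) (i : Bool) (f : C(T2, ℝ)) :
    HasSum (fun n => oscCoef a i n • (wickC v (oscDeg i n)).comp f) ((oscC v a i).comp f) := by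
  have hs : Summable fun n => oscCoef a i n • (wickC v (oscDeg i n)).comp f := by
    have h1 := (summable_pow_div_sqrt_factorial (y := |a| * (‖f‖ + |v| + 1)) (by positivity)).comp_injective
      (oscDeg_injective i)
    refine Summable.of_norm_bounded h1 fun n => ?_
    rw [norm_smul, Real.norm_eq_abs, abs_oscCoef]
    simp only [Function.comp_apply]
    set m := oscDeg i n
    have hf : 0 < √(m.factorial : ℝ) := Real.sqrt_pos.2 (by positivity)
    calc |a| ^ m / m.factorial * ‖(wickC v m).comp f‖ ≤
        |a| ^ m / m.factorial * (√(m.factorial) * (‖f‖ + |v| + 1) ^ m) := by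
          gcongr; exact norm_wickC_comp_le v m f
      _ = _ := by
          rw [mul_pow]
          have : (m.factorial : ℝ) = √(m.factorial : ℝ) * √(m.factorial : ℝ) :=
            (Real.mul_self_sqrt (by positivity)).symm
          rw [div_mul_eq_mul_div, div_eq_div_iff (by positivity) hf.ne']
          nth_rewrite 3 [this]
          ring
  have h := hs.hasSum
  have e1 : ∑' n, oscCoef a i n • (wickC v (oscDeg i n)).comp f = (oscC v a i).comp f := by
    ext x
    exact ((ContinuousMap.evalCLM ℝ x).hasSum h).unique (hasSum_oscC hv a i (f x))
  rwa [e1] at h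

section GaussianSpace

variable (U S : Finset (ℤ × ℤ))

theorem continuous_comp_fieldMap (g : C(ℝ, ℝ)) : Continuous fun w => g.comp (fieldMap U S w) :=
  (ContinuousMap.continuous_postcomp g).comp (fieldMap U S).continuous

theorem polyBdd_wickC (v : ℝ) (n : ℕ) : PolyBdd fun w => (wickC v n).comp (fieldMap U S w) := by
  refine ⟨√(n.factorial) * (‖fieldMap U S‖ + |v| + 1) ^ n, n, by positivity,
    fun w => (norm_wickC_comp_le v n _).trans ?_⟩
  rw [mul_assoc, ← mul_pow]
  have h1 := (fieldMap U S).le_opNorm w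
  gcongr
  nlinarith [norm_nonneg w, norm_nonneg (fieldMap U S), abs_nonneg v,
    mul_nonneg (abs_nonneg v) (norm_nonneg w)]

theorem polyBdd_oscC (v a : ℝ) (i : Bool) :
    PolyBdd fun w => (oscC v a i).comp (fieldMap U S w) :=
  ⟨Real.exp ((a * √v) ^ 2 / 2), 0, (Real.exp_pos _).le, fun w => by
    rw [pow_zero, mul_one]; exact norm_oscC_comp_le v a i _⟩

variable {U S} {T : Finset (ℤ × ℤ)}

/-- An empty index set encodes the orthogonality of different degrees, so a single kernel formula
covers both cases. -/
theorem integral_wickC_mul_wickC (hSU : S ⊆ U) (hTU : T ⊆ U) (hS : IsSymm S) (hT : IsSymm T)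
    (n m : ℕ) (x y : T2) :
    ∫ w, (wickC (sumCov S) n).comp (fieldMap U S w) x * (wickC (sumCov T) m).comp (fieldMap U T w) y
      ∂(stdGaussian (EuclideanSpace ℝ U)) =
      trigKernel (if n = m then Fintype.piFinset fun _ : Fin n => S ∩ T else ∅)
        (fun f => n.factorial * ∏ i, cov (f i)) (fun f => ∑ i, f i) x y := by
  have h := integral_wick_inner_mul_wick_inner (fieldPt U S x) (fieldPt U T y) n m
  rw [norm_fieldPt_sq hSU hS, norm_fieldPt_sq hTU hT, inner_fieldPt_fieldPt hSU hS hT] at h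
  simp only [inner_fieldPt] at h
  refine h.trans ?_
  split_ifs with hnm
  · rw [(hS.inter hT).trigKernel_pow, trigKernel, trigKernel, Finset.mul_sum]
    exact Finset.sum_congr rfl fun f _ => by ring
  · rfl

theorem integral_wickC_rotation (hSU : S ⊆ U) (hS : IsSymm S) {c : ℝ} (hc0 : 0 < c) (hc1 : c ≤ 1)
    (n : ℕ) (w : EuclideanSpace ℝ U) (x : T2) :
    ∫ w', (wickC (sumCov S) n).comp (fieldMap U S (c • w + √(1 - c ^ 2) • w')) x
      ∂(stdGaussian (EuclideanSpace ℝ U)) =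
      c ^ n * (wickC (sumCov S) n).comp (fieldMap U S w) x := by
  have h := integral_wick_inner_rotation (fieldPt U S x) w hc0 hc1 n
  rw [norm_fieldPt_sq hSU hS] at h
  simp only [inner_fieldPt] at h
  exact h

theorem integral_oscC_rotation (hSU : S ⊆ U) (hS : IsSymm S) {c : ℝ} (hc0 : 0 < c) (hc1 : c ≤ 1)
    (a : ℝ) (i : Bool) (w : EuclideanSpace ℝ U) (x : T2) :
    ∫ w', (oscC (sumCov S) a i).comp (fieldMap U S (c • w + √(1 - c ^ 2) • w')) x
      ∂(stdGaussian (EuclideanSpace ℝ U)) =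
      (oscC (sumCov S) (a * c) i).comp (fieldMap U S w) x := by
  have hn : ‖fieldPt U S x‖ = √(sumCov S) := by
    rw [← norm_fieldPt_sq hSU hS x, Real.sqrt_sq (norm_nonneg _)]
  cases i
  · have h := integral_cos_inner_rotation (fieldPt U S x) w hc0 hc1 a
    rw [hn] at h
    simp only [inner_fieldPt] at h
    exact h
  · have h := integral_sin_inner_rotation (fieldPt U S x) w hc0 hc1 a
    rw [hn] at h
    simp only [inner_fieldPt] at h
    exact h

end GaussianSpace

/-! ### The field on a probability space carrying white noise -/

/-- `η` is a family of independent standard Gaussian variables. -/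
structure IsWhiteNoise {Ω : Type} [MeasurableSpace Ω] (μ : Measure Ω) (η : ℤ × ℤ → Ω → ℝ) :
    Prop where
  measurable : ∀ k, Measurable (η k)
  law : ∀ U : Finset (ℤ × ℤ), μ.map (fun z => (WithLp.toLp 2 fun k : U => η k z :
    EuclideanSpace ℝ U)) = stdGaussian (EuclideanSpace ℝ U)

section WhiteNoise

variable {Ω : Type}

/-- The truncated field. -/
def field (η : ℤ × ℤ → Ω → ℝ) (S : Finset (ℤ × ℤ)) (z : Ω) : C(T2, ℝ) :=
  ∑ k ∈ S, η k z • basisFn k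

/-- Realizes fields with different truncations on the common Gaussian space of any larger set U,
where moments and rotations are computed. -/
theorem field_eq_fieldMap (η : ℤ × ℤ → Ω → ℝ) {S U : Finset (ℤ × ℤ)} (hSU : S ⊆ U) (z : Ω) :
    field η S z = fieldMap U S (WithLp.toLp 2 fun k : U => η k z) := by
  rw [fieldMap_apply, field]
  simp only [smul_ite, smul_zero]
  rw [Finset.sum_coe_sort U (fun k => if k ∈ S then η k z • basisFn k else 0),
    ← Finset.sum_filter]
  refine Finset.sum_congr ?_ fun _ _ => rfl
  ext k
  simp only [Finset.mem_filter]
  exact ⟨fun h => ⟨hSU h, h⟩, fun h => h.2⟩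

/-- The Wick power of the truncated field. -/
def wickField (η : ℤ × ℤ → Ω → ℝ) (S : Finset (ℤ × ℤ)) (n : ℕ) (z : Ω) : C(T2, ℝ) :=
  (wickC (sumCov S) n).comp (field η S z)

/-- The Wick cosine and sine of the truncated field. -/
def oscField (η : ℤ × ℤ → Ω → ℝ) (S : Finset (ℤ × ℤ)) (a : ℝ) (i : Bool) (z : Ω) : C(T2, ℝ) :=
  (oscC (sumCov S) a i).comp (field η S z)

variable [MeasurableSpace Ω] {μ : Measure Ω} {η : ℤ × ℤ → Ω → ℝ} (hη : IsWhiteNoise μ η)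
  {𝒦 : Type} [NormedAddCommGroup 𝒦] [InnerProductSpace ℝ 𝒦] (J : C(T2, ℝ) →L[ℝ] 𝒦)
  {S T : Finset (ℤ × ℤ)}

include hη

theorem IsWhiteNoise.measurePreserving (U : Finset (ℤ × ℤ)) :
    MeasurePreserving (fun z => (WithLp.toLp 2 fun k : U => η k z : EuclideanSpace ℝ U)) μ
      (stdGaussian (EuclideanSpace ℝ U)) :=
  ⟨(WithLp.measurable_toLp 2 _).comp (measurable_pi_lambda _ fun k => hη.measurable k), hη.law U⟩

theorem memLp_wickField (S : Finset (ℤ × ℤ)) (n : ℕ) {q : ℝ≥0∞} (hq : q ≠ ⊤) :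
    MemLp (fun z => J (wickField η S n z)) q μ := by
  have h := (((polyBdd_wickC S S (sumCov S) n).clm_comp J).memLp
    (J.continuous.comp (continuous_comp_fieldMap S S _)) hq).comp_measurePreserving
      (hη.measurePreserving S)
  refine h.ae_eq (Eventually.of_forall fun z => ?_)
  simp only [Function.comp_apply, wickField, field_eq_fieldMap η (Finset.Subset.refl S)]

theorem memLp_oscField (S : Finset (ℤ × ℤ)) (a : ℝ) (i : Bool) {q : ℝ≥0∞} (hq : q ≠ ⊤) :
    MemLp (fun z => J (oscField η S a i z)) q μ := by
  have h := (((polyBdd_oscC S S (sumCov S) a i).clm_comp J).memLp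
    (J.continuous.comp (continuous_comp_fieldMap S S _)) hq).comp_measurePreserving
      (hη.measurePreserving S)
  refine h.ae_eq (Eventually.of_forall fun z => ?_)
  simp only [Function.comp_apply, oscField, field_eq_fieldMap η (Finset.Subset.refl S)]

theorem integral_inner_wickField {ι : Type} [Countable ι] {l l' : ι → C(T2, ℝ) →L[ℝ] ℝ}
    (hJ : IsFrame J l l') (hS : IsSymm S) (hT : IsSymm T) (n m : ℕ) :
    ∫ z, inner ℝ (J (wickField η S n z)) (J (wickField η T m z)) ∂μ =
      if n = m then n.factorial * convSum (S ∩ T) (weight J) n else 0 := by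
  set U := S ∪ T
  have hSU : S ⊆ U := Finset.subset_union_left
  have hTU : T ⊆ U := Finset.subset_union_right
  have h := integral_inner_of_kernel hJ (continuous_comp_fieldMap U S (wickC (sumCov S) n))
    (polyBdd_wickC U S (sumCov S) n) (continuous_comp_fieldMap U T (wickC (sumCov T) m))
    (polyBdd_wickC U T (sumCov T) m) (integral_wickC_mul_wickC hSU hTU hS hT n m)
  have hmp := hη.measurePreserving U
  have hc : Continuous fun w : EuclideanSpace ℝ U =>
      inner ℝ (J ((wickC (sumCov S) n).comp (fieldMap U S w)))
        (J ((wickC (sumCov T) m).comp (fieldMap U T w))) :=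
    (J.continuous.comp (continuous_comp_fieldMap U S _)).inner
      (J.continuous.comp (continuous_comp_fieldMap U T _))
  rw [← hmp.map_eq, integral_map hmp.measurable.aemeasurable hc.aestronglyMeasurable] at h
  simp only [wickField, field_eq_fieldMap η hSU, field_eq_fieldMap η hTU]
  rw [h]
  split_ifs
  · rw [convSum, Finset.mul_sum]
    exact Finset.sum_congr rfl fun f _ => by ring
  · simp

/-- A difference of Wick powers of the same degree n is still an eigenvector of the Mehler operator
with eigenvalue cⁿ. Undoing c = (p - 1)^{-1/2} costs (p - 1)^{n/2}, independently of the
truncations. -/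
theorem eLpNorm_wickField_sub_le [CompleteSpace 𝒦] {p : ℝ} (hp : 2 < p) (hS : IsSymm S)
    (hT : IsSymm T) (n : ℕ) :
    eLpNorm (fun z => J (wickField η S n z) - J (wickField η T n z)) (ENNReal.ofReal p) μ ≤
      ENNReal.ofReal (√(p - 1) ^ n) *
        eLpNorm (fun z => J (wickField η S n z) - J (wickField η T n z)) 2 μ := by
  set U := S ∪ T
  have hSU : S ⊆ U := Finset.subset_union_left
  have hTU : T ⊆ U := Finset.subset_union_right
  set r := √(p - 1) with hr
  have hr1 : 1 ≤ r := Real.one_le_sqrt.2 (by linarith)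
  have hr0 : 0 < r := one_pos.trans_le hr1
  have hc0 : 0 < r⁻¹ := inv_pos.2 hr0
  have hc1 : r⁻¹ ≤ 1 := inv_le_one_of_one_le₀ hr1
  set F : EuclideanSpace ℝ U → C(T2, ℝ) := fun w => (wickC (sumCov S) n).comp (fieldMap U S w) -
    (wickC (sumCov T) n).comp (fieldMap U T w) with hF
  have hFc : Continuous F :=
    (continuous_comp_fieldMap U S _).sub (continuous_comp_fieldMap U T _)
  have hFb : PolyBdd F := (polyBdd_wickC U S _ n).sub (polyBdd_wickC U T _ n)
  have hi : ∀ (S' : Finset (ℤ × ℤ)) (w : EuclideanSpace ℝ U) (x : T2),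
      Integrable (fun w' => (wickC (sumCov S') n).comp
        (fieldMap U S' (r⁻¹ • w + √(1 - r⁻¹ ^ 2) • w')) x) (stdGaussian (EuclideanSpace ℝ U)) := by
    intro S' w x
    refine (((polyBdd_wickC U S' (sumCov S') n).rotate (c := r⁻¹) (s := √(1 - r⁻¹ ^ 2)) ?_ ?_
      w).clm_comp (ContinuousMap.evalCLM ℝ x)).integrable ?_
    · rw [abs_of_pos hc0]; exact hc1
    · rw [abs_of_nonneg (Real.sqrt_nonneg _)]
      exact Real.sqrt_le_one.2 (by nlinarith)
    · exact (ContinuousMap.evalCLM ℝ x).continuous.comp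
        ((continuous_comp_fieldMap U S' _).comp (by fun_prop))
  have hmain := eLpNorm_le_of_rotation hp J (F := F) (F' := fun w => (r⁻¹ ^ n) • F w) hFc hFb
    (fun w x => by
      simp only [hF, ContinuousMap.sub_apply, ContinuousMap.smul_apply, smul_eq_mul]
      rw [integral_sub (hi S w x) (hi T w x), integral_wickC_rotation hSU hS hc0 hc1,
        integral_wickC_rotation hTU hT hc0 hc1]
      ring)
  have hsm : eLpNorm (fun w => J (F w)) (ENNReal.ofReal p) (stdGaussian (EuclideanSpace ℝ U)) ≤
      ENNReal.ofReal (r ^ n) * eLpNorm (fun w => J (F w)) 2 (stdGaussian (EuclideanSpace ℝ U)) := by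
    have e1 : (fun w => J (F w)) = (r ^ n) • fun w => J ((r⁻¹ ^ n) • F w) := by
      funext w
      rw [Pi.smul_apply, map_smul, smul_smul, ← mul_pow, mul_inv_cancel₀ hr0.ne', one_pow, one_smul]
    nth_rewrite 1 [e1]
    rw [eLpNorm_const_smul, Real.enorm_of_nonneg (by positivity)]
    gcongr
  have hmp := hη.measurePreserving U
  have hms : AEStronglyMeasurable (fun w => J (F w)) (stdGaussian (EuclideanSpace ℝ U)) :=
    (J.continuous.comp hFc).aestronglyMeasurable
  rw [← eLpNorm_comp_measurePreserving hms hmp, ← eLpNorm_comp_measurePreserving hms hmp] at hsm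
  have e2 : (fun z => J (wickField η S n z) - J (wickField η T n z)) =
      (fun w => J (F w)) ∘ fun z => (WithLp.toLp 2 fun k : U => η k z : EuclideanSpace ℝ U) := by
    funext z
    simp only [Function.comp_apply, hF, wickField, field_eq_fieldMap η hSU,
      field_eq_fieldMap η hTU, map_sub]
  rw [e2]
  exact hsm

/-- The Mehler operator with c = (p - 1)^{-1/2} maps the parameter √(p-1) a to a, so no constant is
lost, only range of the parameter. -/
theorem eLpNorm_oscField_le [CompleteSpace 𝒦] {p : ℝ} (hp : 2 < p) (hS : IsSymm S) (a : ℝ)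
    (i : Bool) :
    eLpNorm (fun z => J (oscField η S a i z)) (ENNReal.ofReal p) μ ≤
      eLpNorm (fun z => J (oscField η S (√(p - 1) * a) i z)) 2 μ := by
  set r := √(p - 1) with hr
  have hr1 : 1 ≤ r := Real.one_le_sqrt.2 (by linarith)
  have hr0 : 0 < r := one_pos.trans_le hr1
  have hsm := eLpNorm_le_of_rotation hp J
    (F := fun w => (oscC (sumCov S) (r * a) i).comp (fieldMap S S w))
    (F' := fun w => (oscC (sumCov S) a i).comp (fieldMap S S w))
    (continuous_comp_fieldMap S S _) (polyBdd_oscC S S _ _ i) (fun w x => by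
      rw [integral_oscC_rotation (Finset.Subset.refl S) hS (inv_pos.2 hr0)
        (inv_le_one_of_one_le₀ hr1)]
      rw [mul_right_comm, mul_inv_cancel₀ hr0.ne', one_mul])
  have hmp := hη.measurePreserving S
  have hms : ∀ b, AEStronglyMeasurable (fun w => J ((oscC (sumCov S) b i).comp (fieldMap S S w)))
      (stdGaussian (EuclideanSpace ℝ S)) := fun b =>
    (J.continuous.comp (continuous_comp_fieldMap S S _)).aestronglyMeasurable
  rw [← eLpNorm_comp_measurePreserving (hms _) hmp,
    ← eLpNorm_comp_measurePreserving (hms _) hmp] at hsm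
  simp only [oscField, field_eq_fieldMap η (Finset.Subset.refl S)]
  exact hsm

end WhiteNoise

end Torus

end

noncomputable section

namespace OrthogonalNet

variable {𝓗 : Type} [NormedAddCommGroup 𝓗] [InnerProductSpace ℝ 𝓗]

/-! ### Orthogonal series -/

theorem norm_sum_sq {y : ℕ → 𝓗} (h : ∀ n m, n ≠ m → inner ℝ (y n) (y m) = 0) (s : Finset ℕ) :
    ‖∑ n ∈ s, y n‖ ^ 2 = ∑ n ∈ s, ‖y n‖ ^ 2 := by
  rw [← real_inner_self_eq_norm_sq, sum_inner]
  refine Finset.sum_congr rfl fun n hn => ?_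
  rw [inner_sum, Finset.sum_eq_single_of_mem n hn fun m _ hm => h n m hm.symm,
    real_inner_self_eq_norm_sq]

theorem hasSum_norm_sq {y : ℕ → 𝓗} (h : ∀ n m, n ≠ m → inner ℝ (y n) (y m) = 0) {w : 𝓗}
    (hw : HasSum y w) : HasSum (fun n => ‖y n‖ ^ 2) (‖w‖ ^ 2) := by
  have h1 : Tendsto (fun s : Finset ℕ => ‖∑ n ∈ s, y n‖ ^ 2) atTop (𝓝 (‖w‖ ^ 2)) :=
    (Tendsto.norm hw).pow 2
  simp only [norm_sum_sq h] at h1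
  exact h1

theorem summable_of_summable_norm_sq [CompleteSpace 𝓗] {y : ℕ → 𝓗}
    (h : ∀ n m, n ≠ m → inner ℝ (y n) (y m) = 0) (hy : Summable fun n => ‖y n‖ ^ 2) :
    Summable y := by
  rw [summable_iff_vanishing_norm]
  intro ε hε
  obtain ⟨s, hs⟩ := summable_iff_vanishing_norm.1 hy (ε ^ 2) (by positivity)
  refine ⟨s, fun t ht => ?_⟩
  have h1 := hs t ht
  rw [← norm_sum_sq h, Real.norm_of_nonneg (by positivity)] at h1
  exact lt_of_pow_lt_pow_left₀ 2 hε.le h1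

/-! ### Orthogonal nets with monotone norms -/

/-- A sequence of mutually orthogonal nets with orthogonal increments. -/
structure IsOrthogonalNet {I : Type} [Preorder I] (x : ℕ → I → 𝓗) (r : ℕ → I → ℝ) : Prop where
  inner_eq : ∀ n S T, S ≤ T → inner ℝ (x n S) (x n T) = r n S
  inner_ne : ∀ n m S T, n ≠ m → inner ℝ (x n S) (x m T) = 0

variable {I : Type} [SemilatticeSup I] {x : ℕ → I → 𝓗} {r : ℕ → I → ℝ}

namespace IsOrthogonalNet

theorem norm_sq (h : IsOrthogonalNet x r) (n : ℕ) (S : I) : ‖x n S‖ ^ 2 = r n S := by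
  rw [← real_inner_self_eq_norm_sq, h.inner_eq n S S le_rfl]

theorem norm_sub_sq (h : IsOrthogonalNet x r) (n : ℕ) {S T : I} (hST : S ≤ T) :
    ‖x n T - x n S‖ ^ 2 = r n T - r n S := by
  rw [norm_sub_sq_real, real_inner_comm, h.inner_eq n S T hST, h.norm_sq, h.norm_sq]
  ring

theorem monotone (h : IsOrthogonalNet x r) (n : ℕ) : Monotone (r n) := fun S T hST => by
  have := h.norm_sub_sq n hST
  nlinarith [sq_nonneg ‖x n T - x n S‖]

theorem smul_comp (h : IsOrthogonalNet x r) (c : ℕ → ℝ) {d : ℕ → ℕ} (hd : Function.Injective d) :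
    IsOrthogonalNet (fun n S => c n • x (d n) S) fun n S => c n ^ 2 * r (d n) S where
  inner_eq n S T hST := by
    rw [inner_smul_left, inner_smul_right, h.inner_eq _ S T hST, conj_trivial]; ring
  inner_ne n m S T hnm := by
    rw [inner_smul_left, inner_smul_right, h.inner_ne _ _ S T (hd.ne hnm), mul_zero, mul_zero]

/-- Squared increments are differences of the monotone bounded function r n, so the net is Cauchy.
-/
theorem exists_tendsto [Nonempty I] [CompleteSpace 𝓗] (h : IsOrthogonalNet x r) (n : ℕ)
    (hb : BddAbove (Set.range (r n))) : ∃ y, Tendsto (x n) atTop (𝓝 y) := by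
  refine cauchySeq_tendsto_of_complete (Metric.cauchySeq_iff'.2 fun ε hε => ?_)
  have hlim := tendsto_atTop_ciSup (h.monotone n) hb
  have hε2 : 0 < ε ^ 2 := by positivity
  obtain ⟨S, hS⟩ := (hlim.eventually (lt_mem_nhds (sub_lt_self _ hε2))).exists
  refine ⟨S, fun T hT => ?_⟩
  rw [dist_eq_norm]
  refine lt_of_pow_lt_pow_left₀ 2 hε.le ?_
  rw [h.norm_sub_sq n hT]
  have := le_ciSup hb T
  linarith

variable {y : ℕ → 𝓗}

theorem inner_lim [Nonempty I] (h : IsOrthogonalNet x r) (hy : ∀ n, Tendsto (x n) atTop (𝓝 (y n))) {n m : ℕ}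
    (hnm : n ≠ m) : inner ℝ (y n) (y m) = 0 :=
  tendsto_nhds_unique ((hy n).inner (hy m))
    (tendsto_const_nhds.congr fun S => (h.inner_ne n m S S hnm).symm)

theorem inner_lim_left [Nonempty I] (h : IsOrthogonalNet x r) (hy : ∀ n, Tendsto (x n) atTop (𝓝 (y n)))
    {n m : ℕ} (hnm : n ≠ m) (S : I) : inner ℝ (y n) (x m S) = 0 :=
  tendsto_nhds_unique ((hy n).inner tendsto_const_nhds)
    (tendsto_const_nhds.congr fun T => (h.inner_ne n m T S hnm).symm)

theorem tendsto_norm_sq [Nonempty I] (h : IsOrthogonalNet x r) (hy : ∀ n, Tendsto (x n) atTop (𝓝 (y n)))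
    (n : ℕ) : Tendsto (r n) atTop (𝓝 (‖y n‖ ^ 2)) :=
  ((hy n).norm.pow 2).congr fun S => h.norm_sq n S

theorem norm_lim_sub_sq [Nonempty I] (h : IsOrthogonalNet x r) (hy : ∀ n, Tendsto (x n) atTop (𝓝 (y n)))
    (n : ℕ) (S : I) : ‖y n - x n S‖ ^ 2 = ‖y n‖ ^ 2 - r n S := by
  have h1 : Tendsto (fun T => ‖x n T - x n S‖ ^ 2) atTop (𝓝 (‖y n - x n S‖ ^ 2)) :=
    ((hy n).sub_const _).norm.pow 2
  refine tendsto_nhds_unique h1 (((h.tendsto_norm_sq hy n).sub_const (r n S)).congr' ?_)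
  filter_upwards [eventually_ge_atTop S] with T hT
  exact (h.norm_sub_sq n hT).symm

theorem summable_norm_sq_lim [Nonempty I] (h : IsOrthogonalNet x r)
    (hy : ∀ n, Tendsto (x n) atTop (𝓝 (y n))) {M : ℝ}
    (hM : ∀ S N, ∑ n ∈ Finset.range N, r n S ≤ M) : Summable fun n => ‖y n‖ ^ 2 := by
  refine summable_of_sum_range_le (c := M) (fun n => by positivity) fun N => ?_
  exact le_of_tendsto' (tendsto_finsetSum _ fun n _ => h.tendsto_norm_sq hy n) fun S => hM S N

theorem summable_lim [Nonempty I] [CompleteSpace 𝓗] (h : IsOrthogonalNet x r)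
    (hy : ∀ n, Tendsto (x n) atTop (𝓝 (y n))) {M : ℝ}
    (hM : ∀ S N, ∑ n ∈ Finset.range N, r n S ≤ M) : Summable y :=
  summable_of_summable_norm_sq (fun _ _ => h.inner_lim hy) (h.summable_norm_sq_lim hy hM)

theorem summable [CompleteSpace 𝓗] (h : IsOrthogonalNet x r) {M : ℝ}
    (hM : ∀ S N, ∑ n ∈ Finset.range N, r n S ≤ M) (S : I) : Summable fun n => x n S :=
  summable_of_summable_norm_sq (fun n m => h.inner_ne n m S S)
    (summable_of_sum_range_le (c := M) (fun n => by positivity) fun N => by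
      simpa only [h.norm_sq] using hM S N)

theorem norm_sq_le_of_hasSum (h : IsOrthogonalNet x r) {M : ℝ}
    (hM : ∀ S N, ∑ n ∈ Finset.range N, r n S ≤ M) {S : I} {X : 𝓗}
    (hX : HasSum (fun n => x n S) X) : ‖X‖ ^ 2 ≤ M := by
  have h1 := (hasSum_norm_sq (fun n m => h.inner_ne n m S S) hX).tendsto_sum_nat
  refine le_of_tendsto' h1 fun N => ?_
  simpa only [h.norm_sq] using hM S N

/-- W - X S is the orthogonal sum of the differences y n - x n S. Their squared norms tend to 0 for
each n and are dominated by the summable ‖y n‖², so dominated convergence for series applies. -/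
theorem tendsto_of_hasSum [Nonempty I] (h : IsOrthogonalNet x r)
    (hy : ∀ n, Tendsto (x n) atTop (𝓝 (y n))) {M : ℝ}
    (hM : ∀ S N, ∑ n ∈ Finset.range N, r n S ≤ M) {W : 𝓗} (hW : HasSum y W) {X : I → 𝓗}
    (hX : ∀ S, HasSum (fun n => x n S) (X S)) : Tendsto X atTop (𝓝 W) := by
  have h1 : ∀ S, HasSum (fun n => ‖y n - x n S‖ ^ 2) (‖W - X S‖ ^ 2) := fun S =>
    hasSum_norm_sq (fun n m hnm => by
      rw [inner_sub_left, inner_sub_right, inner_sub_right, h.inner_lim hy hnm,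
        h.inner_lim_left hy hnm, real_inner_comm, h.inner_lim_left hy hnm.symm,
        h.inner_ne n m S S hnm]
      simp) (hW.sub (hX S))
  have h2 : Tendsto (fun S => ∑' n, ‖y n - x n S‖ ^ 2) atTop (𝓝 (∑' _ : ℕ, (0 : ℝ))) := by
    refine tendsto_tsum_of_dominated_convergence (h.summable_norm_sq_lim hy hM) (fun n => ?_)
      (Eventually.of_forall fun S n => ?_)
    · have := ((hy n).const_sub (y n)).norm.pow 2
      simpa using this
    · rw [Real.norm_of_nonneg (by positivity), h.norm_lim_sub_sq hy]
      have := h.norm_sq n S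
      nlinarith [sq_nonneg ‖x n S‖]
  simp only [fun S => (h1 S).tsum_eq, tsum_zero] at h2
  rw [tendsto_iff_norm_sub_tendsto_zero]
  have h3 := h2.sqrt
  simp only [Real.sqrt_zero, Real.sqrt_sq (norm_nonneg _)] at h3
  simpa only [norm_sub_rev] using h3

end IsOrthogonalNet

end OrthogonalNet

end

noncomputable section

/-! ### Limits of Wick powers and Wick trigonometric functions along the net of frequency sets. -/

namespace Torus

open OrthogonalNet

/-- The nonempty finite symmetric sets of frequencies. -/
abbrev Freq : Type := {S : Finset (ℤ × ℤ) // IsSymm S ∧ S.Nonempty}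

instance : SemilatticeSup Freq :=
  Subtype.semilatticeSup fun _ _ hS hT => ⟨hS.1.union hT.1, hS.2.mono Finset.subset_union_left⟩

instance : Nonempty Freq := ⟨{0}, by simp [IsSymm], by simp⟩

theorem weight_nonneg {𝒦 : Type} [NormedAddCommGroup 𝒦] [InnerProductSpace ℝ 𝒦]
    (J : C(T2, ℝ) →L[ℝ] 𝒦) (k : ℤ × ℤ) : 0 ≤ weight J k := by
  unfold weight; positivity

section Limits

variable {Ω : Type} [MeasurableSpace Ω] {μ : Measure Ω} {η : ℤ × ℤ → Ω → ℝ}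
  {𝒦 : Type} [NormedAddCommGroup 𝒦] [InnerProductSpace ℝ 𝒦]

/-- The class in `L²` of the truncated Wick power. -/
def wickLp (hη : IsWhiteNoise μ η) (J : C(T2, ℝ) →L[ℝ] 𝒦) (n : ℕ) (S : Freq) : Lp 𝒦 2 μ :=
  (memLp_wickField hη J S.1 n (by simp : (2 : ℝ≥0∞) ≠ ⊤)).toLp _

/-- The class in `L²` of the truncated Wick cosine or sine. -/
def oscLp (hη : IsWhiteNoise μ η) (J : C(T2, ℝ) →L[ℝ] 𝒦) (a : ℝ) (i : Bool) (S : Freq) :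
    Lp 𝒦 2 μ :=
  (memLp_oscField hη J S.1 a i (by simp : (2 : ℝ≥0∞) ≠ ⊤)).toLp _

theorem coeFn_wickLp (hη : IsWhiteNoise μ η) (J : C(T2, ℝ) →L[ℝ] 𝒦) (n : ℕ) (S : Freq) :
    wickLp hη J n S =ᵐ[μ] fun z => J (wickField η S.1 n z) :=
  MemLp.coeFn_toLp _

theorem coeFn_oscLp (hη : IsWhiteNoise μ η) (J : C(T2, ℝ) →L[ℝ] 𝒦) (a : ℝ) (i : Bool) (S : Freq) :
    oscLp hη J a i S =ᵐ[μ] fun z => J (oscField η S.1 a i z) :=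
  MemLp.coeFn_toLp _

variable {ι : Type} [Countable ι] {J : C(T2, ℝ) →L[ℝ] 𝒦} {l l' : ι → C(T2, ℝ) →L[ℝ] ℝ}

theorem inner_wickLp (hη : IsWhiteNoise μ η) (hJ : IsFrame J l l') (n m : ℕ) (S T : Freq) :
    inner ℝ (wickLp hη J n S) (wickLp hη J m T) =
      if n = m then n.factorial * convSum (S.1 ∩ T.1) (weight J) n else 0 := by
  rw [← integral_inner_wickField hη J hJ S.2.1 T.2.1, L2.inner_def]
  refine integral_congr_ae ?_
  filter_upwards [coeFn_wickLp hη J n S, coeFn_wickLp hη J m T] with z h1 h2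
  rw [h1, h2]

/-- The inner product sees only the common frequencies S ∩ T, which equal S when S ⊆ T: this is the
orthogonality of increments. -/
theorem isOrthogonalNet_wickLp (hη : IsWhiteNoise μ η) (hJ : IsFrame J l l') :
    IsOrthogonalNet (wickLp hη J) fun n S => n.factorial * convSum S.1 (weight J) n where
  inner_eq n S T hST := by
    rw [inner_wickLp hη hJ, if_pos rfl, Finset.inter_eq_left.2 hST]
  inner_ne n m S T hnm := by rw [inner_wickLp hη hJ, if_neg hnm]

theorem Admissible.convSum_le {w : ℤ × ℤ → ℝ} {b : ℝ} (hw : ∀ k, 0 ≤ w k) (hb : 0 < b)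
    (h : Admissible w b) (n : ℕ) :
    BddAbove (Set.range fun S : Freq => (n.factorial : ℝ) * convSum S.1 w n) := by
  obtain ⟨M, hM⟩ := h
  refine ⟨n.factorial * (n.factorial / b ^ n * M), ?_⟩
  rintro _ ⟨S, rfl⟩
  have h1 : b ^ n / n.factorial * convSum S.1 w n ≤ M :=
    (Finset.single_le_sum (f := fun n => b ^ n / (n.factorial : ℝ) * convSum S.1 w n)
      (fun m _ => mul_nonneg (by positivity) (convSum_nonneg _ hw _))
      (Finset.self_mem_range_succ n)).trans (hM S.1 (n + 1))
  have h2 : (0 : ℝ) < n.factorial := by positivity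
  show (n.factorial : ℝ) * convSum S.1 w n ≤ _
  refine mul_le_mul_of_nonneg_left ?_ h2.le
  calc convSum S.1 w n = n.factorial / b ^ n * (b ^ n / n.factorial * convSum S.1 w n) := by
        field_simp
    _ ≤ _ := mul_le_mul_of_nonneg_left h1 (by positivity)

theorem exists_tendsto_wickLp [CompleteSpace 𝒦] (hη : IsWhiteNoise μ η) (hJ : IsFrame J l l')
    {b : ℝ} (hb : 0 < b) (h : Admissible (weight J) b) (n : ℕ) :
    ∃ y, Tendsto (wickLp hη J n) atTop (𝓝 y) :=
  (isOrthogonalNet_wickLp hη hJ).exists_tendsto n (h.convSum_le (weight_nonneg J) hb n)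

variable [IsProbabilityMeasure μ]

/-- For p ≤ 2 the L² norm dominates, the measure being a probability. For p > 2, hypercontractivity
compares two truncations S and T; letting T grow, lower semicontinuity of the L^p norm under
convergence in measure replaces the truncation T by the limit y, which is not known beforehand to
lie in L^p. -/
theorem tendsto_eLpNorm_wickLp [CompleteSpace 𝒦] (hη : IsWhiteNoise μ η) {n : ℕ} {y : Lp 𝒦 2 μ}
    (hy : Tendsto (wickLp hη J n) atTop (𝓝 y)) (p : ℝ) :
    Tendsto (fun S : Freq => eLpNorm (fun z => J (wickField η S.1 n z) - y z) (ENNReal.ofReal p) μ)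
      atTop (𝓝 0) := by
  have hmeas : ∀ S : Freq, AEStronglyMeasurable (fun z => J (wickField η S.1 n z)) μ := fun S =>
    (memLp_wickField hη J S.1 n (by simp : (2 : ℝ≥0∞) ≠ ⊤)).1
  have h2 : Tendsto (fun S : Freq => eLpNorm (fun z => J (wickField η S.1 n z) - y z) 2 μ)
      atTop (𝓝 0) := by
    rw [Lp.tendsto_Lp_iff_tendsto_eLpNorm'] at hy
    refine hy.congr fun S => eLpNorm_congr_ae ?_
    filter_upwards [coeFn_wickLp hη J n S] with z hz
    rw [Pi.sub_apply, hz]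
  rcases le_or_gt p 2 with hp | hp
  · refine tendsto_of_tendsto_of_tendsto_of_le_of_le tendsto_const_nhds h2 (fun _ => zero_le)
      fun S => eLpNorm_le_eLpNorm_of_exponent_le ?_ ((hmeas S).sub (Lp.aestronglyMeasurable y))
    rw [← ENNReal.ofReal_ofNat]; exact ENNReal.ofReal_le_ofReal hp
  have hm := tendstoInMeasure_of_tendsto_Lp hy
  have h3 : ∀ S : Freq, eLpNorm (fun z => J (wickField η S.1 n z) - y z) (ENNReal.ofReal p) μ ≤
      ENNReal.ofReal (√(p - 1) ^ n) *
        eLpNorm (fun z => J (wickField η S.1 n z) - y z) 2 μ := fun S => by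
    have hT : Tendsto (fun T : Freq => ENNReal.ofReal (√(p - 1) ^ n) *
        (eLpNorm (fun z => J (wickField η S.1 n z) - y z) 2 μ +
          eLpNorm (fun z => J (wickField η T.1 n z) - y z) 2 μ)) atTop
        (𝓝 (ENNReal.ofReal (√(p - 1) ^ n) *
        (eLpNorm (fun z => J (wickField η S.1 n z) - y z) 2 μ + 0))) :=
      ENNReal.Tendsto.const_mul (tendsto_const_nhds.add h2) (Or.inr ENNReal.ofReal_ne_top)
    rw [add_zero] at hT
    -- The bound at T is below its limit plus ε only eventually, hence the slack ε.
    refine ENNReal.le_of_forall_pos_le_add fun ε hε hlt => ?_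
    have hev := hT.eventually (gt_mem_nhds
      (ENNReal.lt_add_right hlt.ne (ENNReal.coe_pos.2 hε).ne'))
    refine eLpNorm_le_of_tendstoInMeasure (u := (atTop : Filter Freq))
      (f := fun T z => J (wickField η S.1 n z) - J (wickField η T.1 n z)) ?_ ?_
      fun T => (hmeas S).sub (hmeas T)
    · filter_upwards [hev] with T hT
      refine (eLpNorm_wickField_sub_le hη J hp S.2.1 T.2.1 n).trans (le_trans ?_ hT.le)
      gcongr
      have : (fun z => J (wickField η S.1 n z) - J (wickField η T.1 n z)) =
          (fun z => J (wickField η S.1 n z) - y z) - fun z => J (wickField η T.1 n z) - y z := by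
        ext z; simp
      rw [this]
      exact eLpNorm_sub_le ((hmeas S).sub (Lp.aestronglyMeasurable y))
        ((hmeas T).sub (Lp.aestronglyMeasurable y)) (by norm_num)
    · refine tendstoInMeasure_of_tendsto_eLpNorm (p := 2) (by simp)
        (fun T => (hmeas S).sub (hmeas T)) ((hmeas S).sub (Lp.aestronglyMeasurable y)) ?_
      refine h2.congr fun T => ?_
      rw [← eLpNorm_neg]
      congr 1
      ext z; simp
  have h4 := ENNReal.Tendsto.const_mul (a := ENNReal.ofReal (√(p - 1) ^ n)) h2
    (Or.inr ENNReal.ofReal_ne_top)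
  rw [mul_zero] at h4
  exact tendsto_of_tendsto_of_tendsto_of_le_of_le tendsto_const_nhds h4 (fun _ => zero_le) h3

theorem tendstoLp_wickField [CompleteSpace 𝒦] (hη : IsWhiteNoise μ η) {n : ℕ} {y : Lp 𝒦 2 μ}
    (hy : Tendsto (wickLp hη J n) atTop (𝓝 y)) {S : ℕ → Freq} (hS : Tendsto S atTop atTop) (p : ℝ) :
    TendstoLp (ENNReal.ofReal p) μ (fun N z => J (wickField η (S N).1 n z)) y := by
  have h1 := (tendsto_eLpNorm_wickLp (J := J) hη hy p).comp hS
  have h2 : ∀ N, MemLp (fun z => J (wickField η (S N).1 n z)) (ENNReal.ofReal p) μ := fun N =>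
    memLp_wickField hη J (S N).1 n ENNReal.ofReal_ne_top
  refine ⟨h2, ?_, h1⟩
  obtain ⟨N, hN⟩ := (h1.eventually (gt_mem_nhds ENNReal.zero_lt_top)).exists
  have h3 : MemLp (fun z => J (wickField η (S N).1 n z) - y z) (ENNReal.ofReal p) μ :=
    ⟨(h2 N).1.sub (Lp.aestronglyMeasurable y), hN⟩
  have := (h2 N).sub h3
  refine this.ae_eq (Eventually.of_forall fun z => ?_)
  simp

end Limits

section Series

variable {Ω : Type} [MeasurableSpace Ω] {μ : Measure Ω} {η : ℤ × ℤ → Ω → ℝ}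
  {𝒦 : Type} [NormedAddCommGroup 𝒦] [InnerProductSpace ℝ 𝒦] [CompleteSpace 𝒦]
  {ι : Type} [Countable ι] {J : C(T2, ℝ) →L[ℝ] 𝒦} {l l' : ι → C(T2, ℝ) →L[ℝ] ℝ}

/-- For a term of degree d the squared coefficient times d! is (a²)^d/d!, the coefficient in
`Admissible`. Degrees of the other parity contribute nonnegative terms and may be added. -/
theorem Admissible.exists_sum_osc_le {w : ℤ × ℤ → ℝ} {a : ℝ} (hw : ∀ k, 0 ≤ w k)
    (h : Admissible w (a ^ 2)) (i : Bool) : ∃ M : ℝ, ∀ (S : Freq) (N : ℕ),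
      ∑ n ∈ Finset.range N, oscCoef a i n ^ 2 *
        ((oscDeg i n).factorial * convSum S.1 w (oscDeg i n)) ≤ M := by
  obtain ⟨M, hM⟩ := h
  refine ⟨M, fun S N => ?_⟩
  have h1 : ∀ n, oscCoef a i n ^ 2 * ((oscDeg i n).factorial * convSum S.1 w (oscDeg i n)) =
      (a ^ 2) ^ oscDeg i n / (oscDeg i n).factorial * convSum S.1 w (oscDeg i n) := fun n => by
    rw [← sq_abs, abs_oscCoef, div_pow, ← pow_mul, mul_comm (oscDeg i n) 2, pow_mul, sq_abs]
    have : ((oscDeg i n).factorial : ℝ) ≠ 0 := by positivity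
    field_simp
  simp only [h1]
  have h2 : ∑ m ∈ (Finset.range N).image (oscDeg i),
      (a ^ 2) ^ m / (m.factorial : ℝ) * convSum S.1 w m = ∑ n ∈ Finset.range N,
      (a ^ 2) ^ oscDeg i n / ((oscDeg i n).factorial : ℝ) * convSum S.1 w (oscDeg i n) :=
    Finset.sum_image fun _ _ _ _ hnm => oscDeg_injective i hnm
  rw [← h2]
  obtain ⟨K, hK⟩ := ((Finset.range N).image (oscDeg i)).exists_nat_subset_range
  exact (Finset.sum_le_sum_of_subset_of_nonneg hK fun m _ _ =>
    mul_nonneg (by positivity) (convSum_nonneg _ hw _)).trans (hM S.1 K)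

/-- Orthogonality provides an L² sum X. Some subsequence of partial sums tends to X almost
everywhere, while for each z the partial sums tend to the truncated Wick function, so the two agree.
-/
theorem hasSum_oscLp (hη : IsWhiteNoise μ η) (hJ : IsFrame J l l') {a : ℝ}
    (ha : Admissible (weight J) (a ^ 2)) (i : Bool) (S : Freq) :
    HasSum (fun n => oscCoef a i n • wickLp hη J (oscDeg i n) S) (oscLp hη J a i S) := by
  obtain ⟨M, hM⟩ := ha.exists_sum_osc_le (weight_nonneg J) i
  have hs := ((isOrthogonalNet_wickLp hη hJ).smul_comp (oscCoef a i)
    (oscDeg_injective i)).summable hM S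
  obtain ⟨X, hX⟩ := hs
  have hm := tendstoInMeasure_of_tendsto_Lp hX.tendsto_sum_nat
  obtain ⟨ns, hns, hae⟩ := hm.exists_seq_tendsto_ae
  have hcoe : ∀ᵐ z ∂μ, ∀ n, wickLp hη J (oscDeg i n) S z = J (wickField η S.1 (oscDeg i n) z) :=
    ae_all_iff.2 fun n => coeFn_wickLp hη J _ S
  have hsmul : ∀ᵐ z ∂μ, ∀ n, (oscCoef a i n • wickLp hη J (oscDeg i n) S : Lp 𝒦 2 μ) z =
      oscCoef a i n • wickLp hη J (oscDeg i n) S z :=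
    ae_all_iff.2 fun n => Lp.coeFn_smul _ _
  have hsum : ∀ᵐ z ∂μ, ∀ N, (∑ n ∈ Finset.range N, oscCoef a i n • wickLp hη J (oscDeg i n) S :
      Lp 𝒦 2 μ) z = ∑ n ∈ Finset.range N,
        (oscCoef a i n • wickLp hη J (oscDeg i n) S : Lp 𝒦 2 μ) z :=
    ae_all_iff.2 fun N => (Lp.coeFn_finsetSum _ _).trans
      (Eventually.of_forall fun z => Finset.sum_apply _ _ _)
  have heq : X = oscLp hη J a i S := by
    refine Lp.ext ?_
    filter_upwards [hae, hcoe, hsmul, hsum, coeFn_oscLp hη J a i S] with z h1 h2 h3 h4 h5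
    rw [h5]
    refine tendsto_nhds_unique h1 ?_
    have h6 := (J.hasSum (hasSum_oscC_comp (sumCov_pos S.2.2) a i
      (field η S.1 z))).tendsto_sum_nat.comp hns.tendsto_atTop
    refine h6.congr fun N => ?_
    rw [Function.comp_apply, h4]
    refine Finset.sum_congr rfl fun n _ => ?_
    rw [h3, h2, map_smul]
    rfl
  rwa [heq] at hX

/-- W is the limit along the directed set of all finite symmetric frequency sets, so the same W
serves every sequence of cut-offs and also sums the series. -/
theorem exists_osc_limit (hη : IsWhiteNoise μ η) (hJ : IsFrame J l l') {y : ℕ → Lp 𝒦 2 μ}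
    (hy : ∀ n, Tendsto (wickLp hη J n) atTop (𝓝 (y n))) {a : ℝ}
    (ha : Admissible (weight J) (a ^ 2)) (i : Bool) : ∃ W : Lp 𝒦 2 μ,
      SeriesLp 2 μ (fun n z => oscCoef a i n • y (oscDeg i n) z) W ∧
      (∀ S : ℕ → Freq, Tendsto S atTop atTop →
        TendstoLp 2 μ (fun N z => J (oscField η (S N).1 a i z)) W) ∧
      ∀ p : ℝ, 2 < p → Admissible (weight J) ((√(p - 1) * a) ^ 2) →
        MemLp W (ENNReal.ofReal p) μ := by
  obtain ⟨M, hM⟩ := ha.exists_sum_osc_le (weight_nonneg J) i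
  have hnet := (isOrthogonalNet_wickLp hη hJ).smul_comp (oscCoef a i) (oscDeg_injective i)
  have hy' : ∀ n, Tendsto (fun S => oscCoef a i n • wickLp hη J (oscDeg i n) S) atTop
      (𝓝 (oscCoef a i n • y (oscDeg i n))) := fun n => (hy _).const_smul _
  obtain ⟨W, hW⟩ := hnet.summable_lim hy' hM
  have hlim : Tendsto (oscLp hη J a i) atTop (𝓝 W) :=
    hnet.tendsto_of_hasSum hy' hM hW fun S => hasSum_oscLp hη hJ ha i S
  refine ⟨W, ⟨fun N => ?_, Lp.memLp W, ?_⟩, fun S hS => ⟨fun N => ?_, Lp.memLp W, ?_⟩,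
    fun p hp hpa => ⟨Lp.aestronglyMeasurable W, ?_⟩⟩
  · exact memLp_finsetSum _ fun n _ => (Lp.memLp (y (oscDeg i n))).const_smul _
  · have h1 := (Lp.tendsto_Lp_iff_tendsto_eLpNorm' _ _).1 hW.tendsto_sum_nat
    refine h1.congr fun N => eLpNorm_congr_ae ?_
    have hsmul : ∀ᵐ z ∂μ, ∀ n, (oscCoef a i n • y (oscDeg i n) : Lp 𝒦 2 μ) z =
        oscCoef a i n • y (oscDeg i n) z :=
      ae_all_iff.2 fun n => Lp.coeFn_smul _ _
    filter_upwards [hsmul, Lp.coeFn_finsetSum (Finset.range N)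
      fun n => oscCoef a i n • y (oscDeg i n)] with z h2 h3
    rw [Pi.sub_apply, h3, Finset.sum_apply]
    simp only [h2]
  · exact memLp_oscField hη J _ a i (by simp)
  · have h1 := (Lp.tendsto_Lp_iff_tendsto_eLpNorm' _ _).1 (hlim.comp hS)
    refine h1.congr fun N => eLpNorm_congr_ae ?_
    filter_upwards [coeFn_oscLp hη J a i (S N)] with z hz
    rw [Pi.sub_apply, Function.comp_apply, hz]
  -- The truncations are bounded in L^p by their L² norms at √(p-1) a, hence by √K; convergence in
  -- measure transfers the bound to W.
  · obtain ⟨K, hK⟩ := hpa.exists_sum_osc_le (weight_nonneg J) i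
    have hnet2 := (isOrthogonalNet_wickLp hη hJ).smul_comp (oscCoef (√(p - 1) * a) i)
      (oscDeg_injective i)
    have hb : ∀ S : Freq, eLpNorm (oscLp hη J a i S) (ENNReal.ofReal p) μ ≤
        ENNReal.ofReal (√K) := fun S => by
      rw [eLpNorm_congr_ae (coeFn_oscLp hη J a i S)]
      refine (eLpNorm_oscField_le hη J hp S.2.1 a i).trans ?_
      rw [← eLpNorm_congr_ae (coeFn_oscLp hη J (√(p - 1) * a) i S)]
      refine (ENNReal.le_ofReal_iff_toReal_le (Lp.eLpNorm_ne_top _) (Real.sqrt_nonneg _)).2 ?_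
      rw [← Lp.norm_def]
      exact Real.le_sqrt_of_sq_le
        (hnet2.norm_sq_le_of_hasSum hK (hasSum_oscLp hη hJ hpa i S))
    refine (eLpNorm_le_of_tendstoInMeasure (Eventually.of_forall hb)
      (tendstoInMeasure_of_tendsto_Lp hlim) fun S => Lp.aestronglyMeasurable _).trans_lt
      ENNReal.ofReal_lt_top

end Series

end Torus

end

noncomputable section

namespace Torus

/-! ### The two Hilbert space valued observables -/

theorem isFrame_toSobolev {α : ℝ} (hα : 0 ≤ α) : IsFrame (toSobolev hα)
    (fun k => lam k ^ (-α / 2) • Complex.reCLM.comp (coefCLM k))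
    (fun k => lam k ^ (-α / 2) • Complex.imCLM.comp (coefCLM k)) := fun f g => by
  have h := Sobolev.hasSum_real_inner (toSobolev hα f) (toSobolev hα g)
  refine h.congr_fun fun k => ?_
  have h2 : lam k ^ (-α) = lam k ^ (-α / 2) * lam k ^ (-α / 2) := by
    rw [← Real.rpow_add (lam_pos k)]; congr 1; ring
  simp only [hat_toSobolev, _root_.smul_apply, ContinuousLinearMap.comp_apply,
    Complex.reCLM_apply, Complex.imCLM_apply, smul_eq_mul, h2, coefCLM_apply]
  ring

theorem isFrame_testCLM (g : H) : IsFrame (testCLM g) (fun _ : Unit => testCLM g)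
    fun _ : Unit => 0 := fun f f' => by
  simp [mul_comm]

end Torus

end

noncomputable section

namespace Torus

/-! ### The free field as a white noise -/

/-- Pairing with a trigonometric function. -/
theorem re_tsum_hat_trig {w : ℤ × ℤ → ℝ} (hw : ∀ k, w (-k) = w k) {s : ℝ} (v : Sobolev s)
    (k : ℤ × ℤ) : (∑' j, (w j : ℂ) * coefCLM j (cosC k + sinC k) * hat v.toDistr (-j)).re =
      2 * π * w k * ((hat v.toDistr k).re - (hat v.toDistr k).im) := by
  have hv : hat v.toDistr (-k) = conj (hat v.toDistr k) := v.2.2 k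
  have h : HasSum (fun j => (w j : ℂ) * coefCLM j (cosC k + sinC k) * hat v.toDistr (-j))
      (π * w k * ((1 - Complex.I) * conj (hat v.toDistr k) +
        (1 + Complex.I) * hat v.toDistr k)) := by
    have h1 := hasSum_ite_eq k
      ((w k : ℂ) * (π * (1 - Complex.I)) * hat v.toDistr (-k))
    have h2 := hasSum_ite_eq (-k)
      ((w k : ℂ) * (π * (1 + Complex.I)) * hat v.toDistr k)
    have h3 := h1.add h2
    rw [hv] at h3
    convert h3 using 1
    · ext j
      rw [map_add, coefCLM_cosC, coefCLM_sinC]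
      have e1 : k = -j ↔ j = -k := by rw [eq_neg_iff_add_eq_zero, eq_neg_iff_add_eq_zero, add_comm]
      simp only [eq_comm (a := k) (b := j), e1, Complex.div_I]
      by_cases h4 : j = k <;> by_cases h5 : j = -k
      · simp only [if_pos h4, if_pos h5]
        rw [← hv]
        rw [h4] at h5 ⊢
        rw [← h5]; ring
      · simp only [if_pos h4, if_neg h5]
        rw [h4, hv]; ring
      · simp only [if_neg h4, if_pos h5]
        rw [h5, neg_neg, hw]; ring
      · simp only [if_neg h4, if_neg h5]
        ring
    · ring
  rw [h.tsum_eq, ← Complex.ofReal_mul, Complex.re_ofReal_mul]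
  simp only [ Complex.add_re, Complex.mul_re, Complex.sub_re,
    Complex.one_re, Complex.I_re, Complex.sub_im, Complex.one_im, Complex.I_im, Complex.conj_re,
    Complex.conj_im, Complex.add_im]
  ring

/-- The element of `H^{-δ}` that represents the coordinate of a distribution along `basisFn k`. -/
def coordVec {δ : ℝ} (hδ : 0 ≤ δ) (k : ℤ × ℤ) : Sobolev (-δ) :=
  (√(lam k) * lam k ^ δ / (2 * π)) • toSobolev hδ (cosC k + sinC k)

/-- The normalized real coordinates of a distribution. -/
def coord {s : ℝ} (k : ℤ × ℤ) (z : Sobolev s) : ℝ :=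
  √(lam k) * ((hat z.toDistr k).re - (hat z.toDistr k).im)

theorem inner_coordVec {δ : ℝ} (hδ : 0 ≤ δ) (k : ℤ × ℤ) (z : Sobolev (-δ)) :
    inner ℝ (coordVec hδ k) z = coord k z := by
  have h := re_tsum_hat_trig (w := fun j => lam j ^ (-δ)) (fun j => by rw [lam_neg]) z k
  rw [coordVec, inner_smul_left, Sobolev.inner_eq]
  simp only [hat_toSobolev, conj_trivial]
  rw [h, coord, Real.rpow_neg (lam_pos k).le]
  have := (Real.rpow_pos_of_pos (lam_pos k) δ).ne'
  field_simp

theorem coord_trig {δ : ℝ} (hδ : 0 ≤ δ) (k m : ℤ × ℤ) :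
    coord k (toSobolev hδ (cosC m + sinC m)) = if k = m then 2 * π * √(lam k) else 0 := by
  rw [coord, hat_toSobolev, map_add, coefCLM_cosC, coefCLM_sinC, Complex.div_I]
  have e1 : m = k ↔ k = m := eq_comm
  simp only [e1]
  split_ifs <;> simp <;> ring

/-- The operator A^{1+δ} relative to the H^{-δ} product amounts to A = λ⁻¹ relative to the L²
product. The factor √λ in `coord` normalizes this, so the coordinates are orthonormal and δ
disappears. -/
theorem powerForm_coordVec {δ : ℝ} (hδ : 0 ≤ δ) (k m : ℤ × ℤ) :
    powerForm (1 + δ) (coordVec hδ k) (coordVec hδ m) = if k = m then 1 else 0 := by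
  have h := re_tsum_hat_trig (w := fun j => √(lam k) * lam k ^ δ / (2 * π) *
    (lam j ^ (-(1 + δ)) * lam j ^ (-δ))) (fun j => by rw [lam_neg]) (coordVec hδ m) k
  have h1 : ∀ j, ((lam j ^ (-(1 + δ)) : ℝ) : ℂ) *
      (((lam j ^ (-δ) : ℝ) : ℂ) * hat (coordVec hδ k).toDistr j *
        hat (coordVec hδ m).toDistr (-j)) =
      ((√(lam k) * lam k ^ δ / (2 * π) * (lam j ^ (-(1 + δ)) * lam j ^ (-δ)) : ℝ) : ℂ) *
        coefCLM j (cosC k + sinC k) * hat (coordVec hδ m).toDistr (-j) := fun j => by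
    have h2 : hat (coordVec hδ k).toDistr j =
        ((√(lam k) * lam k ^ δ / (2 * π) : ℝ) : ℂ) * coefCLM j (cosC k + sinC k) := by
      rw [coordVec, ← Sobolev.hatCLM_apply, map_smul, Complex.real_smul, Sobolev.hatCLM_apply,
        hat_toSobolev]
    rw [h2]
    push_cast
    ring
  rw [powerForm]
  simp only [h1]
  rw [h]
  have h3 : coord k (coordVec hδ m) =
      √(lam m) * lam m ^ δ / (2 * π) * if k = m then 2 * π * √(lam k) else 0 := by
    rw [← coord_trig hδ k m, coordVec, coord, coord, ← Sobolev.hatCLM_apply, map_smul,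
      Complex.real_smul, Complex.re_ofReal_mul, Complex.im_ofReal_mul, Sobolev.hatCLM_apply]
    ring
  have hl := lam_pos k
  have hsq : √(lam k) * √(lam k) = lam k := Real.mul_self_sqrt hl.le
  have h4 : √(lam k) * ((hat (coordVec hδ m).toDistr k).re - (hat (coordVec hδ m).toDistr k).im) =
      √(lam m) * lam m ^ δ / (2 * π) * if k = m then 2 * π * √(lam k) else 0 := h3
  have h5 : lam k ^ (-(1 + δ)) = (lam k)⁻¹ * (lam k ^ δ)⁻¹ := by
    rw [neg_add, Real.rpow_add hl, Real.rpow_neg_one, Real.rpow_neg hl.le]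
  have hd := (Real.rpow_pos_of_pos hl δ).ne'
  calc 2 * π * (√(lam k) * lam k ^ δ / (2 * π) * (lam k ^ (-(1 + δ)) * lam k ^ (-δ))) *
        ((hat (coordVec hδ m).toDistr k).re - (hat (coordVec hδ m).toDistr k).im) =
      lam k ^ δ * (lam k ^ (-(1 + δ)) * lam k ^ (-δ)) * (√(lam k) *
        ((hat (coordVec hδ m).toDistr k).re - (hat (coordVec hδ m).toDistr k).im)) := by
        field_simp
    _ = if k = m then 1 else 0 := by
        rw [h4, h5, Real.rpow_neg hl.le]
        split_ifs with hkm
        · subst hkm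
          field_simp
          rw [sq, hsq]
        · simp

section FreeField

variable {δ : ℝ} {μ : Measure (Sobolev (-δ))}

theorem IsFreeField.integral_sum_sq (hδ : 0 ≤ δ) (hμ : IsFreeField δ μ) {ι : Type} (A : Finset ι)
    (c : ι → ℝ) (κ : ι → ℤ × ℤ) (hκ : Function.Injective κ) :
    ∫ z, (∑ i ∈ A, c i * coord (κ i) z) ^ 2 ∂μ = ∑ i ∈ A, c i ^ 2 := by
  have := hμ.gaussian
  have hL : ∀ k, MemLp (coord k : Sobolev (-δ) → ℝ) 2 μ := fun k => by
    have h := IsGaussian.memLp_dual μ (innerSL ℝ (coordVec hδ k)) 2 (by simp)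
    refine h.ae_eq (Eventually.of_forall fun z => ?_)
    rw [innerSL_apply_apply, inner_coordVec]
  have hi : ∀ k m, Integrable (fun z : Sobolev (-δ) => coord k z * coord m z) μ := fun k m =>
    (hL k).integrable_mul (hL m)
  have hc : ∀ k m, ∫ z : Sobolev (-δ), coord k z * coord m z ∂μ = if k = m then 1 else 0 :=
    fun k m => by
    rw [← powerForm_coordVec hδ, ← hμ.covariance]
    simp only [inner_coordVec]
  have e1 : ∀ z : Sobolev (-δ), (∑ i ∈ A, c i * coord (κ i) z) ^ 2 =
      ∑ i ∈ A, ∑ j ∈ A, c i * c j * (coord (κ i) z * coord (κ j) z) := fun z => by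
    rw [sq, Finset.sum_mul_sum]
    exact Finset.sum_congr rfl fun i _ => Finset.sum_congr rfl fun j _ => by ring
  simp only [e1]
  rw [integral_finsetSum _ fun i _ => integrable_finsetSum _ fun j _ => (hi _ _).const_mul _]
  refine Finset.sum_congr rfl fun i hiA => ?_
  rw [integral_finsetSum _ fun j _ => (hi _ _).const_mul _]
  simp only [integral_const_mul, hc, hκ.eq_iff]
  rw [Finset.sum_eq_single_of_mem i hiA fun j _ hj => by
    rw [if_neg (hκ.ne hj.symm), mul_zero], if_pos rfl]
  ring

/-- Every linear combination of coordinates is a continuous functional, hence centred Gaussian with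
variance ‖t‖²; characteristic functions then identify the joint law. -/
theorem IsFreeField.isWhiteNoise (hδ : 0 ≤ δ) (hμ : IsFreeField δ μ) :
    IsWhiteNoise μ (coord : ℤ × ℤ → Sobolev (-δ) → ℝ) := by
  have := hμ.gaussian
  have hcont : ∀ k, Continuous (coord k : Sobolev (-δ) → ℝ) := fun k => by
    have h : Continuous fun z => inner ℝ (coordVec hδ k) z := by fun_prop
    simpa only [inner_coordVec] using h
  refine ⟨fun k => (hcont k).measurable, fun U => ?_⟩
  have hm : Measurable fun z : Sobolev (-δ) =>
      (WithLp.toLp 2 fun k : U => coord k.1 z : EuclideanSpace ℝ U) :=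
    (WithLp.measurable_toLp 2 _).comp (measurable_pi_lambda _ fun k => (hcont k).measurable)
  have := Measure.isProbabilityMeasure_map (μ := μ) hm.aemeasurable
  refine Measure.ext_of_charFun (funext fun t => ?_)
  rw [charFun_stdGaussian, charFun_apply, integral_map hm.aemeasurable (by fun_prop)]
  set L : StrongDual ℝ (Sobolev (-δ)) := innerSL ℝ (∑ k : U, t k • coordVec hδ k.1) with hLdef
  have hL : ∀ z, L z = ∑ k : U, t k * coord k.1 z := fun z => by
    rw [hLdef, innerSL_apply_apply, sum_inner]
    refine Finset.sum_congr rfl fun k _ => ?_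
    rw [inner_smul_left, inner_coordVec, conj_trivial]
  have h1 := IsGaussian.charFunDual_eq (μ := μ) L
  have hmean : ∫ z, L z ∂μ = 0 := by
    simp only [hLdef, innerSL_apply_apply]
    exact hμ.mean_zero _
  have hvar : Var[L; μ] = ‖t‖ ^ 2 := by
    rw [variance_of_integral_eq_zero L.continuous.measurable.aemeasurable hmean]
    simp only [hL]
    rw [hμ.integral_sum_sq hδ Finset.univ (fun k : U => t k) Subtype.val Subtype.val_injective,
      EuclideanSpace.norm_sq_eq]
    simp
  rw [charFunDual_apply, integral_complex_ofReal, hmean, hvar] at h1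
  have h2 : ∀ z : Sobolev (-δ), inner ℝ (WithLp.toLp 2 fun k : U => coord k.1 z :
      EuclideanSpace ℝ U) t = L z := fun z => by
    rw [hL, PiLp.inner_apply]
    rfl
  simp only [h2]
  rw [h1]
  congr 1
  push_cast
  ring

theorem field_apply {Ω : Type} (η : ℤ × ℤ → Ω → ℝ) (S : Finset (ℤ × ℤ)) (z : Ω) (x : T2) :
    field η S z x = ∑ k ∈ S, η k z * basisFn k x := by
  simp [field, ContinuousMap.sum_apply]

/-- Term by term the two sums differ by (Re ẑ(k)) sin(k·x) - (Im ẑ(k)) cos(k·x), up to sign and a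
factor. This is odd in k because z is real, and cancels over S. -/
theorem proj_eq_field {s : ℝ} {Λ : Set (ℝ × ℝ)} {S : Finset (ℤ × ℤ)} (hS : IsSymm S)
    (hΛ : ∀ k : ℤ × ℤ, k ∈ S ↔ ((k.1 : ℝ), (k.2 : ℝ)) ∈ Λ) (z : Sobolev s) (x : T2) :
    proj Λ z x = field coord S z x := by
  have h1 : ∑' k : ℤ × ℤ, Set.indicator {k : ℤ × ℤ | ((k.1 : ℝ), (k.2 : ℝ)) ∈ Λ}
      (fun k => hat z.toDistr k * e k x) k = ∑ k ∈ S, hat z.toDistr k * e k x := by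
    rw [tsum_eq_sum (s := S)]
    · refine Finset.sum_congr rfl fun k hk => Set.indicator_of_mem ?_ _
      exact (hΛ k).1 hk
    · intro k hk
      refine Set.indicator_of_notMem ?_ _
      exact fun h => hk ((hΛ k).2 h)
  have hz : ∀ k, hat z.toDistr (-k) = conj (hat z.toDistr k) := z.2.2
  have h2 := hS.sum_odd (f := fun k => (2 * π)⁻¹ *
    ((hat z.toDistr k).re * sinC k x - (hat z.toDistr k).im * cosC k x)) (fun k => by
      rw [hz, Complex.conj_re, Complex.conj_im, sinC_neg, cosC_neg]; ring)
  rw [proj, h1, Complex.re_sum, field_apply, ← sub_eq_zero, ← Finset.sum_sub_distrib, ← neg_eq_zero,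
    ← Finset.sum_neg_distrib, ← h2]
  refine Finset.sum_congr rfl fun k _ => ?_
  have hl : √(lam k) * (√(lam k))⁻¹ = 1 := mul_inv_cancel₀ (Real.sqrt_pos.2 (lam_pos k)).ne'
  have he : e k x = ((2 * π)⁻¹ : ℝ) * char k x := by
    rw [char_eq]
    have : (2 * π : ℂ) ≠ 0 := by
      exact_mod_cast Real.two_pi_pos.ne'
    push_cast
    field_simp
  rw [he, basisFn, coord, ContinuousMap.smul_apply, ContinuousMap.add_apply, smul_eq_mul,
    mul_left_comm, Complex.re_ofReal_mul, Complex.mul_re, ← cosC_apply, ← sinC_apply]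
  linear_combination (2 * π)⁻¹ * ((hat z.toDistr k).re - (hat z.toDistr k).im) *
    (cosC k x + sinC k x) * hl

theorem IsFreeField.rho_eq (hδ : 0 ≤ δ) (hμ : IsFreeField δ μ) {Λ : Set (ℝ × ℝ)}
    {S : Finset (ℤ × ℤ)} (hS : IsSymm S)
    (hΛ : ∀ k : ℤ × ℤ, k ∈ S ↔ ((k.1 : ℝ), (k.2 : ℝ)) ∈ Λ) (x : T2) :
    rho μ Λ x = √(sumCov S) := by
  rw [rho]
  congr 1
  simp only [proj_eq_field hS hΛ, field_apply]
  have h := hμ.integral_sum_sq hδ S (fun k => basisFn k x) id Function.injective_id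
  simp only [id_eq, mul_comm (basisFn _ x)] at h
  rw [h, ← trigKernel_self S x, ← hS.sum_basisFn]
  exact Finset.sum_congr rfl fun k _ => sq _

theorem IsFreeField.wickApprox_eq (hδ : 0 ≤ δ) (hμ : IsFreeField δ μ) {Λ : Set (ℝ × ℝ)}
    (S : Freq) (hΛ : ∀ k : ℤ × ℤ, k ∈ S.1 ↔ ((k.1 : ℝ), (k.2 : ℝ)) ∈ Λ) (n : ℕ)
    (z : Sobolev (-δ)) : wickApprox μ n Λ z = wickField coord S.1 n z := by
  ext x
  -- Nonemptiness of the frequency set makes ρ positive, so the rescaling by ρ⁻¹ in the definition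
  -- is genuine.
  have hv := sumCov_pos S.2.2
  have hf : √(n.factorial : ℝ) ≠ 0 := (Real.sqrt_pos.2 (by positivity)).ne'
  have h1 := Wick.wick_eq_hermite (Real.sqrt_pos.2 hv).ne' n (field coord S.1 z x)
  rw [Real.sq_sqrt hv.le, Wick.aeval_hermite_eq] at h1
  rw [wickApprox, hμ.rho_eq hδ S.2.1 hΛ, proj_eq_field S.2.1 hΛ, hermiteH]
  refine Eq.trans ?_ h1.symm
  field_simp

theorem IsFreeField.cosApprox_eq (hδ : 0 ≤ δ) (hμ : IsFreeField δ μ) {Λ : Set (ℝ × ℝ)}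
    (S : Freq) (hΛ : ∀ k : ℤ × ℤ, k ∈ S.1 ↔ ((k.1 : ℝ), (k.2 : ℝ)) ∈ Λ) (a : ℝ)
    (z : Sobolev (-δ)) : cosApprox μ a Λ z = oscField coord S.1 a false z := by
  ext x
  rw [cosApprox, hμ.rho_eq hδ S.2.1 hΛ, proj_eq_field S.2.1 hΛ]
  rfl

theorem IsFreeField.sinApprox_eq (hδ : 0 ≤ δ) (hμ : IsFreeField δ μ) {Λ : Set (ℝ × ℝ)}
    (S : Freq) (hΛ : ∀ k : ℤ × ℤ, k ∈ S.1 ↔ ((k.1 : ℝ), (k.2 : ℝ)) ∈ Λ) (a : ℝ)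
    (z : Sobolev (-δ)) : sinApprox μ a Λ z = oscField coord S.1 a true z := by
  ext x
  rw [sinApprox, hμ.rho_eq hδ S.2.1 hΛ, proj_eq_field S.2.1 hΛ]
  rfl

end FreeField

/-! ### Cut-off sets -/

theorem IsCutoff.smul_finite {Λ : Set (ℝ × ℝ)} (hΛ : IsCutoff Λ) (N : ℕ) :
    {k : ℤ × ℤ | ((k.1 : ℝ), (k.2 : ℝ)) ∈ (N : ℝ) • Λ}.Finite := by
  have hb : Bornology.IsBounded ((N : ℝ) • Λ) := (hΛ.compact.smul (N : ℝ)).isBounded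
  obtain ⟨R, hR⟩ := hb.exists_norm_le
  refine (Set.finite_Icc (-⌈R⌉, -⌈R⌉) (⌈R⌉, ⌈R⌉)).subset fun k hk => ?_
  have h := hR _ hk
  rw [Prod.norm_def, max_le_iff, Real.norm_eq_abs, Real.norm_eq_abs, abs_le, abs_le] at h
  dsimp only at h
  obtain ⟨⟨h1, h2⟩, h3, h4⟩ := h
  have hc := Int.le_ceil R
  have e1 : k.1 ≤ ⌈R⌉ := by exact_mod_cast h2.trans hc
  have e2 : k.2 ≤ ⌈R⌉ := by exact_mod_cast h4.trans hc
  have e3 : -⌈R⌉ ≤ k.1 := by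
    have : ((-⌈R⌉ : ℤ) : ℝ) ≤ k.1 := by push_cast; linarith
    exact_mod_cast this
  have e4 : -⌈R⌉ ≤ k.2 := by
    have : ((-⌈R⌉ : ℤ) : ℝ) ≤ k.2 := by push_cast; linarith
    exact_mod_cast this
  exact ⟨⟨e3, e4⟩, e1, e2⟩

/-- Since Λ contains a neighbourhood of 0, its dilates eventually contain any finite set of
frequencies, so cut-offs are sequences tending to infinity in the net. At N = 0 the dilate is {0},
still nonempty. -/
theorem IsCutoff.exists_freq {Λ : Set (ℝ × ℝ)} (hΛ : IsCutoff Λ) : ∃ S : ℕ → Freq,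
    (∀ N (k : ℤ × ℤ), k ∈ (S N).1 ↔ ((k.1 : ℝ), (k.2 : ℝ)) ∈ (N : ℝ) • Λ) ∧
      Tendsto S atTop atTop := by
  have h0 : (0 : ℝ × ℝ) ∈ Λ := interior_subset hΛ.zero_mem
  refine ⟨fun N => ⟨(hΛ.smul_finite N).toFinset, fun k hk => ?_, ⟨0, ?_⟩⟩, fun N k => by simp, ?_⟩
  · rw [Set.Finite.mem_toFinset, Set.mem_ofPred_eq] at hk ⊢
    obtain ⟨p, hp, hpk⟩ := hk
    refine ⟨-p, by rw [← Set.mem_neg, hΛ.symm]; exact hp, ?_⟩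
    have hpk' : (N : ℝ) • p = ((k.1 : ℝ), (k.2 : ℝ)) := hpk
    show (N : ℝ) • -p = _
    rw [smul_neg, hpk']
    simp
  · rw [Set.Finite.mem_toFinset, Set.mem_ofPred_eq]
    exact ⟨0, h0, by simp; rfl⟩
  · refine tendsto_atTop.2 fun T => ?_
    have h1 : ∀ k ∈ T.1, ∀ᶠ N : ℕ in atTop, ((k.1 : ℝ), (k.2 : ℝ)) ∈ (N : ℝ) • Λ := fun k _ => by
      have hlim : Tendsto (fun N : ℕ => (N : ℝ)⁻¹ • ((k.1 : ℝ), (k.2 : ℝ))) atTop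
          (𝓝 ((0 : ℝ) • ((k.1 : ℝ), (k.2 : ℝ)))) :=
        tendsto_inv_atTop_nhds_zero_nat.smul_const _
      rw [zero_smul] at hlim
      filter_upwards [hlim.eventually (mem_interior_iff_mem_nhds.1 hΛ.zero_mem),
        eventually_gt_atTop 0] with N hN hN0
      have hN1 : (N : ℝ) ≠ 0 := by positivity
      exact ⟨_, hN, smul_inv_smul₀ hN1 _⟩
    filter_upwards [(Finset.eventually_all T.1).2 h1] with N hN
    show T.1 ⊆ (hΛ.smul_finite N).toFinset
    intro k hk
    rw [Set.Finite.mem_toFinset]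
    exact hN k hk

end Torus

end

noncomputable section

namespace Torus

/-! ### Duality -/

theorem duality_eq_inner {α : ℝ} (u : Sobolev (-α)) (v : Sobolev α) :
    duality u v = inner ℂ v.toSeq u.toSeq := by
  have h : HasSum (fun k => inner ℂ (v.toSeq k) (u.toSeq k)) (inner ℂ v.toSeq u.toSeq) :=
    lp.hasSum_inner v.toSeq u.toSeq
  rw [← h.tsum_eq, duality]
  refine tsum_congr fun k => ?_
  have h1 : lam k ^ (-α / 2) * lam k ^ (α / 2) = 1 := by
    rw [← Real.rpow_add (lam_pos k), neg_div, neg_add_cancel, Real.rpow_zero]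
  have h2 : ((lam k ^ (-α / 2) : ℝ) : ℂ) * ((lam k ^ (α / 2) : ℝ) : ℂ) = 1 := by exact_mod_cast h1
  rw [RCLike.inner_apply, Sobolev.toSeq_apply, Sobolev.toSeq_apply, map_mul, Complex.conj_ofReal]
  linear_combination -(hat u.toDistr k * conj (hat v.toDistr k)) * h2

theorem continuous_duality {α : ℝ} (v : Sobolev α) :
    Continuous fun u : Sobolev (-α) => duality u v := by
  simp only [duality_eq_inner]
  exact continuous_const.inner (Sobolev.isometry_toSeq _).continuous

/-- Parseval's identity. Smoothness of f makes its Fourier series absolutely summable, so it may be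
integrated against g term by term. -/
theorem testCLM_eq_duality {f : C(T2, ℝ)} (hf : (fun x => ((f x : ℝ) : ℂ)) ∈ TestFun) {α : ℝ}
    (hα : 0 ≤ α) (g : H) (hg : l2Distr g ∈ sobolev α) :
    ((testCLM g f : ℝ) : ℂ) = duality (toSobolev hα f) ⟨l2Distr g, hg⟩ := by
  set φ : TestFun := ⟨fun x => ((f x : ℝ) : ℂ), hf⟩
  have hgi : Integrable (fun x => ((g x : ℝ) : ℂ)) (volume : Measure T2) :=
    ((Lp.memLp g).integrable (by norm_num)).ofReal
  have hint : ∀ k, Integrable (fun x => e k x * ((g x : ℝ) : ℂ)) (volume : Measure T2) := fun k =>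
    hgi.bdd_mul (continuous_e k).aestronglyMeasurable
      (Eventually.of_forall fun x => (norm_e k x).le)
  have h := hasSum_integral_of_summable_integral_norm (μ := (volume : Measure T2))
    (F := fun k x => coef φ k * (e k x * ((g x : ℝ) : ℂ)))
    (fun k => (hint k).const_mul _) (by
      simp only [norm_mul, norm_e]
      simp only [integral_const_mul]
      exact (summable_coef φ).mul_right _)
  have h1 : ∀ x, ∑' k, coef φ k * (e k x * ((g x : ℝ) : ℂ)) = ((f x * g x : ℝ) : ℂ) := fun x => by
    have h2 := (hasSum_fourier φ x).mul_right ((g x : ℝ) : ℂ)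
    simp only [mul_assoc] at h2
    rw [h2.tsum_eq]
    push_cast
    rfl
  simp only [h1, integral_const_mul] at h
  rw [integral_complex_ofReal] at h
  rw [testCLM_apply, ← h.tsum_eq]
  change _ = ∑' k, hat (toSobolev hα f).toDistr k * conj (hat (l2Distr g) k)
  refine tsum_congr fun k => ?_
  have h3 : ∫ x, e k x * ((g x : ℝ) : ℂ) = conj (hat (l2Distr g) k) := by
    rw [← hg.2 k, hat_l2Distr, neg_neg]
    simp only [mul_comm]
  rw [h3, hat_toSobolev, coefCLM_apply, hat_toH]
  rfl

theorem contDiff_field {Ω : Type} (η : ℤ × ℤ → Ω → ℝ) (S : Finset (ℤ × ℤ)) (z : Ω) :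
    ContDiff ℝ ∞ fun p => field η S z (mk p) := by
  have h1 : ∀ k : ℤ × ℤ, ContDiff ℝ ∞ fun p => char k (mk p) := fun k => by
    have h := TestFun.contDiff (eTest k)
    have h' : ContDiff ℝ ∞ fun p => e k (mk p) := h
    simp only [char_eq]
    exact contDiff_const.mul h'
  simp only [field_apply]
  refine ContDiff.sum fun k _ => contDiff_const.mul ?_
  have h2 : ContDiff ℝ ∞ fun p => cosC k (mk p) := Complex.reCLM.contDiff.comp (h1 k)
  have h3 : ContDiff ℝ ∞ fun p => sinC k (mk p) := Complex.imCLM.contDiff.comp (h1 k)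
  exact contDiff_const.mul (h2.add h3)

theorem oscField_mem_testFun {Ω : Type} (η : ℤ × ℤ → Ω → ℝ) (S : Finset (ℤ × ℤ)) (a : ℝ) (i : Bool)
    (z : Ω) : (fun x => ((oscField η S a i z x : ℝ) : ℂ)) ∈ TestFun := by
  have h := contDiff_field η S z
  suffices h' : ContDiff ℝ ∞ fun p => oscField η S a i z (mk p) from
    Complex.ofRealCLM.contDiff.comp h'
  cases i
  · exact (Real.contDiff_cos.comp (contDiff_const.mul h)).mul contDiff_const
  · exact (Real.contDiff_sin.comp (contDiff_const.mul h)).mul contDiff_const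

/-- Both approximations converge almost everywhere along a common subsequence, obtained by
extracting twice; continuity of the duality in its first argument carries the identity to the
limits. -/
theorem ae_eq_duality_of_tendstoLp {Ω : Type} [MeasurableSpace Ω] {μ : Measure Ω} {α : ℝ}
    (hα : 0 ≤ α) {g : H} {v : Sobolev α} {F : ℕ → Ω → C(T2, ℝ)} {W : Ω → Sobolev (-α)} {V : Ω → ℝ}
    (hW : TendstoLp 2 μ (fun N z => toSobolev hα (F N z)) W)
    (hV : TendstoLp 2 μ (fun N z => testCLM g (F N z)) V)
    (h : ∀ N z, ((testCLM g (F N z) : ℝ) : ℂ) = duality (toSobolev hα (F N z)) v) :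
    ∀ᵐ z ∂μ, ((V z : ℝ) : ℂ) = duality (W z) v := by
  obtain ⟨ns, hns, h1⟩ := (tendstoInMeasure_of_tendsto_eLpNorm (by simp : (2 : ℝ≥0∞) ≠ 0)
    (fun N => (hW.1 N).1) hW.2.1.1 hW.2.2).exists_seq_tendsto_ae
  obtain ⟨ms, hms, h2⟩ := (tendstoInMeasure_of_tendsto_eLpNorm (by simp : (2 : ℝ≥0∞) ≠ 0)
    (fun N => (hV.1 (ns N)).1) hV.2.1.1 (hV.2.2.comp hns.tendsto_atTop)).exists_seq_tendsto_ae
  filter_upwards [h1, h2] with z h3 h4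
  have h5 := ((continuous_duality v).tendsto _).comp (h3.comp hms.tendsto_atTop)
  have h6 := (Complex.continuous_ofReal.tendsto _).comp h4
  refine tendsto_nhds_unique h6 (h5.congr fun N => ?_)
  exact (h _ z).symm

end Torus

end

/-! ### The limits for all parameters, and the corollary. -/

open Torus

theorem corollary3p1 (δ : ℝ) (hδ : 0 < δ) (μ₀ : Measure (Torus.Sobolev (-δ)))
    (hμ₀ : Torus.IsFreeField δ μ₀) :
    -- the Wick powers `:zⁿ:` in `H^{-α}` and `:zⁿ:(g)`, the Wick cosine and sine in `H^{-α}`,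
    -- and the tested Wick cosine and sine
    ∃ (Φ : (α : ℝ) → ℕ → Torus.Sobolev (-δ) → Torus.Sobolev (-α))
      (Φg : ℕ → Torus.H → Torus.Sobolev (-δ) → ℝ)
      (WCos WSin : (α : ℝ) → (a : ℝ) → Torus.Sobolev (-δ) → Torus.Sobolev (-α))
      (WCosg WSing : ℝ → Torus.H → Torus.Sobolev (-δ) → ℝ),
      (∀ (α : ℝ) (hα : 0 < α) (n : ℕ), Torus.IsWickPower hα.le μ₀ n (Φ α n)) ∧
      (∀ (n : ℕ) (g : Torus.H), Torus.IsWickPowerTested μ₀ n g (Φg n g)) ∧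
      -- convergence in `L²(μ₀; H^{-α})`
      (∀ (α : ℝ) (hα : 0 < α), α ≤ 1 → ∀ a : ℝ, |a| < Real.sqrt (4 * π * α) →
        Torus.SeriesLp 2 μ₀
          (fun n z => ((-1) ^ n * a ^ (2 * n) / ((2 * n).factorial : ℝ)) • Φ α (2 * n) z)
          (WCos α a) ∧
        Torus.SeriesLp 2 μ₀
          (fun n z =>
            ((-1) ^ n * a ^ (2 * n + 1) / ((2 * n + 1).factorial : ℝ)) • Φ α (2 * n + 1) z)
          (WSin α a) ∧
        ∀ Λ : Set (ℝ × ℝ), Torus.IsCutoff Λ →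
          Torus.TendstoLp 2 μ₀
            (fun N z => Torus.embed hα.le
              (Torus.toH (Torus.cosApprox μ₀ a ((N : ℝ) • Λ) z))) (WCos α a) ∧
          Torus.TendstoLp 2 μ₀
            (fun N z => Torus.embed hα.le
              (Torus.toH (Torus.sinApprox μ₀ a ((N : ℝ) • Λ) z))) (WSin α a)) ∧
      -- convergence in `L²(μ₀)` of the tested quantities
      (∀ a : ℝ, |a| < Real.sqrt (4 * π) → ∀ g : Torus.H,
        Torus.SeriesLp 2 μ₀
          (fun n z => (-1) ^ n * a ^ (2 * n) / ((2 * n).factorial : ℝ) * Φg (2 * n) g z)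
          (WCosg a g) ∧
        Torus.SeriesLp 2 μ₀
          (fun n z =>
            (-1) ^ n * a ^ (2 * n + 1) / ((2 * n + 1).factorial : ℝ) * Φg (2 * n + 1) g z)
          (WSing a g) ∧
        ∀ Λ : Set (ℝ × ℝ), Torus.IsCutoff Λ →
          Torus.TendstoLp 2 μ₀
            (fun N z => ∫ x, Torus.cosApprox μ₀ a ((N : ℝ) • Λ) z x * g x) (WCosg a g) ∧
          Torus.TendstoLp 2 μ₀
            (fun N z => ∫ x, Torus.sinApprox μ₀ a ((N : ℝ) • Λ) z x * g x) (WSing a g)) ∧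
      -- the tested quantities are the dualities with `g` if `g ∈ H^α`
      (∀ α : ℝ, 0 < α → α ≤ 1 → ∀ a : ℝ, |a| < Real.sqrt (4 * π * α) →
        ∀ (g : Torus.H) (hg : Torus.l2Distr g ∈ Torus.sobolev α),
          (∀ᵐ z ∂μ₀, ((WCosg a g z : ℝ) : ℂ) = Torus.duality (WCos α a z) ⟨Torus.l2Distr g, hg⟩) ∧
          (∀ᵐ z ∂μ₀, ((WSing a g z : ℝ) : ℂ) =
            Torus.duality (WSin α a z) ⟨Torus.l2Distr g, hg⟩)) ∧
      -- integrability
      (∀ p : ℝ, 2 ≤ p →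
        (∀ α : ℝ, 0 < α → α ≤ 1 → ∀ a : ℝ, |a| < Real.sqrt (4 * π * α / (p - 1)) →
          MemLp (WCos α a) (ENNReal.ofReal p) μ₀ ∧ MemLp (WSin α a) (ENNReal.ofReal p) μ₀) ∧
        (∀ a : ℝ, |a| < Real.sqrt (4 * π / (p - 1)) → ∀ g : Torus.H,
          MemLp (WCosg a g) (ENNReal.ofReal p) μ₀ ∧
          MemLp (WSing a g) (ENNReal.ofReal p) μ₀)) := by
  have := hμ₀.gaussian
  have hη := hμ₀.isWhiteNoise hδ.le
  have hab : ∀ {a c : ℝ}, |a| < √c → a ^ 2 < c := fun {a c} h => by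
    rw [← sq_abs]; exact (Real.lt_sqrt (abs_nonneg a)).1 h
  have hpab : ∀ {a c p : ℝ}, 2 ≤ p → |a| < √(c / (p - 1)) →
      (√(p - 1) * a) ^ 2 < c ∧ a ^ 2 < c := fun {a c p} hp h => by
    have h1 : 0 < p - 1 := by linarith
    have h2 := hab h
    rw [lt_div_iff₀ h1] at h2
    rw [mul_pow, Real.sq_sqrt h1.le]
    exact ⟨by linarith, by nlinarith [sq_nonneg a]⟩
  -- The inner quantifier over hα keeps y independent of the proof of positivity, which `toSobolev`
  -- takes as an argument.
  have hY : ∀ α : ℝ, 0 < α → ∀ n, ∃ y : Lp (Sobolev (-α)) 2 μ₀,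
      ∀ hα : 0 < α, Tendsto (wickLp hη (toSobolev hα.le) n) atTop (𝓝 y) := fun α hα n => by
    obtain ⟨b, hb, h⟩ := exists_admissible_weight_toSobolev hα
    obtain ⟨y, hy⟩ := exists_tendsto_wickLp hη (isFrame_toSobolev hα.le) hb h n
    exact ⟨y, fun _ => hy⟩
  choose! Y hY using hY
  have hZ : ∀ n (g : H), ∃ y : Lp ℝ 2 μ₀, Tendsto (wickLp hη (testCLM g) n) atTop (𝓝 y) :=
    fun n g => exists_tendsto_wickLp hη (isFrame_testCLM g) one_pos
      (admissible_weight_testCLM g zero_le_one (by nlinarith [Real.pi_gt_three])) n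
  choose Z hZ using hZ
  have hW := fun (α : ℝ) (hα : 0 < α) (hα1 : α ≤ 1) (a : ℝ) (ha : a ^ 2 < 4 * π * α) (i : Bool) =>
    exists_osc_limit hη (isFrame_toSobolev hα.le) (fun n => hY α hα n hα)
      (admissible_weight_toSobolev hα hα1 (sq_nonneg a) ha) i
  have hV := fun (a : ℝ) (ha : a ^ 2 < 4 * π) (g : H) (i : Bool) =>
    exists_osc_limit hη (isFrame_testCLM g) (fun n => hZ n g)
      (admissible_weight_testCLM g (sq_nonneg a) ha) i
  choose W hW1 hW2 hW3 using hW
  choose V hV1 hV2 hV3 using hV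
  classical
  -- Outside the admissible range of parameters nothing is claimed, and the value 0 is used there.
  let W' : Bool → (α : ℝ) → ℝ → Sobolev (-δ) → Sobolev (-α) := fun i α a =>
    if h : 0 < α ∧ α ≤ 1 ∧ a ^ 2 < 4 * π * α then W α h.1 h.2.1 a h.2.2 i else 0
  let V' : Bool → ℝ → H → Sobolev (-δ) → ℝ := fun i a g =>
    if h : a ^ 2 < 4 * π then V a h g i else 0
  have hW' : ∀ {α a : ℝ} (hα : 0 < α) (hα1 : α ≤ 1) (ha : a ^ 2 < 4 * π * α) (i : Bool),
      W' i α a = W α hα hα1 a ha i := fun hα hα1 ha i => dif_pos ⟨hα, hα1, ha⟩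
  have hV' : ∀ {a : ℝ} (ha : a ^ 2 < 4 * π) (g : H) (i : Bool), V' i a g = V a ha g i :=
    fun ha g i => dif_pos ha
  have hosc : ∀ (i : Bool) {α : ℝ} (hα : 0 < α), α ≤ 1 → ∀ {a : ℝ}, a ^ 2 < 4 * π * α →
      ∀ {S : ℕ → Freq}, Tendsto S atTop atTop → TendstoLp 2 μ₀
        (fun N z => toSobolev hα.le (oscField coord (S N).1 a i z)) (W' i α a) :=
    fun i α hα hα1 a ha S hS => by
      rw [hW' hα hα1 ha]; exact hW2 α hα hα1 a ha i S hS
  have hosct : ∀ (i : Bool) {a : ℝ}, a ^ 2 < 4 * π → ∀ (g : H)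
      {S : ℕ → Freq}, Tendsto S atTop atTop → TendstoLp 2 μ₀
        (fun N z => testCLM g (oscField coord (S N).1 a i z)) (V' i a g) :=
    fun i a ha g S hS => by rw [hV' ha]; exact hV2 a ha g i S hS
  have hdual : ∀ (i : Bool) (α : ℝ), 0 < α → α ≤ 1 → ∀ a : ℝ, |a| < √(4 * π * α) →
      ∀ (g : H) (hg : l2Distr g ∈ sobolev α),
        ∀ᵐ z ∂μ₀, ((V' i a g z : ℝ) : ℂ) = duality (W' i α a z) ⟨l2Distr g, hg⟩ :=
    fun i α hα hα1 a ha g hg => by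
      -- Any sequence tending to infinity will do, because the limits do not depend on it.
      obtain ⟨S, hS⟩ := exists_seq_tendsto (atTop : Filter Freq)
      have ha' : a ^ 2 < 4 * π := (hab ha).trans_le (mul_le_of_le_one_right (by positivity) hα1)
      exact ae_eq_duality_of_tendstoLp hα.le (hosc i hα hα1 (hab ha) hS) (hosct i ha' g hS)
        fun N z => testCLM_eq_duality (oscField_mem_testFun coord (S N).1 a i z) hα.le g hg
  have hLp : ∀ (i : Bool) {p : ℝ}, 2 ≤ p → ∀ {α : ℝ}, 0 < α → α ≤ 1 →
      ∀ {a : ℝ}, |a| < √(4 * π * α / (p - 1)) → MemLp (W' i α a) (ENNReal.ofReal p) μ₀ :=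
    fun i p hp α hα hα1 a ha => by
      obtain ⟨h1, h2⟩ := hpab hp ha
      rw [hW' hα hα1 h2]
      -- At p = 2 membership is already known; the hypercontractive bound is only available for p >
      -- 2.
      rcases hp.eq_or_lt with rfl | hp
      · rw [ENNReal.ofReal_ofNat]; exact Lp.memLp _
      · exact hW3 α hα hα1 a h2 i p hp (admissible_weight_toSobolev hα hα1 (sq_nonneg _) h1)
  have hLpt : ∀ (i : Bool) {p : ℝ}, 2 ≤ p → ∀ {a : ℝ}, |a| < √(4 * π / (p - 1)) → ∀ g : H,
      MemLp (V' i a g) (ENNReal.ofReal p) μ₀ := fun i p hp a ha g => by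
    obtain ⟨h1, h2⟩ := hpab hp ha
    rw [hV' h2]
    rcases hp.eq_or_lt with rfl | hp
    · rw [ENNReal.ofReal_ofNat]; exact Lp.memLp _
    · exact hV3 a h2 g i p hp (admissible_weight_testCLM g (sq_nonneg _) h1)
  refine ⟨fun α n => Y α n, fun n g => Z n g, W' false, W' true, V' false, V' true,
    fun α hα n Λ hΛ p _ => ?_, fun n g Λ hΛ p _ => ?_,
    fun α hα hα1 a ha => ⟨?_, ?_, fun Λ hΛ => ?_⟩, fun a ha g => ⟨?_, ?_, fun Λ hΛ => ?_⟩,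
    fun α hα hα1 a ha g hg => ⟨hdual false α hα hα1 a ha g hg, hdual true α hα hα1 a ha g hg⟩,
    fun p hp => ⟨fun α hα hα1 a ha => ⟨hLp false hp hα hα1 ha, hLp true hp hα hα1 ha⟩,
      fun a ha g => ⟨hLpt false hp ha g, hLpt true hp ha g⟩⟩⟩
  · obtain ⟨S, hS, hlim⟩ := hΛ.exists_freq
    simp only [fun N z => hμ₀.wickApprox_eq hδ.le (S N) (hS N) n z]
    exact tendstoLp_wickField hη (hY α hα n hα) hlim p
  · obtain ⟨S, hS, hlim⟩ := hΛ.exists_freq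
    simp only [fun N z => hμ₀.wickApprox_eq hδ.le (S N) (hS N) n z]
    exact tendstoLp_wickField hη (hZ n g) hlim p
  · rw [hW' hα hα1 (hab ha)]
    exact hW1 α hα hα1 a (hab ha) false
  · rw [hW' hα hα1 (hab ha)]
    exact hW1 α hα hα1 a (hab ha) true
  · obtain ⟨S, hS, hlim⟩ := hΛ.exists_freq
    simp only [fun N z => hμ₀.cosApprox_eq hδ.le (S N) (hS N) a z,
      fun N z => hμ₀.sinApprox_eq hδ.le (S N) (hS N) a z]
    exact ⟨hosc false hα hα1 (hab ha) hlim, hosc true hα hα1 (hab ha) hlim⟩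
  · rw [hV' (hab ha)]
    exact hV1 a (hab ha) g false
  · rw [hV' (hab ha)]
    exact hV1 a (hab ha) g true
  · obtain ⟨S, hS, hlim⟩ := hΛ.exists_freq
    simp only [fun N z => hμ₀.cosApprox_eq hδ.le (S N) (hS N) a z,
      fun N z => hμ₀.sinApprox_eq hδ.le (S N) (hS N) a z]
    exact ⟨hosct false (hab ha) g hlim, hosct true (hab ha) g hlim⟩
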